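/- **A new functional in similarity variables for the radial semilinear wave equation, and a blow-up criterion.** Let $p>1$. Let $N\ge 1$ be an integer with $p\le 1+\frac{4}{N-1}$ if $N\ge 2$. Put $\rho(y)=(1-y^2)^{\frac{2}{p-1}}$ and let $\mathcal H$ be the space of pairs $(q_1,q_2)\in H^1_{loc}\times L^2_{loc}(-1,1)$ with $\int_{-1}^1\big(q_1^2+(q_1')^2(1-y^2)+q_2^2\big)\rho\,dy<\infty$. For $r_0>0$ consider the equation, for $y\in(-1,1)$, $$\partial_s^2 w=\frac1\rho\partial_y\big(\rho(1-y^2)\partial_y w\big)-\frac{2(p+1)}{(p-1)^2}w+|w|^{p-1}w-\frac{p+3}{p-1}\partial_s w-2y\,\partial^2_{y,s}w+e^{-s}\frac{N-1}{r_0+ye^{-s}}\partial_y w.\qquad(*)$$ A solution of $(*)$ on a time interval $J$ is a $w$ with $(w,\partial_s w)\in C(J,\mathcal H)$ satisfying $(*)$ in the weak sense. Define $$E(w)=\int_{-1}^1\Big(\tfrac12(\partial_s w)^2+\tfrac12(\partial_y w)^2(1-y^2)+\tfrac{p+1}{(p-1)^2}w^2-\tfrac1{p+1}|w|^{p+1}\Big)\rho\,dy,\qquad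 F(w,s)=E(w)-e^{-s}\int_{-1}^1 w\,\partial_s w\,\rho\,dy .$$ There exist $\gamma=\gamma(p)>0$, $S_1=S_1(p)\in\mathbb R$ and $S_0=S_0(N,p)\in\mathbb R$ such that the following hold. (i) Let $T:[0,\infty)\to(0,\infty)$ be $1$-Lipschitz and let $u(r,t)$ be a weak solution, locally of finite energy (that is, locally $u\in C_t H^1_r$ and $\partial_t u\in C_tL^2_r$), of $\partial_t^2u=\partial_r^2u+\frac{N-1}{r}\partial_r u+|u|^{p-1}u$ on $\{(r,t): r>0,\ 0\le t<T(r)\}$. Let $r_0>0$, let $$w(y,s)=(T(r_0)-t)^{\frac2{p-1}}u(r,t),\qquad y=\frac{r-r_0}{T(r_0)-t},\qquad s=-\log(T(r_0)-t),$$ and let $s_*=\max\big(-\log T(r_0),\,S_0,\,S_0-2\log r_0\big)$. Assume $(w,\partial_s w)\in C([s_*,\infty),\mathcal H)$. Then $s\mapsto F(w(s),s)$ is absolutely continuous on compact subintervals of $[s_*,\infty)$, and at every $s\ge s_*$ where it has a right derivative (in particular, almost everywhere) the integral on the right below is finite and $$\frac{d}{ds}F(w(s),s)\le\gamma e^{-s}F(w(s),s)-\frac{2}{p-1}\int_{-1}^1(\partial_s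 w(s))^2\frac{\rho}{1-y^2}\,dy .$$ Hence $H(w,s)=F(w,s)\,e^{\gamma e^{-s}}$ is a Lyapunov functional: $s\mapsto H(w(s),s)$ is nonincreasing on $[s_*,\infty)$. (ii) Let $r_0>0$ and $s_0\ge\max\big(S_1,\,S_1-2\log r_0\big)$. There is no solution $W$ of $(*)$ on the whole interval $[s_0,\infty)$ such that $\|W(s)\|_{L^{p+1}(-1,1)}$ is locally bounded in $s\in[s_0,\infty)$ and $F(W(s_0),s_0)<0$. -/

import Mathlib

open Set Filter Topology MeasureTheory
open scoped ContDiff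

noncomputable section

namespace RadialWave

/-!
Conventions. Functions of time and space take the time variable first: `u t r`, `w s y`.
-/

/-- `φ` is a smooth function with compact support contained in the open interval `(a, b)`. -/
def IsTest (a b : ℝ) (φ : ℝ → ℝ) : Prop :=
  ContDiff ℝ ∞ φ ∧ HasCompactSupport φ ∧ tsupport φ ⊆ Ioo a b

/-- `g` is the weak (distributional) derivative of `f` on `(a, b)`. -/
def IsWeakDeriv (a b : ℝ) (f g : ℝ → ℝ) : Prop :=
  ∀ φ, IsTest a b φ → ∫ x in Ioo a b, f x * deriv φ x = -∫ x in Ioo a b, g x * φ x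

/-! ### The radial wave equation -/

/-- The domain `{(r, t) | 0 < r, 0 ≤ t < T(r)}` under the graph of `T`. -/
def influenceDomain (T : ℝ → ℝ) : Set (ℝ × ℝ) :=
  {q | 0 < q.1 ∧ 0 ≤ q.2 ∧ q.2 < T q.1}

/-- On the rectangle `(a, b) × [t₁, t₂]` the function `u` is an energy solution of
`∂ₜ² u = ∂ᵣ² u + (N - 1) / r * ∂ᵣ u + |u| ^ (p - 1) * u`, with derivatives `ur = ∂ᵣ u` and
`ut = ∂ₜ u`: `u ∈ C([t₁, t₂], H¹(a, b))`, `ut ∈ C([t₁, t₂], L²(a, b))`, and the equation holds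
against every test function of `r`. -/
structure IsEnergySolutionOnRect (N : ℕ) (p : ℝ) (u ur ut : ℝ → ℝ → ℝ) (a b t₁ t₂ : ℝ) :
    Prop where
  memLp : ∀ t ∈ Icc t₁ t₂, MemLp (u t) 2 (volume.restrict (Ioo a b)) ∧
    MemLp (ur t) 2 (volume.restrict (Ioo a b)) ∧ MemLp (ut t) 2 (volume.restrict (Ioo a b))
  weakDeriv_r : ∀ t ∈ Icc t₁ t₂, IsWeakDeriv a b (u t) (ur t)
  continuous : ∀ t ∈ Icc t₁ t₂, Tendsto
    (fun τ => ∫ r in Ioo a b,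
      ((u τ r - u t r) ^ 2 + (ur τ r - ur t r) ^ 2 + (ut τ r - ut t r) ^ 2))
    (𝓝[Icc t₁ t₂] t) (𝓝 0)
  weakDeriv_t : ∀ φ, IsTest a b φ → ∀ t ∈ Icc t₁ t₂,
    HasDerivWithinAt (fun τ => ∫ r in Ioo a b, u τ r * φ r)
      (∫ r in Ioo a b, ut t r * φ r) (Icc t₁ t₂) t
  equation : ∀ φ, IsTest a b φ → ∀ t ∈ Icc t₁ t₂,
    HasDerivWithinAt (fun τ => ∫ r in Ioo a b, ut τ r * φ r)
      (∫ r in Ioo a b, (-(ur t r * deriv φ r) + ((N : ℝ) - 1) / r * ur t r * φ r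
        + |u t r| ^ (p - 1) * u t r * φ r)) (Icc t₁ t₂) t

/-- `u` is a solution, locally of finite energy, of the radial wave equation on the domain under
the graph of `T` (away from the axis `r = 0`). -/
def IsRadialSolution (N : ℕ) (p : ℝ) (T : ℝ → ℝ) (u : ℝ → ℝ → ℝ) : Prop :=
  ∃ ur ut : ℝ → ℝ → ℝ, ∀ a b t₁ t₂ : ℝ, a < b → t₁ < t₂ →
    Icc a b ×ˢ Icc t₁ t₂ ⊆ influenceDomain T → IsEnergySolutionOnRect N p u ur ut a b t₁ t₂

/-- The similarity variables transformation with vertex `(r₀, T₀)`: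
`w(y, s) = (T₀ - t) ^ (2 / (p - 1)) * u(r, t)` with `y = (r - r₀) / (T₀ - t)` and
`s = -log (T₀ - t)`. -/
def similarity (p r₀ T₀ : ℝ) (u : ℝ → ℝ → ℝ) (s y : ℝ) : ℝ :=
  Real.exp (-s) ^ (2 / (p - 1)) * u (T₀ - Real.exp (-s)) (r₀ + y * Real.exp (-s))

/-! ### The energy space and the functionals -/

/-- The weight `ρ(y) = (1 - y²) ^ (2 / (p - 1))`. -/
def rho (p y : ℝ) : ℝ := (1 - y ^ 2) ^ (2 / (p - 1))

/-- The density of the squared norm of the energy space at `(f, g)`, where `f'` is the weak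
derivative of `f`. -/
def energyDensity (p : ℝ) (f f' g : ℝ → ℝ) (y : ℝ) : ℝ :=
  (f y ^ 2 + f' y ^ 2 * (1 - y ^ 2) + g y ^ 2) * rho p y

/-- The pair `(f, g)` belongs to the weighted energy space on `(-1, 1)`, and `f'` is the weak
derivative of `f`. -/
structure MemEnergySpace (p : ℝ) (f f' g : ℝ → ℝ) : Prop where
  meas : AEStronglyMeasurable f (volume.restrict (Ioo (-1) 1))
  meas' : AEStronglyMeasurable f' (volume.restrict (Ioo (-1) 1))
  meas_g : AEStronglyMeasurable g (volume.restrict (Ioo (-1) 1))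
  weakDeriv : IsWeakDeriv (-1) 1 f f'
  integrable : IntegrableOn (energyDensity p f f' g) (Ioo (-1) 1)

/-- `(w, ∂ₛ w)` is continuous on the set of times `J` with values in the energy space;
`wy` and `ws` are the weak derivatives of `w` in `y` and in `s`. -/
structure IsEnergyPath (p : ℝ) (J : Set ℝ) (w wy ws : ℝ → ℝ → ℝ) : Prop where
  mem : ∀ s ∈ J, MemEnergySpace p (w s) (wy s) (ws s)
  continuous : ∀ s ∈ J, Tendsto
    (fun σ => ∫ y in Ioo (-1) 1, energyDensity p (fun y => w σ y - w s y)
      (fun y => wy σ y - wy s y) (fun y => ws σ y - ws s y) y) (𝓝[J] s) (𝓝 0)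
  weakDeriv_s : ∀ φ, IsTest (-1) 1 φ → ∀ s ∈ J,
    HasDerivWithinAt (fun σ => ∫ y in Ioo (-1) 1, w σ y * φ y)
      (∫ y in Ioo (-1) 1, ws s y * φ y) J s

/-- `w` is a solution on the set of times `J`, continuous with values in the energy space, of
`∂ₛ² w = ρ⁻¹ ∂_y (ρ (1 - y²) ∂_y w) - 2(p+1)/(p-1)² w + |w|^(p-1) w - (p+3)/(p-1) ∂ₛ w`
`- 2 y ∂_y ∂ₛ w + e⁻ˢ (N-1)/(r₀ + y e⁻ˢ) ∂_y w`.
The equation is tested against `ρ φ`, with `φ` a test function on `(-1, 1)`, where `ρ` is smooth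
and positive. -/
structure IsSimilaritySolution (N : ℕ) (p r₀ : ℝ) (J : Set ℝ) (w wy ws : ℝ → ℝ → ℝ) : Prop where
  path : IsEnergyPath p J w wy ws
  equation : ∀ φ, IsTest (-1) 1 φ → ∀ s ∈ J,
    HasDerivWithinAt (fun σ => ∫ y in Ioo (-1) 1, ws σ y * (rho p y * φ y))
      (∫ y in Ioo (-1) 1,
        (-(rho p y * (1 - y ^ 2) * wy s y * deriv φ y)
          - 2 * (p + 1) / (p - 1) ^ 2 * w s y * (rho p y * φ y)
          + |w s y| ^ (p - 1) * w s y * (rho p y * φ y)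
          - (p + 3) / (p - 1) * ws s y * (rho p y * φ y)
          + ws s y * deriv (fun x => 2 * x * (rho p x * φ x)) y
          + Real.exp (-s) * (((N : ℝ) - 1) / (r₀ + y * Real.exp (-s))) * wy s y
            * (rho p y * φ y))) J s

/-- The functional `E(w)`, at a state with `w = f`, `∂_y w = f'`, `∂ₛ w = g`. -/
def energyE (p : ℝ) (f f' g : ℝ → ℝ) : ℝ :=
  ∫ y in Ioo (-1) 1, (1 / 2 * g y ^ 2 + 1 / 2 * f' y ^ 2 * (1 - y ^ 2)
    + (p + 1) / (p - 1) ^ 2 * f y ^ 2 - 1 / (p + 1) * |f y| ^ (p + 1)) * rho p y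

/-- The functional `F(w, s) = E(w) - e⁻ˢ ∫ w ∂ₛ w ρ`. -/
def functionalF (p : ℝ) (f f' g : ℝ → ℝ) (s : ℝ) : ℝ :=
  energyE p f f' g - Real.exp (-s) * ∫ y in Ioo (-1) 1, f y * g y * rho p y

/-- The functional `H(w, s) = F(w, s) * exp (γ e⁻ˢ)`. -/
def functionalH (p γ : ℝ) (f f' g : ℝ → ℝ) (s : ℝ) : ℝ :=
  functionalF p f f' g s * Real.exp (γ * Real.exp (-s))

end RadialWave

end

noncomputable section

namespace RadialWave

/-! ### Differentiation in a Hilbert space -/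

section Hilbert

variable {E : Type*} [NormedAddCommGroup E] [InnerProductSpace ℝ E]

/-! Write α = 2/(p-1), X = ∂ₛw, Y = ∂_y w, e = exp(-s), R = (N-1)/(r₀ + y e). Formally dE/ds = -2α ∫
X² ρ/(1-y²) + e ∫ R X Y ρ. The last term has no sign. Young's inequality trades it for part of the
dissipation and a small multiple of e ∫ Y² (1-y²) ρ, which E does not control because of its
negative potential part. The correction -e ∫ w X ρ produces e ∫ (Y² (1-y²) + α(α+1) w² - |w|^(p+1))
ρ, up to mixed terms. After subtraction of γ e F the quadratic terms in w and Y carry the factor 1 -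
γ/2 and the potential the factor -(1 - γ/(p+1)). So every γ with 2 < γ ≤ p+1 gives the right signs
with room to spare in the quadratic terms; the proof takes the midpoint γ = (p+3)/2. The room
absorbs the mixed terms once e and e/r₀² are small. The singular mixed term 4α y² w X/(1-y²) needs
Hardy's inequality (`MemEnergySpace.hardy_cutoff`). Half of the dissipation is spent, hence the
constant 2/(p-1) in the result. The bound on p enters only as N - 1 ≤ 2α, so the threshold
`exists_threshold` depends on p alone.

The computation must be justified for finite energy solutions, which cannot be multiplied by X
directly. In the characteristic unknowns A = X + (y-1)Y and B = X + (y+1)Y one has X²/2 + (1-y²)Y²/2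
= (1+y)A²/4 + (1-y)B²/4 and X = (1+y)A/2 + (1-y)B/2, and A, B solve transport equations with
velocities y+1 and y-1. A weak transport equation becomes an ordinary derivative in L² along its
flow, whence the product rule `hasDerivWithinAt_integral_mul`. It needs no regularization. Cutoffs
in y make everything local (`IsCharacteristicSolution.hasDerivWithinAt_truncated`). The flux through
the cutoff region has a favourable sign in X², so its upper bound involves only w and Y and vanishes
in the limit (`flux_le`, `dissipation_le`). The limit is taken abstractly in `DissipativeLimit`: the
upper bound makes the truncated dissipations integrable in time, uniformly in the cutoff; with a
cruder lower bound this gives absolute continuity, and the integrated inequality gives the bound on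
right derivatives and the monotonicity of H.

Both parts of the theorem feed `IsCharacteristicSolution`: a solution u through the change of
variables applied to ∂ₜu ∓ ∂ᵣu (`HasRects.isCharacteristicSolution`), a solution of the equation in
similarity variables through factorization of its principal part
(`IsSimilaritySolution.isCharacteristicSolution`).

For the blow-up criterion, suppose F < 0 at time s₀. Moving the vertex of the similarity variables
up by δ > 0 gives another solution, a dilation of W by l = e^{-s}/(δ + e^{-s}), which reads W only
at times below -log δ. Its F is still negative initially when δ is small
(`tendsto_functionalF_dilate`), so its H stays below a negative constant. But F is at least
-(1/(p+1)) ∫ |w|^(p+1) ρ for late times, and for the dilated solution this is O(l^(α(p+1)-1)), which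
tends to 0: a contradiction (`IsCharacteristicSolution.functionalF_nonneg`). -/

theorem norm_le_of_dense_inner_le {D : Set E} (hD : Dense D) {x : E} {C : ℝ} (hC : 0 ≤ C)
    (h : ∀ φ ∈ D, |inner ℝ φ x| ≤ C * ‖φ‖) : ‖x‖ ≤ C := by
  have hcl : IsClosed {φ : E | |inner ℝ φ x| ≤ C * ‖φ‖} :=
    isClosed_le (by fun_prop) (by fun_prop)
  have hx : |inner ℝ x x| ≤ C * ‖x‖ := closure_minimal (fun φ hφ => h φ hφ) hcl (hD x)
  rw [real_inner_self_eq_norm_sq, abs_pow, abs_norm] at hx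
  by_contra! hlt
  nlinarith

/-- A path which is weakly differentiable against a dense set, with derivative continuous at `s`,
is strongly differentiable at `s`. -/
theorem hasDerivWithinAt_of_weak {D : Set E} (hD : Dense D) {J : Set ℝ} (hJ : Convex ℝ J)
    {g G : ℝ → E} {s : ℝ}
    (hg : ∀ φ ∈ D, ∀ σ ∈ J, HasDerivWithinAt (fun σ => inner ℝ φ (g σ)) (inner ℝ φ (G σ)) J σ)
    (hs : s ∈ J) (hG : ContinuousWithinAt G J s) : HasDerivWithinAt g (G s) J s := by
  rw [hasDerivWithinAt_iff_isLittleO, Asymptotics.isLittleO_iff]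
  intro ε hε
  obtain ⟨δ, hδ, hball⟩ := Metric.continuousWithinAt_iff.1 hG ε hε
  have hmem : J ∩ Metric.ball s δ ∈ 𝓝[J] s :=
    inter_mem self_mem_nhdsWithin (mem_nhdsWithin_of_mem_nhds (Metric.ball_mem_nhds s hδ))
  filter_upwards [hmem] with t ht
  refine norm_le_of_dense_inner_le hD (by positivity) fun φ hφ => ?_
  have hconv : Convex ℝ (J ∩ Metric.ball s δ) := hJ.inter (convex_ball s δ)
  -- The mean value inequality is used on each scalar pairing minus its linearization. The bound `ε
  -- * ‖φ‖` is uniform over the dense set, which upgrades weak differentiability to strong.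
  have key := hconv.norm_image_sub_le_of_norm_hasDerivWithin_le
    (f := fun σ => inner ℝ φ (g σ) - σ * inner ℝ φ (G s))
    (f' := fun σ => inner ℝ φ (G σ) - 1 * inner ℝ φ (G s)) (C := ε * ‖φ‖) (x := s) (y := t)
    (fun σ hσ => (((hg φ hφ σ hσ.1).mono inter_subset_left).sub
      ((hasDerivWithinAt_id σ _).mul_const _)))
    (fun σ hσ => by
      rw [one_mul, ← inner_sub_right, Real.norm_eq_abs]
      refine (abs_real_inner_le_norm _ _).trans ?_
      rw [mul_comm]
      exact mul_le_mul_of_nonneg_right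
        (by rw [← dist_eq_norm]; exact (hball hσ.1 hσ.2).le) (norm_nonneg _))
    ⟨hs, Metric.mem_ball_self hδ⟩ ht
  rw [inner_sub_right, inner_sub_right, inner_smul_right]
  rw [Real.norm_eq_abs] at key
  calc _ = |inner ℝ φ (g t) - t * inner ℝ φ (G s) - (inner ℝ φ (g s) - s * inner ℝ φ (G s))| := by
        congr 1; ring
    _ ≤ _ := key
    _ = _ := by ring

/-- Product rule for the pairing of a strongly continuous, weakly differentiable path with a
strongly differentiable path. -/
theorem hasDerivWithinAt_inner_of_weak {J : Set ℝ} {g Ψ : ℝ → E} {Ψ' : E} {L s : ℝ}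
    (hgΨ : HasDerivWithinAt (fun σ => inner ℝ (g σ) (Ψ s)) L J s)
    (hg : ContinuousWithinAt g J s) (hΨ : HasDerivWithinAt Ψ Ψ' J s) :
    HasDerivWithinAt (fun σ => inner ℝ (g σ) (Ψ σ)) (L + inner ℝ (g s) Ψ') J s := by
  rw [hasDerivWithinAt_iff_tendsto_slope] at hgΨ hΨ ⊢
  -- The slope of the pairing splits into the slope against the frozen `Ψ s` and the pairing of `g
  -- σ` with the slope of `Ψ`; the latter only needs continuity of `g`.
  have h2 : Tendsto (fun σ => inner ℝ (g σ) (slope Ψ s σ)) (𝓝[J \ {s}] s)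
      (𝓝 (inner ℝ (g s) Ψ')) :=
    Tendsto.inner (hg.mono_left (nhdsWithin_mono _ sdiff_subset)) hΨ
  refine (hgΨ.add h2).congr fun σ => ?_
  simp only [slope_def_module, inner_smul_right, inner_sub_right, smul_eq_mul]
  ring

end Hilbert

/-! ### Paths in `L²` -/

open Classical in
/-- The class of `f` in `L²`, and `0` if `f` is not square integrable. -/
def toL2 (μ : Measure ℝ) (f : ℝ → ℝ) : Lp ℝ 2 μ :=
  if h : MemLp f 2 μ then h.toLp f else 0

theorem toL2_of_memLp {μ : Measure ℝ} {f : ℝ → ℝ} (h : MemLp f 2 μ) : toL2 μ f = h.toLp f :=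
  dif_pos h

theorem coeFn_toL2 {μ : Measure ℝ} {f : ℝ → ℝ} (h : MemLp f 2 μ) : toL2 μ f =ᵐ[μ] f := by
  rw [toL2_of_memLp h]; exact h.coeFn_toLp

theorem inner_toL2 {μ : Measure ℝ} {f g : ℝ → ℝ} (hf : MemLp f 2 μ) (hg : MemLp g 2 μ) :
    inner ℝ (toL2 μ f) (toL2 μ g) = ∫ x, f x * g x ∂μ := by
  rw [L2.inner_def]
  refine integral_congr_ae ?_
  filter_upwards [coeFn_toL2 hf, coeFn_toL2 hg] with x h1 h2
  rw [h1, h2]; simp [mul_comm]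

theorem toL2_sub {μ : Measure ℝ} {f g : ℝ → ℝ} (hf : MemLp f 2 μ) (hg : MemLp g 2 μ) :
    toL2 μ f - toL2 μ g = toL2 μ (f - g) := by
  rw [toL2_of_memLp hf, toL2_of_memLp hg, toL2_of_memLp (hf.sub hg), MemLp.toLp_sub]

theorem toL2_smul {μ : Measure ℝ} {f : ℝ → ℝ} (hf : MemLp f 2 μ) (c : ℝ) :
    c • toL2 μ f = toL2 μ (c • f) := by
  rw [toL2_of_memLp hf, toL2_of_memLp (hf.const_smul c), MemLp.toLp_const_smul]

theorem norm_toL2 {μ : Measure ℝ} {f : ℝ → ℝ} (hf : MemLp f 2 μ) :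
    ‖toL2 μ f‖ = (eLpNorm f 2 μ).toReal := by
  rw [toL2_of_memLp hf, Lp.norm_toLp]

/-- The path `s ↦ g s` is continuous on `J` with values in `L²(μ)`. -/
structure L2ContOn (μ : Measure ℝ) (J : Set ℝ) (g : ℝ → ℝ → ℝ) : Prop where
  memLp : ∀ s ∈ J, MemLp (g s) 2 μ
  tendsto : ∀ s ∈ J, Tendsto (fun σ => eLpNorm (g σ - g s) 2 μ) (𝓝[J] s) (𝓝 0)

namespace L2ContOn

variable {μ ν : Measure ℝ} {J : Set ℝ} {g h : ℝ → ℝ → ℝ}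

theorem continuousOn (hg : L2ContOn μ J g) : ContinuousOn (fun s => toL2 μ (g s)) J := by
  intro s hs
  rw [ContinuousWithinAt, tendsto_iff_norm_sub_tendsto_zero]
  have h := (ENNReal.tendsto_toReal ENNReal.zero_ne_top).comp (hg.tendsto s hs)
  rw [ENNReal.toReal_zero] at h
  refine h.congr' ?_
  filter_upwards [self_mem_nhdsWithin] with σ hσ
  rw [toL2_sub (hg.memLp σ hσ) (hg.memLp s hs), norm_toL2 ((hg.memLp σ hσ).sub (hg.memLp s hs))]
  rfl

theorem of_le {C : ENNReal} (hC : C ≠ ⊤) (hg : L2ContOn μ J g)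
    (hmem : ∀ s ∈ J, MemLp (h s) 2 ν)
    (hle : ∀ s ∈ J, ∀ᶠ σ in 𝓝[J] s, eLpNorm (h σ - h s) 2 ν ≤ C * eLpNorm (g σ - g s) 2 μ) :
    L2ContOn ν J h := by
  refine ⟨hmem, fun s hs => ?_⟩
  have h0 := ENNReal.Tendsto.const_mul (a := C) (hg.tendsto s hs) (Or.inr hC)
  rw [mul_zero] at h0
  exact tendsto_of_tendsto_of_tendsto_of_le_of_le' tendsto_const_nhds h0
    (Eventually.of_forall fun _ => zero_le) (hle s hs)

theorem add (hg : L2ContOn μ J g) (hh : L2ContOn μ J h) :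
    L2ContOn μ J (fun s y => g s y + h s y) := by
  refine ⟨fun s hs => (hg.memLp s hs).add (hh.memLp s hs), fun s hs => ?_⟩
  have h0 := (hg.tendsto s hs).add (hh.tendsto s hs)
  rw [add_zero] at h0
  refine tendsto_of_tendsto_of_tendsto_of_le_of_le' tendsto_const_nhds h0
    (Eventually.of_forall fun _ => zero_le) ?_
  filter_upwards [self_mem_nhdsWithin] with σ hσ
  have : (fun y => g σ y + h σ y) - (fun y => g s y + h s y) = (g σ - g s) + (h σ - h s) := by
    ext y; simp; ring
  rw [this]
  exact eLpNorm_add_le ((hg.memLp σ hσ).sub (hg.memLp s hs)).1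
    ((hh.memLp σ hσ).sub (hh.memLp s hs)).1 (by norm_num)

/-- Multiplication by coefficients which are locally bounded and depend continuously on time,
uniformly in space. -/
theorem mul_coeff (hg : L2ContOn μ J g) {k : ℝ → ℝ → ℝ}
    (hmeas : ∀ s ∈ J, AEStronglyMeasurable (k s) μ)
    (hbd : ∀ s ∈ J, ∃ M, ∀ᶠ σ in 𝓝[J] s, ∀ᵐ y ∂μ, |k σ y| ≤ M)
    (hk : ∀ s ∈ J, ∀ ε > 0, ∀ᶠ σ in 𝓝[J] s, ∀ᵐ y ∂μ, |k σ y - k s y| ≤ ε) :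
    L2ContOn μ J (fun s y => k s y * g s y) := by
  have hmul : ∀ (c f : ℝ → ℝ) (C : ℝ), AEStronglyMeasurable c μ → (∀ᵐ y ∂μ, |c y| ≤ C) →
      MemLp f 2 μ → MemLp (fun y => c y * f y) 2 μ ∧
        eLpNorm (fun y => c y * f y) 2 μ ≤ ENNReal.ofReal C * eLpNorm f 2 μ := by
    intro c f C hc hcC hf
    have hle : ∀ᵐ y ∂μ, ‖c y * f y‖ ≤ C * ‖f y‖ := by
      filter_upwards [hcC] with y hy
      rw [norm_mul]; exact mul_le_mul_of_nonneg_right hy (norm_nonneg _)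
    exact ⟨hf.of_le_mul (hc.mul hf.1) hle, eLpNorm_le_mul_eLpNorm_of_ae_le_mul hle 2⟩
  refine ⟨fun s hs => ?_, fun s hs => ?_⟩
  · obtain ⟨M, hM⟩ := hbd s hs
    exact (hmul _ _ M (hmeas s hs) (hM.self_of_nhdsWithin hs) (hg.memLp s hs)).1
  obtain ⟨M, hM⟩ := hbd s hs
  have hgs := hg.memLp s hs
  have h1 : Tendsto (fun σ => ENNReal.ofReal M * eLpNorm (g σ - g s) 2 μ) (𝓝[J] s) (𝓝 0) := by
    have h0 := ENNReal.Tendsto.const_mul (a := ENNReal.ofReal M) (hg.tendsto s hs)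
      (Or.inr ENNReal.ofReal_ne_top)
    rwa [mul_zero] at h0
  have h2 : Tendsto (fun σ => eLpNorm (fun y => (k σ y - k s y) * g s y) 2 μ) (𝓝[J] s) (𝓝 0) := by
    rw [ENNReal.tendsto_nhds_zero]
    intro ε hε
    obtain ⟨δ, hδ, hδε⟩ : ∃ δ : ℝ, 0 < δ ∧ ENNReal.ofReal δ * eLpNorm (g s) 2 μ ≤ ε := by
      have ht : Tendsto (fun δ : ℝ => ENNReal.ofReal δ * eLpNorm (g s) 2 μ) (𝓝[>] 0) (𝓝 0) := by
        have h3 : Tendsto (fun δ : ℝ => ENNReal.ofReal δ) (𝓝[>] 0) (𝓝 0) := by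
          have := (ENNReal.continuous_ofReal.tendsto (0 : ℝ)).mono_left
            (nhdsWithin_le_nhds (s := Ioi 0))
          simpa using this
        have h4 := ENNReal.Tendsto.mul_const (b := eLpNorm (g s) 2 μ) h3 (Or.inr hgs.2.ne)
        rwa [zero_mul] at h4
      obtain ⟨δ, h5, h6⟩ := ((ENNReal.tendsto_nhds_zero.1 ht ε hε).and self_mem_nhdsWithin).exists
      exact ⟨δ, h6, h5⟩
    filter_upwards [hk s hs δ hδ, self_mem_nhdsWithin] with σ hσ hσJ
    exact (hmul _ _ δ ((hmeas σ hσJ).sub (hmeas s hs)) hσ hgs).2.trans hδε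
  have h0 := h1.add h2
  rw [add_zero] at h0
  refine tendsto_of_tendsto_of_tendsto_of_le_of_le' tendsto_const_nhds h0
    (Eventually.of_forall fun _ => zero_le) ?_
  filter_upwards [self_mem_nhdsWithin, hM] with σ hσ hσM
  have : (fun y => k σ y * g σ y) - (fun y => k s y * g s y) =
      (fun y => k σ y * (g σ - g s) y) + fun y => (k σ y - k s y) * g s y := by
    ext y; simp; ring
  rw [this]
  have hd := (hg.memLp σ hσ).sub hgs
  refine (eLpNorm_add_le ((hmeas σ hσ).mul hd.1)
    (((hmeas σ hσ).sub (hmeas s hs)).mul hgs.1) (by norm_num)).trans ?_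
  exact add_le_add (hmul _ _ M (hmeas σ hσ) hσM hd).2 le_rfl

theorem mul_time (hg : L2ContOn μ J g) {m : ℝ → ℝ} (hm : ContinuousOn m J) :
    L2ContOn μ J (fun s y => m s * g s y) := by
  refine hg.mul_coeff (k := fun s _ => m s) (fun _ _ => aestronglyMeasurable_const)
    (fun s hs => ⟨|m s| + 1, ?_⟩) (fun s hs ε hε => ?_)
  · filter_upwards [(hm s hs).abs.eventually (eventually_lt_nhds (lt_add_one |m s|))] with σ hσ
    exact Eventually.of_forall fun _ => hσ.le
  · filter_upwards [(Metric.continuousWithinAt_iff'.1 (hm s hs)) ε hε] with σ hσ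
    exact Eventually.of_forall fun _ => by rw [← Real.dist_eq]; exact hσ.le

theorem bdd_mul (hg : L2ContOn μ J g) {k : ℝ → ℝ} {M : ℝ} (hmeas : AEStronglyMeasurable k μ)
    (hbd : ∀ᵐ y ∂μ, |k y| ≤ M) : L2ContOn μ J (fun s y => k y * g s y) :=
  hg.mul_coeff (k := fun _ => k) (fun _ _ => hmeas) (fun _ _ => ⟨M, Eventually.of_forall fun _ => hbd⟩)
    (fun s _ ε hε => Eventually.of_forall fun σ => Eventually.of_forall fun y => by
      simpa using hε.le)

theorem const_mul (hg : L2ContOn μ J g) (c : ℝ) : L2ContOn μ J (fun s y => c * g s y) :=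
  hg.bdd_mul (k := fun _ => c) (M := |c|) aestronglyMeasurable_const
    (Eventually.of_forall fun _ => le_rfl)

theorem mono_measure (hg : L2ContOn μ J g) (hν : ν ≤ μ) : L2ContOn ν J g :=
  hg.of_le (C := 1) ENNReal.one_ne_top (fun s hs => (hg.memLp s hs).mono_measure hν)
    (fun s _ => Eventually.of_forall fun σ => by rw [one_mul]; exact eLpNorm_mono_measure _ hν)

theorem continuousOn_integral_mul (hg : L2ContOn μ J g) (hh : L2ContOn μ J h) :
    ContinuousOn (fun s => ∫ y, g s y * h s y ∂μ) J := by
  refine (hg.continuousOn.inner (𝕜 := ℝ) hh.continuousOn).congr fun s hs => ?_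
  exact (inner_toL2 (hg.memLp s hs) (hh.memLp s hs)).symm

/-- Extension by zero. -/
theorem of_restrict {S : Set ℝ} (hS : MeasurableSet S) (hg : L2ContOn (volume.restrict S) J g)
    (h0 : ∀ s ∈ J, ∀ y ∉ S, g s y = 0) : L2ContOn volume J g := by
  have hind : ∀ s ∈ J, S.indicator (g s) = g s := fun s hs =>
    indicator_eq_self.2 fun y hy => by_contra fun hyS => hy (h0 s hs y hyS)
  refine hg.of_le (C := 1) ENNReal.one_ne_top (fun s hs => ?_) (fun s hs => ?_)
  · rw [← hind s hs]; exact (memLp_indicator_iff_restrict hS).2 (hg.memLp s hs)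
  · filter_upwards [self_mem_nhdsWithin] with σ hσ
    rw [one_mul, ← eLpNorm_indicator_eq_eLpNorm_restrict hS]
    refine le_of_eq (congrArg (fun f => eLpNorm f 2 volume) ?_)
    rw [indicator_sub', hind s hs, hind σ hσ]

/-- `L²` continuity from convergence of the integrals of the squares of the differences. -/
theorem of_integral_sq (hmem : ∀ s ∈ J, MemLp (g s) 2 μ)
    (ht : ∀ s ∈ J, Tendsto (fun σ => ∫ y, (g σ y - g s y) ^ 2 ∂μ) (𝓝[J] s) (𝓝 0)) :
    L2ContOn μ J g := by
  refine ⟨hmem, fun s hs => ?_⟩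
  have h1 := ENNReal.tendsto_ofReal ((Real.continuous_sqrt.tendsto 0).comp (ht s hs))
  rw [Real.sqrt_zero, ENNReal.ofReal_zero] at h1
  refine h1.congr' ?_
  filter_upwards [self_mem_nhdsWithin] with σ hσ
  have hd := (hmem σ hσ).sub (hmem s hs)
  have h2 : inner ℝ (toL2 μ (g σ - g s)) (toL2 μ (g σ - g s)) = ‖toL2 μ (g σ - g s)‖ ^ 2 :=
    real_inner_self_eq_norm_sq _
  rw [inner_toL2 hd hd, norm_toL2 hd] at h2
  have h3 : ∫ y, (g σ y - g s y) ^ 2 ∂μ = (eLpNorm (g σ - g s) 2 μ).toReal ^ 2 := by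
    rw [← h2]; congr 1; ext y; simp [sq]
  simp only [Function.comp_apply]
  rw [h3, Real.sqrt_sq ENNReal.toReal_nonneg, ENNReal.ofReal_toReal hd.2.ne]

end L2ContOn

/-! ### Test functions -/

namespace IsTest

variable {a b : ℝ} {φ : ℝ → ℝ}

theorem zero_of_notMem (h : IsTest a b φ) {y : ℝ} (hy : y ∉ Ioo a b) : φ y = 0 :=
  image_eq_zero_of_notMem_tsupport fun h' => hy (h.2.2 h')

theorem deriv_zero_of_notMem (h : IsTest a b φ) {y : ℝ} (hy : y ∉ Ioo a b) : deriv φ y = 0 :=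
  image_eq_zero_of_notMem_tsupport fun h' => hy (h.2.2 (tsupport_deriv_subset h'))

theorem differentiable (h : IsTest a b φ) : Differentiable ℝ φ := h.1.differentiable (by simp)

theorem continuous (h : IsTest a b φ) : Continuous φ := h.1.continuous

theorem continuous_deriv (h : IsTest a b φ) : Continuous (deriv φ) :=
  h.1.continuous_deriv (by simp)

theorem deriv (h : IsTest a b φ) : IsTest a b (deriv φ) :=
  ⟨((contDiff_infty_iff_deriv (𝕜 := ℝ)).1 h.1).2, h.2.1.deriv,
    tsupport_deriv_subset.trans h.2.2⟩

theorem mono (h : IsTest a b φ) {a' b' : ℝ} (ha : a' ≤ a) (hb : b ≤ b') : IsTest a' b' φ :=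
  ⟨h.1, h.2.1, h.2.2.trans (Ioo_subset_Ioo ha hb)⟩

theorem mul_left (h : IsTest a b φ) {k : ℝ → ℝ} (hk : ContDiff ℝ ∞ k) :
    IsTest a b (fun y => k y * φ y) :=
  ⟨hk.mul h.1, h.2.1.mul_left, (tsupport_mul_subset_right (f := k) (g := φ)).trans h.2.2⟩

/-- Multiplication by a coefficient which is smooth on the open interval only. -/
theorem mul_left_of_contDiffOn (h : IsTest a b φ) {k : ℝ → ℝ} (hk : ContDiffOn ℝ ∞ k (Ioo a b)) :
    IsTest a b (fun y => k y * φ y) := by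
  refine ⟨?_, h.2.1.mul_left, (tsupport_mul_subset_right (f := k) (g := φ)).trans h.2.2⟩
  rw [contDiff_iff_contDiffAt]
  intro y
  by_cases hy : y ∈ tsupport φ
  · exact ((hk y (h.2.2 hy)).contDiffAt (isOpen_Ioo.mem_nhds (h.2.2 hy))).mul h.1.contDiffAt
  · have : (fun y => k y * φ y) =ᶠ[𝓝 y] fun _ => 0 := by
      filter_upwards [(notMem_tsupport_iff_eventuallyEq.1 hy)] with z hz
      rw [hz]; simp
    exact contDiffAt_const.congr_of_eventuallyEq this

/-- Compactness of the support leaves room at both ends, so quantities controlled only on compact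
subintervals can be used on the support. For the zero function the middle third serves. -/
theorem exists_shrink (h : IsTest a b φ) (hab : a < b) :
    ∃ A B, a < A ∧ A < B ∧ B < b ∧ IsTest A B φ := by
  rcases (tsupport φ).eq_empty_or_nonempty with h0 | h0
  · refine ⟨(2 * a + b) / 3, (a + 2 * b) / 3, by linarith, by linarith, by linarith,
      h.1, h.2.1, by simp [h0]⟩
  · have hc : IsCompact (tsupport φ) := h.2.1
    obtain ⟨x, hx, hxm⟩ := hc.exists_isMinOn h0 continuousOn_id
    obtain ⟨z, hz, hzm⟩ := hc.exists_isMaxOn h0 continuousOn_id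
    have h1 := h.2.2 hx
    have h2 := h.2.2 hz
    have h3 : x ≤ z := hxm hz
    refine ⟨(a + x) / 2, (z + b) / 2, by linarith [h1.1], by linarith [h1.1, h2.2],
      by linarith [h2.2], h.1, h.2.1, fun y hy => ?_⟩
    have h4 : x ≤ y := hxm hy
    have h5 : y ≤ z := hzm hy
    exact ⟨by linarith [h1.1], by linarith [h2.2]⟩

theorem setIntegral_mul (h : IsTest a b φ) (f : ℝ → ℝ) :
    ∫ y in Ioo a b, f y * φ y = ∫ y, f y * φ y :=
  setIntegral_eq_integral_of_forall_compl_eq_zero fun y hy => by rw [h.zero_of_notMem hy, mul_zero]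

theorem exists_bound (h : IsTest a b φ) : ∃ M, ∀ y, |φ y| ≤ M :=
  h.2.1.exists_bound_of_continuous h.continuous

/-- A test function which equals `1` on a given compact subinterval. -/
theorem exists_eq_one {A B : ℝ} (hA : a < A) (hB : B < b) :
    ∃ θ, IsTest a b θ ∧ (∀ y ∈ Icc A B, θ y = 1) ∧ ∀ y, |θ y| ≤ 1 := by
  obtain ⟨θ, h1, h2, h3, h4⟩ := exists_contMDiff_support_eq_eq_one_iff
    (I := modelWithCornersSelf ℝ ℝ) (n := ⊤) (s := Ioo ((a + A) / 2) ((B + b) / 2))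
    (t := Icc A B) isOpen_Ioo isClosed_Icc
    (fun y hy => ⟨by linarith [hy.1], by linarith [hy.2]⟩)
  have hts : tsupport θ ⊆ Icc ((a + A) / 2) ((B + b) / 2) := by
    rw [tsupport, h3]; exact closure_minimal Ioo_subset_Icc_self isClosed_Icc
  refine ⟨θ, ⟨h1.contDiff, HasCompactSupport.of_support_subset_isCompact isCompact_Icc
    (subset_closure.trans hts), hts.trans fun y hy => ⟨by linarith [hy.1], by linarith [hy.2]⟩⟩,
    fun y hy => (h4 y).1 hy, fun y => ?_⟩
  have := h2 (mem_range_self y)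
  rw [abs_le]; exact ⟨by linarith [this.1], this.2⟩

theorem memLp (h : IsTest a b φ) (p : ENNReal) (μ : Measure ℝ) [IsFiniteMeasureOnCompacts μ] :
    MemLp φ p μ := h.continuous.memLp_of_hasCompactSupport h.2.1

end IsTest

/-- Local integrability makes products with test functions integrable. -/
theorem integrableOn_mul_test {a b : ℝ} {φ G : ℝ → ℝ} (hab : a < b) (hφ : IsTest a b φ)
    (hG : LocallyIntegrableOn G (Ioo a b)) : Integrable (fun y => G y * φ y) := by
  obtain ⟨A, B, hA, hAB, hB, h⟩ := hφ.exists_shrink hab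
  have h1 : IntegrableOn G (Icc A B) := hG.integrableOn_compact_subset
    (fun y hy => ⟨hA.trans_le hy.1, hy.2.trans_lt hB⟩) isCompact_Icc
  obtain ⟨M, hM⟩ := h.exists_bound
  have h2 : IntegrableOn (fun y => G y * φ y) (Icc A B) :=
    h1.mul_bdd (c := M) h.continuous.aestronglyMeasurable
      (Eventually.of_forall fun y => by simpa using hM y)
  rw [← integrable_indicator_iff measurableSet_Icc] at h2
  refine h2.congr (Eventually.of_forall fun y => ?_)
  by_cases hy : y ∈ Icc A B
  · simp [hy]
  · simp [hy, h.zero_of_notMem fun h' => hy (Ioo_subset_Icc_self h')]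

theorem locallyIntegrableOn_of_memLp {a b : ℝ} {g : ℝ → ℝ} {r : ENNReal} (hr : 1 ≤ r)
    (h : ∀ c d, a < c → d < b → MemLp g r (volume.restrict (Icc c d))) :
    LocallyIntegrableOn g (Ioo a b) := by
  intro x hx
  have h1 : a < (a + x) / 2 := by linarith [hx.1]
  have h2 : (x + b) / 2 < b := by linarith [hx.2]
  refine ⟨Icc ((a + x) / 2) ((x + b) / 2),
    mem_nhdsWithin_of_mem_nhds (Icc_mem_nhds (by linarith [hx.1]) (by linarith [hx.2])), ?_⟩
  exact (h _ _ h1 h2).integrable hr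

/-! ### Differentiability in `L²` of rescaled test functions -/

/-- Compactly supported derivatives are bounded; a single constant is taken for all the orders so
that later error estimates stay uniform in space. -/
theorem exists_taylor_bound {φ : ℝ → ℝ} (hφ : ContDiff ℝ ∞ φ) (hc : HasCompactSupport φ) :
    ∃ C, 0 ≤ C ∧ (∀ x, |φ x| ≤ C) ∧ (∀ x, |deriv φ x| ≤ C) ∧ (∀ x z, |φ z - φ x| ≤ C * |z - x|) ∧
      ∀ x z, |φ z - φ x - (z - x) * deriv φ x| ≤ C * |z - x| ^ 2 := by
  have hd : ContDiff ℝ ∞ (deriv φ) := ((contDiff_infty_iff_deriv (𝕜 := ℝ)).1 hφ).2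
  have hdd : ContDiff ℝ ∞ (deriv (deriv φ)) := ((contDiff_infty_iff_deriv (𝕜 := ℝ)).1 hd).2
  obtain ⟨C0, h0⟩ := hc.exists_bound_of_continuous hφ.continuous
  obtain ⟨C1, h1⟩ := hc.deriv.exists_bound_of_continuous hd.continuous
  obtain ⟨C2, h2⟩ := hc.deriv.deriv.exists_bound_of_continuous hdd.continuous
  set C := max C0 (max C1 C2)
  have l0 : C0 ≤ C := le_max_left _ _
  have l1 : C1 ≤ C := (le_max_left _ _).trans (le_max_right _ _)
  have l2 : C2 ≤ C := (le_max_right _ _).trans (le_max_right _ _)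
  have hC : 0 ≤ C := (norm_nonneg _).trans ((h0 0).trans l0)
  have dphi : Differentiable ℝ φ := hφ.differentiable (by simp)
  have dphi' : Differentiable ℝ (deriv φ) := hd.differentiable (by simp)
  have hlip' : ∀ x z, |deriv φ z - deriv φ x| ≤ C * |z - x| := fun x z => by
    simpa using convex_univ.norm_image_sub_le_of_norm_deriv_le (f := deriv φ) (C := C)
      (fun u _ => dphi' u) (fun u _ => (h2 u).trans l2) (mem_univ x) (mem_univ z)
  refine ⟨C, hC, fun x => (h0 x).trans l0, fun x => (h1 x).trans l1, fun x z => ?_,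
    fun x z => ?_⟩
  · simpa using convex_univ.norm_image_sub_le_of_norm_deriv_le (f := φ) (C := C)
      (fun u _ => dphi u) (fun u _ => (h1 u).trans l1) (mem_univ x) (mem_univ z)
  · have key := (convex_uIcc x z).norm_image_sub_le_of_norm_hasDerivWithin_le
      (f := fun u => φ u - u * deriv φ x) (f' := fun u => deriv φ u - 1 * deriv φ x)
      (C := C * |z - x|)
      (fun u _ => ((dphi u).hasDerivAt.sub ((hasDerivAt_id u).mul_const _)).hasDerivWithinAt)
      (fun u hu => by
        rw [one_mul]
        refine (hlip' x u).trans (mul_le_mul_of_nonneg_left ?_ hC)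
        exact abs_sub_left_of_mem_uIcc hu) left_mem_uIcc right_mem_uIcc
    rw [Real.norm_eq_abs, Real.norm_eq_abs] at key
    calc _ = |φ z - z * deriv φ x - (φ x - x * deriv φ x)| := by congr 1; ring
      _ ≤ _ := key
      _ = _ := by ring

/-- A family of functions which is differentiable at `s` uniformly in space is differentiable as
a path in `L²` of a finite measure. -/
theorem hasDerivWithinAt_toL2 {μ : Measure ℝ} [IsFiniteMeasure μ] {J : Set ℝ} {s : ℝ}
    {Ψ : ℝ → ℝ → ℝ} {Ψ' : ℝ → ℝ} (hΨ : ∀ σ, MemLp (Ψ σ) 2 μ) (hΨ' : MemLp Ψ' 2 μ)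
    {r : ℝ → ℝ} (hr : r =o[𝓝[J] s] fun σ => σ - s)
    (hle : ∀ σ, ∀ᵐ x ∂μ, |Ψ σ x - Ψ s x - (σ - s) * Ψ' x| ≤ r σ) :
    HasDerivWithinAt (fun σ => toL2 μ (Ψ σ)) (toL2 μ Ψ') J s := by
  rw [hasDerivWithinAt_iff_isLittleO]
  refine Asymptotics.IsBigO.trans_isLittleO ?_ hr
  refine Asymptotics.IsBigO.of_bound ((μ univ).toReal ^ (1 / 2 : ℝ))
    (Eventually.of_forall fun σ => ?_)
  have hm := ((hΨ σ).sub (hΨ s)).sub (hΨ'.const_smul (σ - s))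
  rw [toL2_sub (hΨ σ) (hΨ s), toL2_smul hΨ', toL2_sub ((hΨ σ).sub (hΨ s)) (hΨ'.const_smul _),
    norm_toL2 hm]
  have h1 := eLpNorm_le_of_ae_bound (p := 2) (μ := μ) (f := Ψ σ - Ψ s - (σ - s) • Ψ') (C := r σ)
    (by filter_upwards [hle σ] with x hx; simpa using hx)
  have h2 := ENNReal.toReal_mono (by finiteness) h1
  rw [ENNReal.toReal_mul, ← ENNReal.toReal_rpow] at h2
  refine h2.trans ?_
  rcases le_or_gt 0 (r σ) with h0 | h0
  · rw [ENNReal.toReal_ofReal h0, Real.norm_of_nonneg h0]; norm_num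
  · rw [ENNReal.ofReal_of_nonpos h0.le]; simp; positivity

theorem memLp_restrict_Ioo_of_continuous {a b : ℝ} {f : ℝ → ℝ} (hf : Continuous f) {r : ENNReal} :
    MemLp f r (volume.restrict (Ioo a b)) := by
  obtain ⟨C, hC⟩ := isCompact_Icc.exists_bound_of_continuousOn (hf.continuousOn (s := Icc a b))
  refine MemLp.of_bound hf.aestronglyMeasurable C ?_
  filter_upwards [ae_restrict_mem measurableSet_Ioo] with x hx
  exact hC x (Ioo_subset_Icc_self hx)

/-- Smoothness of φ makes the Taylor remainder uniform in x, which is enough on a bounded interval.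
It lets a moving change of variables be differentiated on the test function instead of on a rough
solution. -/
theorem hasDerivWithinAt_toL2_comp_affine {a b : ℝ} {φ : ℝ → ℝ} (hφ : ContDiff ℝ ∞ φ)
    (hc : HasCompactSupport φ) {J : Set ℝ} {s : ℝ} {m α β : ℝ → ℝ} {m' α' β' : ℝ}
    (hm : HasDerivWithinAt m m' J s) (hα : HasDerivWithinAt α α' J s)
    (hβ : HasDerivWithinAt β β' J s) :
    HasDerivWithinAt
      (fun σ => toL2 (volume.restrict (Ioo a b)) fun x => m σ * φ (α σ + β σ * x))
      (toL2 (volume.restrict (Ioo a b)) fun x => m' * φ (α s + β s * x)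
        + m s * ((α' + β' * x) * deriv φ (α s + β s * x))) J s := by
  obtain ⟨C, hC, b0, b1, b2, b3⟩ := exists_taylor_bound hφ hc
  have hd : Continuous (deriv φ) := hφ.continuous_deriv (by simp)
  have hcont : ∀ {f : ℝ → ℝ}, Continuous f → MemLp f 2 (volume.restrict (Ioo a b)) := fun {f} hf =>
    memLp_restrict_Ioo_of_continuous hf
  set M := max |a| |b|
  have hM : ∀ x ∈ Ioo a b, |x| ≤ M := fun x hx => abs_le_max_abs_abs hx.1.le hx.2.le
  have hM0 : 0 ≤ M := (abs_nonneg a).trans (le_max_left _ _)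
  have lm := hasDerivWithinAt_iff_isLittleO.1 hm
  have lα := hasDerivWithinAt_iff_isLittleO.1 hα
  have lβ := hasDerivWithinAt_iff_isLittleO.1 hβ
  have Oα := hα.differentiableWithinAt.isBigO_sub
  have Oβ := hβ.differentiableWithinAt.isBigO_sub
  simp only [smul_eq_mul] at lm lα lβ
  set D : ℝ → ℝ := fun σ => |α σ - α s| + M * |β σ - β s| with hD
  have OD : D =O[𝓝[J] s] fun σ => σ - s := Oα.norm_left.add (Oβ.norm_left.const_mul_left M)
  have hD0 : ∀ σ, 0 ≤ D σ := fun σ => by positivity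
  have tz : Tendsto (fun σ => σ - s) (𝓝[J] s) (𝓝 0) := by
    have : Tendsto (fun σ => σ - s) (𝓝 s) (𝓝 (s - s)) := (continuous_sub_right s).tendsto s
    rw [sub_self] at this
    exact this.mono_left nhdsWithin_le_nhds
  have oid : (fun σ => σ - s) =o[𝓝[J] s] fun _ => (1 : ℝ) :=
    (Asymptotics.isLittleO_one_iff ℝ).2 tz
  have oD : D =o[𝓝[J] s] fun _ => (1 : ℝ) := OD.trans_isLittleO oid
  -- The error consists of the remainder of `m`, the product of the increments of `m` and of the
  -- argument, the quadratic Taylor remainder of φ, and the remainders of `α` and `β`. Each is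
  -- little-o of the time increment.
  refine hasDerivWithinAt_toL2 (fun σ => hcont (by fun_prop)) (hcont (by fun_prop))
    (r := fun σ => C * |m σ - m s - (σ - s) * m'| + |m'| * C * (|σ - s| * D σ)
      + |m s| * C * (D σ * D σ)
      + |m s| * C * (|α σ - α s - (σ - s) * α'| + M * |β σ - β s - (σ - s) * β'|)) ?_ ?_
  · have e1 : (fun σ => |σ - s| * D σ) =o[𝓝[J] s] fun σ => σ - s := by
      have := (Asymptotics.isBigO_refl (fun σ => σ - s) (𝓝[J] s)).norm_left.mul_isLittleO oD
      simpa using this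
    have e2 : (fun σ => D σ * D σ) =o[𝓝[J] s] fun σ => σ - s := by
      simpa using OD.mul_isLittleO oD
    exact (((lm.norm_left.const_mul_left C).add (e1.const_mul_left _)).add
      (e2.const_mul_left _)).add ((lα.norm_left.add (lβ.norm_left.const_mul_left M)).const_mul_left _)
  · intro σ
    filter_upwards [ae_restrict_mem measurableSet_Ioo] with x hx
    have hx := hM x hx
    set u := α s + β s * x with hu
    set z := α σ + β σ * x with hz
    have hzu : |z - u| ≤ D σ := by
      have : z - u = (α σ - α s) + x * (β σ - β s) := by rw [hu, hz]; ring
      rw [this, hD]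
      refine (abs_add_le _ _).trans (add_le_add le_rfl ?_)
      rw [abs_mul]; gcongr
    have hrem : |z - u - (σ - s) * (α' + β' * x)|
        ≤ |α σ - α s - (σ - s) * α'| + M * |β σ - β s - (σ - s) * β'| := by
      have : z - u - (σ - s) * (α' + β' * x)
          = (α σ - α s - (σ - s) * α') + x * (β σ - β s - (σ - s) * β') := by rw [hu, hz]; ring
      rw [this]
      refine (abs_add_le _ _).trans (add_le_add le_rfl ?_)
      rw [abs_mul]; gcongr
    have split : m σ * φ z - m s * φ u
          - (σ - s) * (m' * φ u + m s * ((α' + β' * x) * deriv φ u))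
        = φ z * (m σ - m s - (σ - s) * m') + m' * ((σ - s) * (φ z - φ u))
          + m s * (φ z - φ u - (z - u) * deriv φ u)
          + m s * (deriv φ u * (z - u - (σ - s) * (α' + β' * x))) := by ring
    rw [split]
    refine (abs_add_le _ _).trans (add_le_add ((abs_add_le _ _).trans (add_le_add
      ((abs_add_le _ _).trans (add_le_add ?_ ?_)) ?_)) ?_)
    · rw [abs_mul]; gcongr; exact b0 z
    · rw [abs_mul, abs_mul]
      calc _ ≤ |m'| * (|σ - s| * (C * D σ)) := by
            gcongr; exact (b2 u z).trans (by gcongr)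
        _ = _ := by ring
    · rw [abs_mul]
      calc _ ≤ |m s| * (C * D σ ^ 2) := by
            gcongr; exact (b3 u z).trans (by gcongr)
        _ = _ := by ring
    · rw [abs_mul, abs_mul]
      calc _ ≤ |m s| * (C * (|α σ - α s - (σ - s) * α'| + M * |β σ - β s - (σ - s) * β'|)) := by
            gcongr; exact b1 u
        _ = _ := by ring

/-! ### Weak transport equations with affine velocity -/

/-- At time `s` (within `J`), `g` satisfies `∂ₛ g + (v₀ + v₁ y) ∂_y g = G` weakly on `(a, b)`. -/
def WeakTransport (a b : ℝ) (J : Set ℝ) (s v₀ v₁ : ℝ) (g : ℝ → ℝ → ℝ) (G : ℝ → ℝ) : Prop :=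
  ∀ φ, IsTest a b φ → HasDerivWithinAt (fun σ => ∫ y in Ioo a b, g σ y * φ y)
    (∫ y in Ioo a b, (g s y * (v₁ * φ y + (v₀ + v₁ * y) * deriv φ y) + G y * φ y)) J s

theorem integral_comp_affine (F : ℝ → ℝ) (c : ℝ) {l : ℝ} (hl : 0 < l) :
    ∫ x, F x = ∫ y, l * F (c + l * y) := by
  rw [integral_const_mul, Measure.integral_comp_mul_left (fun z => F (c + z)) l,
    integral_add_left_eq_self (fun z => F z) c, abs_of_pos (inv_pos.2 hl), smul_eq_mul,
    mul_inv_cancel_left₀ hl.ne']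

theorem IsTest.comp_affine {A B a b : ℝ} {φ : ℝ → ℝ} (h : IsTest A B φ) {c l : ℝ} (hl : 0 < l)
    (ha : a ≤ c + l * A) (hb : c + l * B ≤ b) : IsTest a b (fun x => φ (-c / l + 1 / l * x)) := by
  have hcont : Continuous fun x : ℝ => -c / l + 1 / l * x := by fun_prop
  have hsub : tsupport (fun x => φ (-c / l + 1 / l * x)) ⊆
      (fun x => -c / l + 1 / l * x) ⁻¹' tsupport φ := tsupport_comp_subset_preimage φ hcont
  have hin : (fun x => -c / l + 1 / l * x) ⁻¹' tsupport φ ⊆ Ioo a b := by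
    intro x hx
    have h1 := h.2.2 hx
    have e : l * (-c / l + 1 / l * x) = x - c := by field_simp; ring
    have h2 := mul_lt_mul_of_pos_left h1.1 hl
    have h3 := mul_lt_mul_of_pos_left h1.2 hl
    rw [e] at h2 h3
    exact ⟨by linarith, by linarith⟩
  refine ⟨h.1.comp (by fun_prop), ?_, hsub.trans hin⟩
  exact HasCompactSupport.of_support_subset_isCompact (isCompact_Icc (a := a) (b := b))
    ((subset_tsupport _).trans ((hsub.trans hin).trans Ioo_subset_Icc_self))

/-- Change of variables in a weak transport equation. -/
theorem WeakTransport.comp_affine {a b : ℝ} (hab : a < b) {J' J : Set ℝ} {g : ℝ → ℝ → ℝ}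
    {G : ℝ → ℝ} {τ m c l : ℝ → ℝ} {τ' m' c' l' s v₀ v₁ : ℝ}
    (hT : WeakTransport a b J' (τ s) v₀ v₁ g G)
    (hg : L2ContOn (volume.restrict (Ioo a b)) J' g)
    (hG : LocallyIntegrableOn G (Ioo a b))
    (hτ : HasDerivWithinAt τ τ' J s) (hm : HasDerivWithinAt m m' J s)
    (hc : HasDerivWithinAt c c' J s) (hl : HasDerivWithinAt l l' J s) (hl0 : 0 < l s)
    (hs : s ∈ J) (hmap : ∀ᶠ σ in 𝓝[J] s, τ σ ∈ J')
    {A B : ℝ} {φ : ℝ → ℝ} (hφ : IsTest A B φ) (ha : a < c s + l s * A) (hb : c s + l s * B < b) :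
    HasDerivWithinAt (fun σ => ∫ y, m σ * g (τ σ) (c σ + l σ * y) * φ y)
      (∫ y, (m s * g (τ s) (c s + l s * y) * ((τ' * v₁ * l s - l') / l s * φ y
        + ((τ' * (v₀ + v₁ * c s) - c') / l s + (τ' * v₁ * l s - l') / l s * y) * deriv φ y)
        + (m' * g (τ s) (c s + l s * y) + m s * τ' * G (c s + l s * y)) * φ y)) J s := by
  have hl0' := hl0.ne'
  have hts : τ s ∈ J' := hmap.self_of_nhdsWithin hs
  set μ := volume.restrict (Ioo a b) with hμ
  -- Duality: the amplitude, the dilation and the Jacobian are all moved onto the test function, so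
  -- the integral is the pairing of `g (τ σ)` with a differentiable path.
  set Ψ : ℝ → ℝ → ℝ := fun σ x => m σ / l σ * φ (-c σ / l σ + 1 / l σ * x) with hΨ
  have hk : HasDerivWithinAt (fun σ => m σ / l σ) ((m' * l s - m s * l') / l s ^ 2) J s :=
    hm.div hl hl0'
  have hα : HasDerivWithinAt (fun σ => -c σ / l σ) ((-c' * l s - -c s * l') / l s ^ 2) J s :=
    hc.neg.div hl hl0'
  have hβ : HasDerivWithinAt (fun σ => 1 / l σ) ((0 * l s - 1 * l') / l s ^ 2) J s :=
    (hasDerivWithinAt_const s J (1 : ℝ)).div hl hl0'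
  have hΨd := hasDerivWithinAt_toL2_comp_affine (a := a) (b := b) hφ.1 hφ.2.1 hk hα hβ
  have htest0 : IsTest a b (fun x => φ (-c s / l s + 1 / l s * x)) :=
    hφ.comp_affine hl0 ha.le hb.le
  have htest0' : IsTest a b (fun x => deriv φ (-c s / l s + 1 / l s * x)) :=
    hφ.deriv.comp_affine hl0 ha.le hb.le
  have htest : IsTest a b (Ψ s) := htest0.mul_left contDiff_const
  set Ψ' : ℝ → ℝ := fun x => (m' * l s - m s * l') / l s ^ 2 * φ (-c s / l s + 1 / l s * x)
      + m s / l s * (((-c' * l s - -c s * l') / l s ^ 2 + (0 * l s - 1 * l') / l s ^ 2 * x)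
        * deriv φ (-c s / l s + 1 / l s * x)) with hΨ'
  have hdΨ : ∀ x, deriv (Ψ s) x = m s / l s * (1 / l s * deriv φ (-c s / l s + 1 / l s * x)) := by
    intro x
    have h1 : HasDerivAt (fun x => -c s / l s + 1 / l s * x) (1 / l s) x := by
      simpa using ((hasDerivAt_id x).const_mul (1 / l s)).const_add (-c s / l s)
    have h2 := ((hφ.differentiable _).hasDerivAt.comp x h1).const_mul (m s / l s)
    rw [show deriv (Ψ s) x = _ from h2.deriv]; ring
  have hmemΨ : ∀ σ, MemLp (Ψ σ) 2 μ := fun σ =>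
    memLp_restrict_Ioo_of_continuous (by have := hφ.continuous; fun_prop)
  have hmemΨ' : MemLp Ψ' 2 μ := memLp_restrict_Ioo_of_continuous (by
    have := hφ.continuous; have := hφ.continuous_deriv; fun_prop)
  have hcontτ : Tendsto τ (𝓝[J] s) (𝓝[J'] (τ s)) :=
    tendsto_nhdsWithin_iff.2 ⟨hτ.continuousWithinAt, hmap⟩
  have hgc : ContinuousWithinAt (fun σ => toL2 μ (g (τ σ))) J s :=
    Tendsto.comp (hg.continuousOn (τ s) hts) hcontτ
  have hweak : HasDerivWithinAt (fun σ => inner ℝ (toL2 μ (g (τ σ))) (toL2 μ (Ψ s)))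
      (τ' * ∫ y in Ioo a b, (g (τ s) y * (v₁ * Ψ s y + (v₀ + v₁ * y) * deriv (Ψ s) y)
        + G y * Ψ s y)) J s := by
    -- `τ` is only known to map into `J'` near `s`, so the chain rule is applied on the
    -- intersection, which is a neighbourhood of `s` within `J`.
    have hτ'' : HasDerivWithinAt τ τ' (J ∩ τ ⁻¹' J') s := hτ.mono inter_subset_left
    have h1 := (hT (Ψ s) htest).comp s hτ'' (fun σ hσ => hσ.2)
    rw [mul_comm] at h1
    have h2 := h1.mono_of_mem_nhdsWithin (inter_mem self_mem_nhdsWithin hmap)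
    refine h2.congr_of_eventuallyEq_of_mem ?_ hs
    filter_upwards [hmap] with σ hσ
    exact inner_toL2 (hg.memLp _ hσ) (hmemΨ s)
  have hK := hasDerivWithinAt_inner_of_weak hweak hgc hΨd
  have hev : ∀ᶠ σ in 𝓝[J] s, 0 < l σ ∧ a < c σ + l σ * A ∧ c σ + l σ * B < b := by
    have e1 := hl.continuousWithinAt.eventually (eventually_gt_nhds hl0)
    have e2 := (hc.continuousWithinAt.add (hl.continuousWithinAt.mul_const A)).eventually
      (eventually_gt_nhds ha)
    have e3 := (hc.continuousWithinAt.add (hl.continuousWithinAt.mul_const B)).eventually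
      (eventually_lt_nhds hb)
    filter_upwards [e1, e2, e3] with σ h1 h2 h3 using ⟨h1, h2, h3⟩
  have heq : (fun σ => ∫ y, m σ * g (τ σ) (c σ + l σ * y) * φ y) =ᶠ[𝓝[J] s]
      fun σ => inner ℝ (toL2 μ (g (τ σ))) (toL2 μ (Ψ σ)) := by
    filter_upwards [hev, hmap] with σ h1 h2
    rw [inner_toL2 (hg.memLp _ h2) (hmemΨ σ)]
    have ht : IsTest a b (Ψ σ) :=
      (hφ.comp_affine h1.1 h1.2.1.le h1.2.2.le).mul_left contDiff_const
    rw [hμ, ht.setIntegral_mul, integral_comp_affine (fun y => g (τ σ) y * Ψ σ y) (c σ) h1.1]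
    congr 1; ext y
    have h0 := h1.1.ne'
    have : -c σ / l σ + 1 / l σ * (c σ + l σ * y) = y := by field_simp; ring
    simp only [hΨ]
    rw [this]; field_simp
  refine (hK.congr_of_eventuallyEq_of_mem heq hs).congr_deriv ?_
  have hg' : LocallyIntegrableOn (g (τ s)) (Ioo a b) :=
    IntegrableOn.locallyIntegrableOn ((hg.memLp _ hts).integrable (by norm_num))
  have ht1 : IsTest a b (fun y => v₁ * Ψ s y + (v₀ + v₁ * y) * deriv (Ψ s) y) := by
    have e : (fun y => v₁ * Ψ s y + (v₀ + v₁ * y) * deriv (Ψ s) y)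
        = deriv (fun y => (v₀ + v₁ * y) * Ψ s y) := by
      ext y
      have h1 : HasDerivAt (fun y : ℝ => v₀ + v₁ * y) v₁ y := by
        simpa using ((hasDerivAt_id y).const_mul v₁).const_add v₀
      exact ((h1.mul (htest.differentiable y).hasDerivAt).deriv).symm
    rw [e]
    exact (htest.mul_left (by fun_prop)).deriv
  have ht2 : IsTest a b Ψ' := by
    have e1 := htest0.mul_left (k := fun _ => (m' * l s - m s * l') / l s ^ 2) contDiff_const
    have e2 := htest0'.mul_left (k := fun x => m s / l s *
      ((-c' * l s - -c s * l') / l s ^ 2 + (0 * l s - 1 * l') / l s ^ 2 * x)) (by fun_prop)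
    have e3 : Ψ' = fun x => ((m' * l s - m s * l') / l s ^ 2 * φ (-c s / l s + 1 / l s * x))
      + (m s / l s * ((-c' * l s - -c s * l') / l s ^ 2 + (0 * l s - 1 * l') / l s ^ 2 * x))
        * deriv φ (-c s / l s + 1 / l s * x) := by
      ext x; simp only [hΨ']; ring
    rw [e3]
    exact ⟨e1.1.add e2.1, e1.2.1.add e2.2.1,
      (tsupport_add _ _).trans (union_subset e1.2.2 e2.2.2)⟩
  have i1 := integrableOn_mul_test hab ht1 hg'
  have i2 := integrableOn_mul_test hab htest hG
  have i3 := integrableOn_mul_test hab ht2 hg'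
  rw [inner_toL2 (hg.memLp _ hts) hmemΨ', ← integral_const_mul, ← integral_add
    ((i1.fun_add i2).const_mul τ').integrableOn i3.integrableOn]
  rw [setIntegral_eq_integral_of_forall_compl_eq_zero (fun y hy => by
    rw [ht1.zero_of_notMem hy, htest.zero_of_notMem hy, ht2.zero_of_notMem hy]; ring),
    integral_comp_affine _ (c s) hl0]
  congr 1; ext y
  have : -c s / l s + 1 / l s * (c s + l s * y) = y := by field_simp; ring
  simp only [hΨ', hdΨ]
  simp only [hΨ]
  rw [this]
  field_simp
  ring

namespace WeakTransport

variable {a b s v₀ v₁ : ℝ} {J : Set ℝ} {g h : ℝ → ℝ → ℝ} {G H : ℝ → ℝ}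

theorem test_velocity {φ : ℝ → ℝ} (hφ : IsTest a b φ) (v₀ v₁ : ℝ) :
    IsTest a b (fun y => v₁ * φ y + (v₀ + v₁ * y) * deriv φ y) := by
  have e : (fun y => v₁ * φ y + (v₀ + v₁ * y) * deriv φ y)
      = deriv (fun y => (v₀ + v₁ * y) * φ y) := by
    ext y
    have h1 : HasDerivAt (fun y : ℝ => v₀ + v₁ * y) v₁ y := by
      simpa using ((hasDerivAt_id y).const_mul v₁).const_add v₀
    exact ((h1.mul (hφ.differentiable y).hasDerivAt).deriv).symm
  rw [e]
  exact (hφ.mul_left (by fun_prop)).deriv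

/-- The velocity can be changed when the weak space derivative is a function. -/
theorem change_velocity (hab : a < b) (hT : WeakTransport a b J s v₀ v₁ g G) {gy : ℝ → ℝ}
    (hw : IsWeakDeriv a b (g s) gy) (hg : LocallyIntegrableOn (g s) (Ioo a b))
    (hgy : LocallyIntegrableOn gy (Ioo a b)) (hG : LocallyIntegrableOn G (Ioo a b))
    (u₀ u₁ : ℝ) :
    WeakTransport a b J s u₀ u₁ g
      (fun y => G y + ((u₀ - v₀) + (u₁ - v₁) * y) * gy y) := by
  intro φ hφ
  refine (hT φ hφ).congr_deriv ?_
  have hφ' := hφ.mul_left (k := fun y => (u₀ - v₀) + (u₁ - v₁) * y) (by fun_prop)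
  have e1 := hw _ hφ'
  have hd : ∀ y, deriv (fun y => ((u₀ - v₀) + (u₁ - v₁) * y) * φ y) y
      = (u₁ - v₁) * φ y + ((u₀ - v₀) + (u₁ - v₁) * y) * deriv φ y := by
    intro y
    have h1 : HasDerivAt (fun y : ℝ => (u₀ - v₀) + (u₁ - v₁) * y) (u₁ - v₁) y := by
      simpa using ((hasDerivAt_id y).const_mul (u₁ - v₁)).const_add (u₀ - v₀)
    exact (h1.mul (hφ.differentiable y).hasDerivAt).deriv
  simp only [hd] at e1
  have j1 := (integrableOn_mul_test hab (test_velocity hφ v₀ v₁) hg).integrableOn (s := Ioo a b)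
  have j2 := (integrableOn_mul_test hab hφ hG).integrableOn (s := Ioo a b)
  have j3 := (integrableOn_mul_test hab (test_velocity hφ (u₀ - v₀) (u₁ - v₁)) hg).integrableOn
    (s := Ioo a b)
  have j4 := (integrableOn_mul_test hab hφ' hgy).integrableOn (s := Ioo a b)
  -- The integration by parts is recorded as a vanishing integral and added, so that the two sides
  -- can be compared pointwise.
  have e2 : (∫ y in Ioo a b, (g s y * ((u₁ - v₁) * φ y + ((u₀ - v₀) + (u₁ - v₁) * y) * deriv φ y)
      + gy y * (((u₀ - v₀) + (u₁ - v₁) * y) * φ y))) = 0 := by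
    rw [integral_add j3 j4, e1]; ring
  rw [← add_zero (∫ y in Ioo a b, (g s y * (v₁ * φ y + (v₀ + v₁ * y) * deriv φ y) + G y * φ y)),
    ← e2, ← integral_add (j1.fun_add j2) (j3.fun_add j4)]
  congr 1; ext y; ring

theorem add (hab : a < b) (hg : WeakTransport a b J s v₀ v₁ g G) (hh : WeakTransport a b J s v₀ v₁ h H)
    (hgi : ∀ σ ∈ J, LocallyIntegrableOn (g σ) (Ioo a b)) (hGi : LocallyIntegrableOn G (Ioo a b))
    (hhi : ∀ σ ∈ J, LocallyIntegrableOn (h σ) (Ioo a b)) (hHi : LocallyIntegrableOn H (Ioo a b))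
    (hs : s ∈ J) (c : ℝ) :
    WeakTransport a b J s v₀ v₁ (fun σ y => g σ y + c * h σ y) (fun y => G y + c * H y) := by
  intro φ hφ
  have key := (hg φ hφ).add ((hh φ hφ).const_mul c)
  refine (key.congr_of_mem (fun σ hσ => ?_) hs).congr_deriv ?_
  · have i1 := (integrableOn_mul_test hab hφ (hgi σ hσ)).integrableOn (s := Ioo a b)
    have i2 := (integrableOn_mul_test hab hφ (hhi σ hσ)).integrableOn (s := Ioo a b)
    simp only [Pi.add_apply]
    rw [← integral_const_mul, ← integral_add i1 (i2.const_mul c)]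
    congr 1; ext y; ring
  · have i1 := (integrableOn_mul_test hab (test_velocity hφ v₀ v₁) (hgi s hs)).integrableOn
      (s := Ioo a b)
    have i2 := (integrableOn_mul_test hab hφ hGi).integrableOn (s := Ioo a b)
    have i3 := (integrableOn_mul_test hab (test_velocity hφ v₀ v₁) (hhi s hs)).integrableOn
      (s := Ioo a b)
    have i4 := (integrableOn_mul_test hab hφ hHi).integrableOn (s := Ioo a b)
    rw [← integral_const_mul, ← integral_add (i1.fun_add i2) ((i3.fun_add i4).const_mul c)]
    congr 1; ext y; ring

theorem mono_interval (hT : WeakTransport a b J s v₀ v₁ g G) {c d : ℝ} (hc : a ≤ c) (hd : d ≤ b) :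
    WeakTransport c d J s v₀ v₁ g G := by
  intro φ hφ
  have hφ' := hφ.mono hc hd
  have h1 := hT φ hφ'
  simp only [hφ'.setIntegral_mul] at h1
  rw [setIntegral_eq_integral_of_forall_compl_eq_zero (fun y hy => by
    rw [hφ'.zero_of_notMem hy, hφ'.deriv_zero_of_notMem hy]; ring)] at h1
  simp only [hφ.setIntegral_mul]
  rwa [setIntegral_eq_integral_of_forall_compl_eq_zero (fun y hy => by
    rw [hφ.zero_of_notMem hy, hφ.deriv_zero_of_notMem hy]; ring)]

theorem congr_ae (hT : WeakTransport a b J s v₀ v₁ g G) (hs : s ∈ J)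
    (hg : ∀ σ ∈ J, h σ =ᵐ[volume.restrict (Ioo a b)] g σ)
    (hG : H =ᵐ[volume.restrict (Ioo a b)] G) : WeakTransport a b J s v₀ v₁ h H := by
  intro φ hφ
  refine ((hT φ hφ).congr_of_mem (fun σ hσ => integral_congr_ae ?_) hs).congr_deriv
    (integral_congr_ae ?_)
  · filter_upwards [hg σ hσ] with y hy; rw [hy]
  · filter_upwards [hg s hs, hG] with y h1 h2; rw [h1, h2]

end WeakTransport

/-! ### Affine changes of variables in `L²` -/

theorem eLpNorm_comp_affine (f : ℝ → ℝ) (c : ℝ) {l : ℝ} (hl : 0 < l) :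
    eLpNorm (fun y => f (c + l * y)) 2 volume
      = ENNReal.ofReal l⁻¹ ^ (1 / (2 : ENNReal)).toReal * eLpNorm f 2 volume := by
  have hemb : MeasurableEmbedding fun y : ℝ => c + l * y :=
    ((Homeomorph.mulLeft₀ l hl.ne').trans (Homeomorph.addLeft c)).measurableEmbedding
  have hmap : Measure.map (fun y : ℝ => c + l * y) volume = ENNReal.ofReal l⁻¹ • volume := by
    have h1 : (fun y : ℝ => c + l * y) = (fun z => c + z) ∘ fun y => l * y := rfl
    rw [h1, ← Measure.map_map (by fun_prop) (by fun_prop), Real.map_volume_mul_left hl.ne',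
      Measure.map_smul, map_add_left_eq_self, abs_of_pos (inv_pos.2 hl)]
  have h2 := hemb.eLpNorm_map_measure (g := f) (p := 2) (μ := volume)
  rw [hmap, eLpNorm_smul_measure_of_ne_top (by norm_num)] at h2
  rw [show (fun y => f (c + l * y)) = f ∘ fun y => c + l * y from rfl, ← h2, smul_eq_mul]

theorem memLp_comp_affine {f : ℝ → ℝ} (hf : MemLp f 2 volume) (c : ℝ) {l : ℝ} (hl : 0 < l) :
    MemLp (fun y => f (c + l * y)) 2 volume := by
  refine ⟨?_, ?_⟩
  · refine hf.1.comp_quasiMeasurePreserving ⟨by fun_prop, ?_⟩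
    have h1 : (fun y : ℝ => c + l * y) = (fun z => c + z) ∘ fun y => l * y := rfl
    rw [h1, ← Measure.map_map (by fun_prop) (by fun_prop), Real.map_volume_mul_left hl.ne',
      Measure.map_smul, map_add_left_eq_self]
    exact Measure.smul_absolutelyContinuous
  · rw [eLpNorm_comp_affine f c hl]
    exact ENNReal.mul_lt_top (by finiteness) hf.2

/-- Rescaling is strongly continuous on `L²`. -/
theorem tendsto_eLpNorm_comp_affine {f : ℝ → ℝ} (hf : MemLp f 2 volume) {ι : Type*} {F : Filter ι}
    {c l : ι → ℝ} {c₀ l₀ : ℝ} (hc : Tendsto c F (𝓝 c₀)) (hl : Tendsto l F (𝓝 l₀)) (hl₀ : 0 < l₀) :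
    Tendsto (fun i => eLpNorm (fun y => f (c i + l i * y) - f (c₀ + l₀ * y)) 2 volume) F (𝓝 0) := by
  -- The norm on L² of all the rescalings with factor at least `l₀ / 2` is bounded by this constant.
  set K : ENNReal := ENNReal.ofReal (l₀ / 2)⁻¹ ^ (1 / (2 : ENNReal)).toReal with hK
  have hKtop : K ≠ ⊤ := by rw [hK]; finiteness
  have hsmall : ∀ (h : ℝ → ℝ) (c : ℝ) (l : ℝ), l₀ / 2 ≤ l →
      eLpNorm (fun y => h (c + l * y)) 2 volume ≤ K * eLpNorm h 2 volume := by
    intro h c l hl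
    have : 0 < l := by linarith
    rw [eLpNorm_comp_affine h c this, hK]
    gcongr
  have hl2 : ∀ᶠ i in F, l₀ / 2 ≤ l i := (hl.eventually (eventually_gt_nhds (by linarith))).mono
    fun i hi => hi.le
  -- the case of a smooth compactly supported function
  have hsmooth : ∀ φ : ℝ → ℝ, ContDiff ℝ ∞ φ → HasCompactSupport φ →
      Tendsto (fun i => eLpNorm (fun y => φ (c i + l i * y) - φ (c₀ + l₀ * y)) 2 volume) F (𝓝 0) := by
    intro φ hφ hφc
    obtain ⟨C, hC, -, -, b2, -⟩ := exists_taylor_bound hφ hφc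
    obtain ⟨r, hr⟩ := hφc.isCompact.isBounded.subset_closedBall 0
    set R := (|r| + |c₀| + 1) / (l₀ / 2)
    have hzero : ∀ (c l y : ℝ), |c| ≤ |c₀| + 1 → l₀ / 2 ≤ l → y ∉ Icc (-R) R →
        φ (c + l * y) = 0 := by
      intro c l y hc hl hy
      refine image_eq_zero_of_notMem_tsupport fun hmem => hy ?_
      have h1 : |c + l * y| ≤ r := by simpa using hr hmem
      have hl0 : 0 < l := by linarith
      have h2 : |l * y| ≤ |r| + |c₀| + 1 := by
        have : |l * y| ≤ |c + l * y| + |c| := by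
          have := abs_sub (c + l * y) c
          rwa [add_sub_cancel_left] at this
        linarith [le_abs_self r]
      rw [abs_mul, abs_of_pos hl0] at h2
      rw [mem_Icc, ← abs_le]
      rw [le_div_iff₀ (by linarith)]
      nlinarith [abs_nonneg y]
    have hb : Tendsto (fun i => ENNReal.ofReal (C * (|c i - c₀| + R * |l i - l₀|))
        * (volume (Icc (-R) R)) ^ (1 / (2 : ℝ))) F (𝓝 0) := by
      have h1 : Tendsto (fun i => C * (|c i - c₀| + R * |l i - l₀|)) F (𝓝 0) := by
        have e1 := (hc.sub_const c₀).abs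
        have e2 := (hl.sub_const l₀).abs
        simp only [sub_self, abs_zero] at e1 e2
        simpa using (e1.add (e2.const_mul R)).const_mul C
      have h2 := ENNReal.tendsto_ofReal h1
      rw [ENNReal.ofReal_zero] at h2
      have h3 := ENNReal.Tendsto.mul_const (b := (volume (Icc (-R) R)) ^ (1 / (2 : ℝ))) h2
        (Or.inr (by rw [Real.volume_Icc]; finiteness))
      rwa [zero_mul] at h3
    refine tendsto_of_tendsto_of_tendsto_of_le_of_le' tendsto_const_nhds hb
      (Eventually.of_forall fun _ => zero_le) ?_
    have hc1 : ∀ᶠ i in F, |c i| ≤ |c₀| + 1 :=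
      (hc.abs.eventually (eventually_lt_nhds (lt_add_one _))).mono fun i hi => hi.le
    filter_upwards [hl2, hc1] with i h1 h2
    have hind : (fun y => φ (c i + l i * y) - φ (c₀ + l₀ * y)) = (Icc (-R) R).indicator
        (fun y => φ (c i + l i * y) - φ (c₀ + l₀ * y)) := by
      refine (indicator_eq_self.2 fun y hy => by_contra fun hyS => hy ?_).symm
      rw [hzero _ _ y h2 h1 hyS, hzero _ _ y (by linarith) (by linarith) hyS, sub_zero]
    rw [hind, eLpNorm_indicator_eq_eLpNorm_restrict measurableSet_Icc]
    refine (eLpNorm_le_of_ae_bound (C := C * (|c i - c₀| + R * |l i - l₀|)) ?_).trans (le_of_eq ?_)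
    · filter_upwards [ae_restrict_mem measurableSet_Icc] with y hy
      refine (b2 _ _).trans (mul_le_mul_of_nonneg_left ?_ hC)
      have : c i + l i * y - (c₀ + l₀ * y) = (c i - c₀) + y * (l i - l₀) := by ring
      rw [this]
      refine (abs_add_le _ _).trans (add_le_add le_rfl ?_)
      rw [abs_mul]
      exact mul_le_mul_of_nonneg_right (abs_le.2 hy) (abs_nonneg _)
    · rw [Measure.restrict_apply_univ, mul_comm]; norm_num
  rw [ENNReal.tendsto_nhds_zero]
  intro ε hε
  obtain ⟨δ, hδ, hδε⟩ : ∃ δ : ℝ, 0 < δ ∧ K * ENNReal.ofReal δ + K * ENNReal.ofReal δ ≤ ε / 2 := by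
    have ht : Tendsto (fun δ : ℝ => K * ENNReal.ofReal δ + K * ENNReal.ofReal δ) (𝓝[>] 0) (𝓝 0) := by
      have h3 : Tendsto (fun δ : ℝ => ENNReal.ofReal δ) (𝓝[>] 0) (𝓝 0) := by
        have := (ENNReal.continuous_ofReal.tendsto (0 : ℝ)).mono_left
          (nhdsWithin_le_nhds (s := Ioi 0))
        simpa using this
      have h4 := ENNReal.Tendsto.const_mul (a := K) h3 (Or.inr hKtop)
      rw [mul_zero] at h4
      simpa using h4.add h4
    obtain ⟨δ, h5, h6⟩ := ((ENNReal.tendsto_nhds_zero.1 ht (ε / 2)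
      (ENNReal.half_pos hε.ne')).and self_mem_nhdsWithin).exists
    exact ⟨δ, h6, h5⟩
  -- Density of smooth compactly supported functions: the two errors of approximation are carried
  -- through the rescalings at the cost of the factor `K`.
  obtain ⟨φ, hφc, hφ, hfφ⟩ := hf.exist_eLpNorm_sub_le (by norm_num) (by norm_num) hδ
  have hφm : MemLp φ 2 volume := hφ.continuous.memLp_of_hasCompactSupport hφc
  have hd := hf.sub hφm
  filter_upwards [hl2, ENNReal.tendsto_nhds_zero.1 (hsmooth φ hφ hφc) (ε / 2)
    (ENNReal.half_pos hε.ne')] with i h1 h2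
  have hli : 0 < l i := by linarith
  have split : (fun y => f (c i + l i * y) - f (c₀ + l₀ * y))
      = ((fun y => (f - φ) (c i + l i * y)) - fun y => (f - φ) (c₀ + l₀ * y))
        + fun y => φ (c i + l i * y) - φ (c₀ + l₀ * y) := by
    ext y; simp; ring
  have m1 := memLp_comp_affine hd (c i) hli
  have m2 := memLp_comp_affine hd c₀ hl₀
  have m3 := (memLp_comp_affine hφm (c i) hli).sub (memLp_comp_affine hφm c₀ hl₀)
  rw [split]
  calc _ ≤ (eLpNorm (fun y => (f - φ) (c i + l i * y)) 2 volume
        + eLpNorm (fun y => (f - φ) (c₀ + l₀ * y)) 2 volume)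
        + eLpNorm (fun y => φ (c i + l i * y) - φ (c₀ + l₀ * y)) 2 volume :=
        (eLpNorm_add_le (m1.sub m2).1 m3.1 (by norm_num)).trans
          (add_le_add (eLpNorm_sub_le m1.1 m2.1 (by norm_num)) le_rfl)
    _ ≤ (K * ENNReal.ofReal δ + K * ENNReal.ofReal δ) + ε / 2 := by
        gcongr
        · exact (hsmall _ _ _ h1).trans (by gcongr)
        · exact (hsmall _ _ _ (by linarith)).trans (by gcongr)
    _ ≤ ε / 2 + ε / 2 := by gcongr
    _ = ε := ENNReal.add_halves ε

/-- The difference splits into a uniformly bounded rescaling of `g (τ σ) - g (τ s)` and two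
rescalings of the fixed function `g (τ s)`, which are close by strong continuity. -/
theorem L2ContOn.comp_affine {J J' : Set ℝ} {g : ℝ → ℝ → ℝ} (hg : L2ContOn volume J' g)
    {τ c l : ℝ → ℝ} (hτ : ContinuousOn τ J) (hmaps : MapsTo τ J J') (hc : ContinuousOn c J)
    (hl : ContinuousOn l J) (hl0 : ∀ s ∈ J, 0 < l s) :
    L2ContOn volume J (fun s y => g (τ s) (c s + l s * y)) := by
  refine ⟨fun s hs => memLp_comp_affine (hg.memLp _ (hmaps hs)) _ (hl0 s hs), fun s hs => ?_⟩
  have ls := hl0 s hs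
  have h1 := tendsto_eLpNorm_comp_affine (hg.memLp _ (hmaps hs)) (hc s hs) (hl s hs) ls
  have hev : ∀ᶠ σ in 𝓝[J] s, τ σ ∈ J' := by
    filter_upwards [self_mem_nhdsWithin] with σ hσ
    exact hmaps hσ
  have hτs : Tendsto τ (𝓝[J] s) (𝓝[J'] (τ s)) := tendsto_nhdsWithin_iff.2 ⟨hτ s hs, hev⟩
  set K : ENNReal := ENNReal.ofReal (l s / 2)⁻¹ ^ (1 / (2 : ENNReal)).toReal with hK
  have h2 := ENNReal.Tendsto.const_mul (a := K) ((hg.tendsto _ (hmaps hs)).comp hτs)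
    (Or.inr (by rw [hK]; finiteness))
  have h3 := h2.add h1
  rw [mul_zero, add_zero] at h3
  refine tendsto_of_tendsto_of_tendsto_of_le_of_le' tendsto_const_nhds h3
    (Eventually.of_forall fun _ => zero_le) ?_
  have hl2 : ∀ᶠ σ in 𝓝[J] s, l s / 2 < l σ :=
    Tendsto.eventually (hl s hs) (eventually_gt_nhds (by linarith))
  filter_upwards [self_mem_nhdsWithin, hl2] with σ hσ h4
  have hlσ := hl0 σ hσ
  have split : ((fun y => g (τ σ) (c σ + l σ * y)) - fun y => g (τ s) (c s + l s * y))
      = (fun y => (g (τ σ) - g (τ s)) (c σ + l σ * y))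
        + fun y => g (τ s) (c σ + l σ * y) - g (τ s) (c s + l s * y) := by
    ext y; simp
  have hgs := hg.memLp _ (hmaps hs)
  have m1 := memLp_comp_affine ((hg.memLp _ (hmaps hσ)).sub hgs) (c σ) hlσ
  have m2 := (memLp_comp_affine hgs (c σ) hlσ).sub (memLp_comp_affine hgs (c s) ls)
  rw [split]
  refine (eLpNorm_add_le m1.1 m2.1 (by norm_num)).trans (add_le_add ?_ le_rfl)
  rw [eLpNorm_comp_affine _ _ hlσ]
  simp only [Function.comp_apply, hK]
  gcongr

/-! ### Strong differentiability and the product rule for transport equations -/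

theorem hasDerivWithinAt_toL2_of_weak {J : Set ℝ} (hJ : Convex ℝ J) {k K : ℝ → ℝ → ℝ}
    (hk : L2ContOn volume J k) (hK : L2ContOn volume J K)
    (hw : ∀ φ, ContDiff ℝ ∞ φ → HasCompactSupport φ → ∀ σ ∈ J,
      HasDerivWithinAt (fun σ => ∫ y, k σ y * φ y) (∫ y, K σ y * φ y) J σ)
    {s : ℝ} (hs : s ∈ J) :
    HasDerivWithinAt (fun σ => toL2 volume (k σ)) (toL2 volume (K s)) J s := by
  refine hasDerivWithinAt_of_weak (G := fun σ => toL2 volume (K σ))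
    (Lp.dense_hasCompactSupport_contDiff (F := ℝ) (μ := (volume : Measure ℝ)) (p := 2)
      (by norm_num)) hJ ?_ hs (hK.continuousOn s hs)
  rintro f ⟨φ, hfφ, hφc, hφ⟩ σ hσ
  have hφm : MemLp φ 2 volume := hφ.continuous.memLp_of_hasCompactSupport hφc
  have hf : f = toL2 volume φ := Lp.ext (hfφ.trans (coeFn_toL2 hφm).symm)
  have e : ∀ (h : ℝ → ℝ → ℝ), L2ContOn volume J h → ∀ t ∈ J,
      inner ℝ f (toL2 volume (h t)) = ∫ y, h t y * φ y := fun h hh t ht => by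
    rw [hf, inner_toL2 hφm (hh.memLp t ht)]; congr 1; ext y; ring
  rw [e K hK σ hσ]
  exact (hw φ hφ hφc σ hσ).congr_of_mem (fun t ht => e k hk t ht) hσ

/-- Strong differentiability along the flow of `y ↦ κ + y`. -/
theorem hasDerivWithinAt_toL2_flow {J : Set ℝ} (hJ : Convex ℝ J) {κ : ℝ} {k K : ℝ → ℝ → ℝ}
    (hk : L2ContOn volume J k) (hK : L2ContOn volume J K)
    (hT : ∀ R : ℝ, ∀ σ ∈ J, WeakTransport (-R) R J σ κ 1 k (K σ)) {s : ℝ} (hs : s ∈ J) :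
    HasDerivWithinAt (fun σ => toL2 volume fun y => Real.exp ((σ - s) / 2)
        * k σ ((-κ + κ * Real.exp (σ - s)) + Real.exp (σ - s) * y))
      (toL2 volume fun y => 1 / 2 * k s y + K s y) J s := by
  have hle : ∀ σ, HasDerivWithinAt (fun σ => Real.exp (σ - s)) (Real.exp (σ - s)) J σ := fun σ => by
    simpa using ((hasDerivAt_id σ).sub_const s).exp.hasDerivWithinAt
  have hme : ∀ σ, HasDerivWithinAt (fun σ => Real.exp ((σ - s) / 2))
      (1 / 2 * Real.exp ((σ - s) / 2)) J σ := fun σ => by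
    have := (((hasDerivAt_id σ).sub_const s).div_const 2).exp.hasDerivWithinAt (s := J)
    refine this.congr_deriv ?_
    simp [mul_comm]
  have hce : ∀ σ, HasDerivWithinAt (fun σ => -κ + κ * Real.exp (σ - s)) (κ * Real.exp (σ - s)) J σ :=
    fun σ => ((hle σ).const_mul κ).const_add (-κ)
  have hcont : ∀ h : ℝ → ℝ → ℝ, L2ContOn volume J h → L2ContOn volume J fun σ y =>
      Real.exp ((σ - s) / 2) * h σ ((-κ + κ * Real.exp (σ - s)) + Real.exp (σ - s) * y) := fun h hh =>
    (hh.comp_affine (τ := id) continuousOn_id (fun _ h => h) (by fun_prop) (by fun_prop)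
      (fun _ _ => Real.exp_pos _)).mul_time (by fun_prop)
  have hG : L2ContOn volume J fun σ y => 1 / 2 * (Real.exp ((σ - s) / 2)
      * k σ ((-κ + κ * Real.exp (σ - s)) + Real.exp (σ - s) * y)) + Real.exp ((σ - s) / 2)
      * K σ ((-κ + κ * Real.exp (σ - s)) + Real.exp (σ - s) * y) :=
    ((hcont k hk).const_mul _).add (hcont K hK)
  have key := hasDerivWithinAt_toL2_of_weak hJ (hcont k hk) hG ?_ hs
  · simpa using key
  intro φ hφ hφc σ hσ
  obtain ⟨r, hr⟩ := hφc.isCompact.isBounded.subset_ball 0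
  rw [Real.ball_eq_Ioo, zero_sub, zero_add] at hr
  have hφt : IsTest (-r) r φ := ⟨hφ, hφc, hr⟩
  set cσ := -κ + κ * Real.exp (σ - s) with hcσ
  set R := |cσ| + Real.exp (σ - s) * |r| + 1 with hR
  have he := Real.exp_pos (σ - s)
  have hb1 : -R < cσ + Real.exp (σ - s) * -r := by
    have := neg_abs_le cσ
    have := mul_le_mul_of_nonneg_left (le_abs_self r) he.le
    rw [hR]; linarith
  have hb2 : cσ + Real.exp (σ - s) * r < R := by
    have := le_abs_self cσ
    have := mul_le_mul_of_nonneg_left (le_abs_self r) he.le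
    rw [hR]; linarith
  have hR0 : -R < R := by
    have : 0 < R := by positivity
    linarith
  have hloc : LocallyIntegrableOn (K σ) (Ioo (-R) R) :=
    locallyIntegrableOn_of_memLp (r := 2) (by norm_num) fun c d _ _ => (hK.memLp σ hσ).restrict _
  have := WeakTransport.comp_affine hR0 (τ := id) (hT R σ hσ)
    (hk.mono_measure Measure.restrict_le_self) hloc (hasDerivWithinAt_id σ J) (hme σ) (hce σ)
    (hle σ) he hσ (by filter_upwards [self_mem_nhdsWithin] with t ht using ht) hφt hb1 hb2
  refine this.congr_deriv (integral_congr_ae (Eventually.of_forall fun y => ?_))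
  -- The affine map solves the flow equation of the field κ + y, so in these moving coordinates both
  -- coefficients of the velocity cancel and no derivative falls on the test function. What remains
  -- is an honest time derivative in L².
  have z1 : (1 * 1 * Real.exp (σ - s) - Real.exp (σ - s)) / Real.exp (σ - s) = 0 := by
    rw [one_mul, one_mul, sub_self, zero_div]
  have z2 : (1 * (κ + 1 * (-κ + κ * Real.exp (σ - s))) - κ * Real.exp (σ - s)) / Real.exp (σ - s)
      = 0 := by rw [div_eq_zero_iff]; left; ring
  simp only [z1, z2, id, hcσ]
  ring

/-- The product rule for two functions transported by the field `κ + y`. -/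
theorem hasDerivWithinAt_integral_mul {J : Set ℝ} (hJ : Convex ℝ J) {κ : ℝ}
    {k₁ k₂ K₁ K₂ : ℝ → ℝ → ℝ} (hk₁ : L2ContOn volume J k₁) (hK₁ : L2ContOn volume J K₁)
    (hk₂ : L2ContOn volume J k₂) (hK₂ : L2ContOn volume J K₂)
    (hT₁ : ∀ R : ℝ, ∀ σ ∈ J, WeakTransport (-R) R J σ κ 1 k₁ (K₁ σ))
    (hT₂ : ∀ R : ℝ, ∀ σ ∈ J, WeakTransport (-R) R J σ κ 1 k₂ (K₂ σ)) {s : ℝ} (hs : s ∈ J) :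
    HasDerivWithinAt (fun σ => ∫ y, k₁ σ y * k₂ σ y)
      (∫ y, (k₁ s y * k₂ s y + K₁ s y * k₂ s y + k₁ s y * K₂ s y)) J s := by
  have h1 := hasDerivWithinAt_toL2_flow hJ hk₁ hK₁ hT₁ hs
  have h2 := hasDerivWithinAt_toL2_flow hJ hk₂ hK₂ hT₂ hs
  have m1 := hk₁.memLp s hs
  have m2 := hk₂.memLp s hs
  have n1 := hK₁.memLp s hs
  have n2 := hK₂.memLp s hs
  have h3 := h1.inner ℝ h2
  refine (h3.congr_of_mem (fun σ hσ => ?_) hs).congr_deriv ?_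
  · have e := Real.exp_pos (σ - s)
    rw [inner_toL2 ((memLp_comp_affine (hk₁.memLp σ hσ) _ e).const_mul _)
      ((memLp_comp_affine (hk₂.memLp σ hσ) _ e).const_mul _),
      integral_comp_affine _ (-κ + κ * Real.exp (σ - s)) e]
    congr 1; ext y
    -- The Jacobian of the flow is split evenly between the two factors, which makes the pullback an
    -- isometry and the pairing of the pullbacks equal to the original integral.
    have : Real.exp (σ - s) = Real.exp ((σ - s) / 2) * Real.exp ((σ - s) / 2) := by
      rw [← Real.exp_add]; ring_nf
    nth_rewrite 1 [this]
    ring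
  · have z : ∀ k : ℝ → ℝ → ℝ, (fun y => Real.exp ((s - s) / 2)
        * k s ((-κ + κ * Real.exp (s - s)) + Real.exp (s - s) * y)) = k s := fun k => by
      ext y; simp
    simp only [z]
    have p1 : MemLp (fun y => 1 / 2 * k₁ s y + K₁ s y) 2 volume := (m1.const_mul _).add n1
    have p2 : MemLp (fun y => 1 / 2 * k₂ s y + K₂ s y) 2 volume := (m2.const_mul _).add n2
    have q1 : Integrable (fun y => k₁ s y * (1 / 2 * k₂ s y + K₂ s y)) := m1.integrable_mul p2
    have q2 : Integrable (fun y => (1 / 2 * k₁ s y + K₁ s y) * k₂ s y) := p1.integrable_mul m2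
    rw [inner_toL2 m1 p2, inner_toL2 p1 m2, ← integral_add q1 q2]
    congr 1; ext y; ring

/-! ### Local versions -/

/-- The path `g` is continuous on `J` with values in `L²` of every compact subinterval. -/
def LocL2ContOn (a b : ℝ) (J : Set ℝ) (g : ℝ → ℝ → ℝ) : Prop :=
  ∀ c d, a < c → d < b → L2ContOn (volume.restrict (Icc c d)) J g

theorem MemLp.test_mul {c d : ℝ} {ψ h : ℝ → ℝ} (hψ : IsTest c d ψ) {r : ENNReal}
    (hh : MemLp h r (volume.restrict (Icc c d))) : MemLp (fun y => ψ y * h y) r volume := by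
  obtain ⟨M, hM⟩ := hψ.exists_bound
  have h1 : MemLp (fun y => ψ y * h y) r (volume.restrict (Icc c d)) := by
    refine hh.of_le_mul (c := M) (hψ.continuous.aestronglyMeasurable.mul hh.1)
      (Eventually.of_forall fun y => ?_)
    rw [norm_mul]; exact mul_le_mul_of_nonneg_right (hM y) (norm_nonneg _)
  rw [← memLp_indicator_iff_restrict measurableSet_Icc] at h1
  convert! h1 using 1
  ext y
  by_cases hy : y ∈ Icc c d
  · simp [hy]
  · simp [hy, hψ.zero_of_notMem fun h' => hy (Ioo_subset_Icc_self h')]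

namespace LocL2ContOn

variable {a b : ℝ} {J : Set ℝ} {g h : ℝ → ℝ → ℝ}

theorem memLp (hg : LocL2ContOn a b J g) {s : ℝ} (hs : s ∈ J) {c d : ℝ} (hc : a < c) (hd : d < b) :
    MemLp (g s) 2 (volume.restrict (Icc c d)) := (hg c d hc hd).memLp s hs

theorem locallyIntegrableOn (hg : LocL2ContOn a b J g) {s : ℝ} (hs : s ∈ J) :
    LocallyIntegrableOn (g s) (Ioo a b) :=
  locallyIntegrableOn_of_memLp (r := 2) (by norm_num) fun _ _ hc hd => hg.memLp hs hc hd

theorem add (hg : LocL2ContOn a b J g) (hh : LocL2ContOn a b J h) :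
    LocL2ContOn a b J fun s y => g s y + h s y :=
  fun c d hc hd => (hg c d hc hd).add (hh c d hc hd)

theorem const_mul (hg : LocL2ContOn a b J g) (k : ℝ) : LocL2ContOn a b J fun s y => k * g s y :=
  fun c d hc hd => (hg c d hc hd).const_mul k

theorem mul_continuousOn (hg : LocL2ContOn a b J g) {k : ℝ → ℝ} (hk : ContinuousOn k (Ioo a b)) :
    LocL2ContOn a b J fun s y => k y * g s y := by
  intro c d hc hd
  have hk' : ContinuousOn k (Icc c d) :=
    hk.mono fun y hy => ⟨hc.trans_le hy.1, hy.2.trans_lt hd⟩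
  obtain ⟨M, hM⟩ := isCompact_Icc.exists_bound_of_continuousOn hk'
  refine (hg c d hc hd).bdd_mul (hk'.aestronglyMeasurable measurableSet_Icc) (M := M) ?_
  filter_upwards [ae_restrict_mem measurableSet_Icc] with y hy using hM y hy

theorem test_mul (hg : LocL2ContOn a b J g) (hab : a < b) {ψ : ℝ → ℝ} (hψ : IsTest a b ψ) :
    L2ContOn volume J fun s y => ψ y * g s y := by
  obtain ⟨A, B, hA, -, hB, h⟩ := hψ.exists_shrink hab
  obtain ⟨M, hM⟩ := h.exists_bound
  refine ((hg A B hA hB).bdd_mul h.continuous.aestronglyMeasurable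
    (Eventually.of_forall hM)).of_restrict measurableSet_Icc fun s _ y hy => ?_
  rw [h.zero_of_notMem fun h' => hy (Ioo_subset_Icc_self h'), zero_mul]

theorem continuousOn_integral (hg : LocL2ContOn a b J g) (hh : LocL2ContOn a b J h) (hab : a < b)
    {ψ : ℝ → ℝ} (hψ : IsTest a b ψ) : ContinuousOn (fun s => ∫ y, ψ y * (g s y * h s y)) J := by
  obtain ⟨A, B, hA, -, hB, h'⟩ := hψ.exists_shrink hab
  -- A second cutoff, equal to 1 on the support of the first, turns both factors into genuine L²
  -- paths without changing the product.
  obtain ⟨θ, hθ, hθ1, -⟩ := IsTest.exists_eq_one hA hB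
  refine ((hg.test_mul hab hψ).continuousOn_integral_mul (hh.test_mul hab hθ)).congr fun s _ => ?_
  congr 1; ext y
  by_cases hy : y ∈ Icc A B
  · rw [hθ1 y hy]; ring
  · rw [h'.zero_of_notMem fun h0 => hy (Ioo_subset_Icc_self h0)]; ring

theorem integrable_test_mul_mul (hg : LocL2ContOn a b J g) (hh : LocL2ContOn a b J h) (hab : a < b)
    {ψ : ℝ → ℝ} (hψ : IsTest a b ψ) {s : ℝ} (hs : s ∈ J) :
    Integrable fun y => ψ y * (g s y * h s y) := by
  obtain ⟨A, B, hA, -, hB, h'⟩ := hψ.exists_shrink hab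
  have := MemLp.test_mul h' (r := 1)
    (memLp_one_iff_integrable.2 ((hg.memLp hs hA hB).integrable_mul (hh.memLp hs hA hB)))
  exact memLp_one_iff_integrable.1 this

end LocL2ContOn

/-- Localization of a weak transport equation. -/
theorem WeakTransport.test_mul {a b s v₀ v₁ : ℝ} {J : Set ℝ} {g : ℝ → ℝ → ℝ} {G : ℝ → ℝ}
    (hT : WeakTransport a b J s v₀ v₁ g G) {ψ : ℝ → ℝ} (hψ : IsTest a b ψ) (R : ℝ) :
    WeakTransport (-R) R J s v₀ v₁ (fun s y => ψ y * g s y)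
      (fun y => ψ y * G y + (v₀ + v₁ * y) * deriv ψ y * g s y) := by
  intro φ hφ
  have hφψ : IsTest a b (fun y => φ y * ψ y) := hψ.mul_left hφ.1
  have h1 := hT _ hφψ
  have hd : ∀ y, _root_.deriv (fun y => φ y * ψ y) y = deriv φ y * ψ y + φ y * deriv ψ y := fun y =>
    ((hφ.differentiable y).hasDerivAt.mul (hψ.differentiable y).hasDerivAt).deriv
  simp only [hφψ.setIntegral_mul, hd] at h1
  rw [setIntegral_eq_integral_of_forall_compl_eq_zero (fun y hy => by
    rw [hψ.zero_of_notMem hy, hψ.deriv_zero_of_notMem hy]; ring)] at h1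
  simp only [hφ.setIntegral_mul]
  rw [setIntegral_eq_integral_of_forall_compl_eq_zero (fun y hy => by
    rw [hφ.zero_of_notMem hy, hφ.deriv_zero_of_notMem hy]; ring)]
  convert! h1 using 1
  · ext σ; congr 1; ext y; ring
  · congr 1; ext y; ring

/-- Localized product rule for two functions transported by the field `κ + y`. -/
theorem hasDerivWithinAt_integral_test_mul_mul {a b : ℝ} (hab : a < b) {J : Set ℝ}
    (hJ : Convex ℝ J) {κ : ℝ} {g₁ g₂ G₁ G₂ : ℝ → ℝ → ℝ} (hg₁ : LocL2ContOn a b J g₁)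
    (hG₁ : LocL2ContOn a b J G₁) (hg₂ : LocL2ContOn a b J g₂) (hG₂ : LocL2ContOn a b J G₂)
    (hT₁ : ∀ σ ∈ J, WeakTransport a b J σ κ 1 g₁ (G₁ σ))
    (hT₂ : ∀ σ ∈ J, WeakTransport a b J σ κ 1 g₂ (G₂ σ)) {ψ : ℝ → ℝ} (hψ : IsTest a b ψ)
    {s : ℝ} (hs : s ∈ J) :
    HasDerivWithinAt (fun σ => ∫ y, ψ y * (g₁ σ y * g₂ σ y))
      (∫ y, (g₁ s y * g₂ s y * (ψ y + (κ + y) * deriv ψ y)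
        + ψ y * (G₁ s y * g₂ s y + g₁ s y * G₂ s y))) J s := by
  obtain ⟨A, B, hA, -, hB, h'⟩ := hψ.exists_shrink hab
  obtain ⟨θ, hθ, hθ1, -⟩ := IsTest.exists_eq_one hA hB
  have hθ1' : ∀ y ∈ Ioo A B, deriv θ y = 0 := fun y hy => by
    have : θ =ᶠ[𝓝 y] fun _ => 1 := by
      filter_upwards [isOpen_Ioo.mem_nhds hy] with z hz using hθ1 z (Ioo_subset_Icc_self hz)
    rw [this.deriv_eq, deriv_const]
  have hvc : ∀ ψ : ℝ → ℝ, IsTest a b ψ → IsTest a b fun y => (κ + 1 * y) * deriv ψ y := fun ψ hψ =>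
    hψ.deriv.mul_left (by fun_prop)
  have key := hasDerivWithinAt_integral_mul hJ (hg₁.test_mul hab hθ)
    ((hG₁.test_mul hab hθ).add (hg₁.test_mul hab (hvc θ hθ))) (hg₂.test_mul hab hψ)
    ((hG₂.test_mul hab hψ).add (hg₂.test_mul hab (hvc ψ hψ)))
    (fun R σ hσ => (hT₁ σ hσ).test_mul hθ R) (fun R σ hσ => (hT₂ σ hσ).test_mul hψ R) hs
  convert! key using 1
  · ext σ; congr 1; ext y
    by_cases hy : y ∈ Ioo A B
    · rw [hθ1 y (Ioo_subset_Icc_self hy)]; ring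
    · rw [h'.zero_of_notMem hy]; ring
  · congr 1; ext y
    by_cases hy : y ∈ Ioo A B
    · rw [hθ1 y (Ioo_subset_Icc_self hy), hθ1' y hy]; ring
    · rw [h'.zero_of_notMem hy, h'.deriv_zero_of_notMem hy]; ring

/-- Differentiation of `∫ ψ Φ(w)` along a locally bounded path with a time derivative in `L²`. -/
theorem hasDerivWithinAt_integral_test_mul_comp {a b : ℝ} (hab : a < b) {J : Set ℝ}
    (hJ : Convex ℝ J) {w ws : ℝ → ℝ → ℝ} (hw : LocL2ContOn a b J w) (hws : LocL2ContOn a b J ws)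
    (hT : ∀ σ ∈ J, WeakTransport a b J σ 0 0 w (ws σ)) {s : ℝ} (hs : s ∈ J)
    (hbd : ∀ c d, a < c → d < b →
      ∃ M, ∀ᶠ σ in 𝓝[J] s, ∀ᵐ y ∂volume.restrict (Icc c d), |w σ y| ≤ M)
    {Φ Φ' : ℝ → ℝ} (hΦ : Continuous Φ) (hΦ' : Continuous Φ')
    (hquad : ∀ M, ∃ C, ∀ x z, |x| ≤ M → |z| ≤ M → |Φ z - Φ x - (z - x) * Φ' x| ≤ C * (z - x) ^ 2)
    {ψ : ℝ → ℝ} (hψ : IsTest a b ψ) :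
    HasDerivWithinAt (fun σ => ∫ y, ψ y * Φ (w σ y)) (∫ y, ψ y * (Φ' (w s y) * ws s y)) J s := by
  obtain ⟨A, B, hA, -, hB, h'⟩ := hψ.exists_shrink hab
  obtain ⟨θ, hθ, hθ1, -⟩ := IsTest.exists_eq_one hA hB
  obtain ⟨M, hM⟩ := hbd A B hA hB
  obtain ⟨C₀, hC₀⟩ := hquad M
  set C := |C₀|
  have hC : ∀ x z, |x| ≤ M → |z| ≤ M → |Φ z - Φ x - (z - x) * Φ' x| ≤ C * (z - x) ^ 2 :=
    fun x z hx hz => (hC₀ x z hx hz).trans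
      (mul_le_mul_of_nonneg_right (le_abs_self _) (sq_nonneg _))
  obtain ⟨Mψ, hMψ⟩ := hψ.exists_bound
  have hMψ0 : 0 ≤ Mψ := (abs_nonneg _).trans (hMψ 0)
  have hwθ := hw.test_mul hab hθ
  have hwsθ := hws.test_mul hab hθ
  have hcomp : ∀ F : ℝ → ℝ, Continuous F → ∀ σ ∈ J,
      (∀ᵐ y ∂volume.restrict (Icc A B), |w σ y| ≤ M) → ∀ r : ENNReal,
      MemLp (fun y => ψ y * F (w σ y)) r volume := by
    intro F hF σ hσ hb r
    refine MemLp.test_mul h' ?_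
    obtain ⟨C, hC⟩ := isCompact_Icc.exists_bound_of_continuousOn (hF.continuousOn (s := Icc (-M) M))
    refine MemLp.of_bound (hF.comp_aestronglyMeasurable (hw.memLp hσ hA hB).1) C ?_
    filter_upwards [hb] with y hy using hC _ (abs_le.1 hy)
  have hMs := hM.self_of_nhdsWithin hs
  have hf : HasDerivWithinAt (fun σ => toL2 volume fun y => θ y * w σ y)
      (toL2 volume fun y => θ y * ws s y) J s := by
    refine hasDerivWithinAt_toL2_of_weak hJ hwθ hwsθ (fun φ hφ hφc σ hσ => ?_) hs
    have ht : IsTest a b fun y => φ y * θ y := hθ.mul_left hφ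
    have h1 := hT σ hσ _ ht
    simp only [zero_mul, add_zero, mul_zero, zero_add, ht.setIntegral_mul] at h1
    convert! h1 using 1
    · ext σ; congr 1; ext y; ring
    · congr 1; ext y; ring
  have hΦ'm := hcomp Φ' hΦ' s hs hMs 2
  have hlin := (hasDerivWithinAt_const s J (toL2 volume fun y => ψ y * Φ' (w s y))).inner ℝ hf
  rw [inner_zero_left, add_zero] at hlin
  -- The integral is compared with its linearization at time `s`. The remainder is quadratic in the
  -- L² increment of `w`, and this increment is O(σ - s) because `w` is differentiable in L².
  have hrem : HasDerivWithinAt (fun σ => (∫ y, ψ y * Φ (w σ y))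
      - inner ℝ (toL2 volume fun y => ψ y * Φ' (w s y)) (toL2 volume fun y => θ y * w σ y)) 0 J s := by
    rw [hasDerivWithinAt_iff_isLittleO]
    have hO := hf.differentiableWithinAt.isBigO_sub
    have tz : (fun σ => σ - s) =o[𝓝[J] s] fun _ => (1 : ℝ) := by
      rw [Asymptotics.isLittleO_one_iff]
      have : Tendsto (fun σ => σ - s) (𝓝 s) (𝓝 (s - s)) := (continuous_sub_right s).tendsto s
      rw [sub_self] at this
      exact this.mono_left nhdsWithin_le_nhds
    have ho := hO.norm_left.mul_isLittleO (hO.norm_left.trans_isLittleO tz)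
    simp only [mul_one] at ho
    refine Asymptotics.IsBigO.trans_isLittleO ?_ ho
    refine Asymptotics.IsBigO.of_bound (Mψ * C) ?_
    filter_upwards [self_mem_nhdsWithin, hM] with σ hσ hMσ
    have i1 := memLp_one_iff_integrable.1 (hcomp Φ hΦ σ hσ hMσ 1)
    have i2 := memLp_one_iff_integrable.1 (hcomp Φ hΦ s hs hMs 1)
    have hd := (hwθ.memLp σ hσ).sub (hwθ.memLp s hs)
    have i3 : Integrable (fun y => (ψ y * Φ' (w s y)) * (θ y * w σ y)) :=
      hΦ'm.integrable_mul (hwθ.memLp σ hσ)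
    have i4 : Integrable (fun y => (ψ y * Φ' (w s y)) * (θ y * w s y)) :=
      hΦ'm.integrable_mul (hwθ.memLp s hs)
    have i5 : Integrable (fun y => (θ y * w σ y - θ y * w s y) * (θ y * w σ y - θ y * w s y)) :=
      hd.integrable_mul hd
    have j1 : Integrable (fun y => ψ y * Φ (w σ y) - (ψ y * Φ' (w s y)) * (θ y * w σ y)) := i1.sub i3
    have j2 : Integrable (fun y => ψ y * Φ (w s y) - (ψ y * Φ' (w s y)) * (θ y * w s y)) := i2.sub i4
    rw [smul_zero, sub_zero, inner_toL2 hΦ'm (hwθ.memLp σ hσ), inner_toL2 hΦ'm (hwθ.memLp s hs),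
      ← integral_sub i1 i3, ← integral_sub i2 i4, ← integral_sub j1 j2,
      toL2_sub (hwθ.memLp σ hσ) (hwθ.memLp s hs), Real.norm_eq_abs _, Real.norm_eq_abs (_ * _),
      abs_mul, abs_norm, ← real_inner_self_eq_norm_mul_norm, inner_toL2 hd hd, ← integral_const_mul]
    refine abs_integral_le_integral_abs.trans (integral_mono_ae ?_ (i5.const_mul _) ?_)
    · exact (j1.sub j2).abs
    have hMσ' := (ae_restrict_iff' measurableSet_Icc).1 hMσ
    have hMs' := (ae_restrict_iff' measurableSet_Icc).1 hMs
    filter_upwards [hMσ', hMs'] with y h1 h2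
    by_cases hy : y ∈ Icc A B
    · have h3 := hC _ _ (h2 hy) (h1 hy)
      simp only [Pi.sub_apply, hθ1 y hy, one_mul]
      have : ψ y * Φ (w σ y) - ψ y * Φ' (w s y) * w σ y - (ψ y * Φ (w s y) - ψ y * Φ' (w s y) * w s y)
        = ψ y * (Φ (w σ y) - Φ (w s y) - (w σ y - w s y) * Φ' (w s y)) := by ring
      rw [this, abs_mul, mul_assoc]
      refine mul_le_mul (hMψ y) (h3.trans (le_of_eq (by ring))) (abs_nonneg _) hMψ0
    · have z := h'.zero_of_notMem fun h0 => hy (Ioo_subset_Icc_self h0)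
      simp only [z, zero_mul, sub_zero, abs_zero]
      have := mul_self_nonneg (θ y * w σ y - θ y * w s y)
      have := abs_nonneg C₀
      simp only [Pi.sub_apply]
      positivity
  refine ((hlin.add hrem).congr_of_mem (fun σ _ => ?_) hs).congr_deriv ?_
  · simp
  · rw [add_zero, inner_toL2 hΦ'm (hwsθ.memLp s hs)]
    congr 1; ext y
    by_cases hy : y ∈ Icc A B
    · rw [hθ1 y hy]; ring
    · rw [h'.zero_of_notMem fun h0 => hy (Ioo_subset_Icc_self h0)]; ring

/-! ### Weak derivatives and absolutely continuous representatives -/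

theorem _root_.MeasureTheory.LocallyIntegrableOn.intervalIntegrable {a b x y : ℝ} {g : ℝ → ℝ}
    (hg : LocallyIntegrableOn g (Ioo a b)) (hx : x ∈ Ioo a b) (hy : y ∈ Ioo a b) :
    IntervalIntegrable g volume x y := by
  rw [intervalIntegrable_iff']
  exact hg.integrableOn_compact_subset (ordConnected_Ioo.uIcc_subset hx hy) isCompact_uIcc

section Primitive

variable {a b : ℝ} {g : ℝ → ℝ}

theorem absolutelyContinuous_primitive (hg : LocallyIntegrableOn g (Ioo a b)) {x₀ x y : ℝ}
    (h₀ : x₀ ∈ Ioo a b) (hx : x ∈ Ioo a b) (hy : y ∈ Ioo a b) (C : ℝ) :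
    AbsolutelyContinuousOnInterval (fun t => C + ∫ u in x₀..t, g u) x y := by
  have hle : ∀ u v : ℝ, u ∈ Ioo a b → v ∈ Ioo a b → u ≤ x₀ → x₀ ≤ v →
      AbsolutelyContinuousOnInterval (fun t => ∫ u in x₀..t, g u) u v := fun u v hu hv h1 h2 =>
    (hg.intervalIntegrable hu hv).absolutelyContinuousOnInterval_intervalIntegral
      (mem_uIcc_of_le h1 h2)
  have h1 : AbsolutelyContinuousOnInterval (fun t => ∫ u in x₀..t, g u) x y := by
    refine (hle (min x₀ (min x y)) (max x₀ (max x y)) ?_ ?_ (min_le_left _ _)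
      (le_max_left _ _)).mono ?_
    · simp only [mem_Ioo, lt_min_iff, min_lt_iff] at *; tauto
    · simp only [mem_Ioo, lt_max_iff, max_lt_iff] at *; tauto
    · rw [uIcc_of_le ((min_le_left x₀ (min x y)).trans (le_max_left _ _))]
      intro t ht
      rw [mem_uIcc] at ht
      refine ⟨?_, ?_⟩
      · rcases ht with ht | ht
        · exact ((min_le_right _ _).trans (min_le_left _ _)).trans ht.1
        · exact ((min_le_right _ _).trans (min_le_right _ _)).trans ht.1
      · rcases ht with ht | ht
        · exact ht.2.trans ((le_max_right _ _).trans (le_max_right _ _))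
        · exact ht.2.trans ((le_max_left _ _).trans (le_max_right _ _))
  have h2 : AbsolutelyContinuousOnInterval (fun _ : ℝ => C) x y :=
    LipschitzOnWith.absolutelyContinuousOnInterval (K := 0) (by simp [LipschitzOnWith])
  exact h2.add h1

theorem ae_hasDerivAt_primitive (hg : LocallyIntegrableOn g (Ioo a b)) {x₀ x y : ℝ}
    (h₀ : x₀ ∈ Ioo a b) (hx : x ∈ Ioo a b) (hy : y ∈ Ioo a b) (C : ℝ) :
    ∀ᵐ t, t ∈ uIcc x y → HasDerivAt (fun t => C + ∫ u in x₀..t, g u) (g t) t := by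
  filter_upwards [(hg.intervalIntegrable hx hy).ae_hasDerivAt_integral] with t ht htm
  have h1 := (ht htm x left_mem_uIcc).const_add (C + ∫ u in x₀..x, g u)
  have hmem : Ioo a b ∈ 𝓝 t := isOpen_Ioo.mem_nhds (ordConnected_Ioo.uIcc_subset hx hy htm)
  refine h1.congr_of_eventuallyEq ?_
  filter_upwards [hmem] with z hz
  rw [← intervalIntegral.integral_add_adjacent_intervals (hg.intervalIntegrable h₀ hx)
    (hg.intervalIntegrable hx hz)]
  ring

/-- The fundamental theorem of calculus for a product with an absolutely continuous primitive. -/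
theorem integral_primitive_mul (hg : LocallyIntegrableOn g (Ioo a b)) {x₀ x y : ℝ}
    (h₀ : x₀ ∈ Ioo a b) (hx : x ∈ Ioo a b) (hy : y ∈ Ioo a b) (C : ℝ) {k : ℝ → ℝ}
    (hk : ContDiffOn ℝ 1 k (Ioo a b)) {F : ℝ → ℝ} (hF : F = fun t => C + ∫ u in x₀..t, g u) :
    ∫ t in x..y, (g t * k t + F t * deriv k t) = F y * k y - F x * k x := by
  have ac1 : AbsolutelyContinuousOnInterval F x y :=
    hF ▸ absolutelyContinuous_primitive hg h₀ hx hy C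
  have ac2 : AbsolutelyContinuousOnInterval k x y :=
    (hk.mono (ordConnected_Ioo.uIcc_subset hx hy)).absolutelyContinuousOnInterval
  rw [← ac1.integral_deriv_mul_eq_sub ac2]
  refine intervalIntegral.integral_congr_ae ?_
  filter_upwards [ae_hasDerivAt_primitive hg h₀ hx hy C] with t ht htm
  rw [hF, (ht (uIoc_subset_uIcc htm)).deriv]

/-- The product rule for absolutely continuous functions, applied to F · F · k. Hardy's inequality
takes k = y ρ times a cutoff, the pointwise bound takes k = ρ. -/
theorem integral_primitive_sq_mul (hg : LocallyIntegrableOn g (Ioo a b)) {x₀ x y : ℝ}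
    (h₀ : x₀ ∈ Ioo a b) (hx : x ∈ Ioo a b) (hy : y ∈ Ioo a b) (C : ℝ) {k : ℝ → ℝ}
    (hk : ContDiffOn ℝ 1 k (Ioo a b)) {F : ℝ → ℝ} (hF : F = fun t => C + ∫ u in x₀..t, g u) :
    ∫ t in x..y, (2 * (F t * g t * k t) + F t ^ 2 * deriv k t) = F y ^ 2 * k y - F x ^ 2 * k x := by
  have ac1 : AbsolutelyContinuousOnInterval F x y :=
    hF ▸ absolutelyContinuous_primitive hg h₀ hx hy C
  have ac2 : AbsolutelyContinuousOnInterval k x y :=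
    (hk.mono (ordConnected_Ioo.uIcc_subset hx hy)).absolutelyContinuousOnInterval
  have ac3 : AbsolutelyContinuousOnInterval (fun t => F t * F t) x y := ac1.fun_mul ac1
  rw [sq, sq, ← ac3.integral_deriv_mul_eq_sub ac2]
  refine intervalIntegral.integral_congr_ae ?_
  filter_upwards [ae_hasDerivAt_primitive hg h₀ hx hy C] with t ht htm
  have hd : HasDerivAt F (g t) t := hF ▸ ht (uIoc_subset_uIcc htm)
  have e : deriv (fun t => F t * F t) t = g t * F t + F t * g t := (hd.mul hd).deriv
  rw [e]
  ring

end Primitive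

/-- A function with a weak derivative agrees almost everywhere with a primitive of it. -/
theorem IsWeakDeriv.exists_primitive {a b : ℝ} (hab : a < b) {f g : ℝ → ℝ}
    (h : IsWeakDeriv a b f g) (hf : LocallyIntegrableOn f (Ioo a b))
    (hg : LocallyIntegrableOn g (Ioo a b)) {x₀ : ℝ} (h₀ : x₀ ∈ Ioo a b) :
    ∃ C : ℝ, ∀ᵐ y ∂volume.restrict (Ioo a b), f y = C + ∫ u in x₀..y, g u := by
  set F : ℝ → ℝ := fun y => 0 + ∫ u in x₀..y, g u with hF
  have hFc : ContinuousOn F (Ioo a b) := fun x hx => by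
    have h1 : (a + x) / 2 ∈ Ioo a b := ⟨by linarith [hx.1], by linarith [hx.1, hx.2]⟩
    have h2 : (x + b) / 2 ∈ Ioo a b := ⟨by linarith [hx.1, hx.2], by linarith [hx.2]⟩
    have h3 := (absolutelyContinuous_primitive hg h₀ h1 h2 0).continuousOn
    rw [uIcc_of_le (by linarith [hx.1, hx.2])] at h3
    exact (h3.continuousAt (Icc_mem_nhds (by linarith [hx.1]) (by linarith [hx.2]))).continuousWithinAt
  have hFloc : LocallyIntegrableOn F (Ioo a b) := hFc.locallyIntegrableOn measurableSet_Ioo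
  -- the difference `f - F` has vanishing weak derivative
  have hzero : ∀ φ, IsTest a b φ → ∫ y, (f y - F y) * deriv φ y = 0 := by
    intro φ hφ
    have e1 := h φ hφ
    rw [hφ.deriv.setIntegral_mul, hφ.setIntegral_mul] at e1
    obtain ⟨A, B, hA, hAB, hB, hφ'⟩ := hφ.exists_shrink hab
    have e2 := integral_primitive_mul hg h₀ (x := A) (y := B) ⟨hA, hAB.trans hB⟩
      ⟨hA.trans hAB, hB⟩ 0 (k := φ) ((hφ.1.of_le (by simp)).contDiffOn) hF
    rw [hφ'.zero_of_notMem (by simp), hφ'.zero_of_notMem (by simp), mul_zero, mul_zero, sub_zero,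
      intervalIntegral.integral_of_le hAB.le, integral_Ioc_eq_integral_Ioo,
      setIntegral_eq_integral_of_forall_compl_eq_zero (fun y hy => by
        rw [hφ'.zero_of_notMem hy, hφ'.deriv_zero_of_notMem hy]; ring)] at e2
    have i1 := integrableOn_mul_test hab hφ.deriv hf
    have i2 := integrableOn_mul_test hab hφ.deriv hFloc
    have i3 := integrableOn_mul_test hab hφ hg
    rw [integral_add i3 i2] at e2
    simp only [sub_mul]
    rw [integral_sub i1 i2, e1]
    linarith
  have hdloc : LocallyIntegrableOn (fun y => f y - F y) (Ioo a b) := hf.sub hFloc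
  -- a test function of integral one
  obtain ⟨θ, hθ, hθ1⟩ : ∃ θ, IsTest a b θ ∧ ∫ y, θ y = 1 := by
    obtain ⟨ε, hε, hball⟩ := Metric.isOpen_iff.1 isOpen_Ioo x₀ h₀
    let B : ContDiffBump x₀ := ⟨ε / 4, ε / 2, by linarith, by linarith⟩
    refine ⟨B.normed volume, ⟨B.contDiff_normed, B.hasCompactSupport_normed, ?_⟩,
      B.integral_normed⟩
    rw [B.tsupport_normed_eq]
    exact (Metric.closedBall_subset_ball (by change ε / 2 < ε; linarith)).trans hball
  set c := ∫ y, (f y - F y) * θ y with hc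
  have hconst : ∀ᵐ y, y ∈ Ioo a b → f y - F y - c = 0 := by
    refine isOpen_Ioo.ae_eq_zero_of_integral_contDiff_smul_eq_zero
      (hdloc.sub ((locallyIntegrable_const c).locallyIntegrableOn _)) fun ψ hψ hψc hψs => ?_
    have hψt : IsTest a b ψ := ⟨hψ, hψc, hψs⟩
    set I := ∫ y, ψ y with hI
    obtain ⟨A, B, hA, hAB, hB, hψ'⟩ := hψt.exists_shrink hab
    obtain ⟨A', B', hA', hAB', hB', hθ'⟩ := hθ.exists_shrink hab
    set m := min A A'
    set M := max B B'
    have hψ2 := hψ'.mono (min_le_left A A') (le_max_left B B')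
    have hθ2 := hθ'.mono (min_le_right A A') (le_max_right B B')
    have hmM : m ≤ M := (min_le_left _ _).trans (hAB.le.trans (le_max_left _ _))
    have ham : a < m := lt_min hA hA'
    have hMb : M < b := max_lt hB hB'
    -- Subtracting the mean along θ makes the primitive of η compactly supported, hence a test
    -- function. Thus a function with zero weak derivative pairs with ψ as the constant `c` does.
    set η : ℝ → ℝ := fun y => ψ y - I * θ y with hη
    have hηs : ContDiff ℝ ∞ η := hψ.sub (contDiff_const.mul hθ.1)
    have hη0 : ∀ y ∉ Ioo m M, η y = 0 := fun y hy => by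
      rw [hη]; simp only; rw [hψ2.zero_of_notMem hy, hθ2.zero_of_notMem hy]; ring
    have hψi : Integrable ψ := hψ.continuous.integrable_of_hasCompactSupport hψc
    have hθi : Integrable θ := hθ.continuous.integrable_of_hasCompactSupport hθ.2.1
    have hηint : ∫ y, η y = 0 := by
      rw [hη, integral_sub hψi (hθi.const_mul I), integral_const_mul, hθ1, ← hI]; ring
    set P : ℝ → ℝ := fun x => ∫ u in m..x, η u with hP
    have hPd : ∀ x, HasDerivAt P (η x) x := fun x =>
      (hηs.continuous.integral_hasStrictDerivAt m x).hasDerivAt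
    have hPd' : deriv P = η := funext fun x => (hPd x).deriv
    have hP0 : ∀ x ∉ Icc m M, P x = 0 := by
      intro x hx
      rw [mem_Icc, not_and_or, not_le, not_le] at hx
      rcases hx with hx | hx
      · refine (intervalIntegral.integral_congr (g := fun _ => 0) fun u hu => ?_).trans (by simp)
        rw [uIcc_of_ge hx.le] at hu
        exact hη0 u fun h' => absurd h'.1 (not_lt.2 hu.2)
      · have : P x = ∫ y, η y := by
          rw [hP]; simp only
          rw [intervalIntegral.integral_of_le (hmM.trans hx.le)]
          exact setIntegral_eq_integral_of_forall_compl_eq_zero fun u hu =>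
            hη0 u fun h' => hu ⟨h'.1, h'.2.le.trans hx.le⟩
        rw [this, hηint]
    have hPs : tsupport P ⊆ Icc m M :=
      closure_minimal (fun x hx => by_contra fun h' => hx (hP0 x h')) isClosed_Icc
    have hPt : IsTest a b P := by
      refine ⟨contDiff_infty_iff_deriv.2 ⟨fun x => (hPd x).differentiableAt, hPd' ▸ hηs⟩,
        HasCompactSupport.of_support_subset_isCompact isCompact_Icc
          ((subset_tsupport _).trans hPs), hPs.trans fun y hy =>
          ⟨ham.trans_le hy.1, hy.2.trans_lt hMb⟩⟩
    have e := hzero P hPt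
    rw [hPd'] at e
    have i1 := integrableOn_mul_test hab hψt hdloc
    have i2 := integrableOn_mul_test hab hθ hdloc
    have e2 : ∫ y, ((f y - F y) * ψ y - I * ((f y - F y) * θ y)) = 0 := by
      rw [← e]; congr 1; ext y; rw [hη]; ring
    rw [integral_sub i1 (i2.const_mul I), integral_const_mul, ← hc] at e2
    have e3 : ∫ y, ψ y • (f y - F y - c) = ∫ y, ((f y - F y) * ψ y - c * ψ y) := by
      congr 1; ext y; rw [smul_eq_mul]; ring
    rw [e3, integral_sub i1 (hψi.const_mul c), integral_const_mul, ← hI]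
    linarith
  refine ⟨c, (ae_restrict_iff' measurableSet_Ioo).2 ?_⟩
  filter_upwards [hconst] with y hy hym
  have := hy hym
  rw [hF] at this
  simp only at this
  linarith

/-- Weak derivatives are unique. -/
theorem ae_eq_of_integral_test_eq {a b : ℝ} (hab : a < b) {f g : ℝ → ℝ}
    (hf : LocallyIntegrableOn f (Ioo a b)) (hg : LocallyIntegrableOn g (Ioo a b))
    (h : ∀ φ, IsTest a b φ → ∫ y in Ioo a b, f y * φ y = ∫ y in Ioo a b, g y * φ y) :
    f =ᵐ[volume.restrict (Ioo a b)] g := by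
  have h1 : ∀ᵐ y, y ∈ Ioo a b → f y - g y = 0 := by
    refine isOpen_Ioo.ae_eq_zero_of_integral_contDiff_smul_eq_zero (hf.sub hg) fun ψ h1 h2 h3 => ?_
    have ht : IsTest a b ψ := ⟨h1, h2, h3⟩
    have e := h ψ ht
    rw [ht.setIntegral_mul, ht.setIntegral_mul] at e
    have e3 : ∫ y, ψ y • (f y - g y) = ∫ y, (f y * ψ y - g y * ψ y) := by
      congr 1; ext y; rw [smul_eq_mul]; ring
    rw [e3, integral_sub (integrableOn_mul_test hab ht hf) (integrableOn_mul_test hab ht hg), e,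
      sub_self]
  refine (ae_restrict_iff' measurableSet_Ioo).2 ?_
  filter_upwards [h1] with y hy hym
  linarith [hy hym]

/-! ### The weight -/

section Weight

variable {p y : ℝ}

theorem one_sub_sq_pos (hy : y ∈ Ioo (-1 : ℝ) 1) : 0 < 1 - y ^ 2 := by nlinarith [hy.1, hy.2]

theorem rho_pos (hy : y ∈ Ioo (-1 : ℝ) 1) : 0 < rho p y := Real.rpow_pos_of_pos (one_sub_sq_pos hy) _

theorem rho_le_one (hp : 1 < p) (hy : y ∈ Ioo (-1 : ℝ) 1) : rho p y ≤ 1 :=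
  Real.rpow_le_one (one_sub_sq_pos hy).le (by nlinarith [sq_nonneg y])
    (div_nonneg (by norm_num) (by linarith))

theorem hasDerivAt_rho (hy : y ∈ Ioo (-1 : ℝ) 1) :
    HasDerivAt (rho p) (-(2 * (2 / (p - 1)) * y) * (rho p y / (1 - y ^ 2))) y := by
  have h0 := one_sub_sq_pos hy
  have h1 : HasDerivAt (fun y : ℝ => 1 - y ^ 2) (-(2 * y)) y := by
    simpa using ((hasDerivAt_id y).pow 2).const_sub 1
  have h2 := h1.rpow_const (p := 2 / (p - 1)) (Or.inl h0.ne')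
  refine h2.congr_deriv ?_
  rw [Real.rpow_sub_one h0.ne', rho]
  ring

theorem contDiffOn_rho : ContDiffOn ℝ ∞ (rho p) (Ioo (-1) 1) := by
  intro y hy
  have h0 := one_sub_sq_pos hy
  exact ((by fun_prop : ContDiffAt ℝ ∞ (fun y : ℝ => 1 - y ^ 2) y).rpow_const_of_ne
    h0.ne').contDiffWithinAt

theorem continuousOn_rho : ContinuousOn (rho p) (Ioo (-1) 1) := contDiffOn_rho.continuousOn

theorem contDiffOn_rho_div : ContDiffOn ℝ ∞ (fun y => rho p y / (1 - y ^ 2)) (Ioo (-1) 1) :=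
  contDiffOn_rho.div (by fun_prop) fun _ hy => (one_sub_sq_pos hy).ne'

end Weight

/-! ### Cutoff functions -/

/-- A cutoff function, equal to `1` where `n (1 - y²) ≥ 2` and to `0` where `n (1 - y²) ≤ 1`. -/
def cutoff (n : ℕ) (y : ℝ) : ℝ := Real.smoothTransition (n * (1 - y ^ 2) - 1)

/-- The derivative of `cutoff n` is `-y * cutoffSlope n`. -/
def cutoffSlope (n : ℕ) (y : ℝ) : ℝ :=
  2 * n * deriv Real.smoothTransition (n * (1 - y ^ 2) - 1)

section Cutoff

variable {n m : ℕ} {y : ℝ}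

theorem cutoff_nonneg : 0 ≤ cutoff n y := Real.smoothTransition.nonneg _

theorem cutoff_le_one : cutoff n y ≤ 1 := Real.smoothTransition.le_one _

theorem cutoff_eq_one (h : 2 ≤ n * (1 - y ^ 2)) : cutoff n y = 1 :=
  Real.smoothTransition.one_of_one_le (by linarith)

theorem hasDerivAt_cutoff : HasDerivAt (cutoff n) (-y * cutoffSlope n y) y := by
  have h1 : HasDerivAt (fun y : ℝ => n * (1 - y ^ 2) - 1) (n * (-(2 * y))) y := by
    simpa using ((((hasDerivAt_id y).pow 2).const_sub 1).const_mul (n : ℝ)).sub_const 1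
  have hd : Differentiable ℝ Real.smoothTransition :=
    (Real.smoothTransition.contDiff (n := 1)).differentiable (by simp)
  refine ((hd (n * (1 - y ^ 2) - 1)).hasDerivAt.comp y h1).congr_deriv ?_
  rw [cutoffSlope]; ring

theorem isTest_cutoff (n : ℕ) : IsTest (-1) 1 (cutoff n) := by
  have hsub : tsupport (cutoff n) ⊆ {y | 1 ≤ n * (1 - y ^ 2)} := by
    refine closure_minimal (fun y hy => ?_) (isClosed_le (by fun_prop) (by fun_prop))
    by_contra h
    simp only [mem_ofPred_eq, not_le] at h
    exact hy (Real.smoothTransition.zero_of_nonpos (by linarith))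
  have hsub2 : tsupport (cutoff n) ⊆ Ioo (-1) 1 := fun y hy => by
    have h : (1 : ℝ) ≤ n * (1 - y ^ 2) := hsub hy
    have hn : (0 : ℝ) ≤ n := n.cast_nonneg
    have : 0 < 1 - y ^ 2 := by
      by_contra! h'
      nlinarith
    exact ⟨by nlinarith, by nlinarith⟩
  refine ⟨?_, ?_, hsub2⟩
  · exact (Real.smoothTransition.contDiff (n := ⊤)).comp (by fun_prop)
  · exact HasCompactSupport.of_support_subset_isCompact (isCompact_Icc (a := (-1 : ℝ)) (b := 1))
      ((subset_tsupport _).trans (hsub2.trans Ioo_subset_Icc_self))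

theorem contDiff_cutoffSlope (n : ℕ) : ContDiff ℝ ∞ (cutoffSlope n) := by
  have h : ContDiff ℝ ∞ (deriv Real.smoothTransition) :=
    ((contDiff_infty_iff_deriv (𝕜 := ℝ)).1 (Real.smoothTransition.contDiff (n := ⊤))).2
  exact contDiff_const.mul (h.comp (by fun_prop))

theorem deriv_smoothTransition_eq_zero {x : ℝ} (h : x < 0 ∨ 1 < x) :
    deriv Real.smoothTransition x = 0 := by
  rcases h with h | h
  · have : Real.smoothTransition =ᶠ[𝓝 x] fun _ => 0 := by
      filter_upwards [Iio_mem_nhds h] with z hz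
      exact Real.smoothTransition.zero_of_nonpos (le_of_lt hz)
    rw [this.deriv_eq, deriv_const]
  · have : Real.smoothTransition =ᶠ[𝓝 x] fun _ => 1 := by
      filter_upwards [Ioi_mem_nhds h] with z hz
      exact Real.smoothTransition.one_of_one_le (le_of_lt hz)
    rw [this.deriv_eq, deriv_const]

theorem cutoffSlope_nonneg : 0 ≤ cutoffSlope n y := by
  have := Real.smoothTransition.monotone.deriv_nonneg (x := n * (1 - y ^ 2) - 1)
  rw [cutoffSlope]; positivity

theorem cutoffSlope_eq_zero_of_lt (h : 2 < n * (1 - y ^ 2)) : cutoffSlope n y = 0 := by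
  rw [cutoffSlope, deriv_smoothTransition_eq_zero (Or.inr (by linarith)), mul_zero]

theorem cutoffSlope_eq_zero_of_lt_one (h : n * (1 - y ^ 2) < 1) : cutoffSlope n y = 0 := by
  rw [cutoffSlope, deriv_smoothTransition_eq_zero (Or.inl (by linarith)), mul_zero]

theorem isTest_cutoffSlope (n : ℕ) : IsTest (-1) 1 (cutoffSlope n) := by
  have hsub : tsupport (cutoffSlope n) ⊆ {y | 1 ≤ n * (1 - y ^ 2)} := by
    refine closure_minimal (fun y hy => ?_) (isClosed_le (by fun_prop) (by fun_prop))
    by_contra h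
    simp only [mem_ofPred_eq, not_le] at h
    exact hy (cutoffSlope_eq_zero_of_lt_one h)
  have hsub2 : tsupport (cutoffSlope n) ⊆ Ioo (-1) 1 := fun y hy => by
    have h : (1 : ℝ) ≤ n * (1 - y ^ 2) := hsub hy
    have hn : (0 : ℝ) ≤ n := n.cast_nonneg
    have : 0 < 1 - y ^ 2 := by
      by_contra! h'
      nlinarith
    exact ⟨by nlinarith, by nlinarith⟩
  refine ⟨contDiff_cutoffSlope n, ?_, hsub2⟩
  exact HasCompactSupport.of_support_subset_isCompact (isCompact_Icc (a := (-1 : ℝ)) (b := 1))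
      ((subset_tsupport _).trans (hsub2.trans Ioo_subset_Icc_self))

/-- `cutoffSlope n y * (1 - y²)` is bounded, and supported where `cutoff (2 * n) = 1`. -/
theorem exists_cutoffSlope_bound : ∃ M, 0 < M ∧ ∀ (n : ℕ) (y : ℝ), y ∈ Ioo (-1 : ℝ) 1 →
    cutoffSlope n y * (1 - y ^ 2) ≤ M * cutoff (2 * n) y := by
  have hcont : Continuous (deriv Real.smoothTransition) :=
    (Real.smoothTransition.contDiff (n := 1)).continuous_deriv (by simp)
  obtain ⟨K, hK⟩ := isCompact_Icc.exists_bound_of_continuousOn (hcont.continuousOn (s := Icc 0 1))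
  have hK0 : 0 ≤ K := (norm_nonneg _).trans (hK 0 (by simp))
  refine ⟨4 * K + 1, by positivity, fun n y hy => ?_⟩
  have hq := one_sub_sq_pos hy
  rcases lt_or_ge ((n : ℝ) * (1 - y ^ 2)) 1 with h | h
  · rw [cutoffSlope_eq_zero_of_lt_one h, zero_mul]
    exact mul_nonneg (by positivity) cutoff_nonneg
  rcases lt_or_ge 2 ((n : ℝ) * (1 - y ^ 2)) with h2 | h2
  · rw [cutoffSlope_eq_zero_of_lt h2, zero_mul]
    exact mul_nonneg (by positivity) cutoff_nonneg
  -- On the transition region 1 ≤ n(1-y²) ≤ 2, so 2n(1-y²) ≥ 2 and the cutoff of index 2n equals 1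
  -- there. The factor n in the slope is compensated by n(1-y²) ≤ 2.
  rw [cutoff_eq_one (by push_cast; linarith), mul_one, cutoffSlope]
  have h3 := (abs_le.1 (hK (n * (1 - y ^ 2) - 1) ⟨by linarith, by linarith⟩)).2
  have h4 : 0 ≤ (n : ℝ) * (1 - y ^ 2) := by linarith
  calc _ = 2 * (n * (1 - y ^ 2)) * deriv Real.smoothTransition (n * (1 - y ^ 2) - 1) := by ring
    _ ≤ 2 * (n * (1 - y ^ 2)) * K := by gcongr
    _ ≤ 2 * 2 * K := by gcongr
    _ ≤ _ := by linarith

theorem cutoff_le_cutoff (hnm : n ≤ m) (hy : y ∈ Ioo (-1 : ℝ) 1) : cutoff n y ≤ cutoff m y := by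
  refine Real.smoothTransition.monotone ?_
  have := one_sub_sq_pos hy
  gcongr

theorem eventually_lt_mul_one_sub_sq (hy : y ∈ Ioo (-1 : ℝ) 1) :
    ∀ᶠ n : ℕ in atTop, 2 < n * (1 - y ^ 2) := by
  have hq := one_sub_sq_pos hy
  filter_upwards [tendsto_natCast_atTop_atTop.eventually_gt_atTop (2 / (1 - y ^ 2))] with n hn
  rwa [div_lt_iff₀ hq] at hn

theorem tendsto_cutoff (hy : y ∈ Ioo (-1 : ℝ) 1) :
    Tendsto (fun n => cutoff n y) atTop (𝓝 1) :=
  tendsto_const_nhds.congr' <| by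
    filter_upwards [eventually_lt_mul_one_sub_sq hy] with n hn
    exact (cutoff_eq_one hn.le).symm

theorem tendsto_cutoffSlope (hy : y ∈ Ioo (-1 : ℝ) 1) :
    Tendsto (fun n => cutoffSlope n y) atTop (𝓝 0) :=
  tendsto_const_nhds.congr' <| by
    filter_upwards [eventually_lt_mul_one_sub_sq hy] with n hn
    exact (cutoffSlope_eq_zero_of_lt hn).symm

theorem tendsto_integral_cutoff_mul {G : ℝ → ℝ} (hG : IntegrableOn G (Ioo (-1) 1)) :
    Tendsto (fun n => ∫ y in Ioo (-1) 1, cutoff n y * G y) atTop (𝓝 (∫ y in Ioo (-1) 1, G y)) := by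
  refine tendsto_integral_of_dominated_convergence (fun y => |G y|)
    (fun n => (isTest_cutoff n).continuous.aestronglyMeasurable.mul hG.1) hG.abs
    (fun n => Eventually.of_forall fun y => ?_) ?_
  · rw [Real.norm_eq_abs, abs_mul, abs_of_nonneg cutoff_nonneg]
    exact mul_le_of_le_one_left (abs_nonneg _) cutoff_le_one
  · filter_upwards [ae_restrict_mem measurableSet_Ioo] with y hy
    simpa using (tendsto_cutoff hy).mul_const (G y)

/-- Fatou's lemma: uniform bounds on truncated integrals of a nonnegative function give
integrability. This yields both Hardy's inequality and the finiteness of the dissipation integral.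
-/
theorem integrableOn_of_cutoff {G : ℝ → ℝ} {C : ℝ}
    (hG : AEStronglyMeasurable G (volume.restrict (Ioo (-1) 1))) (hG0 : ∀ y ∈ Ioo (-1) 1, 0 ≤ G y)
    (hi : ∀ n, IntegrableOn (fun y => cutoff n y * G y) (Ioo (-1) 1))
    (hC : ∀ n, ∫ y in Ioo (-1) 1, cutoff n y * G y ≤ C) :
    IntegrableOn G (Ioo (-1) 1) ∧ ∫ y in Ioo (-1) 1, G y ≤ C := by
  have h0 : 0 ≤ᵐ[volume.restrict (Ioo (-1) 1)] G := by
    filter_upwards [ae_restrict_mem measurableSet_Ioo] with y hy using hG0 y hy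
  have hint : IntegrableOn G (Ioo (-1) 1) := by
    refine ⟨hG, ?_⟩
    rw [hasFiniteIntegral_iff_ofReal h0]
    have h1 : ∫⁻ y in Ioo (-1) 1, ENNReal.ofReal (G y) = ∫⁻ y in Ioo (-1) 1,
        liminf (fun n => ENNReal.ofReal (cutoff n y * G y)) atTop := by
      refine lintegral_congr_ae ?_
      filter_upwards [ae_restrict_mem measurableSet_Ioo] with y hy
      have := ENNReal.tendsto_ofReal ((tendsto_cutoff hy).mul_const (G y))
      rw [one_mul] at this
      exact this.liminf_eq.symm
    rw [h1]
    refine (lintegral_liminf_le' fun n => (hi n).1.aemeasurable.ennreal_ofReal).trans_lt ?_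
    refine lt_of_le_of_lt ?_ (ENNReal.ofReal_lt_top (r := C))
    refine liminf_le_of_le (by isBoundedDefault) fun b hb => ?_
    obtain ⟨n, hn⟩ := hb.exists
    refine hn.trans ?_
    rw [← ofReal_integral_eq_lintegral_ofReal (hi n)]
    · exact ENNReal.ofReal_le_ofReal (hC n)
    · filter_upwards [h0] with y hy using mul_nonneg cutoff_nonneg hy
  exact ⟨hint, le_of_tendsto' (tendsto_integral_cutoff_mul hint) hC⟩

end Cutoff

/-! ### Hardy and Sobolev inequalities in the energy space -/

/-- `f` is square integrable on compact subintervals of `(-1, 1)`. -/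
def LocMemL2 (f : ℝ → ℝ) : Prop :=
  ∀ c d : ℝ, -1 < c → d < 1 → MemLp f 2 (volume.restrict (Icc c d))

theorem LocMemL2.locallyIntegrableOn {f : ℝ → ℝ} (h : LocMemL2 f) :
    LocallyIntegrableOn f (Ioo (-1) 1) :=
  locallyIntegrableOn_of_memLp (r := 2) (by norm_num) h

theorem LocMemL2.integrable_test_mul_mul {f g ψ : ℝ → ℝ} (hf : LocMemL2 f) (hg : LocMemL2 g)
    (hψ : IsTest (-1) 1 ψ) : Integrable fun y => ψ y * (f y * g y) := by
  obtain ⟨A, B, hA, -, hB, h'⟩ := hψ.exists_shrink (by norm_num)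
  exact memLp_one_iff_integrable.1 (MemLp.test_mul h' (r := 1)
    (memLp_one_iff_integrable.2 ((hf A B hA hB).integrable_mul (hg A B hA hB))))

theorem LocMemL2.of_weight {f k : ℝ → ℝ}
    (hf : AEStronglyMeasurable f (volume.restrict (Ioo (-1) 1)))
    (hk : ContinuousOn k (Ioo (-1) 1)) (hk0 : ∀ y ∈ Ioo (-1) 1, 0 < k y)
    (hi : IntegrableOn (fun y => f y ^ 2 * k y) (Ioo (-1) 1)) : LocMemL2 f := by
  intro c d hc hd
  have hsub : Icc c d ⊆ Ioo (-1) 1 := fun y hy => ⟨hc.trans_le hy.1, hy.2.trans_lt hd⟩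
  have hfm : AEStronglyMeasurable f (volume.restrict (Icc c d)) := hf.mono_set hsub
  rw [memLp_two_iff_integrable_sq hfm]
  have hkinv : ContinuousOn (fun y => (k y)⁻¹) (Icc c d) :=
    (hk.mono hsub).inv₀ fun y hy => (hk0 y (hsub hy)).ne'
  obtain ⟨M, hM⟩ := isCompact_Icc.exists_bound_of_continuousOn hkinv
  have h1 : IntegrableOn (fun y => f y ^ 2 * k y * (k y)⁻¹) (Icc c d) :=
    (hi.mono_set hsub).mul_bdd (c := M) (hkinv.aestronglyMeasurable measurableSet_Icc) (by
      filter_upwards [ae_restrict_mem measurableSet_Icc] with y hy using hM y hy)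
  refine h1.congr ?_
  filter_upwards [ae_restrict_mem measurableSet_Icc] with y hy
  rw [mul_assoc, mul_inv_cancel₀ (hk0 y (hsub hy)).ne', mul_one]

namespace MemEnergySpace

variable {p : ℝ} {f f' g : ℝ → ℝ}

theorem integrable_parts (h : MemEnergySpace p f f' g) :
    IntegrableOn (fun y => f y ^ 2 * rho p y) (Ioo (-1) 1) ∧
    IntegrableOn (fun y => f' y ^ 2 * ((1 - y ^ 2) * rho p y)) (Ioo (-1) 1) ∧
    IntegrableOn (fun y => g y ^ 2 * rho p y) (Ioo (-1) 1) := by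
  have hr : AEStronglyMeasurable (rho p) (volume.restrict (Ioo (-1) 1)) :=
    continuousOn_rho.aestronglyMeasurable measurableSet_Ioo
  have hq : Continuous fun y : ℝ => 1 - y ^ 2 := by fun_prop
  refine ⟨Integrable.mono h.integrable ((h.meas.pow 2).mul hr) ?_,
    Integrable.mono h.integrable ((h.meas'.pow 2).mul (hq.aestronglyMeasurable.mul hr)) ?_,
    Integrable.mono h.integrable ((h.meas_g.pow 2).mul hr) ?_⟩ <;>
  · filter_upwards [ae_restrict_mem measurableSet_Ioo] with y hy
    have hρ := rho_pos (p := p) hy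
    have hq := one_sub_sq_pos hy
    have h1 := mul_nonneg (sq_nonneg (f y)) hρ.le
    have h2 := mul_nonneg (sq_nonneg (f' y)) (mul_nonneg hq.le hρ.le)
    have h3 := mul_nonneg (sq_nonneg (g y)) hρ.le
    have h4 : energyDensity p f f' g y = f y ^ 2 * rho p y
        + f' y ^ 2 * ((1 - y ^ 2) * rho p y) + g y ^ 2 * rho p y := by rw [energyDensity]; ring
    rw [Real.norm_eq_abs, Real.norm_eq_abs, h4, abs_of_nonneg (by assumption),
      abs_of_nonneg (by positivity)]
    linarith

theorem locMemL2 (h : MemEnergySpace p f f' g) : LocMemL2 f ∧ LocMemL2 f' ∧ LocMemL2 g := by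
  obtain ⟨h1, h2, h3⟩ := h.integrable_parts
  exact ⟨.of_weight h.meas continuousOn_rho (fun _ => rho_pos) h1,
    .of_weight h.meas' ((by fun_prop : ContinuousOn (fun y : ℝ => 1 - y ^ 2) _).mul continuousOn_rho)
      (fun y hy => mul_pos (one_sub_sq_pos hy) (rho_pos hy)) h2,
    .of_weight h.meas_g continuousOn_rho (fun _ => rho_pos) h3⟩

/-- Hardy's inequality with a cutoff. -/
theorem hardy_cutoff (hp : 1 < p) (h : MemEnergySpace p f f' g) (n : ℕ) :
    2 / (p - 1) * ∫ y in Ioo (-1) 1, cutoff n y * (f y ^ 2 * (y ^ 2 * (rho p y / (1 - y ^ 2))))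
      ≤ (∫ y in Ioo (-1) 1, cutoff n y * (f y ^ 2 * rho p y))
        + (2 / (p - 1))⁻¹ * ∫ y in Ioo (-1) 1, cutoff n y * (f' y ^ 2 * ((1 - y ^ 2) * rho p y)) := by
  set α := 2 / (p - 1) with hα
  have hα0 : 0 < α := div_pos (by norm_num) (by linarith)
  obtain ⟨hf, hf', -⟩ := h.locMemL2
  obtain ⟨C, hC⟩ := h.weakDeriv.exists_primitive (by norm_num) hf.locallyIntegrableOn
    hf'.locallyIntegrableOn (x₀ := 0) (by norm_num)
  set F : ℝ → ℝ := fun t => C + ∫ u in (0 : ℝ)..t, f' u with hF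
  have hχ := isTest_cutoff n
  have ht1 : IsTest (-1) 1 fun y => rho p y * cutoff n y := hχ.mul_left_of_contDiffOn contDiffOn_rho
  have hψ : IsTest (-1) 1 fun y => y * (rho p y * cutoff n y) := ht1.mul_left contDiff_id
  have ht2 : IsTest (-1) 1 fun y => (1 - y ^ 2) * (rho p y * cutoff n y) :=
    ht1.mul_left (by fun_prop)
  have ht3 : IsTest (-1) 1 fun y => y ^ 2 * (rho p y / (1 - y ^ 2) * cutoff n y) :=
    (hχ.mul_left_of_contDiffOn contDiffOn_rho_div).mul_left (by fun_prop)
  have hψd : ∀ y ∈ Ioo (-1 : ℝ) 1, deriv (fun y => y * (rho p y * cutoff n y)) y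
      = rho p y * cutoff n y - y ^ 2 * cutoffSlope n y * rho p y
        - 2 * α * (y ^ 2 * (rho p y / (1 - y ^ 2) * cutoff n y)) := fun y hy => by
    have := ((hasDerivAt_id y).mul ((hasDerivAt_rho (p := p) hy).mul
      (hasDerivAt_cutoff (n := n) (y := y)))).deriv
    refine this.trans ?_
    simp only [id, Pi.mul_apply, hα]
    ring
  obtain ⟨A, B, hA, hAB, hB, hψ'⟩ := hψ.exists_shrink (by norm_num)
  have key := integral_primitive_sq_mul hf'.locallyIntegrableOn (x₀ := 0) (by norm_num)
    (x := A) (y := B) ⟨hA, hAB.trans hB⟩ ⟨hA.trans hAB, hB⟩ C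
    ((hψ.1.of_le (by simp)).contDiffOn) hF
  rw [hψ'.zero_of_notMem (by simp), hψ'.zero_of_notMem (by simp), mul_zero, mul_zero, sub_zero,
      intervalIntegral.integral_of_le hAB.le, integral_Ioc_eq_integral_Ioo,
      setIntegral_eq_integral_of_forall_compl_eq_zero (fun y hy => by
        rw [hψ'.zero_of_notMem hy, hψ'.deriv_zero_of_notMem hy]; ring)] at key
  rw [← setIntegral_eq_integral_of_forall_compl_eq_zero (s := Ioo (-1) 1) (fun y hy => by
        rw [hψ.zero_of_notMem hy, hψ.deriv_zero_of_notMem hy]; ring)] at key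
  have i0 := (hf.integrable_test_mul_mul hf ht1).integrableOn (s := Ioo (-1) 1)
  have i1 := (hf'.integrable_test_mul_mul hf' ht2).integrableOn (s := Ioo (-1) 1)
  have i2 := (hf.integrable_test_mul_mul hf ht3).integrableOn (s := Ioo (-1) 1)
  have i3 := (hf.integrable_test_mul_mul hf' hψ).integrableOn (s := Ioo (-1) 1)
  have i4 := (hf.integrable_test_mul_mul hf hψ.deriv).integrableOn (s := Ioo (-1) 1)
  have i5 := (i3.const_mul 2).add i4
  have iR := (i0.add (i1.const_mul α⁻¹)).sub (i2.const_mul α)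
  have hle : (0 : ℝ) ≤ ∫ y in Ioo (-1) 1, (rho p y * cutoff n y * (f y * f y)
      + α⁻¹ * ((1 - y ^ 2) * (rho p y * cutoff n y) * (f' y * f' y))
      - α * (y ^ 2 * (rho p y / (1 - y ^ 2) * cutoff n y) * (f y * f y))) := by
    rw [← key]
    refine integral_mono_ae ?_ iR ?_
    · refine i5.congr ?_
      filter_upwards [hC] with y hy
      simp only [Pi.add_apply]
      rw [hF]; simp only; rw [← hy]; ring
    · filter_upwards [hC, ae_restrict_mem measurableSet_Ioo] with y hy hym
      have hy' : F y = f y := hy.symm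
      simp only [hy', hψd y hym]
      have hq := one_sub_sq_pos hym
      have hρ := rho_pos (p := p) hym
      have hc : 0 ≤ cutoff n y := cutoff_nonneg
      -- Since the derivative of the cutoff is -y times a nonnegative slope, its contribution has
      -- the favourable sign and is dropped. The rest of the difference is the square of (1-y²) f' -
      -- α y f.
      have hs : 0 ≤ y ^ 2 * cutoffSlope n y * rho p y * f y ^ 2 := by
        have := cutoffSlope_nonneg (n := n) (y := y); positivity
      have hy1 : 0 ≤ rho p y / (1 - y ^ 2) * cutoff n y
          * (α⁻¹ * ((1 - y ^ 2) * f' y - α * y * f y) ^ 2) := by positivity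
      have hy2 : rho p y / (1 - y ^ 2) * cutoff n y * (α⁻¹ * ((1 - y ^ 2) * f' y - α * y * f y) ^ 2)
          = α⁻¹ * ((1 - y ^ 2) * (rho p y * cutoff n y) * (f' y * f' y))
            - 2 * (f y * f' y * (y * (rho p y * cutoff n y)))
            + α * (y ^ 2 * (rho p y / (1 - y ^ 2) * cutoff n y) * (f y * f y)) := by
        field_simp; ring
      nlinarith
  have j0 : IntegrableOn (fun y => rho p y * cutoff n y * (f y * f y)
      + α⁻¹ * ((1 - y ^ 2) * (rho p y * cutoff n y) * (f' y * f' y))) (Ioo (-1) 1) :=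
    i0.add (i1.const_mul α⁻¹)
  rw [integral_sub j0 (i2.const_mul α), integral_add i0 (i1.const_mul α⁻¹),
    integral_const_mul, integral_const_mul] at hle
  have e0 : ∀ y, cutoff n y * (f y ^ 2 * rho p y) = rho p y * cutoff n y * (f y * f y) :=
    fun y => by ring
  have e1 : ∀ y, cutoff n y * (f' y ^ 2 * ((1 - y ^ 2) * rho p y))
      = (1 - y ^ 2) * (rho p y * cutoff n y) * (f' y * f' y) := fun y => by ring
  have e2 : ∀ y, cutoff n y * (f y ^ 2 * (y ^ 2 * (rho p y / (1 - y ^ 2))))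
      = y ^ 2 * (rho p y / (1 - y ^ 2) * cutoff n y) * (f y * f y) := fun y => by ring
  simp only [e0, e1, e2]
  linarith

theorem parts_le (h : MemEnergySpace p f f' g) :
    (∫ y in Ioo (-1) 1, f y ^ 2 * rho p y) ≤ (∫ y in Ioo (-1) 1, energyDensity p f f' g y) ∧
    (∫ y in Ioo (-1) 1, f' y ^ 2 * ((1 - y ^ 2) * rho p y))
      ≤ (∫ y in Ioo (-1) 1, energyDensity p f f' g y) ∧
    (∫ y in Ioo (-1) 1, g y ^ 2 * rho p y) ≤ (∫ y in Ioo (-1) 1, energyDensity p f f' g y) := by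
  obtain ⟨h1, h2, h3⟩ := h.integrable_parts
  refine ⟨integral_mono_ae h1 h.integrable ?_, integral_mono_ae h2 h.integrable ?_,
    integral_mono_ae h3 h.integrable ?_⟩ <;>
  · filter_upwards [ae_restrict_mem measurableSet_Ioo] with y hy
    have hρ := rho_pos (p := p) hy
    have hq := one_sub_sq_pos hy
    have h1 := mul_nonneg (sq_nonneg (f y)) hρ.le
    have h2 := mul_nonneg (sq_nonneg (f' y)) (mul_nonneg hq.le hρ.le)
    have h3 := mul_nonneg (sq_nonneg (g y)) hρ.le
    have h4 : energyDensity p f f' g y = f y ^ 2 * rho p y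
        + f' y ^ 2 * ((1 - y ^ 2) * rho p y) + g y ^ 2 * rho p y := by rw [energyDensity]; ring
    rw [h4]
    linarith

theorem norm_nonneg (_ : MemEnergySpace p f f' g) :
    0 ≤ ∫ y in Ioo (-1) 1, energyDensity p f f' g y := by
  refine setIntegral_nonneg measurableSet_Ioo fun y hy => ?_
  have := rho_pos (p := p) hy
  have := one_sub_sq_pos hy
  rw [energyDensity]; positivity

theorem integral_cutoff_le {G : ℝ → ℝ} (hG : IntegrableOn G (Ioo (-1) 1))
    (h0 : ∀ y ∈ Ioo (-1) 1, 0 ≤ G y) (n : ℕ) :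
    IntegrableOn (fun y => cutoff n y * G y) (Ioo (-1) 1) ∧
      ∫ y in Ioo (-1) 1, cutoff n y * G y ≤ ∫ y in Ioo (-1) 1, G y := by
  have hi : IntegrableOn (fun y => cutoff n y * G y) (Ioo (-1) 1) :=
    hG.bdd_mul (c := 1) (isTest_cutoff n).continuous.aestronglyMeasurable
      (Eventually.of_forall fun y => by
        rw [Real.norm_eq_abs, abs_of_nonneg cutoff_nonneg]; exact cutoff_le_one)
  refine ⟨hi, integral_mono_ae hi hG ?_⟩
  filter_upwards [ae_restrict_mem measurableSet_Ioo] with y hy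
  exact mul_le_of_le_one_left (h0 y hy) cutoff_le_one

/-- Hardy's inequality in the energy space. -/
theorem hardy (hp : 1 < p) (h : MemEnergySpace p f f' g) :
    IntegrableOn (fun y => f y ^ 2 * (rho p y / (1 - y ^ 2))) (Ioo (-1) 1) ∧
    ∫ y in Ioo (-1) 1, f y ^ 2 * (rho p y / (1 - y ^ 2))
      ≤ (1 + (2 / (p - 1))⁻¹ * (1 + (2 / (p - 1))⁻¹))
        * ∫ y in Ioo (-1) 1, energyDensity p f f' g y := by
  set α := 2 / (p - 1) with hα
  have hα0 : 0 < α := div_pos (by norm_num) (by linarith)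
  set N := ∫ y in Ioo (-1) 1, energyDensity p f f' g y
  obtain ⟨h1, h2, -⟩ := h.integrable_parts
  obtain ⟨l1, l2, -⟩ := h.parts_le
  obtain ⟨hf, -, -⟩ := h.locMemL2
  have hrq : ContinuousOn (fun y => rho p y / (1 - y ^ 2)) (Ioo (-1) 1) :=
    contDiffOn_rho_div.continuousOn
  have hmain := integrableOn_of_cutoff (G := fun y => f y ^ 2 * (y ^ 2 * (rho p y / (1 - y ^ 2))))
    (C := α⁻¹ * (1 + α⁻¹) * N)
    ((h.meas.pow 2).mul ((by fun_prop : Continuous fun y : ℝ => y ^ 2).aestronglyMeasurable.mul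
      (hrq.aestronglyMeasurable measurableSet_Ioo)))
    (fun y hy => by
      have := rho_pos (p := p) hy
      have := one_sub_sq_pos hy
      positivity)
    (fun n => by
      have ht3 : IsTest (-1) 1 fun y => y ^ 2 * (rho p y / (1 - y ^ 2) * cutoff n y) :=
        ((isTest_cutoff n).mul_left_of_contDiffOn contDiffOn_rho_div).mul_left (by fun_prop)
      refine ((hf.integrable_test_mul_mul hf ht3).integrableOn (s := Ioo (-1) 1)).congr
        (Eventually.of_forall fun y => ?_)
      simp only; ring)
    (fun n => by
      have hh := h.hardy_cutoff hp n
      rw [← hα] at hh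
      have e1 := (integral_cutoff_le h1 (fun y hy => by
        have := rho_pos (p := p) hy; positivity) n).2
      have e2 := (integral_cutoff_le h2 (fun y hy => by
        have := rho_pos (p := p) hy; have := one_sub_sq_pos hy; positivity) n).2
      have e3 := mul_le_mul_of_nonneg_left (e2.trans l2) (inv_nonneg.2 hα0.le)
      calc _ = α⁻¹ * (α * ∫ y in Ioo (-1) 1,
              cutoff n y * (f y ^ 2 * (y ^ 2 * (rho p y / (1 - y ^ 2))))) := by field_simp
        _ ≤ α⁻¹ * (N + α⁻¹ * N) := by gcongr; linarith
        _ = _ := by ring)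
  -- The identity 1 = (1-y²) + y² removes the factor y² that vanishes at the origin.
  have e : ∀ᵐ y ∂volume.restrict (Ioo (-1) 1), f y ^ 2 * rho p y
      + f y ^ 2 * (y ^ 2 * (rho p y / (1 - y ^ 2))) = f y ^ 2 * (rho p y / (1 - y ^ 2)) := by
    filter_upwards [ae_restrict_mem measurableSet_Ioo] with y hy
    have := (one_sub_sq_pos hy).ne'
    field_simp; ring
  refine ⟨(h1.add hmain.1).congr e, ?_⟩
  rw [← integral_congr_ae e, integral_add h1 hmain.1]
  calc _ ≤ N + α⁻¹ * (1 + α⁻¹) * N := add_le_add l1 hmain.2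
    _ = _ := by ring

/-- The pointwise bound in the energy space. -/
theorem sq_mul_rho_le (hp : 1 < p) (h : MemEnergySpace p f f' g) :
    ∀ᵐ y ∂volume.restrict (Ioo (-1) 1), f y ^ 2 * rho p y
      ≤ (2 + (1 + 2 * (2 / (p - 1))) * (1 + (2 / (p - 1))⁻¹ * (1 + (2 / (p - 1))⁻¹)))
        * ∫ y in Ioo (-1) 1, energyDensity p f f' g y := by
  set α := 2 / (p - 1) with hα
  have hα0 : 0 < α := div_pos (by norm_num) (by linarith)
  set N := ∫ y in Ioo (-1) 1, energyDensity p f f' g y with hN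
  have hN0 : 0 ≤ N := h.norm_nonneg
  obtain ⟨h1, h2, -⟩ := h.integrable_parts
  obtain ⟨l1, l2, -⟩ := h.parts_le
  obtain ⟨hf, hf', -⟩ := h.locMemL2
  obtain ⟨h3, l3⟩ := h.hardy hp
  rw [← hα] at l3
  set K := 1 + α⁻¹ * (1 + α⁻¹)
  obtain ⟨C, hC⟩ := h.weakDeriv.exists_primitive (by norm_num) hf.locallyIntegrableOn
    hf'.locallyIntegrableOn (x₀ := 0) (by norm_num)
  set F : ℝ → ℝ := fun t => C + ∫ u in (0 : ℝ)..t, f' u with hF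
  have hG : IntegrableOn (fun y => (1 + 2 * α) * (f y ^ 2 * (rho p y / (1 - y ^ 2)))
      + f' y ^ 2 * ((1 - y ^ 2) * rho p y)) (Ioo (-1) 1) := (h3.const_mul (1 + 2 * α)).add h2
  -- The derivative of F² ρ is bounded by (1+2α) f² ρ/(1-y²) + f'² (1-y²) ρ, an integrable function
  -- by Hardy's inequality, so the oscillation of F² ρ is controlled by the energy norm.
  have hosc : ∀ x ∈ Ioo (-1 : ℝ) 1, ∀ z ∈ Ioo (-1 : ℝ) 1,
      F z ^ 2 * rho p z - F x ^ 2 * rho p x ≤ (1 + 2 * α) * (K * N) + N := by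
    intro x hx z hz
    rw [← integral_primitive_sq_mul hf'.locallyIntegrableOn (x₀ := 0) (by norm_num) hx hz C
      (contDiffOn_rho.of_le (by simp)) hF]
    have hsub : uIoc x z ⊆ Ioo (-1) 1 :=
      uIoc_subset_uIcc.trans (ordConnected_Ioo.uIcc_subset hx hz)
    calc _ ≤ ∫ y in uIoc x z, ‖2 * (F y * f' y * rho p y) + F y ^ 2 * deriv (rho p) y‖ :=
          (Real.le_norm_self _).trans intervalIntegral.norm_integral_le_integral_norm_uIoc
      _ ≤ ∫ y in uIoc x z, ((1 + 2 * α) * (f y ^ 2 * (rho p y / (1 - y ^ 2)))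
            + f' y ^ 2 * ((1 - y ^ 2) * rho p y)) := by
          refine integral_mono_of_nonneg (Eventually.of_forall fun y => _root_.norm_nonneg _)
            (hG.mono_set hsub) ?_
          filter_upwards [ae_restrict_of_ae_restrict_of_subset hsub hC,
            ae_restrict_mem measurableSet_uIoc] with y hy hym
          have hym := hsub hym
          have hy' : F y = f y := hy.symm
          have hq := one_sub_sq_pos hym
          have hρ := rho_pos (p := p) hym
          rw [hy', (hasDerivAt_rho hym).deriv, ← hα, Real.norm_eq_abs]
          have hy1 : |y| ≤ 1 := abs_le.2 ⟨hym.1.le, hym.2.le⟩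
          have a1 : |2 * (f y * f' y * rho p y)| ≤ f y ^ 2 * (rho p y / (1 - y ^ 2))
              + f' y ^ 2 * ((1 - y ^ 2) * rho p y) := by
            have e1 : rho p y = (1 - y ^ 2) * (rho p y / (1 - y ^ 2)) := by field_simp
            have e2 : 0 < rho p y / (1 - y ^ 2) := by positivity
            set r := rho p y / (1 - y ^ 2)
            rw [e1, abs_le]
            have b1 : 0 ≤ r * (f y + (1 - y ^ 2) * f' y) ^ 2 := by positivity
            have b2 : 0 ≤ r * (f y - (1 - y ^ 2) * f' y) ^ 2 := by positivity
            constructor <;> nlinarith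
          have a2 : |f y ^ 2 * (-(2 * α * y) * (rho p y / (1 - y ^ 2)))|
              ≤ 2 * α * (f y ^ 2 * (rho p y / (1 - y ^ 2))) := by
            have e2 : 0 < rho p y / (1 - y ^ 2) := by positivity
            have e3 : f y ^ 2 * (-(2 * α * y) * (rho p y / (1 - y ^ 2)))
              = -y * (2 * α * (f y ^ 2 * (rho p y / (1 - y ^ 2)))) := by ring
            rw [e3, abs_mul, abs_neg, abs_of_nonneg (a := 2 * α * _) (by positivity)]
            exact mul_le_of_le_one_left (by positivity) hy1
          refine (abs_add_le _ _).trans ((add_le_add a1 a2).trans (le_of_eq ?_))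
          ring
      _ ≤ ∫ y in Ioo (-1) 1, ((1 + 2 * α) * (f y ^ 2 * (rho p y / (1 - y ^ 2)))
            + f' y ^ 2 * ((1 - y ^ 2) * rho p y)) := by
          refine setIntegral_mono_set hG ?_ hsub.eventuallyLE
          filter_upwards [ae_restrict_mem measurableSet_Ioo] with y hy
          have := rho_pos (p := p) hy
          have := one_sub_sq_pos hy
          simp only [Pi.zero_apply]
          positivity
      _ = (1 + 2 * α) * (∫ y in Ioo (-1) 1, f y ^ 2 * (rho p y / (1 - y ^ 2)))
            + ∫ y in Ioo (-1) 1, f' y ^ 2 * ((1 - y ^ 2) * rho p y) := by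
          rw [integral_add (h3.const_mul _) h2, integral_const_mul]
      _ ≤ _ := by gcongr
  -- If F² ρ exceeded N everywhere, its integral over an interval of length 2 would be at least 2N.
  -- This leaves only N = 0, where the integrand would vanish almost everywhere although it is
  -- positive.
  obtain ⟨x, hx, hxN⟩ : ∃ x ∈ Ioo (-1 : ℝ) 1, F x ^ 2 * rho p x ≤ N := by
    by_contra! hcon
    have hlt : (N : ℝ) * 2 ≤ ∫ y in Ioo (-1) 1, f y ^ 2 * rho p y := by
      have e1 : ∫ y in Ioo (-1 : ℝ) 1, N = N * 2 := by
        rw [setIntegral_const, measureReal_def, Real.volume_Ioo]; norm_num; ring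
      rw [← e1]
      refine integral_mono_ae (integrable_const N) h1 ?_
      filter_upwards [hC, ae_restrict_mem measurableSet_Ioo] with y hy hym
      have hy' : F y = f y := hy.symm
      rw [← hy']; exact (hcon y hym).le
    have hN00 : N = 0 := le_antisymm (by linarith) hN0
    have hz : ∫ y in Ioo (-1) 1, f y ^ 2 * rho p y = 0 := le_antisymm (by linarith) (by linarith)
    rw [setIntegral_eq_zero_iff_of_nonneg_ae] at hz
    · have : (ae (volume.restrict (Ioo (-1 : ℝ) 1))).NeBot := by
        rw [ae_neBot]; simp
      obtain ⟨y, hy1, hy2, hy3⟩ := (hz.and (hC.and (ae_restrict_mem measurableSet_Ioo))).exists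
      have hy' : F y = f y := hy2.symm
      have := hcon y hy3
      rw [hy', hN00] at this
      exact absurd hy1 this.ne'
    · filter_upwards [ae_restrict_mem measurableSet_Ioo] with y hy
      have := rho_pos (p := p) hy
      simp only [Pi.zero_apply]
      positivity
    · exact h1
  filter_upwards [hC, ae_restrict_mem measurableSet_Ioo] with z hz hzm
  have hz' : F z = f z := hz.symm
  have := hosc x hx z hzm
  rw [hz'] at this
  calc _ ≤ N + ((1 + 2 * α) * (K * N) + N) := by linarith
    _ = _ := by ring

/-- Control of the potential energy. -/
theorem potential (hp : 1 < p) : ∃ C : ℝ, 0 < C ∧ ∀ {f f' g : ℝ → ℝ}, MemEnergySpace p f f' g →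
    IntegrableOn (fun y => |f y| ^ (p + 1) * rho p y) (Ioo (-1) 1) ∧
    ∫ y in Ioo (-1) 1, |f y| ^ (p + 1) * rho p y
      ≤ (C * ∫ y in Ioo (-1) 1, energyDensity p f f' g y) ^ ((p - 1) / 2)
        * (C * ∫ y in Ioo (-1) 1, energyDensity p f f' g y) := by
  set α := 2 / (p - 1) with hα
  have hα0 : 0 < α := div_pos (by norm_num) (by linarith)
  set K := 1 + α⁻¹ * (1 + α⁻¹) with hK
  have hK0 : 0 < K := by positivity
  refine ⟨2 + (1 + 2 * α) * K, by positivity, fun {f f' g} h => ?_⟩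
  set N := ∫ y in Ioo (-1) 1, energyDensity p f f' g y
  have hN0 : 0 ≤ N := h.norm_nonneg
  set C := 2 + (1 + 2 * α) * K
  have hKC : K ≤ C := by
    have : 0 ≤ 2 * α * K := by positivity
    have : C = 2 + K + 2 * α * K := by ring
    linarith
  obtain ⟨h3, l3⟩ := h.hardy hp
  have hsup := h.sq_mul_rho_le hp
  rw [← hα] at l3
  -- The exponent of ρ is such that ρ^((p-1)/2) = 1-y². Hence |f|^(p+1) ρ is (f² ρ)^((p-1)/2),
  -- bounded pointwise, times exactly the Hardy integrand f² ρ/(1-y²).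
  have hbd : ∀ᵐ y ∂volume.restrict (Ioo (-1) 1), |f y| ^ (p + 1) * rho p y
      ≤ (C * N) ^ ((p - 1) / 2) * (f y ^ 2 * (rho p y / (1 - y ^ 2))) := by
    filter_upwards [hsup, ae_restrict_mem measurableSet_Ioo] with y hy hym
    have hq := one_sub_sq_pos hym
    have hρ := rho_pos (p := p) hym
    have e1 : |f y| ^ (p + 1) = (f y ^ 2) ^ ((p - 1) / 2) * f y ^ 2 := by
      rw [← sq_abs, ← Real.rpow_natCast |f y| 2, ← Real.rpow_mul (abs_nonneg _),
        ← Real.rpow_add' (abs_nonneg _) (by push_cast; linarith)]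
      congr 1; push_cast; ring
    have e2 : rho p y ^ ((p - 1) / 2) = 1 - y ^ 2 := by
      rw [rho, ← Real.rpow_mul hq.le]
      have : 2 / (p - 1) * ((p - 1) / 2) = 1 := by
        have : p - 1 ≠ 0 := by linarith
        field_simp
      rw [this, Real.rpow_one]
    have e3 : (f y ^ 2) ^ ((p - 1) / 2) * (1 - y ^ 2) ≤ (C * N) ^ ((p - 1) / 2) := by
      rw [← e2, ← Real.mul_rpow (sq_nonneg _) hρ.le]
      exact Real.rpow_le_rpow (by positivity) hy (by linarith)
    calc _ = ((f y ^ 2) ^ ((p - 1) / 2) * (1 - y ^ 2)) * (f y ^ 2 * (rho p y / (1 - y ^ 2))) := by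
          rw [e1]; field_simp
      _ ≤ _ := by gcongr
  have hdom := h3.const_mul ((C * N) ^ ((p - 1) / 2))
  have hmeas : AEStronglyMeasurable (fun y => |f y| ^ (p + 1) * rho p y)
      (volume.restrict (Ioo (-1) 1)) :=
    ((Real.continuous_rpow_const (by linarith : (0:ℝ) ≤ p + 1)).comp_aestronglyMeasurable
      h.meas.norm).mul (continuousOn_rho.aestronglyMeasurable measurableSet_Ioo)
  have hint : IntegrableOn (fun y => |f y| ^ (p + 1) * rho p y) (Ioo (-1) 1) := by
    refine Integrable.mono' hdom hmeas ?_
    filter_upwards [hbd, ae_restrict_mem measurableSet_Ioo] with y hy hym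
    have hρ := rho_pos (p := p) hym
    rwa [Real.norm_of_nonneg (by positivity)]
  refine ⟨hint, (integral_mono_ae hint hdom hbd).trans ?_⟩
  rw [integral_const_mul]
  have : 0 ≤ (C * N) ^ ((p - 1) / 2) := by positivity
  refine mul_le_mul_of_nonneg_left (l3.trans ?_) this
  exact mul_le_mul_of_nonneg_right hKC hN0

end MemEnergySpace

variable {p : ℝ}

/-! ### Paths in the energy space -/

theorem hasDerivAt_abs_rpow_add_one (hp : 1 < p) (x : ℝ) :
    HasDerivAt (fun x : ℝ => |x| ^ (p + 1)) ((p + 1) * (|x| ^ (p - 1) * x)) x := by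
  convert! hasDerivAt_abs_rpow x (p := p + 1) (by linarith) using 1
  rw [show p + 1 - 2 = p - 1 by ring]; ring

theorem continuous_abs_rpow_mul (hp : 1 < p) : Continuous fun x : ℝ => |x| ^ (p - 1) * x :=
  (continuous_abs.rpow_const fun _ => Or.inr (by linarith)).mul continuous_id

theorem continuous_abs_rpow (hp : 1 < p) : Continuous fun x : ℝ => |x| ^ (p + 1) :=
  continuous_abs.rpow_const fun _ => Or.inr (by linarith)

/-- The nonlinearity is Lipschitz on bounded sets. -/
theorem abs_rpow_mul_sub_le (hp : 1 < p) {M x z : ℝ} (hx : |x| ≤ M) (hz : |z| ≤ M) :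
    |(|x| ^ (p - 1) * x) - |z| ^ (p - 1) * z| ≤ p * M ^ (p - 1) * |x - z| := by
  have hM : 0 ≤ M := (abs_nonneg x).trans hx
  have key : ∀ x z : ℝ, 0 ≤ x → 0 ≤ z → x ≤ M → z ≤ M →
      |x ^ p - z ^ p| ≤ p * M ^ (p - 1) * |x - z| := by
    intro x z hx0 hz0 hx hz
    refine (convex_Icc 0 M).norm_image_sub_le_of_norm_hasDerivWithin_le
      (f := fun x : ℝ => x ^ p) (f' := fun x => p * x ^ (p - 1)) (fun y hy => ?_) (fun y hy => ?_)
      ⟨hz0, hz⟩ ⟨hx0, hx⟩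
    · exact (Real.hasDerivAt_rpow_const (Or.inr hp.le)).hasDerivWithinAt
    · rw [Real.norm_of_nonneg (mul_nonneg (by linarith) (Real.rpow_nonneg hy.1 _))]
      exact mul_le_mul_of_nonneg_left (Real.rpow_le_rpow hy.1 hy.2 (by linarith)) (by linarith)
  have hpow : ∀ x : ℝ, 0 ≤ x → x ^ (p - 1) * x = x ^ p := fun x hx => by
    rw [← Real.rpow_add_one' hx (by linarith)]; ring_nf
  have hle : ∀ x : ℝ, 0 ≤ x → x ≤ M → x ^ p ≤ p * M ^ (p - 1) * x := fun x h0 hx => by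
    rw [← hpow x h0]
    have h1 : x ^ (p - 1) ≤ M ^ (p - 1) := Real.rpow_le_rpow h0 hx (by linarith)
    have h2 : 0 ≤ M ^ (p - 1) := Real.rpow_nonneg hM _
    nlinarith [mul_le_mul_of_nonneg_right h1 h0, mul_nonneg h2 h0]
  have hn : ∀ x : ℝ, 0 ≤ x → 0 ≤ x ^ p := fun x h => Real.rpow_nonneg h _
  rcases le_total 0 x with h1 | h1 <;> rcases le_total 0 z with h2 | h2
  · rw [abs_of_nonneg h1] at hx ⊢
    rw [abs_of_nonneg h2] at hz ⊢
    rw [hpow x h1, hpow z h2]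
    exact key x z h1 h2 hx hz
  · rw [abs_of_nonneg h1] at hx ⊢
    rw [abs_of_nonpos h2] at hz ⊢
    have e : (-z) ^ (p - 1) * z = -(-z) ^ p := by
      rw [← hpow (-z) (by linarith)]; ring
    rw [hpow x h1, e, sub_neg_eq_add, abs_of_nonneg (add_nonneg (hn _ h1) (hn _ (by linarith))),
      abs_of_nonneg (by linarith : 0 ≤ x - z)]
    have := hle x h1 hx
    have := hle (-z) (by linarith) hz
    linarith
  · rw [abs_of_nonpos h1] at hx ⊢
    rw [abs_of_nonneg h2] at hz ⊢
    have e : (-x) ^ (p - 1) * x = -(-x) ^ p := by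
      rw [← hpow (-x) (by linarith)]; ring
    rw [hpow z h2, e, abs_of_nonpos (by linarith [hn _ h2, hn (-x) (by linarith)]),
      abs_of_nonpos (by linarith : x - z ≤ 0)]
    have := hle z h2 hz
    have := hle (-x) (by linarith) hx
    linarith
  · rw [abs_of_nonpos h1] at hx ⊢
    rw [abs_of_nonpos h2] at hz ⊢
    have e : (-z) ^ (p - 1) * z = -(-z) ^ p := by
      rw [← hpow (-z) (by linarith)]; ring
    have e' : (-x) ^ (p - 1) * x = -(-x) ^ p := by
      rw [← hpow (-x) (by linarith)]; ring
    rw [e, e', show -(-x) ^ p - -(-z) ^ p = -((-x) ^ p - (-z) ^ p) by ring, abs_neg,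
      show x - z = -(-x - -z) by ring, abs_neg]
    exact key (-x) (-z) (by linarith) (by linarith) hx hz

theorem exists_quadratic_remainder {Φ Φ' : ℝ → ℝ} (hΦ : ∀ x, HasDerivAt Φ (Φ' x) x) {M L : ℝ}
    (hL : ∀ x z, |x| ≤ M → |z| ≤ M → |Φ' x - Φ' z| ≤ L * |x - z|) (hL0 : 0 ≤ L) {x z : ℝ}
    (hx : |x| ≤ M) (hz : |z| ≤ M) : |Φ z - Φ x - (z - x) * Φ' x| ≤ L * (z - x) ^ 2 := by
  have hsub : ∀ t ∈ uIcc x z, |t| ≤ M ∧ |t - x| ≤ |z - x| := by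
    intro t ht
    have h1 := abs_le.1 hx
    have h2 := abs_le.1 hz
    rcases le_total x z with h | h
    · rw [uIcc_of_le h] at ht
      refine ⟨abs_le.2 ⟨by linarith [ht.1], by linarith [ht.2]⟩, ?_⟩
      rw [abs_of_nonneg (by linarith [ht.1]), abs_of_nonneg (by linarith)]
      linarith [ht.2]
    · rw [uIcc_of_ge h] at ht
      refine ⟨abs_le.2 ⟨by linarith [ht.1], by linarith [ht.2]⟩, ?_⟩
      rw [abs_of_nonpos (by linarith [ht.2]), abs_of_nonpos (by linarith)]
      linarith [ht.1]
  have := (convex_uIcc x z).norm_image_sub_le_of_norm_hasDerivWithin_le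
    (f := fun t => Φ t - t * Φ' x) (f' := fun t => Φ' t - 1 * Φ' x) (C := L * |z - x|)
    (fun t _ => ((hΦ t).sub ((hasDerivAt_id t).mul_const _)).hasDerivWithinAt) (fun t ht => by
      rw [Real.norm_eq_abs, one_mul]
      exact (hL t x (hsub t ht).1 hx).trans (mul_le_mul_of_nonneg_left (hsub t ht).2 hL0))
    left_mem_uIcc right_mem_uIcc
  rw [Real.norm_eq_abs, Real.norm_eq_abs, mul_assoc, abs_mul_abs_self] at this
  rw [pow_two]
  convert! this using 2
  ring

theorem MemEnergySpace.sub {f f' g F F' G : ℝ → ℝ} (h : MemEnergySpace p f f' g)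
    (H : MemEnergySpace p F F' G) :
    MemEnergySpace p (fun y => f y - F y) (fun y => f' y - F' y) (fun y => g y - G y) := by
  have hm := h.locMemL2
  have Hm := H.locMemL2
  refine ⟨h.meas.sub H.meas, h.meas'.sub H.meas', h.meas_g.sub H.meas_g, fun φ hφ => ?_, ?_⟩
  · have hab : (-1 : ℝ) < 1 := by norm_num
    have i1 : IntegrableOn (fun y => f y * deriv φ y) (Ioo (-1) 1) :=
      (integrableOn_mul_test hab hφ.deriv hm.1.locallyIntegrableOn).integrableOn
    have i2 : IntegrableOn (fun y => F y * deriv φ y) (Ioo (-1) 1) :=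
      (integrableOn_mul_test hab hφ.deriv Hm.1.locallyIntegrableOn).integrableOn
    have i3 : IntegrableOn (fun y => f' y * φ y) (Ioo (-1) 1) :=
      (integrableOn_mul_test hab hφ hm.2.1.locallyIntegrableOn).integrableOn
    have i4 : IntegrableOn (fun y => F' y * φ y) (Ioo (-1) 1) :=
      (integrableOn_mul_test hab hφ Hm.2.1.locallyIntegrableOn).integrableOn
    simp_rw [sub_mul]
    rw [integral_sub i1 i2, integral_sub i3 i4, h.weakDeriv φ hφ, H.weakDeriv φ hφ]
    ring
  · refine Integrable.mono ((h.integrable.const_mul 2).add (H.integrable.const_mul 2)) ?_ ?_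
    · unfold energyDensity
      have hq : AEStronglyMeasurable (fun y : ℝ => 1 - y ^ 2) (volume.restrict (Ioo (-1) 1)) :=
        (by fun_prop : Continuous fun y : ℝ => 1 - y ^ 2).aestronglyMeasurable
      exact ((((h.meas.sub H.meas).pow 2).add (((h.meas'.sub H.meas').pow 2).mul hq)).add
        ((h.meas_g.sub H.meas_g).pow 2)).mul
        (continuousOn_rho.aestronglyMeasurable measurableSet_Ioo)
    · filter_upwards [ae_restrict_mem measurableSet_Ioo] with y hy
      have hq := one_sub_sq_pos hy
      have hr := rho_pos (p := p) hy
      have e1 : ∀ a b c : ℝ, 0 ≤ (a ^ 2 + b ^ 2 * (1 - y ^ 2) + c ^ 2) := fun a b c => by positivity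
      unfold energyDensity
      simp only [Pi.add_apply]
      rw [Real.norm_of_nonneg (mul_nonneg (e1 _ _ _) hr.le), Real.norm_of_nonneg
        (by have := mul_nonneg (e1 (f y) (f' y) (g y)) hr.le
            have := mul_nonneg (e1 (F y) (F' y) (G y)) hr.le
            linarith)]
      rw [← mul_assoc, ← mul_assoc, ← add_mul]
      refine mul_le_mul_of_nonneg_right ?_ hr.le
      nlinarith [sq_nonneg (f y + F y), sq_nonneg (g y + G y),
        mul_nonneg (sq_nonneg (f' y + F' y)) hq.le]

theorem MemEnergySpace.integral_le_sub {f f' g F F' G : ℝ → ℝ} (h : MemEnergySpace p f f' g)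
    (H : MemEnergySpace p F F' G) :
    (∫ y in Ioo (-1) 1, energyDensity p f f' g y)
      ≤ 2 * (∫ y in Ioo (-1) 1, energyDensity p (fun y => f y - F y) (fun y => f' y - F' y)
        (fun y => g y - G y) y) + 2 * ∫ y in Ioo (-1) 1, energyDensity p F F' G y := by
  rw [← integral_const_mul, ← integral_const_mul, ← integral_add ((h.sub H).integrable.const_mul 2)
    (H.integrable.const_mul 2)]
  refine setIntegral_mono_on h.integrable
    (((h.sub H).integrable.const_mul 2).add (H.integrable.const_mul 2)) measurableSet_Ioo
    fun y hy => ?_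
  have hq := one_sub_sq_pos hy
  have hr := rho_pos (p := p) hy
  unfold energyDensity
  rw [← mul_assoc, ← mul_assoc, ← add_mul]
  refine mul_le_mul_of_nonneg_right ?_ hr.le
  nlinarith [sq_nonneg (f y - 2 * F y), sq_nonneg (g y - 2 * G y),
    mul_nonneg (sq_nonneg (f' y - 2 * F' y)) hq.le]

theorem LocL2ContOn.of_weight {J : Set ℝ} {g : ℝ → ℝ → ℝ} {k : ℝ → ℝ}
    (hg : ∀ s ∈ J, LocMemL2 (g s))
    (hk : ContinuousOn k (Ioo (-1) 1)) (hk0 : ∀ y ∈ Ioo (-1) 1, 0 < k y) {E : ℝ → ℝ → ℝ}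
    (hE : ∀ s ∈ J, Tendsto (E s) (𝓝[J] s) (𝓝 0))
    (hle : ∀ s ∈ J, ∀ σ ∈ J, IntegrableOn (fun y => (g σ y - g s y) ^ 2 * k y) (Ioo (-1) 1) ∧
      ∫ y in Ioo (-1) 1, (g σ y - g s y) ^ 2 * k y ≤ E s σ) :
    LocL2ContOn (-1) 1 J g := by
  intro c d hc hd
  refine L2ContOn.of_integral_sq (fun s hs => hg s hs c d hc hd) fun s hs => ?_
  rcases lt_or_ge d c with hcd | hcd
  · simpa [Icc_eq_empty_of_lt hcd] using tendsto_const_nhds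
  have hsub : Icc c d ⊆ Ioo (-1 : ℝ) 1 := fun y hy => ⟨hc.trans_le hy.1, hy.2.trans_lt hd⟩
  obtain ⟨z, hz, hmin⟩ := isCompact_Icc.exists_isMinOn (nonempty_Icc.2 hcd) (hk.mono hsub)
  have hz0 := hk0 z (hsub hz)
  have ht : Tendsto (fun σ => (k z)⁻¹ * E s σ) (𝓝[J] s) (𝓝 0) := by
    simpa using (hE s hs).const_mul (k z)⁻¹
  refine tendsto_of_tendsto_of_tendsto_of_le_of_le' tendsto_const_nhds ht
    (Eventually.of_forall fun σ => integral_nonneg fun y => sq_nonneg _) ?_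
  filter_upwards [self_mem_nhdsWithin] with σ hσ
  have hi := hle s hs σ hσ
  have hsq : IntegrableOn (fun y => (g σ y - g s y) ^ 2) (Icc c d) :=
    ((hg σ hσ c d hc hd).sub (hg s hs c d hc hd)).integrable_sq
  calc ∫ y in Icc c d, (g σ y - g s y) ^ 2
      ≤ ∫ y in Icc c d, (k z)⁻¹ * ((g σ y - g s y) ^ 2 * k y) := by
        refine setIntegral_mono_on hsq ((hi.1.mono_set hsub).const_mul _) measurableSet_Icc
          fun y hy => ?_
        have : k z ≤ k y := hmin hy
        rw [← mul_assoc, mul_comm (k z)⁻¹, mul_assoc, ← div_eq_inv_mul]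
        exact le_mul_of_one_le_right (sq_nonneg _) ((one_le_div hz0).2 this)
    _ = (k z)⁻¹ * ∫ y in Icc c d, (g σ y - g s y) ^ 2 * k y := integral_const_mul _ _
    _ ≤ (k z)⁻¹ * E s σ := by
        refine mul_le_mul_of_nonneg_left (le_trans ?_ hi.2) (inv_nonneg.2 hz0.le)
        refine setIntegral_mono_set hi.1 ?_ (ae_of_all _ hsub)
        filter_upwards [ae_restrict_mem measurableSet_Ioo] with y hy
        exact mul_nonneg (sq_nonneg _) (hk0 y hy).le

namespace IsEnergyPath

variable {J : Set ℝ} {w wy ws : ℝ → ℝ → ℝ}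

theorem locL2ContOn (h : IsEnergyPath p J w wy ws) :
    LocL2ContOn (-1) 1 J w ∧ LocL2ContOn (-1) 1 J wy ∧ LocL2ContOn (-1) 1 J ws := by
  have hq : Continuous fun y : ℝ => 1 - y ^ 2 := by fun_prop
  refine ⟨LocL2ContOn.of_weight (k := rho p) (fun s hs => (h.mem s hs).locMemL2.1) continuousOn_rho
      (fun y hy => rho_pos hy) h.continuous fun s hs σ hσ => ?_,
    LocL2ContOn.of_weight (k := fun y => (1 - y ^ 2) * rho p y)
      (fun s hs => (h.mem s hs).locMemL2.2.1)
      (hq.continuousOn.mul continuousOn_rho)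
      (fun y hy => mul_pos (one_sub_sq_pos hy) (rho_pos hy)) h.continuous fun s hs σ hσ => ?_,
    LocL2ContOn.of_weight (k := rho p) (fun s hs => (h.mem s hs).locMemL2.2.2) continuousOn_rho
      (fun y hy => rho_pos hy) h.continuous fun s hs σ hσ => ?_⟩
  all_goals have hd := (h.mem σ hσ).sub (h.mem s hs)
  · exact ⟨hd.integrable_parts.1, hd.parts_le.1⟩
  · exact ⟨hd.integrable_parts.2.1, hd.parts_le.2.1⟩
  · exact ⟨hd.integrable_parts.2.2, hd.parts_le.2.2⟩

theorem eventually_norm_le (h : IsEnergyPath p J w wy ws) {s : ℝ} (hs : s ∈ J) :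
    ∃ C, ∀ᶠ σ in 𝓝[J] s, ∫ y in Ioo (-1) 1, energyDensity p (w σ) (wy σ) (ws σ) y ≤ C := by
  refine ⟨2 * 1 + 2 * ∫ y in Ioo (-1) 1, energyDensity p (w s) (wy s) (ws s) y, ?_⟩
  filter_upwards [(h.continuous s hs).eventually (ge_mem_nhds one_pos), self_mem_nhdsWithin]
    with σ h1 hσ
  have := (h.mem σ hσ).integral_le_sub (h.mem s hs)
  linarith

theorem exists_norm_le (h : IsEnergyPath p J w wy ws) {K : Set ℝ} (hK : IsCompact K)
    (hKJ : K ⊆ J) :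
    ∃ C, ∀ σ ∈ K, ∫ y in Ioo (-1) 1, energyDensity p (w σ) (wy σ) (ws σ) y ≤ C := by
  refine hK.induction_on (p := fun S => ∃ C, ∀ σ ∈ S,
      ∫ y in Ioo (-1) 1, energyDensity p (w σ) (wy σ) (ws σ) y ≤ C) ⟨0, by simp⟩ ?_ ?_ ?_
  · rintro S T hST ⟨C, hC⟩
    exact ⟨C, fun σ hσ => hC σ (hST hσ)⟩
  · rintro S T ⟨C, hC⟩ ⟨D, hD⟩
    refine ⟨max C D, fun σ hσ => hσ.elim (fun h => (hC σ h).trans (le_max_left _ _))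
      fun h => (hD σ h).trans (le_max_right _ _)⟩
  · intro s hs
    obtain ⟨C, hC⟩ := h.eventually_norm_le (hKJ hs)
    exact ⟨_, nhdsWithin_mono s hKJ hC, C, fun σ hσ => hσ⟩

/-- The weight is bounded below on compact subintervals, so the weighted pointwise bound becomes a
plain one. It is needed because the nonlinearity is Lipschitz only on bounded sets. -/
theorem eventually_abs_le (hp : 1 < p) (h : IsEnergyPath p J w wy ws) {s : ℝ} (hs : s ∈ J)
    {c d : ℝ} (hc : -1 < c) (hd : d < 1) :
    ∃ M, 0 ≤ M ∧ ∀ᶠ σ in 𝓝[J] s, ∀ᵐ y ∂volume.restrict (Icc c d), |w σ y| ≤ M := by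
  obtain ⟨C, hC⟩ := h.eventually_norm_le hs
  rcases lt_or_ge d c with hcd | hcd
  · exact ⟨0, le_rfl, by simp [Icc_eq_empty_of_lt hcd]⟩
  have hsub : Icc c d ⊆ Ioo (-1 : ℝ) 1 := fun y hy => ⟨hc.trans_le hy.1, hy.2.trans_lt hd⟩
  obtain ⟨z, hz, hmin⟩ := isCompact_Icc.exists_isMinOn (nonempty_Icc.2 hcd)
    ((continuousOn_rho (p := p)).mono hsub)
  have hz0 := rho_pos (p := p) (hsub hz)
  set D := 2 + (1 + 2 * (2 / (p - 1))) * (1 + (2 / (p - 1))⁻¹ * (1 + (2 / (p - 1))⁻¹)) with hD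
  have hD0 : 0 ≤ D := by have : 0 < p - 1 := by linarith
                         positivity
  refine ⟨√(D * C / rho p z), Real.sqrt_nonneg _, ?_⟩
  filter_upwards [hC, self_mem_nhdsWithin] with σ hσC hσ
  filter_upwards [ae_mono (Measure.restrict_mono_set _ hsub) ((h.mem σ hσ).sq_mul_rho_le hp),
    ae_restrict_mem measurableSet_Icc] with y hy hyI
  refine Real.abs_le_sqrt ?_
  rw [le_div_iff₀ hz0]
  have hm : rho p z ≤ rho p y := hmin hyI
  calc w σ y ^ 2 * rho p z ≤ w σ y ^ 2 * rho p y := mul_le_mul_of_nonneg_left hm (sq_nonneg _)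
    _ ≤ _ := hy
    _ ≤ _ := mul_le_mul_of_nonneg_left hσC hD0

theorem transport (h : IsEnergyPath p J w wy ws) {s : ℝ} (hs : s ∈ J) :
    WeakTransport (-1) 1 J s 0 0 w (ws s) := by
  intro φ hφ
  simpa using h.weakDeriv_s φ hφ s hs

/-- Composition with a function that is Lipschitz on bounded sets. -/
theorem locL2ContOn_comp (hp : 1 < p) (h : IsEnergyPath p J w wy ws) {Ψ : ℝ → ℝ}
    (hΨc : Continuous Ψ) (h0 : Ψ 0 = 0)
    (hΨ : ∀ M, 0 ≤ M → ∃ L, 0 ≤ L ∧ ∀ x z, |x| ≤ M → |z| ≤ M → |Ψ x - Ψ z| ≤ L * |x - z|) :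
    LocL2ContOn (-1) 1 J fun s y => Ψ (w s y) := by
  intro c d hc hd
  have hw := h.locL2ContOn.1 c d hc hd
  have hmeas : ∀ s ∈ J, AEStronglyMeasurable (fun y => Ψ (w s y)) (volume.restrict (Icc c d)) :=
    fun s hs => hΨc.comp_aestronglyMeasurable (hw.memLp s hs).1
  have hbase : ∀ s ∈ J, ∃ L, 0 ≤ L ∧ ∀ᶠ σ in 𝓝[J] s, ∀ᵐ y ∂volume.restrict (Icc c d),
      |Ψ (w σ y) - Ψ (w s y)| ≤ L * |w σ y - w s y| ∧ |Ψ (w s y)| ≤ L * |w s y| := by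
    intro s hs
    obtain ⟨M, hM0, hM⟩ := h.eventually_abs_le hp hs hc hd
    obtain ⟨L, hL0, hL⟩ := hΨ M hM0
    refine ⟨L, hL0, ?_⟩
    filter_upwards [hM] with σ hσ
    filter_upwards [hσ, hM.self_of_nhdsWithin hs] with y h1 h2
    refine ⟨hL _ _ h1 h2, ?_⟩
    simpa [h0] using hL _ 0 h2 (by simpa using hM0)
  have hmem : ∀ s ∈ J, MemLp (fun y => Ψ (w s y)) 2 (volume.restrict (Icc c d)) := by
    intro s hs
    obtain ⟨L, -, hL⟩ := hbase s hs
    refine (hw.memLp s hs).of_le_mul (hmeas s hs) ?_ (c := L)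
    filter_upwards [hL.self_of_nhdsWithin hs] with y hy
    exact hy.2
  refine ⟨hmem, fun s hs => ?_⟩
  obtain ⟨L, hL0, hL⟩ := hbase s hs
  have ht : Tendsto (fun σ => ENNReal.ofReal L * eLpNorm (w σ - w s) 2
      (volume.restrict (Icc c d))) (𝓝[J] s) (𝓝 0) := by
    simpa using ENNReal.Tendsto.const_mul (hw.tendsto s hs) (Or.inr ENNReal.ofReal_ne_top)
  refine tendsto_of_tendsto_of_tendsto_of_le_of_le' tendsto_const_nhds ht
    (Eventually.of_forall fun _ => bot_le) ?_
  filter_upwards [hL] with σ hσ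
  refine eLpNorm_le_mul_eLpNorm_of_ae_le_mul ?_ _
  filter_upwards [hσ] with y hy
  simpa using hy.1

end IsEnergyPath

/-- The nonlinear and the first order forcing terms of the equation in similarity variables. -/
def forcing (N : ℕ) (p r₀ : ℝ) (w wy : ℝ → ℝ → ℝ) (s y : ℝ) : ℝ :=
  |w s y| ^ (p - 1) * w s y + Real.exp (-s) * (((N : ℝ) - 1) / (r₀ + y * Real.exp (-s))) * wy s y

theorem lower_bound_radius {r₀ s₀ s y : ℝ} (hs : s ∈ Ici s₀) (hy : y ∈ Ioo (-1 : ℝ) 1) :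
    r₀ - Real.exp (-s₀) ≤ r₀ + y * Real.exp (-s) := by
  have h1 : Real.exp (-s) ≤ Real.exp (-s₀) := Real.exp_le_exp.2 (by linarith [mem_Ici.1 hs])
  nlinarith [hy.1, Real.exp_pos (-s)]

/-- The condition exp(-s₀) < r₀ keeps r₀ + y exp(-s) away from 0, so the first order coefficient is
bounded and continuous in time uniformly in y. -/
theorem IsEnergyPath.locL2ContOn_forcing (hp : 1 < p) {N : ℕ} {r₀ s₀ : ℝ} {w wy ws : ℝ → ℝ → ℝ}
    (h : IsEnergyPath p (Ici s₀) w wy ws) (hr : Real.exp (-s₀) < r₀) :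
    LocL2ContOn (-1) 1 (Ici s₀) (forcing N p r₀ w wy) := by
  have h1 : LocL2ContOn (-1) 1 (Ici s₀) fun s y => |w s y| ^ (p - 1) * w s y := by
    refine h.locL2ContOn_comp hp (continuous_abs_rpow_mul hp) (by simp) fun M hM =>
      ⟨p * M ^ (p - 1), by have := Real.rpow_nonneg hM (p - 1); positivity,
        fun x z hx hz => abs_rpow_mul_sub_le hp hx hz⟩
  refine h1.add fun c d hc hd => ?_
  have hsub : Icc c d ⊆ Ioo (-1 : ℝ) 1 := fun y hy => ⟨hc.trans_le hy.1, hy.2.trans_lt hd⟩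
  set m := r₀ - Real.exp (-s₀) with hm
  have hm0 : 0 < m := by linarith
  have hr0 : 0 < r₀ := (Real.exp_pos _).trans hr
  have hle : ∀ s ∈ Ici s₀, Real.exp (-s) ≤ r₀ := fun s hs =>
    (Real.exp_le_exp.2 (by linarith [mem_Ici.1 hs])).trans hr.le
  refine (h.locL2ContOn.2.1 c d hc hd).mul_coeff
    (k := fun s y => Real.exp (-s) * (((N : ℝ) - 1) / (r₀ + y * Real.exp (-s))))
    (fun s hs => ?_) (fun s hs => ⟨r₀ * (|(N : ℝ) - 1| / m), ?_⟩) (fun s hs ε hε => ?_)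
  · refine Measurable.aestronglyMeasurable ?_
    fun_prop
  · filter_upwards [self_mem_nhdsWithin] with σ hσ
    filter_upwards [ae_restrict_mem measurableSet_Icc] with y hy
    have := lower_bound_radius (r₀ := r₀) hσ (hsub hy)
    rw [abs_mul, abs_div, abs_of_pos (Real.exp_pos _), abs_of_pos (by linarith : 0 < r₀ + y * _)]
    refine mul_le_mul (hle σ hσ) ?_ (by have := hm0.trans_le this; positivity) hr0.le
    gcongr
  · have hc : Tendsto (fun σ => |(N : ℝ) - 1| * r₀ / m ^ 2 * |Real.exp (-σ) - Real.exp (-s)|)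
        (𝓝[Ici s₀] s) (𝓝 0) := by
      have : Continuous fun σ => |(N : ℝ) - 1| * r₀ / m ^ 2 * |Real.exp (-σ) - Real.exp (-s)| := by
        fun_prop
      simpa using (this.tendsto s).mono_left nhdsWithin_le_nhds
    filter_upwards [hc.eventually (ge_mem_nhds hε), self_mem_nhdsWithin] with σ hσε hσ
    filter_upwards [ae_restrict_mem measurableSet_Icc] with y hy
    refine le_trans ?_ hσε
    have a1 := lower_bound_radius (r₀ := r₀) hσ (hsub hy)
    have a2 := lower_bound_radius (r₀ := r₀) hs (hsub hy)
    have b1 : 0 < r₀ + y * Real.exp (-σ) := by linarith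
    have b2 : 0 < r₀ + y * Real.exp (-s) := by linarith
    have c1 := b1.ne'
    have c2 := b2.ne'
    have e : Real.exp (-σ) * (((N : ℝ) - 1) / (r₀ + y * Real.exp (-σ)))
        - Real.exp (-s) * (((N : ℝ) - 1) / (r₀ + y * Real.exp (-s)))
        = ((N : ℝ) - 1) * r₀ / ((r₀ + y * Real.exp (-σ)) * (r₀ + y * Real.exp (-s)))
          * (Real.exp (-σ) - Real.exp (-s)) := by
      rw [mul_div_assoc', mul_div_assoc', div_sub_div _ _ c1 c2, div_mul_eq_mul_div]
      congr 1
      ring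
    rw [e, abs_mul, abs_div, abs_mul, abs_of_pos hr0, abs_of_pos (mul_pos b1 b2), pow_two]
    gcongr

/-- Solutions of the equation in similarity variables, in characteristic form. -/
structure IsCharacteristicSolution (N : ℕ) (p r₀ s₀ : ℝ) (w wy ws : ℝ → ℝ → ℝ) : Prop where
  path : IsEnergyPath p (Ici s₀) w wy ws
  right : ∀ s ∈ Ici s₀, WeakTransport (-1) 1 (Ici s₀) s 1 1
    (fun s y => ws s y + (y - 1) * wy s y + 2 / (p - 1) * w s y)
    (fun y => forcing N p r₀ w wy s y
      - (2 / (p - 1) + 1) * (ws s y + (y - 1) * wy s y + 2 / (p - 1) * w s y))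
  left : ∀ s ∈ Ici s₀, WeakTransport (-1) 1 (Ici s₀) s (-1) 1
    (fun s y => ws s y + (y + 1) * wy s y + 2 / (p - 1) * w s y)
    (fun y => forcing N p r₀ w wy s y
      - (2 / (p - 1) + 1) * (ws s y + (y + 1) * wy s y + 2 / (p - 1) * w s y))

/-! ### The derivative of the truncated functional -/

/-- The density of the functional `F`. -/
def densityF (p s : ℝ) (f f' g : ℝ → ℝ) (y : ℝ) : ℝ :=
  (1 / 2 * g y ^ 2 + 1 / 2 * f' y ^ 2 * (1 - y ^ 2) + (p + 1) / (p - 1) ^ 2 * f y ^ 2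
    - 1 / (p + 1) * |f y| ^ (p + 1) - Real.exp (-s) * (f y * g y)) * rho p y

/-- The pointwise dissipation of the truncated functional, as a function of the cutoff `χ` and its
slope `μ`, of `e = exp (-s)`, `R = (N - 1) / (r₀ + y e)` and of the state `(W, Y, X)`. -/
def dissipation (p y χ μ e R W Y X : ℝ) : ℝ :=
  rho p y * (χ * (-2 * (2 / (p - 1)) * X ^ 2 / (1 - y ^ 2) + e * R * X * Y
      + e * (-X ^ 2 + (1 - y ^ 2) * Y ^ 2 + 2 / (p - 1) * (2 / (p - 1) + 1) * W ^ 2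
        - |W| ^ (p + 1) + 2 * (2 / (p - 1)) * W * X - 2 * y * X * Y
        + 4 * (2 / (p - 1)) * y ^ 2 * W * X / (1 - y ^ 2) - e * R * W * Y))
    + -y * μ * (y * X ^ 2 - (1 - y ^ 2) * X * Y
      + e * ((1 - y ^ 2) * W * Y - 2 * y * W * X)))

theorem integrable_test_mul_mul_deriv {a b : ℝ} (hab : a < b) {J : Set ℝ} (κ : ℝ)
    {g₁ g₂ G₁ G₂ : ℝ → ℝ → ℝ} (hg₁ : LocL2ContOn a b J g₁)
    (hG₁ : LocL2ContOn a b J G₁) (hg₂ : LocL2ContOn a b J g₂) (hG₂ : LocL2ContOn a b J G₂)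
    {ψ : ℝ → ℝ} (hψ : IsTest a b ψ) {s : ℝ} (hs : s ∈ J) :
    Integrable fun y => (g₁ s y * g₂ s y * (ψ y + (κ + y) * deriv ψ y)
        + ψ y * (G₁ s y * g₂ s y + g₁ s y * G₂ s y)) := by
  have i1 := hg₁.integrable_test_mul_mul hg₂ hab hψ hs
  have i2 := hg₁.integrable_test_mul_mul hg₂ hab
    (hψ.deriv.mul_left (k := fun y => κ + y) (by fun_prop)) hs
  have i3 := hG₁.integrable_test_mul_mul hg₂ hab hψ hs
  have i4 := hg₁.integrable_test_mul_mul hG₂ hab hψ hs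
  refine (((i1.add i2).add i3).add i4).congr (ae_of_all _ fun y => ?_)
  simp only [Pi.add_apply]
  ring

theorem integral_linear_combination {f₁ f₂ f₃ f₄ f₅ : ℝ → ℝ} (i₁ : Integrable f₁)
    (i₂ : Integrable f₂) (i₃ : Integrable f₃) (i₄ : Integrable f₄) (i₅ : Integrable f₅) (c : ℝ) :
    (∫ y, f₁ y) + (∫ y, f₂ y) + (∫ y, f₅ y) - c * ((∫ y, f₃ y) + ∫ y, f₄ y)
      = ∫ y, (f₁ y + f₂ y + f₅ y - c * (f₃ y + f₄ y)) := by
  have h₁ : Integrable fun y => f₁ y + f₂ y := i₁.add i₂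
  have h₂ : Integrable fun y => f₁ y + f₂ y + f₅ y := h₁.add i₅
  have h₃ : Integrable fun y => f₃ y + f₄ y := i₃.add i₄
  rw [integral_sub h₂ (h₃.const_mul c), integral_add h₁ i₅, integral_add i₁ i₂,
    integral_const_mul, integral_add i₃ i₄]

theorem integral_linear_combination_add {f₁ f₂ f₃ f₄ f₅ f₆ f₇ : ℝ → ℝ} (i₁ : Integrable f₁)
    (i₂ : Integrable f₂) (i₃ : Integrable f₃) (i₄ : Integrable f₄) (i₅ : Integrable f₅)
    (i₆ : Integrable f₆) (i₇ : Integrable f₇) (c : ℝ) :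
    (∫ y, f₁ y) + (∫ y, f₂ y) + (∫ y, f₅ y)
        - (-c * ((∫ y, f₆ y) + ∫ y, f₇ y) + c * ((∫ y, f₃ y) + ∫ y, f₄ y))
      = ∫ y, (f₁ y + f₂ y + f₅ y - c * (f₃ y + f₄ y) + c * (f₆ y + f₇ y)) := by
  have h₁ : Integrable fun y => f₁ y + f₂ y + f₅ y - c * (f₃ y + f₄ y) :=
    ((i₁.add i₂).add i₅).sub ((i₃.add i₄).const_mul c)
  have h₂ : Integrable fun y => c * (f₆ y + f₇ y) := (i₆.add i₇).const_mul c
  rw [integral_add h₁ h₂, ← integral_linear_combination i₁ i₂ i₃ i₄ i₅, integral_const_mul,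
    integral_add i₆ i₇]
  ring

theorem isTest_weight {ψ : ℝ → ℝ} (hψ : IsTest (-1) 1 ψ) (c d : ℝ) :
    IsTest (-1) 1 fun y => (c + d * y) * (rho p y * ψ y) :=
  (hψ.mul_left_of_contDiffOn contDiffOn_rho).mul_left (by fun_prop)

theorem deriv_weight_cutoff {n : ℕ} {y : ℝ} (hy : y ∈ Ioo (-1 : ℝ) 1) (c d : ℝ) :
    deriv (fun y => (c + d * y) * (rho p y * cutoff n y)) y
      = d * (rho p y * cutoff n y) + (c + d * y) * (-(2 * (2 / (p - 1)) * y)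
        * (rho p y / (1 - y ^ 2)) * cutoff n y + rho p y * (-y * cutoffSlope n y)) := by
  have h1 : HasDerivAt (fun y : ℝ => c + d * y) d y := by
    simpa using ((hasDerivAt_id y).const_mul d).const_add c
  exact (h1.mul ((hasDerivAt_rho hy).mul hasDerivAt_cutoff)).deriv

theorem abs_rpow_add_one_eq (hp : 1 < p) (W : ℝ) : |W| ^ (p + 1) = |W| ^ (p - 1) * W ^ 2 := by
  rw [← sq_abs W, ← Real.rpow_natCast, ← Real.rpow_add_of_nonneg (abs_nonneg _) (by linarith)
    (by norm_num)]
  norm_num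
  ring_nf

/-- The algebra behind the derivative of the functional. The kinetic and gradient energy is
(1+y)A²/4 + (1-y)B²/4 and the cross term is split as w X = (1+y)wA/2 + (1-y)wB/2, so that in every
product both factors are transported by the same field. `d` is the derivative of an affine weight
times ρ and the cutoff; the last line comes from differentiating exp(-s). -/
theorem dissipation_eq (hp : 1 < p) {y : ℝ} (hy : y ∈ Ioo (-1 : ℝ) 1) (χ μ e R W Y X : ℝ) :
    let q := 1 - y ^ 2
    let α := 2 / (p - 1)
    let r := rho p y
    let f := |W| ^ (p - 1) * W + e * R * Y
    let A := X + (y - 1) * Y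
    let B := X + (y + 1) * Y
    let GA := f - (α + 1) * (A + α * W) + -α * (X + (1 + y) * Y)
    let GB := f - (α + 1) * (B + α * W) + -α * (X + (-1 + y) * Y)
    let d := fun c d : ℝ => d * (r * χ) + (c + d * y) * (-(2 * α * y) * (r / q) * χ + r * (-y * μ))
    dissipation p y χ μ e R W Y X =
      A * A * ((1 / 4 + 1 / 4 * y) * (r * χ) + (1 + y) * d (1 / 4) (1 / 4))
        + (1 / 4 + 1 / 4 * y) * (r * χ) * (GA * A + A * GA)
      + (B * B * ((1 / 4 + -1 / 4 * y) * (r * χ) + (-1 + y) * d (1 / 4) (-1 / 4))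
        + (1 / 4 + -1 / 4 * y) * (r * χ) * (GB * B + B * GB))
      + (1 + 0 * y) * (r * χ) * ((α * (α + 1) * W - |W| ^ (p - 1) * W) * X)
      - e * (W * A * ((1 / 2 + 1 / 2 * y) * (r * χ) + (1 + y) * d (1 / 2) (1 / 2))
        + (1 / 2 + 1 / 2 * y) * (r * χ) * ((X + (1 + y) * Y) * A + W * GA)
        + (W * B * ((1 / 2 + -1 / 2 * y) * (r * χ) + (-1 + y) * d (1 / 2) (-1 / 2))
        + (1 / 2 + -1 / 2 * y) * (r * χ) * ((X + (-1 + y) * Y) * B + W * GB)))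
      + e * ((1 / 2 + 1 / 2 * y) * (r * χ) * (W * A) + (1 / 2 + -1 / 2 * y) * (r * χ) * (W * B)) := by
  have hq := one_sub_sq_pos hy
  have hq' : 1 - y ^ 2 ≠ 0 := hq.ne'
  have hW := abs_rpow_add_one_eq hp W
  intro q α r f A B GA GB d
  simp only [dissipation, hW]
  simp only [d, GA, GB, A, B, f]
  clear_value d GA GB A B f
  clear hW
  generalize |W| ^ (p - 1) = g
  change r * (χ * (-2 * α * X ^ 2 / q + e * R * X * Y
      + e * (-X ^ 2 + q * Y ^ 2 + α * (α + 1) * W ^ 2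
        - g * W ^ 2 + 2 * α * W * X - 2 * y * X * Y
        + 4 * α * y ^ 2 * W * X / q - e * R * W * Y))
    + -y * μ * (y * X ^ 2 - q * X * Y
      + e * (q * W * Y - 2 * y * W * X))) = _
  clear_value α r
  -- After denominators are cleared, even powers of y are expressed through q; the identity is then
  -- polynomial.
  have h1 : y ^ 2 = 1 - q := by simp only [q]; ring
  have hq0 : q ≠ 0 := hq'
  clear_value q
  field_simp
  have h3 : y ^ 3 = y * (1 - q) := by rw [← h1]; ring
  ring_nf
  simp only [h1, h3]
  ring

namespace IsCharacteristicSolution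

variable {N : ℕ} {r₀ s₀ : ℝ} {w wy ws : ℝ → ℝ → ℝ}

/-- The function w can be transported along any affine field since ∂_y w is a function, so α w can
be subtracted from the characteristic unknowns; this leaves the combinations whose squares make up
the energy density. -/
theorem transports (h : IsCharacteristicSolution N p r₀ s₀ w wy ws) (hp : 1 < p)
    (hr : Real.exp (-s₀) < r₀) {s : ℝ} (hs : s ∈ Ici s₀) :
    WeakTransport (-1) 1 (Ici s₀) s 1 1 w (fun y => ws s y + (1 + y) * wy s y) ∧
    WeakTransport (-1) 1 (Ici s₀) s (-1) 1 w (fun y => ws s y + (-1 + y) * wy s y) ∧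
    WeakTransport (-1) 1 (Ici s₀) s 1 1 (fun s y => ws s y + (y - 1) * wy s y)
      (fun y => forcing N p r₀ w wy s y
        - (2 / (p - 1) + 1) * (ws s y + (y - 1) * wy s y + 2 / (p - 1) * w s y)
        + -(2 / (p - 1)) * (ws s y + (1 + y) * wy s y)) ∧
    WeakTransport (-1) 1 (Ici s₀) s (-1) 1 (fun s y => ws s y + (y + 1) * wy s y)
      (fun y => forcing N p r₀ w wy s y
        - (2 / (p - 1) + 1) * (ws s y + (y + 1) * wy s y + 2 / (p - 1) * w s y)
        + -(2 / (p - 1)) * (ws s y + (-1 + y) * wy s y)) := by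
  have hab : (-1 : ℝ) < 1 := by norm_num
  obtain ⟨lw, ly, ls⟩ := h.path.locL2ContOn
  have lf := h.path.locL2ContOn_forcing hp (N := N) hr
  have lyc : ∀ c : ℝ, LocL2ContOn (-1) 1 (Ici s₀) fun s y => ws s y + (y + c) * wy s y := fun c =>
    ls.add (ly.mul_continuousOn (k := fun y => y + c) (by fun_prop))
  have key : ∀ κ : ℝ, WeakTransport (-1) 1 (Ici s₀) s κ 1 w (fun y => ws s y + (κ + y) * wy s y) := by
    intro κ
    have := (h.path.transport hs).change_velocity hab (h.path.mem s hs).weakDeriv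
      (lw.locallyIntegrableOn hs) (ly.locallyIntegrableOn hs) (ls.locallyIntegrableOn hs) κ 1
    simpa using this
  have key2 : ∀ κ c : ℝ, WeakTransport (-1) 1 (Ici s₀) s κ 1
      (fun s y => ws s y + (y + c) * wy s y + 2 / (p - 1) * w s y)
      (fun y => forcing N p r₀ w wy s y
        - (2 / (p - 1) + 1) * (ws s y + (y + c) * wy s y + 2 / (p - 1) * w s y)) →
      WeakTransport (-1) 1 (Ici s₀) s κ 1 (fun s y => ws s y + (y + c) * wy s y)
      (fun y => forcing N p r₀ w wy s y
        - (2 / (p - 1) + 1) * (ws s y + (y + c) * wy s y + 2 / (p - 1) * w s y)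
        + -(2 / (p - 1)) * (ws s y + (κ + y) * wy s y)) := by
    intro κ c hT
    have l1 := (lyc c).add (lw.const_mul (2 / (p - 1)))
    have l2 := lf.add (l1.const_mul (-(2 / (p - 1) + 1)))
    have l3 := lyc κ
    have l2' : LocallyIntegrableOn (fun y => forcing N p r₀ w wy s y
        - (2 / (p - 1) + 1) * (ws s y + (y + c) * wy s y + 2 / (p - 1) * w s y)) (Ioo (-1) 1) := by
      convert! l2.locallyIntegrableOn hs using 2
      ring
    have l3' : LocallyIntegrableOn (fun y => ws s y + (κ + y) * wy s y) (Ioo (-1) 1) := by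
      convert! l3.locallyIntegrableOn hs using 2
      ring
    have := hT.add hab (key κ) (fun σ hσ => l1.locallyIntegrableOn hσ)
      l2' (fun σ hσ => lw.locallyIntegrableOn hσ) l3' hs (-(2 / (p - 1)))
    convert! this using 3
    ring
  refine ⟨key 1, key (-1), ?_, ?_⟩
  · simpa only [sub_eq_add_neg] using key2 1 (-1) (by simpa only [sub_eq_add_neg] using h.right s hs)
  · exact key2 (-1) 1 (h.left s hs)

theorem hasDerivWithinAt_truncated (h : IsCharacteristicSolution N p r₀ s₀ w wy ws) (hp : 1 < p)
    (hr : Real.exp (-s₀) < r₀) (n : ℕ) {s : ℝ} (hs : s ∈ Ici s₀) :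
    IntegrableOn (fun y => dissipation p y (cutoff n y) (cutoffSlope n y) (Real.exp (-s))
      (((N : ℝ) - 1) / (r₀ + y * Real.exp (-s))) (w s y) (wy s y) (ws s y)) (Ioo (-1) 1) ∧
    HasDerivWithinAt
      (fun σ => ∫ y in Ioo (-1) 1, cutoff n y * densityF p σ (w σ) (wy σ) (ws σ) y)
      (∫ y in Ioo (-1) 1, dissipation p y (cutoff n y) (cutoffSlope n y) (Real.exp (-s))
        (((N : ℝ) - 1) / (r₀ + y * Real.exp (-s))) (w s y) (wy s y) (ws s y)) (Ici s₀) s := by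
  have hab : (-1 : ℝ) < 1 := by norm_num
  obtain ⟨lw, ly, ls⟩ := h.path.locL2ContOn
  have lf := h.path.locL2ContOn_forcing hp (N := N) hr
  set α := 2 / (p - 1) with hα
  have hα0 : 0 ≤ α := by have : 0 < p - 1 := by linarith
                         positivity
  have lA : ∀ c : ℝ, LocL2ContOn (-1) 1 (Ici s₀) fun s y => ws s y + (y + c) * wy s y := fun c =>
    ls.add (ly.mul_continuousOn (k := fun y => y + c) (by fun_prop))
  have lV : ∀ c : ℝ, LocL2ContOn (-1) 1 (Ici s₀) fun s y => ws s y + (c + y) * wy s y := fun c =>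
    ls.add (ly.mul_continuousOn (k := fun y => c + y) (by fun_prop))
  have lA' : LocL2ContOn (-1) 1 (Ici s₀) fun s y => ws s y + (y - 1) * wy s y := by
    simpa only [sub_eq_add_neg] using lA (-1)
  have lG : ∀ c κ : ℝ, LocL2ContOn (-1) 1 (Ici s₀) fun s y => forcing N p r₀ w wy s y
        - (α + 1) * (ws s y + (y + c) * wy s y + α * w s y)
        + -α * (ws s y + (κ + y) * wy s y) := by
    intro c κ
    convert! (lf.add (((lA c).add (lw.const_mul α)).const_mul (-(α + 1)))).add
      ((lV κ).const_mul (-α)) using 3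
    ring
  have lG' : LocL2ContOn (-1) 1 (Ici s₀) fun s y => forcing N p r₀ w wy s y
        - (α + 1) * (ws s y + (y - 1) * wy s y + α * w s y)
        + -α * (ws s y + (1 + y) * wy s y) := by
    simpa only [sub_eq_add_neg] using lG (-1) 1
  have T := fun σ (hσ : σ ∈ Ici s₀) => h.transports hp hr hσ
  have t := fun c d : ℝ => isTest_weight (p := p) (isTest_cutoff n) c d
  have cJ : Convex ℝ (Ici s₀) := convex_Ici s₀
  -- `D1` and `D2` differentiate the squares of the two characteristic unknowns, `D3` and `D4` the
  -- cross term along each of the two fields, and `D5` the zeroth order part.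
  have D1 := hasDerivWithinAt_integral_test_mul_mul hab cJ lA' lG' lA' lG'
    (fun σ hσ => (T σ hσ).2.2.1) (fun σ hσ => (T σ hσ).2.2.1) (t (1 / 4) (1 / 4)) hs
  have D2 := hasDerivWithinAt_integral_test_mul_mul hab cJ (lA 1) (lG 1 (-1)) (lA 1) (lG 1 (-1))
    (fun σ hσ => (T σ hσ).2.2.2) (fun σ hσ => (T σ hσ).2.2.2) (t (1 / 4) (-1 / 4)) hs
  have D3 := hasDerivWithinAt_integral_test_mul_mul hab cJ lw (lV 1) lA' lG'
    (fun σ hσ => (T σ hσ).1) (fun σ hσ => (T σ hσ).2.2.1) (t (1 / 2) (1 / 2)) hs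
  have D4 := hasDerivWithinAt_integral_test_mul_mul hab cJ lw (lV (-1)) (lA 1) (lG 1 (-1))
    (fun σ hσ => (T σ hσ).2.1) (fun σ hσ => (T σ hσ).2.2.2) (t (1 / 2) (-1 / 2)) hs
  have i1 := integrable_test_mul_mul_deriv hab 1 lA' lG' lA' lG' (t (1 / 4) (1 / 4)) hs
  have i2 := integrable_test_mul_mul_deriv hab (-1) (lA 1) (lG 1 (-1)) (lA 1) (lG 1 (-1))
    (t (1 / 4) (-1 / 4)) hs
  have i3 := integrable_test_mul_mul_deriv hab 1 lw (lV 1) lA' lG' (t (1 / 2) (1 / 2)) hs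
  have i4 := integrable_test_mul_mul_deriv hab (-1) lw (lV (-1)) (lA 1) (lG 1 (-1))
    (t (1 / 2) (-1 / 2)) hs
  have j1 := fun σ (hσ : σ ∈ Ici s₀) => lA'.integrable_test_mul_mul lA' hab (t (1 / 4) (1 / 4)) hσ
  have j2 := fun σ (hσ : σ ∈ Ici s₀) =>
    (lA 1).integrable_test_mul_mul (lA 1) hab (t (1 / 4) (-1 / 4)) hσ
  have j3 := fun σ (hσ : σ ∈ Ici s₀) => lw.integrable_test_mul_mul lA' hab (t (1 / 2) (1 / 2)) hσ
  have j4 := fun σ (hσ : σ ∈ Ici s₀) =>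
    lw.integrable_test_mul_mul (lA 1) hab (t (1 / 2) (-1 / 2)) hσ
  -- the potential part
  set Φ : ℝ → ℝ := fun x => α * (α + 1) / 2 * x ^ 2 - 1 / (p + 1) * |x| ^ (p + 1) with hΦ
  set Φ' : ℝ → ℝ := fun x => α * (α + 1) * x - |x| ^ (p - 1) * x with hΦ'
  have hp1 : p + 1 ≠ 0 := by linarith
  have hder : ∀ x, HasDerivAt Φ (Φ' x) x := by
    intro x
    have := ((hasDerivAt_pow 2 x).const_mul (α * (α + 1) / 2)).sub
      ((hasDerivAt_abs_rpow_add_one hp x).const_mul (1 / (p + 1)))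
    refine this.congr_deriv ?_
    simp only [hΦ']
    field_simp
    norm_num
    ring
  have hΦc : Continuous Φ := continuous_iff_continuousAt.2 fun x => (hder x).continuousAt
  have hΦc' : Continuous Φ' := by
    have := continuous_abs_rpow_mul hp
    simp only [hΦ']
    fun_prop
  have hLip : ∀ M, 0 ≤ M → ∃ L, 0 ≤ L ∧ ∀ x z, |x| ≤ M → |z| ≤ M → |Φ' x - Φ' z| ≤ L * |x - z| := by
    intro M hM
    refine ⟨α * (α + 1) + p * M ^ (p - 1), by
      have := Real.rpow_nonneg hM (p - 1); positivity, fun x z hx hz => ?_⟩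
    have e : Φ' x - Φ' z = α * (α + 1) * (x - z) - (|x| ^ (p - 1) * x - |z| ^ (p - 1) * z) := by
      simp only [hΦ']; ring
    rw [e, add_mul]
    refine (abs_sub _ _).trans (add_le_add ?_ (abs_rpow_mul_sub_le hp hx hz))
    rw [abs_mul, abs_of_nonneg (by positivity)]
  have lΦ : LocL2ContOn (-1) 1 (Ici s₀) fun s y => Φ' (w s y) :=
    h.path.locL2ContOn_comp hp hΦc' (by simp [hΦ']) hLip
  have D5 := hasDerivWithinAt_integral_test_mul_comp hab cJ lw ls
    (fun σ hσ => h.path.transport hσ) hs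
    (fun c d hc hd => (h.path.eventually_abs_le hp hs hc hd).imp fun _ h => h.2) hΦc hΦc'
    (fun M => by
      rcases lt_or_ge M 0 with hM | hM
      · exact ⟨0, fun x z hx _ => absurd (abs_nonneg x) (by linarith)⟩
      · obtain ⟨L, hL0, hL⟩ := hLip M hM
        exact ⟨L, fun x z hx hz => exists_quadratic_remainder hder hL hL0 hx hz⟩) (t 1 0)
  have i5 := lΦ.integrable_test_mul_mul ls hab (t 1 0) hs
  have j5 : ∀ σ ∈ Ici s₀, Integrable fun y => (1 + 0 * y) * (rho p y * cutoff n y) * Φ (w σ y) := by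
    intro σ hσ
    have a1 := lw.integrable_test_mul_mul lw hab (t 1 0) hσ
    have a2 := lw.integrable_test_mul_mul (h.path.locL2ContOn_comp hp (continuous_abs_rpow_mul hp)
      (by simp) fun M hM => ⟨p * M ^ (p - 1), by have := Real.rpow_nonneg hM (p - 1); positivity,
        fun x z hx hz => abs_rpow_mul_sub_le hp hx hz⟩) hab (t 1 0) hσ
    refine ((a1.const_mul (α * (α + 1) / 2)).sub (a2.const_mul (1 / (p + 1)))).congr
      (ae_of_all _ fun y => ?_)
    simp only [hΦ, Pi.sub_apply, abs_rpow_add_one_eq hp]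
    ring
  have hexp : HasDerivWithinAt (fun σ => Real.exp (-σ)) (-Real.exp (-s)) (Ici s₀) s := by
    simpa using ((hasDerivAt_neg s).exp).hasDerivWithinAt
  have hD := ((D1.add D2).add D5).sub (hexp.mul (D3.add D4))
  -- In terms of α the mass coefficient of E is α(α+1)/2.
  have c0 : (p + 1) / (p - 1) ^ 2 = α * (α + 1) / 2 := by
    have : p - 1 ≠ 0 := by linarith
    rw [hα]; field_simp; ring
  refine ⟨IntegrableOn.congr_fun (((((i1.add i2).add i5).sub ((i3.add i4).const_mul
    (Real.exp (-s)))).add (((j3 s hs).add (j4 s hs)).const_mul (Real.exp (-s)))).integrableOn)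
    (fun y hy => ?_) measurableSet_Ioo, (hD.congr_of_mem (fun σ hσ => ?_) hs).congr_deriv ?_⟩
  · simp only [Pi.add_apply, Pi.sub_apply, deriv_weight_cutoff hy, dissipation_eq hp hy, forcing]
    ring
  · simp only [Pi.add_apply, Pi.sub_apply, Pi.mul_apply]
    refine Eq.trans ?_ (integral_linear_combination (j1 σ hσ) (j2 σ hσ) (j3 σ hσ) (j4 σ hσ)
      (j5 σ hσ) (Real.exp (-σ))).symm
    refine Eq.trans ?_ (setIntegral_eq_integral_of_forall_compl_eq_zero (s := Ioo (-1 : ℝ) 1) ?_)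
    · refine setIntegral_congr_fun measurableSet_Ioo fun y _ => ?_
      simp only [densityF, hΦ, c0]
      ring
    · intro y hy
      simp [(isTest_cutoff n).zero_of_notMem hy]
  · refine Eq.trans ?_ ((integral_linear_combination_add i1 i2 i3 i4 i5 (j3 s hs) (j4 s hs)
      (Real.exp (-s))).trans ?_)
    · simp only [Pi.add_apply]
    rw [← setIntegral_eq_integral_of_forall_compl_eq_zero (s := Ioo (-1 : ℝ) 1)]
    · refine setIntegral_congr_fun measurableSet_Ioo fun y hy => ?_
      simp only [deriv_weight_cutoff hy, dissipation_eq hp hy, forcing]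
      ring
    · intro y hy
      rw [(t (1 / 4) (1 / 4)).deriv_zero_of_notMem hy, (t (1 / 4) (-1 / 4)).deriv_zero_of_notMem hy,
        (t (1 / 2) (1 / 2)).deriv_zero_of_notMem hy, (t (1 / 2) (-1 / 2)).deriv_zero_of_notMem hy,
        (isTest_cutoff n).zero_of_notMem hy]
      ring

end IsCharacteristicSolution

/-! ### Estimates of the dissipation -/

/-- Young's inequality. The weight α/8 allows five applications while using less than the amount α
of dissipation that may be spent. -/
theorem mul_le_weighted_sq {α : ℝ} (hα : 0 < α) (x z : ℝ) :
    x * z ≤ α / 8 * x ^ 2 + 2 / α * z ^ 2 := by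
  have h : α / 8 * x ^ 2 + 2 / α * z ^ 2 - x * z = α / 8 * (x - 4 / α * z) ^ 2 := by
    field_simp
    ring
  have := mul_nonneg (by positivity : 0 ≤ α / 8) (sq_nonneg (x - 4 / α * z))
  linarith

set_option maxHeartbeats 1000000 in
/-- The polynomial inequality behind the upper bound of the dissipation. -/
theorem quadratic_form_le {α γ e δ R a b c m y P : ℝ} (hα : 0 < α) (hm : m ^ 2 = 1 - y ^ 2)
    (he : 0 ≤ e) (he1 : e ≤ 1) (heδ : e ≤ δ) (hR : (e * R) ^ 2 ≤ δ * e) :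
    -2 * α * a ^ 2 + e * R * (a * b) + e * (-(m ^ 2 * a ^ 2) + b ^ 2 + α * (α + 1) * (m ^ 2 * c ^ 2)
        - P + 2 * α * (m ^ 2 * (c * a)) - 2 * y * (a * b) + 4 * α * y ^ 2 * (c * a)
        - e * R * (c * b)) + γ * e ^ 2 * (m ^ 2 * (c * a))
      ≤ -α * a ^ 2 + e * (-(m ^ 2 * a ^ 2) + b ^ 2 + α * (α + 1) * (m ^ 2 * c ^ 2) - P)
        + δ * e * ((10 / α + 1 / 2) * b ^ 2 + (8 * α + 1 / 2 + 2 * γ ^ 2 / α) * (m ^ 2 * c ^ 2)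
          + (32 * α + 1 / 2) * (y ^ 2 * c ^ 2)) := by
  have hy : y ^ 2 ≤ 1 := by nlinarith [sq_nonneg m]
  have hm1 : m ^ 2 ≤ 1 := by nlinarith [sq_nonneg y]
  have hα' : 0 ≤ 2 / α := by positivity
  have hee : e ^ 2 ≤ δ * e := by rw [pow_two]; exact mul_le_mul_of_nonneg_right heδ he
  have he4 : e ^ 4 ≤ δ * e := by
    have : e ^ 2 ≤ 1 := pow_le_one₀ he he1
    calc e ^ 4 = e ^ 2 * e ^ 2 := by ring
      _ ≤ e ^ 2 * 1 := mul_le_mul_of_nonneg_left this (sq_nonneg e)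
      _ ≤ δ * e := by rwa [mul_one]
  have hem : e ^ 2 * m ^ 2 ≤ δ * e := (mul_le_of_le_one_right (sq_nonneg e) hm1).trans hee
  have hey : e ^ 2 * y ^ 2 ≤ δ * e := (mul_le_of_le_one_right (sq_nonneg e) hy).trans hee
  -- The five mixed terms containing `a` are split by Young's inequality; `b1` to `b5` then show
  -- that the squares produced are of size δ e.
  have h1 := mul_le_weighted_sq hα a (e * R * b)
  have h2 := mul_le_weighted_sq hα a (2 * α * e * m ^ 2 * c)
  have h3 := mul_le_weighted_sq hα a (-(2 * e * y * b))
  have h4 := mul_le_weighted_sq hα a (4 * α * e * y ^ 2 * c)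
  have h5 := mul_le_weighted_sq hα a (γ * e ^ 2 * m ^ 2 * c)
  have b1 : 2 / α * (e * R * b) ^ 2 ≤ δ * e * (2 / α * b ^ 2) := by
    have : (e * R * b) ^ 2 ≤ δ * e * b ^ 2 := by
      rw [mul_pow]; exact mul_le_mul_of_nonneg_right hR (sq_nonneg _)
    calc 2 / α * (e * R * b) ^ 2 ≤ 2 / α * (δ * e * b ^ 2) := mul_le_mul_of_nonneg_left this hα'
      _ = _ := by ring
  have b2 : 2 / α * (2 * α * e * m ^ 2 * c) ^ 2 ≤ δ * e * (8 * α * (m ^ 2 * c ^ 2)) := by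
    have e1 : 2 / α * (2 * α * e * m ^ 2 * c) ^ 2 = (8 * α * (m ^ 2 * c ^ 2)) * (e ^ 2 * m ^ 2) := by
      field_simp
      ring
    rw [e1, mul_comm (δ * e)]
    exact mul_le_mul_of_nonneg_left hem (by positivity)
  have b3 : 2 / α * (-(2 * e * y * b)) ^ 2 ≤ δ * e * (8 / α * b ^ 2) := by
    have e1 : 2 / α * (-(2 * e * y * b)) ^ 2 = (8 / α * b ^ 2) * (e ^ 2 * y ^ 2) := by
      ring
    rw [e1, mul_comm (δ * e)]
    exact mul_le_mul_of_nonneg_left hey (by positivity)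
  have b4 : 2 / α * (4 * α * e * y ^ 2 * c) ^ 2 ≤ δ * e * (32 * α * (y ^ 2 * c ^ 2)) := by
    have e1 : 2 / α * (4 * α * e * y ^ 2 * c) ^ 2 = (32 * α * (y ^ 2 * c ^ 2)) * (e ^ 2 * y ^ 2) := by
      field_simp
      ring
    rw [e1, mul_comm (δ * e)]
    exact mul_le_mul_of_nonneg_left hey (by positivity)
  have b5 : 2 / α * (γ * e ^ 2 * m ^ 2 * c) ^ 2 ≤ δ * e * (2 * γ ^ 2 / α * (m ^ 2 * c ^ 2)) := by
    have e1 : 2 / α * (γ * e ^ 2 * m ^ 2 * c) ^ 2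
        = (2 * γ ^ 2 / α * (m ^ 2 * c ^ 2)) * (e ^ 4 * m ^ 2) := by
      ring
    rw [e1, mul_comm (δ * e)]
    exact mul_le_mul_of_nonneg_left
      ((mul_le_of_le_one_right (pow_nonneg he 4) hm1).trans he4) (by positivity)
  -- The remaining mixed term has no factor `a`. Its c² is written as m² c² + y² c²: the first is
  -- part of the energy, the second is the Hardy integrand.
  have b6 : -(e * (e * R * (c * b))) ≤ δ * e * (1 / 2 * b ^ 2 + 1 / 2 * (m ^ 2 * c ^ 2)
      + 1 / 2 * (y ^ 2 * c ^ 2)) := by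
    have e1 : m ^ 2 * c ^ 2 = c ^ 2 - y ^ 2 * c ^ 2 := by rw [hm]; ring
    have e2 := mul_le_mul_of_nonneg_right hR (sq_nonneg b)
    have e3 := mul_le_mul_of_nonneg_right hee (sq_nonneg c)
    have e4 : 0 ≤ (e * R) ^ 2 * b ^ 2 + 2 * (e * (e * R * (c * b))) + e ^ 2 * c ^ 2 := by
      have := sq_nonneg (e * R * b + e * c)
      linarith
    rw [e1]
    linarith
  have ha : 0 ≤ α * a ^ 2 := by positivity
  have ex : δ * e * ((10 / α + 1 / 2) * b ^ 2 + (8 * α + 1 / 2 + 2 * γ ^ 2 / α) * (m ^ 2 * c ^ 2)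
          + (32 * α + 1 / 2) * (y ^ 2 * c ^ 2)) = δ * e * (2 / α * b ^ 2)
          + δ * e * (8 * α * (m ^ 2 * c ^ 2)) + δ * e * (8 / α * b ^ 2)
          + δ * e * (32 * α * (y ^ 2 * c ^ 2)) + δ * e * (2 * γ ^ 2 / α * (m ^ 2 * c ^ 2))
          + δ * e * (1 / 2 * b ^ 2 + 1 / 2 * (m ^ 2 * c ^ 2) + 1 / 2 * (y ^ 2 * c ^ 2)) := by
    ring
  rw [ex]
  linarith

/-- The term -(y a)² has the good sign and absorbs the cross terms containing `a`. Hence the upper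
bound of the truncation error does not involve the time derivative, whose weighted integral is not
yet known to be finite. -/
theorem flux_le {e a b c m y : ℝ} :
    -y * (y * (m ^ 2 * a ^ 2) - m ^ 2 * (a * b) + e * (m ^ 2 * (c * b) - 2 * y * (m ^ 2 * (c * a))))
      ≤ m ^ 2 * (b ^ 2 + 3 * e ^ 2 * (y ^ 2 * c ^ 2)) := by
  have : -y * (y * a ^ 2 - (a * b) + e * ((c * b) - 2 * y * (c * a)))
      ≤ b ^ 2 + 3 * e ^ 2 * (y ^ 2 * c ^ 2) := by
    nlinarith [sq_nonneg (y * a - b), sq_nonneg (y * e * c + b), sq_nonneg (y * a - 2 * (y * e * c)),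
      sq_nonneg (y * e * c)]
  have := mul_le_mul_of_nonneg_left this (sq_nonneg m)
  linarith

/-- The substitution that makes the dissipation a polynomial. -/
theorem dissipation_eq_of_sqrt {y m : ℝ} (hm : 0 < m) (hmq : m ^ 2 = 1 - y ^ 2)
    (χ μ e R W a b c : ℝ) (hW : W = c * m) :
    dissipation p y χ μ e R W (b / m) (a * m) = rho p y * (χ * (-2 * (2 / (p - 1)) * a ^ 2
      + e * R * (a * b) + e * (-(m ^ 2 * a ^ 2) + b ^ 2
        + 2 / (p - 1) * (2 / (p - 1) + 1) * (m ^ 2 * c ^ 2)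
        - |W| ^ (p + 1) + 2 * (2 / (p - 1)) * (m ^ 2 * (c * a)) - 2 * y * (a * b)
        + 4 * (2 / (p - 1)) * y ^ 2 * (c * a) - e * R * (c * b)))
      + μ * (-y * (y * (m ^ 2 * a ^ 2) - m ^ 2 * (a * b)
        + e * (m ^ 2 * (c * b) - 2 * y * (m ^ 2 * (c * a)))))) := by
  unfold dissipation
  generalize |W| ^ (p + 1) = P
  generalize 2 / (p - 1) = α
  rw [← hmq, hW]
  field_simp

/-- With m = √(1-y²) and f = c m, f' = b/m, g = a m, every singular factor disappears and the
polynomial bounds apply. The coefficient (p-1)/4 is γ/2 - 1 for γ = (p+3)/2: it is the gain obtained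
from comparing with γ e F. -/
theorem dissipation_le (hp : 1 < p) {s δ R y χ μ : ℝ} (hy : y ∈ Ioo (-1 : ℝ) 1) (hχ : 0 ≤ χ)
    (hμ : 0 ≤ μ) (he1 : Real.exp (-s) ≤ 1) (heδ : Real.exp (-s) ≤ δ)
    (hR : (Real.exp (-s) * R) ^ 2 ≤ δ * Real.exp (-s)) (f f' g : ℝ → ℝ) :
    dissipation p y χ μ (Real.exp (-s)) R (f y) (f' y) (g y)
      ≤ (p + 3) / 2 * Real.exp (-s) * (χ * densityF p s f f' g y)
        - 2 / (p - 1) * (χ * (g y ^ 2 * (rho p y / (1 - y ^ 2))))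
        - Real.exp (-s) * (((p - 1) / 4 - δ * (10 / (2 / (p - 1)) + 1 / 2))
            * (χ * (f' y ^ 2 * ((1 - y ^ 2) * rho p y)))
          + ((p - 1) / 4 * (2 / (p - 1) * (2 / (p - 1) + 1))
              - δ * (8 * (2 / (p - 1)) + 1 / 2 + 2 * ((p + 3) / 2) ^ 2 / (2 / (p - 1))))
            * (χ * (f y ^ 2 * rho p y))
          - δ * (32 * (2 / (p - 1)) + 1 / 2) * (χ * (f y ^ 2 * (y ^ 2 * (rho p y / (1 - y ^ 2))))))
        + μ * (1 - y ^ 2) * (f' y ^ 2 * ((1 - y ^ 2) * rho p y)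
          + 3 * (f y ^ 2 * (y ^ 2 * (rho p y / (1 - y ^ 2))))) := by
  have hq := one_sub_sq_pos hy
  have hr := rho_pos (p := p) hy
  obtain ⟨m, hm, hmq⟩ : ∃ m : ℝ, 0 < m ∧ m ^ 2 = 1 - y ^ 2 :=
    ⟨√(1 - y ^ 2), Real.sqrt_pos.2 hq, Real.sq_sqrt hq.le⟩
  have hp1 : 0 < p - 1 := by linarith
  have hα : 0 < 2 / (p - 1) := by positivity
  have c0 : (p + 1) / (p - 1) ^ 2 = 2 / (p - 1) * (2 / (p - 1) + 1) / 2 := by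
    field_simp; ring
  set e := Real.exp (-s) with he
  have he0 : 0 < e := Real.exp_pos _
  obtain ⟨a, ha⟩ : ∃ a, g y = a * m := ⟨g y / m, by field_simp⟩
  obtain ⟨b, hb⟩ : ∃ b, f' y = b / m := ⟨f' y * m, by field_simp⟩
  obtain ⟨c, hc⟩ : ∃ c, f y = c * m := ⟨f y / m, by field_simp⟩
  have h1 := quadratic_form_le (α := 2 / (p - 1)) (γ := (p + 3) / 2) (a := a) (b := b)
    (c := c) (P := |f y| ^ (p + 1)) hα hmq he0.le he1 heδ hR
  have h2 : -y * (y * (m ^ 2 * a ^ 2) - m ^ 2 * (a * b)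
      + e * (m ^ 2 * (c * b) - 2 * y * (m ^ 2 * (c * a))))
      ≤ m ^ 2 * (b ^ 2 + 3 * (y ^ 2 * c ^ 2)) := by
    refine flux_le.trans (mul_le_mul_of_nonneg_left ?_ (sq_nonneg m))
    have : e ^ 2 ≤ 1 := by nlinarith
    nlinarith [mul_nonneg (sq_nonneg y) (sq_nonneg c)]
  have hP : 0 ≤ |f y| ^ (p + 1) := Real.rpow_nonneg (abs_nonneg _) _
  rw [ha, hb, dissipation_eq_of_sqrt hm hmq _ _ _ _ _ _ _ _ hc]
  simp only [densityF, ← he]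
  rw [ha, hb, c0, ← hmq]
  -- This is γ ≤ p+1, the condition under which the potential term of γ e F is dominated by the one
  -- that the correction to E produces.
  have hγ : (p + 3) / 2 * (1 / (p + 1)) ≤ 1 := by
    rw [mul_one_div, div_le_one (by linarith)]; linarith
  generalize |f y| ^ (p + 1) = P at *
  rw [hc]
  generalize hγ0 : 1 / (p + 1) = k at *
  have e1 : (a * m) ^ 2 * (rho p y / m ^ 2) = rho p y * a ^ 2 := by field_simp
  have e2 : (b / m) ^ 2 * (m ^ 2 * rho p y) = rho p y * b ^ 2 := by field_simp
  have e3 : (c * m) ^ 2 * (y ^ 2 * (rho p y / m ^ 2)) = rho p y * (y ^ 2 * c ^ 2) := by field_simp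
  have e4 : (b / m) ^ 2 * m ^ 2 = b ^ 2 := by field_simp
  rw [e1, e2, e3, mul_assoc (1 / 2) ((b / m) ^ 2), e4]
  have k1 := mul_le_mul_of_nonneg_left h1 (mul_nonneg hr.le hχ)
  have k2 := mul_le_mul_of_nonneg_left h2 (mul_nonneg hr.le hμ)
  have k3 : 0 ≤ rho p y * χ * (e * P * (1 - (p + 3) / 2 * k)) := by
    have : 0 ≤ 1 - (p + 3) / 2 * k := by linarith
    positivity
  have k4 : 0 ≤ rho p y * χ * (e * (m ^ 2 * a ^ 2) * (1 + (p + 3) / 4)) := by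
    have : 0 ≤ 1 + (p + 3) / 4 := by linarith
    positivity
  generalize 2 / (p - 1) = α at *
  clear_value e
  generalize rho p y = r at *
  generalize 10 / α = k10 at *
  generalize 2 * ((p + 3) / 2) ^ 2 / α = k11 at *
  linarith

/-! ### Differential inequalities for limits of differentiable functions -/

theorem absolutelyContinuousOnInterval_of_dist_le {f g : ℝ → ℝ} {a b : ℝ}
    (hg : AbsolutelyContinuousOnInterval g a b)
    (h : ∀ x ∈ uIcc a b, ∀ y ∈ uIcc a b, dist (f x) (f y) ≤ dist (g x) (g y)) :
    AbsolutelyContinuousOnInterval f a b := by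
  refine squeeze_zero' (Eventually.of_forall fun E => Finset.sum_nonneg fun i _ => dist_nonneg)
    ?_ hg
  filter_upwards [mem_inf_of_right (mem_principal_self _)] with E hE
  exact Finset.sum_le_sum fun i hi => h _ (hE.1 i hi).1 _ (hE.1 i hi).2

/-- A sequence of integrable functions, increasing and with bounded integrals, is dominated by an
integrable function. -/
theorem exists_integrable_dominating {μ : Measure ℝ} {D : ℕ → ℝ → ℝ} {C : ℝ}
    (hi : ∀ n, Integrable (D n) μ) (h0 : ∀ n, ∀ᵐ s ∂μ, 0 ≤ D n s)
    (hmono : ∀ᵐ s ∂μ, Monotone fun n => D n s) (hC : ∀ n, ∫ s, D n s ∂μ ≤ C) :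
    ∃ θ : ℝ → ℝ, Integrable θ μ ∧ (∀ᵐ s ∂μ, ∀ n, D n s ≤ θ s) := by
  have hm : AEMeasurable (fun s => ⨆ n, ENNReal.ofReal (D n s)) μ :=
    AEMeasurable.iSup fun n => (hi n).1.aemeasurable.ennreal_ofReal
  have hfin : ∫⁻ s, ⨆ n, ENNReal.ofReal (D n s) ∂μ ≠ ⊤ := by
    rw [lintegral_iSup' (fun n => (hi n).1.aemeasurable.ennreal_ofReal)
      (hmono.mono fun s h n m hnm => ENNReal.ofReal_le_ofReal (h hnm))]
    refine ne_top_of_le_ne_top ENNReal.ofReal_ne_top (iSup_le fun n => ?_) (b := ENNReal.ofReal C)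
    rw [← ofReal_integral_eq_lintegral_ofReal (hi n) (h0 n)]
    exact ENNReal.ofReal_le_ofReal (hC n)
  refine ⟨_, integrable_toReal_of_lintegral_ne_top hm hfin, ?_⟩
  filter_upwards [ae_lt_top' hm hfin] with s hs n
  exact (ENNReal.ofReal_le_iff_le_toReal hs.ne).1 (le_iSup (fun n => ENNReal.ofReal (D n s)) n)

/-- Functions `F n`, with limit `F∞`, whose derivatives `P n` satisfy a dissipation inequality. -/
structure DissipativeLimit (s₀ α : ℝ) (k : ℝ → ℝ) (F P D err : ℕ → ℝ → ℝ) (Flim : ℝ → ℝ) :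
    Prop where
  hasDeriv : ∀ n, ∀ s ∈ Ici s₀, HasDerivWithinAt (F n) (P n s) (Ici s₀) s
  le : ∀ n, ∀ s ∈ Ici s₀, P n s ≤ k s * F n s - α * D n s + err n s
  bound : ∀ a b, s₀ ≤ a → ∃ B, ∀ s ∈ Icc a b, ∀ n, |F n s| ≤ B ∧ 0 ≤ err n s ∧ err n s ≤ B ∧
    -(B * (D (2 * n) s + 1)) ≤ P n s
  cont_k : Continuous k
  cont_D : ∀ n, ContinuousOn (D n) (Ici s₀)
  cont_err : ∀ n, ContinuousOn (err n) (Ici s₀)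
  nonneg : ∀ n, ∀ s ∈ Ici s₀, 0 ≤ D n s
  mono : ∀ s ∈ Ici s₀, Monotone fun n => D n s
  tendsto_err : ∀ s ∈ Ici s₀, Tendsto (fun n => err n s) atTop (𝓝 0)
  tendsto : ∀ s ∈ Ici s₀, Tendsto (fun n => F n s) atTop (𝓝 (Flim s))

namespace DissipativeLimit

variable {s₀ α : ℝ} {k Flim : ℝ → ℝ} {F P D err : ℕ → ℝ → ℝ}

theorem continuousOn (h : DissipativeLimit s₀ α k F P D err Flim) (n : ℕ) :
    ContinuousOn (F n) (Ici s₀) := fun s hs => (h.hasDeriv n s hs).continuousWithinAt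

theorem hasDeriv_right (h : DissipativeLimit s₀ α k F P D err Flim) (n : ℕ) {s : ℝ}
    (hs : s₀ ≤ s) : HasDerivWithinAt (F n) (P n s) (Ioi s) s :=
  (h.hasDeriv n s hs).mono fun _ hx => hs.trans (le_of_lt hx)

/-- Monotonicity replaces `D n` by `D m` with `m` fixed, so that the limit in `n` can be taken while
the dissipation stays continuous in time. -/
theorem sub_le (h : DissipativeLimit s₀ α k F P D err Flim) (hα : 0 ≤ α) {m n : ℕ} (hmn : m ≤ n)
    {a b : ℝ} (ha : s₀ ≤ a) (hab : a ≤ b) :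
    F n b - F n a ≤ ∫ s in a..b, (k s * F n s - α * D m s + err n s) := by
  have hsub : Icc a b ⊆ Ici s₀ := fun x hx => ha.trans hx.1
  refine intervalIntegral.sub_le_integral_of_hasDeriv_right_of_le hab
    ((h.continuousOn n).mono hsub) (fun x hx => h.hasDeriv_right n (ha.trans hx.1.le)) ?_
    fun x hx => ?_
  · exact ((((h.cont_k.continuousOn.mul (h.continuousOn n)).sub
      (continuousOn_const.mul (h.cont_D m))).add (h.cont_err n)).mono hsub).integrableOn_Icc
  · have hx0 : x ∈ Ici s₀ := ha.trans hx.1.le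
    have h1 := h.le n x hx0
    have h2 := mul_le_mul_of_nonneg_left (h.mono x hx0 hmn) hα
    simp only at h2
    linarith

theorem limit_sub_le (h : DissipativeLimit s₀ α k F P D err Flim) (hα : 0 ≤ α) (m : ℕ)
    {a b : ℝ} (ha : s₀ ≤ a) (hab : a ≤ b) :
    Flim b - Flim a ≤ ∫ s in a..b, (k s * Flim s - α * D m s) := by
  have hsub : Icc a b ⊆ Ici s₀ := fun x hx => ha.trans hx.1
  obtain ⟨B, hB⟩ := h.bound a b ha
  have hIoc : uIoc a b ⊆ Icc a b := by rw [uIoc_of_le hab]; exact Ioc_subset_Icc_self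
  have hint : Tendsto (fun n => ∫ s in a..b, (k s * F n s - α * D m s + err n s)) atTop
      (𝓝 (∫ s in a..b, (k s * Flim s - α * D m s + 0))) := by
    refine intervalIntegral.tendsto_integral_filter_of_dominated_convergence
      (fun s => |k s| * B + |α * D m s| + B) (Eventually.of_forall fun n => ?_)
      (Eventually.of_forall fun n => ae_of_all _ fun s hs => ?_) ?_ (ae_of_all _ fun s hs => ?_)
    · exact ((((h.cont_k.continuousOn.mul (h.continuousOn n)).sub (continuousOn_const.mul
        (h.cont_D m))).add (h.cont_err n)).mono (hIoc.trans hsub)).aestronglyMeasurable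
        measurableSet_uIoc
    · have hb := hB s (hIoc hs) n
      rw [Real.norm_eq_abs]
      refine (abs_add_le _ _).trans (add_le_add ((abs_sub _ _).trans (add_le_add ?_ le_rfl)) ?_)
      · rw [abs_mul]
        exact mul_le_mul_of_nonneg_left hb.1 (abs_nonneg _)
      · rw [abs_of_nonneg hb.2.1]
        exact hb.2.2.1
    · refine ContinuousOn.intervalIntegrable ?_
      rw [uIcc_of_le hab]
      exact (((h.cont_k.continuousOn.abs.mul continuousOn_const).add
        ((continuousOn_const.mul (h.cont_D m)).abs)).add continuousOn_const).mono hsub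
    · have hs' := hsub (hIoc hs)
      exact (((h.tendsto s hs').const_mul _).sub_const _).add (h.tendsto_err s hs')
  simp only [add_zero] at hint
  refine le_of_tendsto_of_tendsto ((h.tendsto b (ha.trans hab)).sub (h.tendsto a ha)) hint ?_
  filter_upwards [eventually_ge_atTop m] with n hn
  exact h.sub_le hα hn ha hab

/-- Integrating the upper bound of the derivatives bounds the time integrals of all the `D n`; being
increasing in `n`, they lie under one integrable function. The lower bound through `D (2 * n)` then
controls the increments of every `F n` by the same integral, and this passes to the limit. -/
theorem absolutelyContinuous (h : DissipativeLimit s₀ α k F P D err Flim) (hα : 0 < α)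
    {a b : ℝ} (ha : s₀ ≤ a) (hab : a ≤ b) : AbsolutelyContinuousOnInterval Flim a b := by
  have hsub : Icc a b ⊆ Ici s₀ := fun x hx => ha.trans hx.1
  obtain ⟨B, hB⟩ := h.bound a b ha
  have hB0 : 0 ≤ B := (abs_nonneg _).trans (hB a (left_mem_Icc.2 hab) 0).1
  obtain ⟨K, hK⟩ := isCompact_Icc.exists_bound_of_continuousOn (s := Icc a b) h.cont_k.continuousOn
  have hK0 : 0 ≤ K := (norm_nonneg _).trans (hK a (left_mem_Icc.2 hab))
  have hPle : ∀ n, ∀ s ∈ Icc a b, P n s ≤ (K + 1) * B - α * D n s := by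
    intro n s hs
    have h1 := h.le n s (hsub hs)
    have hb := hB s hs n
    have h2 : k s * F n s ≤ K * B := (le_abs_self _).trans (by
      rw [abs_mul]; exact mul_le_mul (hK s hs) hb.1 (abs_nonneg _) hK0)
    linarith [hb.2.2.1]
  have hDi : ∀ n, IntegrableOn (D n) (Icc a b) := fun n =>
    ((h.cont_D n).mono hsub).integrableOn_Icc
  -- `F n` is bounded by `B` at both ends, so the dissipation spent over the interval is at most 2B
  -- plus the integral of the remaining terms of the upper bound.
  have hDC : ∀ n, ∫ s in Icc a b, D n s ≤ (2 * B + (b - a) * ((K + 1) * B)) / α := by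
    intro n
    have h1 := intervalIntegral.integral_le_sub_of_hasDeriv_right_of_le hab
      (((h.continuousOn n).neg).mono hsub)
      (fun x hx => (h.hasDeriv_right n (ha.trans hx.1.le)).neg)
      (((hDi n).const_mul α).sub (integrableOn_const (by simp) (C := (K + 1) * B)))
      fun x hx => by
        have := hPle n x (Ioo_subset_Icc_self hx)
        simp only [Pi.sub_apply]
        linarith
    rw [le_div_iff₀ hα]
    have h2 : ∫ s in a..b, ((fun x : ℝ => α * D n x) - fun _ : ℝ => (K + 1) * B) s
        = α * (∫ s in Icc a b, D n s) - (b - a) * ((K + 1) * B) := by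
      have i1 : IntervalIntegrable (fun x => α * D n x) volume a b :=
        (intervalIntegrable_iff_integrableOn_Icc_of_le hab).2 ((hDi n).const_mul α)
      simp only [Pi.sub_apply]
      rw [intervalIntegral.integral_sub i1 intervalIntegrable_const, intervalIntegral.integral_const,
        intervalIntegral.integral_const_mul, intervalIntegral.integral_of_le hab,
        ← integral_Icc_eq_integral_Ioc, smul_eq_mul]
    rw [h2] at h1
    have h3 := abs_le.1 (hB a (left_mem_Icc.2 hab) n).1
    have h4 := abs_le.1 (hB b (right_mem_Icc.2 hab) n).1
    simp only [Pi.neg_apply] at h1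
    linarith
  obtain ⟨θ, hθ, hDθ⟩ := exists_integrable_dominating (μ := volume.restrict (Icc a b)) hDi
    (fun n => (ae_restrict_mem measurableSet_Icc).mono fun s hs => h.nonneg n s (hsub hs))
    ((ae_restrict_mem measurableSet_Icc).mono fun s hs => h.mono s (hsub hs)) hDC
  -- The first summand dominates the lower bound of the derivatives, the second the upper bound.
  set Θ : ℝ → ℝ := fun s => B * (θ s + 1) + (K + 1) * B with hΘ
  have hΘi : IntegrableOn Θ (Icc a b) := by
    have : IntegrableOn (fun _ : ℝ => (1 : ℝ)) (Icc a b) := integrableOn_const (by simp)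
    exact ((hθ.add this).const_mul B).add (integrableOn_const (by simp) (C := (K + 1) * B))
  have hθ0 : ∀ᵐ s ∂volume.restrict (Icc a b), 0 ≤ θ s := by
    filter_upwards [hDθ, ae_restrict_mem measurableSet_Icc] with s hs hsI
    exact (h.nonneg 0 s (hsub hsI)).trans (hs 0)
  have hII : ∀ {G : ℝ → ℝ}, IntegrableOn G (Icc a b) → ∀ x ∈ Icc a b, ∀ y ∈ Icc a b, x ≤ y →
      IntervalIntegrable G volume x y := fun hG x hx y hy hxy =>
    (intervalIntegrable_iff_integrableOn_Icc_of_le hxy).2 (hG.mono_set (Icc_subset_Icc hx.1 hy.2))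
  have key : ∀ x ∈ Icc a b, ∀ y ∈ Icc a b, x ≤ y → |Flim y - Flim x| ≤ ∫ s in x..y, Θ s := by
    intro x hx y hy hxy
    have hsub' : Icc x y ⊆ Icc a b := Icc_subset_Icc hx.1 hy.2
    refine le_of_tendsto (((h.tendsto y (hsub hy)).sub (h.tendsto x (hsub hx))).abs)
      (Eventually.of_forall fun n => abs_le.2 ⟨?_, ?_⟩)
    · have h1 := intervalIntegral.integral_le_sub_of_hasDeriv_right_of_le hxy
        ((h.continuousOn n).mono (hsub'.trans hsub))
        (fun z hz => h.hasDeriv_right n (hsub (hsub' (Ioo_subset_Icc_self hz))))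
        (φ := fun s => -(B * (D (2 * n) s + 1))) (by
          refine ContinuousOn.integrableOn_Icc (ContinuousOn.neg (continuousOn_const.mul
            (((h.cont_D _).mono (hsub'.trans hsub)).add continuousOn_const))))
        fun z hz => (hB z (hsub' (Ioo_subset_Icc_self hz)) n).2.2.2
      refine le_trans ?_ h1
      rw [intervalIntegral.integral_neg, neg_le_neg_iff]
      refine intervalIntegral.integral_mono_ae_restrict hxy ?_ (hII hΘi x hx y hy hxy) ?_
      · refine ContinuousOn.intervalIntegrable ?_
        rw [uIcc_of_le hxy]
        exact continuousOn_const.mul (((h.cont_D _).mono (hsub'.trans hsub)).add continuousOn_const)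
      · filter_upwards [ae_mono (Measure.restrict_mono_set _ hsub') hDθ] with s hs
        simp only [hΘ]
        have : 0 ≤ (K + 1) * B := by positivity
        nlinarith [mul_le_mul_of_nonneg_left (hs (2 * n)) hB0]
    · have h1 := intervalIntegral.sub_le_integral_of_hasDeriv_right_of_le hxy
        ((h.continuousOn n).mono (hsub'.trans hsub))
        (fun z hz => h.hasDeriv_right n (hsub (hsub' (Ioo_subset_Icc_self hz))))
        (φ := fun s => (K + 1) * B) (integrableOn_const (by simp))
        fun z hz => by
          have hz' := hsub' (Ioo_subset_Icc_self hz)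
          have := hPle n z hz'
          have := mul_nonneg hα.le (h.nonneg n z (hsub hz'))
          linarith
      refine h1.trans ?_
      refine intervalIntegral.integral_mono_ae_restrict hxy intervalIntegrable_const
        (hII hΘi x hx y hy hxy) ?_
      filter_upwards [ae_mono (Measure.restrict_mono_set _ hsub') hθ0] with s hs
      simp only [hΘ]
      have : 0 ≤ B * (θ s + 1) := mul_nonneg hB0 (by linarith)
      linarith
  have hΘab : IntervalIntegrable Θ volume a b :=
    (intervalIntegrable_iff_integrableOn_Icc_of_le hab).2 hΘi
  refine absolutelyContinuousOnInterval_of_dist_le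
    (hΘab.absolutelyContinuousOnInterval_intervalIntegral (c := a) (left_mem_uIcc)) ?_
  rw [uIcc_of_le hab]
  have key' : ∀ x ∈ Icc a b, ∀ y ∈ Icc a b, x ≤ y →
      dist (Flim x) (Flim y) ≤ dist (∫ v in a..x, Θ v) (∫ v in a..y, Θ v) := by
    intro x hx y hy hxy
    rw [dist_comm, dist_comm (∫ v in a..x, Θ v), Real.dist_eq, Real.dist_eq,
      intervalIntegral.integral_interval_sub_left (hII hΘi a (left_mem_Icc.2 hab) y hy hy.1)
        (hII hΘi a (left_mem_Icc.2 hab) x hx hx.1)]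
    exact (key x hx y hy hxy).trans (le_abs_self _)
  intro x hx y hy
  rcases le_total x y with hxy | hxy
  · exact key' x hx y hy hxy
  · rw [dist_comm, dist_comm (∫ v in a..x, Θ v)]
    exact key' y hy x hx hxy

theorem continuousOn_limit (h : DissipativeLimit s₀ α k F P D err Flim) (hα : 0 < α) (b : ℝ) :
    ContinuousOn Flim (Icc s₀ b) := by
  rcases le_total s₀ b with hb | hb
  · simpa [uIcc_of_le hb] using (h.absolutelyContinuous hα le_rfl hb).continuousOn
  · exact ((subsingleton_Icc_of_ge hb).continuousOn _)

theorem continuousOn_Ici (h : DissipativeLimit s₀ α k F P D err Flim) (hα : 0 < α) :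
    ContinuousOn Flim (Ici s₀) := by
  intro s hs
  refine (h.continuousOn_limit hα (s + 1) s ⟨hs, by linarith⟩).mono_of_mem_nhdsWithin ?_
  rw [← Ici_inter_Iic]
  exact inter_mem self_mem_nhdsWithin (mem_nhdsWithin_of_mem_nhds (Iic_mem_nhds (by linarith)))

theorem hasDerivWithinAt_integral (h : DissipativeLimit s₀ α k F P D err Flim) (hα : 0 < α)
    (m : ℕ) {s : ℝ} (hs : s ∈ Ici s₀) :
    HasDerivWithinAt (fun x => ∫ t in s..x, (k t * Flim t - α * D m t))
      (k s * Flim s - α * D m s) (Ici s) s := by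
  have hc : ContinuousOn (fun t => k t * Flim t - α * D m t) (Ici s) :=
    ((h.cont_k.continuousOn.mul (h.continuousOn_Ici hα)).sub
      (continuousOn_const.mul (h.cont_D m))).mono (Ici_subset_Ici.2 hs)
  have hc' := hc.mono Ioi_subset_Ici_self
  exact intervalIntegral.integral_hasDerivWithinAt_right (t := Ioi s) (by simp)
    (hc'.stronglyMeasurableAtFilter_nhdsWithin measurableSet_Ioi s)
    ((hc s self_mem_Ici).mono Ioi_subset_Ici_self)

/-- The integrand with a fixed truncation is continuous, so the integrated inequality can be
differentiated from the right at every point, not merely almost every point. The truncation is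
removed afterwards. -/
theorem derivWithin_le (h : DissipativeLimit s₀ α k F P D err Flim) (hα : 0 < α) (m : ℕ) {s F' : ℝ}
    (hs : s ∈ Ici s₀) (hF : HasDerivWithinAt Flim F' (Ici s) s) :
    F' ≤ k s * Flim s - α * D m s := by
  have h1 := (h.hasDerivWithinAt_integral hα m hs).sub hF
  have h2 : ∀ x ∈ Ici s, Flim x - Flim s ≤ ∫ t in s..x, (k t * Flim t - α * D m t) :=
    fun x hx => h.limit_sub_le hα.le m hs hx
  have h3 := (hasDerivWithinAt_iff_tendsto_slope' (self_notMem_Ioi)).1 (h1.mono Ioi_subset_Ici_self)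
  have : 0 ≤ k s * Flim s - α * D m s - F' := by
    refine ge_of_tendsto h3 ?_
    filter_upwards [self_mem_nhdsWithin] with x hx
    rw [slope_def_field]
    have := h2 x (mem_Ioi.1 hx).le
    refine div_nonneg ?_ (sub_nonneg.2 (le_of_lt hx))
    simp only [Pi.sub_apply, intervalIntegral.integral_same]
    linarith
  linarith

/-- `E` is the integrating factor for the rate `k`. Near x the function `Flim` lies below the
primitive started at `Flim x`, whose product with `E` has right derivative -α D₀ E ≤ 0, so a
comparison principle for right slopes applies. -/
theorem antitoneOn (h : DissipativeLimit s₀ α k F P D err Flim) (hα : 0 < α) {E : ℝ → ℝ}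
    (hE : ∀ s, HasDerivAt E (-k s * E s) s) (hE0 : ∀ s, 0 < E s) :
    AntitoneOn (fun s => Flim s * E s) (Ici s₀) := by
  intro a ha b hb hab
  have hEc : Continuous E := continuous_iff_continuousAt.2 fun s => (hE s).continuousAt
  refine image_le_of_liminf_slope_right_le_deriv_boundary (f := fun s => Flim s * E s)
    (a := a) (b := b) (B := fun _ => Flim a * E a) (B' := fun _ => 0)
    (((h.continuousOn_Ici hα).mono fun x hx => (mem_Ici.1 ha).trans hx.1).mul hEc.continuousOn)
    le_rfl continuousOn_const
    (fun x _ => hasDerivWithinAt_const _ _ _) (fun x hx r hr => ?_) (right_mem_Icc.2 hab)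
  have hx0 : x ∈ Ici s₀ := (mem_Ici.1 ha).trans hx.1
  set U : ℝ → ℝ := fun z => (Flim x + ∫ t in x..z, (k t * Flim t - α * D 0 t)) * E z with hU
  have hd := (((h.hasDerivWithinAt_integral hα 0 hx0).const_add (Flim x)).mul
    (hE x).hasDerivWithinAt).mono Ioi_subset_Ici_self
  have hs := (hasDerivWithinAt_iff_tendsto_slope' (self_notMem_Ioi)).1 hd
  have hval : (k x * Flim x - α * D 0 x) * E x
      + (Flim x + ∫ t in x..x, (k t * Flim t - α * D 0 t)) * (-k x * E x) < r := by
    rw [intervalIntegral.integral_same]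
    have := mul_nonneg (mul_nonneg hα.le (h.nonneg 0 x hx0)) (hE0 x).le
    linarith
  refine Eventually.frequently ?_
  filter_upwards [hs.eventually (gt_mem_nhds hval), self_mem_nhdsWithin] with z hz hzx
  refine lt_of_le_of_lt ?_ hz
  rw [slope_def_field, slope_def_field]
  have h2 := h.limit_sub_le hα.le 0 hx0 (le_of_lt hzx)
  refine div_le_div_of_nonneg_right ?_ (sub_nonneg.2 (le_of_lt hzx))
  simp only [Pi.mul_apply, intervalIntegral.integral_same, add_zero]
  have := mul_le_mul_of_nonneg_right h2 (hE0 z).le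
  linarith

end DissipativeLimit

/-! ### The dissipation inequality -/

/-- Only some constant is needed: the bound serves to control the decrease of the truncated
functional by an integrable function of time. -/
theorem quadratic_form_ge {α e δ R a b c m y P : ℝ} (hα : 0 ≤ α) (hm : m ^ 2 = 1 - y ^ 2)
    (he : 0 ≤ e) (he1 : e ≤ 1) (hR : |e * R| ≤ δ) (hP : 0 ≤ P) :
    -((5 * α + 3 + δ ^ 2) * (a ^ 2 + b ^ 2 + c ^ 2 + P))
      ≤ -2 * α * a ^ 2 + e * R * (a * b) + e * (-(m ^ 2 * a ^ 2) + b ^ 2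
        + α * (α + 1) * (m ^ 2 * c ^ 2)
        - P + 2 * α * (m ^ 2 * (c * a)) - 2 * y * (a * b) + 4 * α * y ^ 2 * (c * a)
        - e * R * (c * b)) := by
  have hy : y ^ 2 ≤ 1 := by linarith [sq_nonneg m]
  have hm1 : m ^ 2 ≤ 1 := by linarith [sq_nonneg y]
  have hya : |y| ≤ 1 := by rwa [← sq_le_one_iff_abs_le_one]
  have hδ : 0 ≤ δ := (abs_nonneg _).trans hR
  have two : ∀ x z : ℝ, |x * z| ≤ 1 / 2 * (x ^ 2 + z ^ 2) := fun x z => by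
    rw [abs_le]; constructor <;> nlinarith [sq_nonneg (x + z), sq_nonneg (x - z)]
  have hab := two a b
  have hca := two c a
  have hR2 : (e * R) ^ 2 ≤ δ ^ 2 := by rw [← sq_abs (e * R)]; gcongr
  have t1 : ∀ x : ℝ, |e * R * (x * b)| ≤ 1 / 2 * (x ^ 2 + δ ^ 2 * b ^ 2) := fun x => by
    have := two x (e * R * b)
    rw [show x * (e * R * b) = e * R * (x * b) by ring, mul_pow (e * R)] at this
    have := mul_le_mul_of_nonneg_right hR2 (sq_nonneg b)
    linarith
  have t2 : |m ^ 2 * (c * a)| ≤ 1 / 2 * (c ^ 2 + a ^ 2) := by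
    rw [abs_mul, abs_of_nonneg (sq_nonneg m)]
    exact (mul_le_of_le_one_left (abs_nonneg _) hm1).trans hca
  have t3 : |y ^ 2 * (c * a)| ≤ 1 / 2 * (c ^ 2 + a ^ 2) := by
    rw [abs_mul, abs_of_nonneg (sq_nonneg y)]
    exact (mul_le_of_le_one_left (abs_nonneg _) hy).trans hca
  have t4 : |y * (a * b)| ≤ 1 / 2 * (a ^ 2 + b ^ 2) := by
    rw [abs_mul]
    exact (mul_le_of_le_one_left (abs_nonneg _) hya).trans hab
  have t5 : m ^ 2 * a ^ 2 ≤ a ^ 2 := mul_le_of_le_one_left (sq_nonneg _) hm1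
  have z1 : -(a ^ 2 + P + α * (c ^ 2 + a ^ 2) + (a ^ 2 + b ^ 2) + 2 * α * (c ^ 2 + a ^ 2)
      + 1 / 2 * (c ^ 2 + δ ^ 2 * b ^ 2)) ≤ -(m ^ 2 * a ^ 2) + b ^ 2
        + α * (α + 1) * (m ^ 2 * c ^ 2)
        - P + 2 * α * (m ^ 2 * (c * a)) - 2 * y * (a * b) + 4 * α * y ^ 2 * (c * a)
        - e * R * (c * b) := by
    have u1 := mul_le_mul_of_nonneg_left (abs_le.1 t2).1 hα
    have u2 := mul_le_mul_of_nonneg_left (abs_le.1 t3).1 hα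
    have u3 := (abs_le.1 t4).2
    have u4 := (abs_le.1 (t1 c)).2
    have u5 : 0 ≤ α * (α + 1) * (m ^ 2 * c ^ 2) := by positivity
    linarith [sq_nonneg b]
  have z2 : ∀ z K : ℝ, 0 ≤ K → -K ≤ z → -K ≤ e * z := fun z K hK hz => by
    have := mul_le_mul_of_nonneg_left hz he
    have := mul_le_of_le_one_left hK he1
    linarith
  have z3 := z2 _ _ (by positivity) z1
  have z4 := (abs_le.1 (t1 a)).1
  have p1 : 0 ≤ δ ^ 2 * a ^ 2 := by positivity
  have p2 : 0 ≤ δ ^ 2 * c ^ 2 := by positivity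
  have p3 : 0 ≤ δ ^ 2 * P := by positivity
  have p4 : 0 ≤ α * P := by positivity
  have p5 : 0 ≤ α * b ^ 2 := by positivity
  have p6 : 0 ≤ α * c ^ 2 := by positivity
  linarith [sq_nonneg a, sq_nonneg b, sq_nonneg c]

/-- From below the term -(y a)² has the bad sign and must be paid for by a². -/
theorem flux_ge {e a b c m y : ℝ} (hm : m ^ 2 = 1 - y ^ 2) (he : 0 ≤ e) (he1 : e ≤ 1) :
    -(3 * (m ^ 2 * (a ^ 2 + b ^ 2 + c ^ 2)))
      ≤ -y * (y * (m ^ 2 * a ^ 2) - m ^ 2 * (a * b)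
        + e * (m ^ 2 * (c * b) - 2 * y * (m ^ 2 * (c * a)))) := by
  have hy : y ^ 2 ≤ 1 := by linarith [sq_nonneg m]
  have he2 : e ^ 2 ≤ 1 := pow_le_one₀ he he1
  have hye : (y * e) ^ 2 ≤ 1 := by
    rw [mul_pow]; exact mul_le_one₀ hy (sq_nonneg e) he2
  have h1 := mul_le_mul_of_nonneg_right hy (sq_nonneg a)
  have h2 := mul_le_mul_of_nonneg_right hy (sq_nonneg b)
  have h3 := mul_le_mul_of_nonneg_right hye (sq_nonneg c)
  have key : -(3 * (a ^ 2 + b ^ 2 + c ^ 2))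
      ≤ -y * (y * a ^ 2 - a * b + e * (c * b - 2 * y * (c * a))) := by
    nlinarith [sq_nonneg (y * a + b), sq_nonneg (y * e * c - b), sq_nonneg (y * a + y * e * c)]
  have := mul_le_mul_of_nonneg_left key (sq_nonneg m)
  linarith

/-- The cutoff slope extends beyond where χ equals 1, so the cost in X² is charged to a wider cutoff
χ', later the one of index 2n. The other terms are integrable without any cutoff. -/
theorem dissipation_ge (hp : 1 < p) {e δ R y χ χ' μ M : ℝ} (hy : y ∈ Ioo (-1 : ℝ) 1) (hχ : 0 ≤ χ)
    (hχχ : χ ≤ χ') (hχ1 : χ' ≤ 1) (hμ : 0 ≤ μ) (hM : 0 ≤ M) (hμM : μ * (1 - y ^ 2) ≤ M * χ')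
    (he : 0 ≤ e) (he1 : e ≤ 1) (hR : |e * R| ≤ δ) (W Y X : ℝ) :
    -((5 * (2 / (p - 1)) + 3 + δ ^ 2 + 3 * M) * (χ' * (X ^ 2 * (rho p y / (1 - y ^ 2)))
      + (Y ^ 2 * ((1 - y ^ 2) * rho p y) + W ^ 2 * (rho p y / (1 - y ^ 2))
        + |W| ^ (p + 1) * rho p y)))
      ≤ dissipation p y χ μ e R W Y X := by
  have hq := one_sub_sq_pos hy
  have hr := rho_pos (p := p) hy
  obtain ⟨m, hm, hmq⟩ : ∃ m : ℝ, 0 < m ∧ m ^ 2 = 1 - y ^ 2 :=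
    ⟨√(1 - y ^ 2), Real.sqrt_pos.2 hq, Real.sq_sqrt hq.le⟩
  have hα : 0 ≤ 2 / (p - 1) := div_nonneg (by norm_num) (by linarith)
  obtain ⟨a, ha⟩ : ∃ a, X = a * m := ⟨X / m, by field_simp⟩
  obtain ⟨b, hb⟩ : ∃ b, Y = b / m := ⟨Y * m, by field_simp⟩
  obtain ⟨c, hc⟩ : ∃ c, W = c * m := ⟨W / m, by field_simp⟩
  have hP : 0 ≤ |W| ^ (p + 1) := Real.rpow_nonneg (abs_nonneg _) _
  have h1 := quadratic_form_ge (a := a) (b := b) (c := c) hα hmq he he1 hR hP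
  have h2 := flux_ge (a := a) (b := b) (c := c) hmq he he1
  rw [ha, hb, dissipation_eq_of_sqrt hm hmq _ _ _ _ _ _ _ _ hc, ← hmq]
  generalize |W| ^ (p + 1) = P at *
  rw [hc]
  have e1 : (a * m) ^ 2 * (rho p y / m ^ 2) = rho p y * a ^ 2 := by field_simp
  have e2 : (b / m) ^ 2 * (m ^ 2 * rho p y) = rho p y * b ^ 2 := by field_simp
  have e3 : (c * m) ^ 2 * (rho p y / m ^ 2) = rho p y * c ^ 2 := by field_simp
  rw [e1, e2, e3]
  generalize 2 / (p - 1) = α at *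
  generalize rho p y = r at *
  set K := 5 * α + 3 + δ ^ 2 with hK
  have hK0 : 0 ≤ K := by positivity
  rw [← hmq] at hμM
  have hχ0 : 0 ≤ χ' := hχ.trans hχχ
  have k1 : -(K * (χ' * (a ^ 2 + b ^ 2 + c ^ 2 + P))) ≤ -(χ * (K * (a ^ 2 + b ^ 2 + c ^ 2 + P))) := by
    have : 0 ≤ K * (a ^ 2 + b ^ 2 + c ^ 2 + P) := by positivity
    have := mul_le_mul_of_nonneg_right hχχ this
    linarith
  have k2 := mul_le_mul_of_nonneg_left h1 hχ
  have k3 := mul_le_mul_of_nonneg_left h2 hμ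
  have k4 := mul_le_mul_of_nonneg_right hμM (by positivity : 0 ≤ a ^ 2 + b ^ 2 + c ^ 2)
  have k5 : (K + 3 * M) * (χ' * (a ^ 2 + b ^ 2 + c ^ 2 + P))
      ≤ (K + 3 * M) * (χ' * a ^ 2 + (b ^ 2 + c ^ 2 + P)) := by
    refine mul_le_mul_of_nonneg_left ?_ (by positivity)
    have : 0 ≤ b ^ 2 + c ^ 2 + P := by positivity
    have := mul_le_of_le_one_left this hχ1
    linarith
  have k6 : 0 ≤ M * χ' * P := by positivity
  have : r * (-((K + 3 * M) * (χ' * a ^ 2 + (b ^ 2 + c ^ 2 + P)))) ≤ r * (χ * (-2 * α * a ^ 2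
      + e * R * (a * b) + e * (-(m ^ 2 * a ^ 2) + b ^ 2
        + α * (α + 1) * (m ^ 2 * c ^ 2)
        - P + 2 * α * (m ^ 2 * (c * a)) - 2 * y * (a * b)
        + 4 * α * y ^ 2 * (c * a) - e * R * (c * b)))
      + μ * (-y * (y * (m ^ 2 * a ^ 2) - m ^ 2 * (a * b)
        + e * (m ^ 2 * (c * b) - 2 * y * (m ^ 2 * (c * a)))))) := by
    refine mul_le_mul_of_nonneg_left ?_ hr.le
    linarith
  linarith

/-- After the time `s₀` the first order forcing term is a small perturbation. -/
def IsSmallPerturbation (N : ℕ) (p r₀ s₀ : ℝ) : Prop :=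
  Real.exp (-s₀) < r₀ ∧ Real.exp (-s₀) ≤ 1 ∧ ∃ δ,
    δ * (10 / (2 / (p - 1)) + 1 / 2 + (32 * (2 / (p - 1)) + 1 / 2) * (2 / (p - 1))⁻¹ ^ 2)
      ≤ (p - 1) / 4 ∧
    δ * (8 * (2 / (p - 1)) + 1 / 2 + 2 * ((p + 3) / 2) ^ 2 / (2 / (p - 1))
        + (32 * (2 / (p - 1)) + 1 / 2) * (2 / (p - 1))⁻¹)
      ≤ (p - 1) / 4 * (2 / (p - 1) * (2 / (p - 1) + 1)) ∧
    Real.exp (-s₀) ≤ δ ∧ ∀ s ∈ Ici s₀, ∀ y ∈ Ioo (-1 : ℝ) 1,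
      (Real.exp (-s) * (((N : ℝ) - 1) / (r₀ + y * Real.exp (-s)))) ^ 2 ≤ δ * Real.exp (-s)

/-- Hardy's inequality turns the δ-terms into multiples C₁ and C₂ of the two quadratic energies.
First δ is chosen so that the gains absorb these, then the time so late that exp(-s) and the first
order coefficient are small compared with δ. -/
theorem exists_threshold (hp : 1 < p) : ∃ S : ℝ, ∀ N : ℕ, 1 ≤ N →
    (2 ≤ N → p ≤ 1 + 4 / ((N : ℝ) - 1)) → ∀ r₀ : ℝ, 0 < r₀ → ∀ s₀ : ℝ,
    max S (S - 2 * Real.log r₀) ≤ s₀ → IsSmallPerturbation N p r₀ s₀ := by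
  have hp1 : 0 < p - 1 := by linarith
  unfold IsSmallPerturbation
  set α := 2 / (p - 1) with hα
  have hα0 : 0 < α := by positivity
  set C₁ := 10 / α + 1 / 2 + (32 * α + 1 / 2) * α⁻¹ ^ 2
  set C₂ := 8 * α + 1 / 2 + 2 * ((p + 3) / 2) ^ 2 / α + (32 * α + 1 / 2) * α⁻¹
  have hC₁ : 0 < C₁ := by positivity
  have hC₂ : 0 < C₂ := by positivity
  obtain ⟨δ, hδ, h1, h2⟩ : ∃ δ > 0, δ * C₁ ≤ (p - 1) / 4 ∧ δ * C₂ ≤ (p - 1) / 4 * (α * (α + 1)) := by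
    refine ⟨min ((p - 1) / 4 / C₁) ((p - 1) / 4 * (α * (α + 1)) / C₂), by positivity, ?_, ?_⟩
    · rw [← le_div_iff₀ hC₁]; exact min_le_left _ _
    · rw [← le_div_iff₀ hC₂]; exact min_le_right _ _
  -- The entry 1/2 keeps r₀ + y exp(-s) above r₀/2, the entry δ bounds exp(-s), and δ/(16 α²) makes
  -- the square of the first order coefficient at most δ exp(-s).
  set ε := min (1 / 2) (min δ (δ / (16 * α ^ 2))) with hε
  have hε0 : 0 < ε := by positivity
  have hεh : ε ≤ 1 / 2 := min_le_left _ _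
  have hεδ : ε ≤ δ := (min_le_right _ _).trans (min_le_left _ _)
  have hεα : ε * (16 * α ^ 2) ≤ δ := by
    rw [← le_div_iff₀ (by positivity)]; exact (min_le_right _ _).trans (min_le_right _ _)
  refine ⟨-Real.log ε, fun N hN hNp r₀ hr₀ s₀ hs₀ => ?_⟩
  have hK0 : 0 ≤ (N : ℝ) - 1 := by
    have : (1 : ℝ) ≤ N := by exact_mod_cast hN
    linarith
  -- The only use of the upper bound on p; it makes the threshold independent of N. For N = 1 the
  -- coefficient vanishes.
  have hK : (N : ℝ) - 1 ≤ 2 * α := by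
    rcases Nat.lt_or_ge N 2 with h | h
    · have : N = 1 := by omega
      rw [this]; norm_num; positivity
    · have hN1 : 0 < (N : ℝ) - 1 := by
        have : (2 : ℝ) ≤ N := by exact_mod_cast h
        linarith
      have h3 : p - 1 ≤ 4 / ((N : ℝ) - 1) := by linarith [hNp h]
      rw [le_div_iff₀ hN1] at h3
      rw [hα, mul_div_assoc', le_div_iff₀ hp1]
      linarith
  have he1 : Real.exp (-s₀) ≤ ε := by
    rw [← Real.le_log_iff_exp_le hε0]
    linarith [(le_max_left _ _).trans hs₀]
  -- This is the origin of the term -2 log r₀ in the threshold.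
  have he2 : Real.exp (-s₀) ≤ ε * r₀ ^ 2 := by
    rw [← Real.le_log_iff_exp_le (by positivity), Real.log_mul hε0.ne' (by positivity),
      Real.log_pow]
    push_cast
    linarith [(le_max_right _ _).trans hs₀]
  have he3 : Real.exp (-s₀) ≤ ε * r₀ := by
    rcases le_total r₀ 1 with h | h
    · refine he2.trans (mul_le_mul_of_nonneg_left ?_ hε0.le)
      rw [pow_two]; exact mul_le_of_le_one_left hr₀.le h
    · exact he1.trans (le_mul_of_one_le_right hε0.le h)
  have he4 : Real.exp (-s₀) ≤ r₀ / 2 := by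
    refine he3.trans ?_
    have := mul_le_mul_of_nonneg_right hεh hr₀.le
    linarith
  refine ⟨by linarith, by linarith, δ, h1, h2, he1.trans hεδ, fun s hs y hy => ?_⟩
  have h3 := lower_bound_radius (r₀ := r₀) hs hy
  have h4 : Real.exp (-s) ≤ Real.exp (-s₀) := Real.exp_le_exp.2 (by linarith [mem_Ici.1 hs])
  have hd : 0 < r₀ + y * Real.exp (-s) := by linarith
  have h5 : ((N : ℝ) - 1) / (r₀ + y * Real.exp (-s)) ≤ 2 * α / (r₀ / 2) := by
    gcongr
    linarith
  have h6 : 0 ≤ ((N : ℝ) - 1) / (r₀ + y * Real.exp (-s)) := by positivity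
  have hE := Real.exp_pos (-s)
  calc (Real.exp (-s) * (((N : ℝ) - 1) / (r₀ + y * Real.exp (-s)))) ^ 2
      ≤ (Real.exp (-s) * (2 * α / (r₀ / 2))) ^ 2 := by gcongr
    _ = Real.exp (-s) * (16 * α ^ 2 / r₀ ^ 2) * Real.exp (-s) := by field_simp; ring
    _ ≤ ε * r₀ ^ 2 * (16 * α ^ 2 / r₀ ^ 2) * Real.exp (-s) := by
        gcongr
        exact h4.trans he2
    _ = ε * (16 * α ^ 2) * Real.exp (-s) := by field_simp
    _ ≤ δ * Real.exp (-s) := by gcongr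

/-! ### The Lyapunov functional -/

/-- The truncated dissipation integral. -/
def truncatedDissipation (p : ℝ) (n : ℕ) (g : ℝ → ℝ) : ℝ :=
  ∫ y in Ioo (-1) 1, cutoff n y * (g y ^ 2 * (rho p y / (1 - y ^ 2)))

/-- The error caused by the truncation. -/
def truncationError (p : ℝ) (n : ℕ) (f f' : ℝ → ℝ) : ℝ :=
  ∫ y in Ioo (-1) 1, cutoffSlope n y * (1 - y ^ 2) * (f' y ^ 2 * ((1 - y ^ 2) * rho p y)
    + 3 * (f y ^ 2 * (y ^ 2 * (rho p y / (1 - y ^ 2)))))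

theorem LocMemL2.integrable_weight {f g ψ k : ℝ → ℝ} (hf : LocMemL2 f) (hg : LocMemL2 g)
    (hψ : IsTest (-1) 1 ψ) (hk : ContDiffOn ℝ ∞ k (Ioo (-1) 1)) :
    IntegrableOn (fun y => k y * ψ y * (f y * g y)) (Ioo (-1) 1) :=
  (hf.integrable_test_mul_mul hg (hψ.mul_left_of_contDiffOn hk)).integrableOn

theorem contDiffOn_flux_weight : ContDiffOn ℝ ∞ (fun y => (1 - y ^ 2) * rho p y) (Ioo (-1) 1) :=
  (by fun_prop : ContDiffOn ℝ ∞ (fun y : ℝ => 1 - y ^ 2) _).mul contDiffOn_rho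

theorem contDiffOn_hardy_weight :
    ContDiffOn ℝ ∞ (fun y => y ^ 2 * (rho p y / (1 - y ^ 2))) (Ioo (-1) 1) :=
  (by fun_prop : ContDiffOn ℝ ∞ (fun y : ℝ => y ^ 2) _).mul contDiffOn_rho_div

namespace MemEnergySpace

variable {f f' g : ℝ → ℝ}

theorem integrable_cutoff (h : MemEnergySpace p f f' g) (n : ℕ) :
    IntegrableOn (fun y => cutoff n y * (f y ^ 2 * rho p y)) (Ioo (-1) 1) ∧
    IntegrableOn (fun y => cutoff n y * (f' y ^ 2 * ((1 - y ^ 2) * rho p y))) (Ioo (-1) 1) ∧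
    IntegrableOn (fun y => cutoff n y * (f y ^ 2 * (y ^ 2 * (rho p y / (1 - y ^ 2)))))
      (Ioo (-1) 1) ∧
    IntegrableOn (fun y => cutoff n y * (g y ^ 2 * (rho p y / (1 - y ^ 2)))) (Ioo (-1) 1) := by
  obtain ⟨hf, hf', hg⟩ := h.locMemL2
  refine ⟨(hf.integrable_weight hf (isTest_cutoff n) (contDiffOn_rho (p := p))).congr (ae_of_all _ fun y => ?_),
    (hf'.integrable_weight hf' (isTest_cutoff n) (contDiffOn_flux_weight (p := p))).congr
      (ae_of_all _ fun y => ?_),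
    (hf.integrable_weight hf (isTest_cutoff n) (contDiffOn_hardy_weight (p := p))).congr
      (ae_of_all _ fun y => ?_),
    (hg.integrable_weight hg (isTest_cutoff n) (contDiffOn_rho_div (p := p))).congr
      (ae_of_all _ fun y => ?_)⟩ <;> simp only <;> ring

theorem integrable_error (h : MemEnergySpace p f f' g) (n : ℕ) :
    IntegrableOn (fun y => cutoffSlope n y * (1 - y ^ 2) * (f' y ^ 2 * ((1 - y ^ 2) * rho p y)
    + 3 * (f y ^ 2 * (y ^ 2 * (rho p y / (1 - y ^ 2)))))) (Ioo (-1) 1) := by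
  obtain ⟨hf, hf', -⟩ := h.locMemL2
  have ht : IsTest (-1) 1 fun y => (1 - y ^ 2) * cutoffSlope n y :=
    (isTest_cutoffSlope n).mul_left (by fun_prop)
  refine ((hf'.integrable_weight hf' ht (contDiffOn_flux_weight (p := p))).add
    ((hf.integrable_weight hf ht (contDiffOn_hardy_weight (p := p))).const_mul 3)).congr
      (ae_of_all _ fun y => ?_)
  simp only [Pi.add_apply]
  ring

theorem integrable_density (hp : 1 < p) (h : MemEnergySpace p f f' g) (s : ℝ) :
    IntegrableOn (densityF p s f f' g) (Ioo (-1) 1) ∧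
      ∫ y in Ioo (-1) 1, densityF p s f f' g y = functionalF p f f' g s := by
  obtain ⟨C, hC, hpot⟩ := potential hp
  obtain ⟨i1, i2, i3⟩ := h.integrable_parts
  have i4 := (hpot h).1
  have hr : AEStronglyMeasurable (rho p) (volume.restrict (Ioo (-1) 1)) :=
    continuousOn_rho.aestronglyMeasurable measurableSet_Ioo
  have i5 : IntegrableOn (fun y => f y * g y * rho p y) (Ioo (-1) 1) := by
    refine Integrable.mono (i1.add i3) ((h.meas.mul h.meas_g).mul hr) ?_
    filter_upwards [ae_restrict_mem measurableSet_Ioo] with y hy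
    have h0 := rho_pos (p := p) hy
    simp only [Pi.add_apply]
    rw [Real.norm_eq_abs, Real.norm_of_nonneg (by positivity), abs_mul, abs_of_pos h0, ← add_mul]
    refine mul_le_mul_of_nonneg_right ?_ h0.le
    rw [abs_le]
    constructor <;> nlinarith [sq_nonneg (f y + g y), sq_nonneg (f y - g y)]
  have iE : IntegrableOn (fun y => (1 / 2 * g y ^ 2 + 1 / 2 * f' y ^ 2 * (1 - y ^ 2)
    + (p + 1) / (p - 1) ^ 2 * f y ^ 2 - 1 / (p + 1) * |f y| ^ (p + 1)) * rho p y) (Ioo (-1) 1) := by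
    refine ((((i3.const_mul (1 / 2)).add (i2.const_mul (1 / 2))).add
      (i1.const_mul ((p + 1) / (p - 1) ^ 2))).sub (i4.const_mul (1 / (p + 1)))).congr
      (ae_of_all _ fun y => ?_)
    simp only [Pi.add_apply, Pi.sub_apply]
    ring
  have e : ∀ y, densityF p s f f' g y = (1 / 2 * g y ^ 2 + 1 / 2 * f' y ^ 2 * (1 - y ^ 2)
    + (p + 1) / (p - 1) ^ 2 * f y ^ 2 - 1 / (p + 1) * |f y| ^ (p + 1)) * rho p y
    - Real.exp (-s) * (f y * g y * rho p y) := fun y => by rw [densityF]; ring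
  refine ⟨(iE.sub (i5.const_mul _)).congr (ae_of_all _ fun y => (e y).symm), ?_⟩
  rw [integral_congr_ae (ae_of_all _ e), integral_sub iE (i5.const_mul _), integral_const_mul]
  rfl

theorem exists_density_bound (hp : 1 < p) : ∃ C, 0 ≤ C ∧ ∀ {f f' g : ℝ → ℝ} {s : ℝ},
    MemEnergySpace p f f' g → Real.exp (-s) ≤ 1 →
    ∫ y in Ioo (-1) 1, |densityF p s f f' g y| ≤ C * ((∫ y in Ioo (-1) 1, energyDensity p f f' g y)
      + ∫ y in Ioo (-1) 1, |f y| ^ (p + 1) * rho p y) := by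
  refine ⟨1 + (p + 1) / (p - 1) ^ 2, by have : 0 < p + 1 := by linarith
                                        positivity, fun {f f' g s} h hs => ?_⟩
  obtain ⟨C, hC, hpot⟩ := potential hp
  have i4 := (hpot h).1
  rw [← integral_add h.integrable i4, ← integral_const_mul]
  refine setIntegral_mono_on (h.integrable_density hp s).1.abs
    ((h.integrable.add i4).const_mul _) measurableSet_Ioo fun y hy => ?_
  have h0 := rho_pos (p := p) hy
  have hq := one_sub_sq_pos hy
  have hP : 0 ≤ |f y| ^ (p + 1) := Real.rpow_nonneg (abs_nonneg _) _
  simp only [densityF, energyDensity]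
  rw [abs_mul, abs_of_pos h0, ← add_mul, ← mul_assoc (1 + (p + 1) / (p - 1) ^ 2)]
  refine mul_le_mul_of_nonneg_right ?_ h0.le
  have hc : 0 ≤ (p + 1) / (p - 1) ^ 2 := by have : 0 < p + 1 := by linarith
                                            positivity
  have hk : 0 ≤ 1 / (p + 1) := by have : 0 < p + 1 := by linarith
                                  positivity
  have hk1 : 1 / (p + 1) ≤ 1 := by rw [div_le_one] <;> linarith
  generalize (p + 1) / (p - 1) ^ 2 = c at *
  generalize 1 / (p + 1) = k at *
  generalize |f y| ^ (p + 1) = P at *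
  have hfg : |Real.exp (-s) * (f y * g y)| ≤ 1 / 2 * (f y ^ 2 + g y ^ 2) := by
    rw [abs_mul, abs_of_pos (Real.exp_pos _)]
    refine (mul_le_of_le_one_left (abs_nonneg _) hs).trans ?_
    rw [abs_le]
    constructor <;> nlinarith [sq_nonneg (f y + g y), sq_nonneg (f y - g y)]
  obtain ⟨u1, u2⟩ := abs_le.1 hfg
  have a1 : 0 ≤ f' y ^ 2 * (1 - y ^ 2) := by positivity
  have a2 := mul_le_of_le_one_left hP hk1
  have a3 := mul_nonneg hk hP
  have a4 := mul_nonneg hc hP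
  have a5 := mul_nonneg hc (sq_nonneg (f y))
  have a6 := mul_nonneg hc (sq_nonneg (g y))
  have a7 := mul_nonneg hc a1
  have a8 := sq_nonneg (f y)
  have a9 := sq_nonneg (g y)
  rw [abs_le]
  constructor <;> linarith

theorem error_nonneg (_ : MemEnergySpace p f f' g) (n : ℕ) : 0 ≤ truncationError p n f f' := by
  refine setIntegral_nonneg measurableSet_Ioo fun y hy => ?_
  have h0 := rho_pos (p := p) hy
  have hq := one_sub_sq_pos hy
  have := cutoffSlope_nonneg (n := n) (y := y)
  positivity

/-- Dominated convergence: the slope times 1-y² is bounded and tends to 0 pointwise, and what it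
multiplies is dominated by an integrable function by Hardy's inequality. -/
theorem tendsto_error (hp : 1 < p) (h : MemEnergySpace p f f' g) :
    Tendsto (fun n => truncationError p n f f') atTop (𝓝 0) := by
  obtain ⟨M, hM0, hM⟩ := exists_cutoffSlope_bound
  have i2 := h.integrable_parts.2.1
  have i3 := (h.hardy hp).1
  have := tendsto_integral_of_dominated_convergence (μ := volume.restrict (Ioo (-1) 1))
    (F := fun n y => cutoffSlope n y * (1 - y ^ 2) * (f' y ^ 2 * ((1 - y ^ 2) * rho p y)
    + 3 * (f y ^ 2 * (y ^ 2 * (rho p y / (1 - y ^ 2)))))) (f := fun _ => 0)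
    (fun y => M * (f' y ^ 2 * ((1 - y ^ 2) * rho p y)
    + 3 * (f y ^ 2 * (rho p y / (1 - y ^ 2)))))
    (fun n => (h.integrable_error n).1) ((i2.add (i3.const_mul 3)).const_mul M)
    (fun n => ?_) ?_
  · simpa [truncationError] using this
  · filter_upwards [ae_restrict_mem measurableSet_Ioo] with y hy
    have h0 := rho_pos (p := p) hy
    have hq := one_sub_sq_pos hy
    have hμ := cutoffSlope_nonneg (n := n) (y := y)
    rw [Real.norm_of_nonneg (by positivity)]
    have hy2 : y ^ 2 ≤ 1 := by linarith
    refine mul_le_mul ((hM n y hy).trans (mul_le_of_le_one_right hM0.le cutoff_le_one)) ?_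
      (by positivity) hM0.le
    have : y ^ 2 * (rho p y / (1 - y ^ 2)) ≤ rho p y / (1 - y ^ 2) :=
      mul_le_of_le_one_left (by positivity) hy2
    gcongr
  · filter_upwards [ae_restrict_mem measurableSet_Ioo] with y hy
    simpa using ((tendsto_cutoffSlope hy).mul_const (1 - y ^ 2)).mul_const
      (f' y ^ 2 * ((1 - y ^ 2) * rho p y) + 3 * (f y ^ 2 * (y ^ 2 * (rho p y / (1 - y ^ 2)))))

theorem error_le (hp : 1 < p) {M : ℝ} (hM0 : 0 ≤ M) (hM : ∀ (n : ℕ) (y : ℝ), y ∈ Ioo (-1 : ℝ) 1 →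
    cutoffSlope n y * (1 - y ^ 2) ≤ M * cutoff (2 * n) y) (h : MemEnergySpace p f f' g) (n : ℕ) :
    truncationError p n f f' ≤ M * ((∫ y in Ioo (-1) 1, f' y ^ 2 * ((1 - y ^ 2) * rho p y))
      + 3 * ∫ y in Ioo (-1) 1, f y ^ 2 * (rho p y / (1 - y ^ 2))) := by
  have i2 := h.integrable_parts.2.1
  have i3 := (h.hardy hp).1
  rw [← integral_const_mul 3, ← integral_add i2 (i3.const_mul 3), ← integral_const_mul]
  refine setIntegral_mono_on (h.integrable_error n) ((i2.add (i3.const_mul 3)).const_mul M)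
    measurableSet_Ioo fun y hy => ?_
  have h0 := rho_pos (p := p) hy
  have hq := one_sub_sq_pos hy
  have hy2 : y ^ 2 ≤ 1 := by linarith
  refine mul_le_mul ((hM n y hy).trans (mul_le_of_le_one_right hM0 cutoff_le_one)) ?_
    (by positivity) hM0
  have : y ^ 2 * (rho p y / (1 - y ^ 2)) ≤ rho p y / (1 - y ^ 2) :=
    mul_le_of_le_one_left (by positivity) hy2
  gcongr

end MemEnergySpace

/-- The pointwise bound leaves one term with the bad sign, the Hardy integrand with coefficient of
order δ. The truncated Hardy inequality distributes it over the two quadratic terms, where the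
smallness condition absorbs it. -/
theorem integral_dissipation_le (hp : 1 < p) {N : ℕ} {r₀ s₀ s : ℝ}
    (hsm : IsSmallPerturbation N p r₀ s₀) (hs : s ∈ Ici s₀) {f f' g : ℝ → ℝ}
    (h : MemEnergySpace p f f' g) (n : ℕ)
    (hi : IntegrableOn (fun y => dissipation p y (cutoff n y) (cutoffSlope n y) (Real.exp (-s))
      (((N : ℝ) - 1) / (r₀ + y * Real.exp (-s))) (f y) (f' y) (g y)) (Ioo (-1) 1)) :
    ∫ y in Ioo (-1) 1, dissipation p y (cutoff n y) (cutoffSlope n y) (Real.exp (-s))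
      (((N : ℝ) - 1) / (r₀ + y * Real.exp (-s))) (f y) (f' y) (g y)
    ≤ (p + 3) / 2 * Real.exp (-s) * (∫ y in Ioo (-1) 1, cutoff n y * densityF p s f f' g y)
      - 2 / (p - 1) * truncatedDissipation p n g + truncationError p n f f' := by
  obtain ⟨-, he1, δ, hδ1, hδ2, heδ, hR⟩ := hsm
  have hes : Real.exp (-s) ≤ Real.exp (-s₀) := Real.exp_le_exp.2 (by linarith [mem_Ici.1 hs])
  have hδ0 : 0 ≤ δ := (Real.exp_pos _).le.trans heδ
  obtain ⟨i1, i2, i3, i4⟩ := h.integrable_cutoff n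
  have i5 := h.integrable_error n
  have iF : IntegrableOn (fun y => cutoff n y * densityF p s f f' g y) (Ioo (-1) 1) :=
    (h.integrable_density hp s).1.bdd_mul (c := 1)
      (isTest_cutoff n).continuous.aestronglyMeasurable
      (ae_of_all _ fun y => by rw [Real.norm_of_nonneg cutoff_nonneg]; exact cutoff_le_one)
  have hp1 : 0 < p - 1 := by linarith
  have hh := h.hardy_cutoff hp n
  have hle := setIntegral_mono_on hi (((iF.const_mul ((p + 3) / 2 * Real.exp (-s))).sub
    (i4.const_mul (2 / (p - 1)))).sub ((((i2.const_mul ((p - 1) / 4 - δ * (10 / (2 / (p - 1)) + 1 / 2))).add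
      (i1.const_mul ((p - 1) / 4 * (2 / (p - 1) * (2 / (p - 1) + 1))
              - δ * (8 * (2 / (p - 1)) + 1 / 2 + 2 * ((p + 3) / 2) ^ 2 / (2 / (p - 1)))))).sub
      (i3.const_mul (δ * (32 * (2 / (p - 1)) + 1 / 2)))).const_mul (Real.exp (-s))) |>.add i5)
    measurableSet_Ioo fun y hy => dissipation_le hp hy cutoff_nonneg cutoffSlope_nonneg
      (hes.trans he1) (hes.trans heδ) (hR s hs y hy) f f' g
  refine hle.trans ?_
  have eq : ∫ y in Ioo (-1) 1, ((p + 3) / 2 * Real.exp (-s) * (cutoff n y * densityF p s f f' g y)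
        - 2 / (p - 1) * (cutoff n y * (g y ^ 2 * (rho p y / (1 - y ^ 2))))
        - Real.exp (-s) * (((p - 1) / 4 - δ * (10 / (2 / (p - 1)) + 1 / 2))
            * (cutoff n y * (f' y ^ 2 * ((1 - y ^ 2) * rho p y)))
          + ((p - 1) / 4 * (2 / (p - 1) * (2 / (p - 1) + 1))
              - δ * (8 * (2 / (p - 1)) + 1 / 2 + 2 * ((p + 3) / 2) ^ 2 / (2 / (p - 1))))
            * (cutoff n y * (f y ^ 2 * rho p y))
          - δ * (32 * (2 / (p - 1)) + 1 / 2)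
            * (cutoff n y * (f y ^ 2 * (y ^ 2 * (rho p y / (1 - y ^ 2))))))
        + cutoffSlope n y * (1 - y ^ 2) * (f' y ^ 2 * ((1 - y ^ 2) * rho p y)
          + 3 * (f y ^ 2 * (y ^ 2 * (rho p y / (1 - y ^ 2)))))) = 
      (p + 3) / 2 * Real.exp (-s) * (∫ y in Ioo (-1) 1, cutoff n y * densityF p s f f' g y)
        - 2 / (p - 1) * truncatedDissipation p n g
        - Real.exp (-s) * (((p - 1) / 4 - δ * (10 / (2 / (p - 1)) + 1 / 2))
            * (∫ y in Ioo (-1) 1, cutoff n y * (f' y ^ 2 * ((1 - y ^ 2) * rho p y)))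
          + ((p - 1) / 4 * (2 / (p - 1) * (2 / (p - 1) + 1))
              - δ * (8 * (2 / (p - 1)) + 1 / 2 + 2 * ((p + 3) / 2) ^ 2 / (2 / (p - 1))))
            * (∫ y in Ioo (-1) 1, cutoff n y * (f y ^ 2 * rho p y))
          - δ * (32 * (2 / (p - 1)) + 1 / 2)
            * ∫ y in Ioo (-1) 1, cutoff n y * (f y ^ 2 * (y ^ 2 * (rho p y / (1 - y ^ 2)))))
        + truncationError p n f f' := by
    rw [integral_add ?_ i5, integral_sub ?_ ?_, integral_sub (iF.const_mul _) (i4.const_mul _),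
      integral_const_mul, integral_const_mul, integral_const_mul, integral_sub ?_ (i3.const_mul _),
      integral_add (i2.const_mul _) (i1.const_mul _), integral_const_mul, integral_const_mul,
      integral_const_mul]
    · rfl
    · exact (i2.const_mul _).add (i1.const_mul _)
    · exact (iF.const_mul _).sub (i4.const_mul _)
    · exact (((i2.const_mul _).add (i1.const_mul _)).sub (i3.const_mul _)).const_mul _
    · exact ((iF.const_mul _).sub (i4.const_mul _)).sub
        ((((i2.const_mul _).add (i1.const_mul _)).sub (i3.const_mul _)).const_mul _)
  refine eq.le.trans ?_
  have hα : 0 < 2 / (p - 1) := by positivity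
  have n1 : 0 ≤ ∫ y in Ioo (-1) 1, cutoff n y * (f y ^ 2 * rho p y) :=
    setIntegral_nonneg measurableSet_Ioo fun y hy => by
      have := rho_pos (p := p) hy
      have := cutoff_nonneg (n := n) (y := y)
      positivity
  have n2 : 0 ≤ ∫ y in Ioo (-1) 1, cutoff n y * (f' y ^ 2 * ((1 - y ^ 2) * rho p y)) :=
    setIntegral_nonneg measurableSet_Ioo fun y hy => by
      have := rho_pos (p := p) hy
      have := one_sub_sq_pos hy
      have := cutoff_nonneg (n := n) (y := y)
      positivity
  generalize (∫ y in Ioo (-1) 1, cutoff n y * (f y ^ 2 * rho p y)) = I₁ at *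
  generalize (∫ y in Ioo (-1) 1, cutoff n y * (f' y ^ 2 * ((1 - y ^ 2) * rho p y))) = I₂ at *
  generalize (∫ y in Ioo (-1) 1, cutoff n y * (f y ^ 2 * (y ^ 2 * (rho p y / (1 - y ^ 2))))) = I₃ at *
  generalize 2 / (p - 1) = α at *
  -- Here `I₁`, `I₂`, `I₃` are the truncated integrals of f² ρ, of f'² (1-y²) ρ and of the Hardy
  -- integrand.
  have h3 : I₃ ≤ α⁻¹ * (I₁ + α⁻¹ * I₂) := by
    rw [inv_mul_eq_div, le_div_iff₀ hα]; linarith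
  have h4 := mul_le_mul_of_nonneg_left h3 (by positivity : 0 ≤ δ * (32 * α + 1 / 2))
  have h5 := mul_le_mul_of_nonneg_right hδ1 n2
  have h6 := mul_le_mul_of_nonneg_right hδ2 n1
  have : 0 ≤ Real.exp (-s) * (((p - 1) / 4 - δ * (10 / α + 1 / 2)) * I₂
    + ((p - 1) / 4 * (α * (α + 1)) - δ * (8 * α + 1 / 2 + 2 * ((p + 3) / 2) ^ 2 / α)) * I₁
    - δ * (32 * α + 1 / 2) * I₃) := by
    refine mul_nonneg (Real.exp_pos _).le ?_
    linarith
  linarith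

namespace IsCharacteristicSolution

variable {N : ℕ} {r₀ s₀ : ℝ} {w wy ws : ℝ → ℝ → ℝ}

theorem integral_dissipation_ge (hp : 1 < p) (hsm : IsSmallPerturbation N p r₀ s₀) :
    ∃ K, 0 ≤ K ∧ ∀ {s : ℝ}, s ∈ Ici s₀ → ∀ {f f' g : ℝ → ℝ}, MemEnergySpace p f f' g → ∀ n : ℕ,
    IntegrableOn (fun y => dissipation p y (cutoff n y) (cutoffSlope n y) (Real.exp (-s))
      (((N : ℝ) - 1) / (r₀ + y * Real.exp (-s))) (f y) (f' y) (g y)) (Ioo (-1) 1) →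
    -(K * (truncatedDissipation p (2 * n) g
      + ((∫ y in Ioo (-1) 1, f' y ^ 2 * ((1 - y ^ 2) * rho p y))
        + (∫ y in Ioo (-1) 1, f y ^ 2 * (rho p y / (1 - y ^ 2)))
        + ∫ y in Ioo (-1) 1, |f y| ^ (p + 1) * rho p y)))
    ≤ ∫ y in Ioo (-1) 1, dissipation p y (cutoff n y) (cutoffSlope n y) (Real.exp (-s))
      (((N : ℝ) - 1) / (r₀ + y * Real.exp (-s))) (f y) (f' y) (g y) := by
  obtain ⟨-, he1, δ, -, -, heδ, hR⟩ := hsm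
  have hδ0 : 0 ≤ δ := (Real.exp_pos _).le.trans heδ
  obtain ⟨M, hM0, hM⟩ := exists_cutoffSlope_bound
  have hα : 0 ≤ 2 / (p - 1) := div_nonneg (by norm_num) (by linarith)
  refine ⟨5 * (2 / (p - 1)) + 3 + δ ^ 2 + 3 * M, by positivity, fun {s} hs {f f' g} h n hi => ?_⟩
  have hes : Real.exp (-s) ≤ Real.exp (-s₀) := Real.exp_le_exp.2 (by linarith [mem_Ici.1 hs])
  obtain ⟨C, -, hpot⟩ := MemEnergySpace.potential hp
  have i1 := (h.integrable_cutoff (2 * n)).2.2.2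
  have i2 := h.integrable_parts.2.1
  have i3 := (h.hardy hp).1
  have i4 := (hpot h).1
  have i23 : IntegrableOn (fun y => f' y ^ 2 * ((1 - y ^ 2) * rho p y)
    + f y ^ 2 * (rho p y / (1 - y ^ 2))) (Ioo (-1) 1) := i2.add i3
  have i234 : IntegrableOn (fun y => f' y ^ 2 * ((1 - y ^ 2) * rho p y)
    + f y ^ 2 * (rho p y / (1 - y ^ 2)) + |f y| ^ (p + 1) * rho p y) (Ioo (-1) 1) := i23.add i4
  rw [← integral_add i2 i3, ← integral_add i23 i4, truncatedDissipation, ← integral_add i1 i234,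
    ← integral_const_mul, ← integral_neg]
  refine setIntegral_mono_on ((i1.add i234).const_mul _).neg hi measurableSet_Ioo fun y hy => ?_
  have hsq := hR s hs y hy
  refine dissipation_ge hp hy cutoff_nonneg (cutoff_le_cutoff (by omega) hy) cutoff_le_one
    cutoffSlope_nonneg hM0.le (hM n y hy) (Real.exp_pos _).le (hes.trans he1) ?_ _ _ _
  refine abs_le_of_sq_le_sq ?_ hδ0
  rw [pow_two δ]
  exact hsq.trans (mul_le_mul_of_nonneg_left (hes.trans heδ) hδ0)

theorem dissipativeLimit (h : IsCharacteristicSolution N p r₀ s₀ w wy ws) (hp : 1 < p)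
    (hsm : IsSmallPerturbation N p r₀ s₀) :
    DissipativeLimit s₀ (2 / (p - 1)) (fun s => (p + 3) / 2 * Real.exp (-s))
      (fun n s => ∫ y in Ioo (-1) 1, cutoff n y * densityF p s (w s) (wy s) (ws s) y)
      (fun n s => ∫ y in Ioo (-1) 1, dissipation p y (cutoff n y) (cutoffSlope n y) (Real.exp (-s))
        (((N : ℝ) - 1) / (r₀ + y * Real.exp (-s))) (w s y) (wy s y) (ws s y))
      (fun n s => truncatedDissipation p n (ws s))
      (fun n s => truncationError p n (w s) (wy s))
      (fun s => functionalF p (w s) (wy s) (ws s) s) := by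
  have hab : (-1 : ℝ) < 1 := by norm_num
  have hT := fun n s (hs : s ∈ Ici s₀) => h.hasDerivWithinAt_truncated hp hsm.1 n hs
  obtain ⟨lw, ly, ls⟩ := h.path.locL2ContOn
  have hcont : ∀ {g : ℝ → ℝ → ℝ} {k ψ : ℝ → ℝ}, LocL2ContOn (-1) 1 (Ici s₀) g → IsTest (-1) 1 ψ →
      ContDiffOn ℝ ∞ k (Ioo (-1) 1) →
      ContinuousOn (fun s => ∫ y in Ioo (-1) 1, k y * ψ y * (g s y * g s y)) (Ici s₀) := by
    intro g k ψ hg hψ hk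
    refine (hg.continuousOn_integral hg hab (hψ.mul_left_of_contDiffOn hk)).congr fun s _ => ?_
    refine setIntegral_eq_integral_of_forall_compl_eq_zero fun y hy => ?_
    simp [hψ.zero_of_notMem hy]
  refine ⟨fun n s hs => (hT n s hs).2, fun n s hs =>
      integral_dissipation_le hp hsm hs (h.path.mem s hs) n (hT n s hs).1,
    fun a b ha => ?_, by fun_prop, fun n => ?_, fun n => ?_, fun n s hs => ?_, fun s hs n m hnm => ?_,
    fun s hs => (h.path.mem s hs).tendsto_error hp, fun s hs => ?_⟩
  · obtain ⟨C₀, hC₀⟩ := h.path.exists_norm_le isCompact_Icc fun x hx => ha.trans hx.1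
    obtain ⟨Cp, hCp, hpot⟩ := MemEnergySpace.potential hp
    obtain ⟨Cd, hCd, hden⟩ := MemEnergySpace.exists_density_bound hp
    obtain ⟨K, hK, hge⟩ := integral_dissipation_ge hp hsm
    obtain ⟨M, hM0, hM⟩ := exists_cutoffSlope_bound
    rcases lt_or_ge b a with hba | hba
    · exact ⟨0, by simp [Icc_eq_empty_of_lt hba]⟩
    have hC₀0 : 0 ≤ C₀ := (h.path.mem a ha).norm_nonneg.trans (hC₀ a (left_mem_Icc.2 hba))
    set Q := (Cp * C₀) ^ ((p - 1) / 2) * (Cp * C₀) with hQ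
    set A := 1 + (2 / (p - 1))⁻¹ * (1 + (2 / (p - 1))⁻¹) with hA
    have hα : 0 < 2 / (p - 1) := div_pos (by norm_num) (by linarith)
    have hA0 : 0 ≤ A := by positivity
    have hQ0 : 0 ≤ Q := by positivity
    refine ⟨Cd * (C₀ + Q) + M * (C₀ + 3 * (A * C₀)) + K * (1 + (C₀ + A * C₀ + Q)),
      fun s hs n => ?_⟩
    have hs0 : s ∈ Ici s₀ := ha.trans hs.1
    have hm := h.path.mem s hs0
    have hN := hC₀ s hs
    have hN0 := hm.norm_nonneg
    have hpl : ∫ y in Ioo (-1) 1, |w s y| ^ (p + 1) * rho p y ≤ Q := by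
      refine (hpot hm).2.trans ?_
      have hCN := mul_le_mul_of_nonneg_left hN hCp.le
      exact mul_le_mul (Real.rpow_le_rpow (mul_nonneg hCp.le hN0) hCN (by linarith)) hCN
        (mul_nonneg hCp.le hN0) (Real.rpow_nonneg (by positivity) _)
    have hes : Real.exp (-s) ≤ 1 :=
      (Real.exp_le_exp.2 (by linarith [mem_Ici.1 hs0])).trans hsm.2.1
    have i2 := (hm.parts_le).2.1.trans hN
    have i3 := (hm.hardy hp).2.trans (mul_le_mul_of_nonneg_left hN hA0)
    have iD := hm.integrable_density hp s
    have t1 : 0 ≤ Cd * (C₀ + Q) := by positivity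
    have t2 : 0 ≤ M * (C₀ + 3 * (A * C₀)) := by positivity
    have t3 : 0 ≤ K * (1 + (C₀ + A * C₀ + Q)) := by positivity
    have hD0 : 0 ≤ truncatedDissipation p (2 * n) (ws s) :=
      setIntegral_nonneg measurableSet_Ioo fun y hy => by
        have := rho_pos (p := p) hy
        have := one_sub_sq_pos hy
        have := cutoff_nonneg (n := 2 * n) (y := y)
        positivity
    refine ⟨?_, hm.error_nonneg n, ?_, ?_⟩
    · have h1 : |∫ y in Ioo (-1) 1, cutoff n y * densityF p s (w s) (wy s) (ws s) y|
          ≤ ∫ y in Ioo (-1) 1, |densityF p s (w s) (wy s) (ws s) y| := by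
        refine (Real.norm_eq_abs _).symm.le.trans
          (norm_integral_le_of_norm_le iD.1.abs (ae_of_all _ fun y => ?_))
        simp only [norm_mul, Real.norm_eq_abs, abs_of_nonneg (cutoff_nonneg (n := n) (y := y))]
        exact mul_le_of_le_one_left (abs_nonneg _) cutoff_le_one
      have h2 := h1.trans (hden hm hes)
      have h3 := mul_le_mul_of_nonneg_left (add_le_add hN hpl) hCd
      linarith
    · have h1 := hm.error_le hp hM0.le hM n
      have h2 := mul_le_mul_of_nonneg_left (add_le_add i2 (mul_le_mul_of_nonneg_left i3
        (by norm_num : (0 : ℝ) ≤ 3))) hM0.le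
      linarith
    · refine le_trans ?_ (hge hs0 hm n (hT n s hs0).1)
      rw [neg_le_neg_iff]
      set D := truncatedDissipation p (2 * n) (ws s)
      have h1 := mul_le_mul_of_nonneg_left (add_le_add (add_le_add i2 i3) hpl) hK
      have h2 : 0 ≤ C₀ + A * C₀ + Q := by positivity
      have h3 := mul_nonneg (mul_nonneg hK h2) hD0
      have h4 := mul_nonneg (add_nonneg t1 t2) (add_nonneg hD0 zero_le_one)
      linarith
  · refine (hcont ls (isTest_cutoff n) (contDiffOn_rho_div (p := p))).congr fun s _ => ?_
    refine integral_congr_ae (ae_of_all _ fun y => ?_)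
    simp only
    ring
  · have ht : IsTest (-1) 1 fun y => (1 - y ^ 2) * cutoffSlope n y :=
      (isTest_cutoffSlope n).mul_left (by fun_prop)
    refine ((hcont ly ht (contDiffOn_flux_weight (p := p))).add
      ((hcont lw ht (contDiffOn_hardy_weight (p := p))).const_mul 3)).congr fun s hs => ?_
    obtain ⟨hf, hf', -⟩ := (h.path.mem s hs).locMemL2
    have i1 := hf'.integrable_weight hf' ht (contDiffOn_flux_weight (p := p))
    have i2 := hf.integrable_weight hf ht (contDiffOn_hardy_weight (p := p))
    simp only [Pi.add_apply]
    rw [← integral_const_mul, ← integral_add i1 (i2.const_mul 3)]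
    refine integral_congr_ae (ae_of_all _ fun y => ?_)
    simp only
    ring
  · exact setIntegral_nonneg measurableSet_Ioo fun y hy => by
      have := rho_pos (p := p) hy
      have := one_sub_sq_pos hy
      have := cutoff_nonneg (n := n) (y := y)
      positivity
  · have hm := h.path.mem s hs
    refine setIntegral_mono_on (hm.integrable_cutoff n).2.2.2 (hm.integrable_cutoff m).2.2.2
      measurableSet_Ioo fun y hy => ?_
    have := rho_pos (p := p) hy
    have := one_sub_sq_pos hy
    exact mul_le_mul_of_nonneg_right (cutoff_le_cutoff hnm hy) (by positivity)
  · have iD := (h.path.mem s hs).integrable_density hp s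
    rw [← iD.2]
    exact tendsto_integral_cutoff_mul iD.1

/-- The functional `F` is absolutely continuous and satisfies the dissipation inequality, and the
functional `H` is nonincreasing. -/
theorem lyapunov (h : IsCharacteristicSolution N p r₀ s₀ w wy ws) (hp : 1 < p)
    (hsm : IsSmallPerturbation N p r₀ s₀) :
    (∀ b, s₀ ≤ b → AbsolutelyContinuousOnInterval
      (fun s => functionalF p (w s) (wy s) (ws s) s) s₀ b) ∧
    (∀ s, s₀ ≤ s → ∀ F' : ℝ,
      HasDerivWithinAt (fun σ => functionalF p (w σ) (wy σ) (ws σ) σ) F' (Ici s) s →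
      IntegrableOn (fun y => ws s y ^ 2 * (rho p y / (1 - y ^ 2))) (Ioo (-1) 1) ∧
      F' ≤ (p + 3) / 2 * Real.exp (-s) * functionalF p (w s) (wy s) (ws s) s
        - 2 / (p - 1) * ∫ y in Ioo (-1) 1, ws s y ^ 2 * (rho p y / (1 - y ^ 2))) ∧
    AntitoneOn (fun s => functionalH p ((p + 3) / 2) (w s) (wy s) (ws s) s) (Ici s₀) := by
  have hd := h.dissipativeLimit hp hsm
  have hα : 0 < 2 / (p - 1) := div_pos (by norm_num) (by linarith)
  refine ⟨fun b hb => hd.absolutelyContinuous hα le_rfl hb, fun s hs F' hF' => ?_, ?_⟩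
  · have hle := fun n => hd.derivWithin_le hα n hs hF'
    have hm := h.path.mem s hs
    -- The bound on the right derivative holds for every truncation with the same constant, so the
    -- dissipation integral is finite at this very time.
    have := integrableOn_of_cutoff (G := fun y => ws s y ^ 2 * (rho p y / (1 - y ^ 2)))
      (C := ((p + 3) / 2 * Real.exp (-s) * functionalF p (w s) (wy s) (ws s) s - F')
        / (2 / (p - 1)))
      ((hm.meas_g.pow 2).mul
        ((contDiffOn_rho_div (p := p)).continuousOn.aestronglyMeasurable measurableSet_Ioo))
      (fun y hy => by
        have := rho_pos (p := p) hy
        have := one_sub_sq_pos hy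
        positivity)
      (fun n => (hm.integrable_cutoff n).2.2.2) (fun n => by
        rw [le_div_iff₀ hα]
        have := hle n
        simp only [truncatedDissipation] at this
        linarith)
    refine ⟨this.1, ?_⟩
    have h2 := this.2
    rw [le_div_iff₀ hα] at h2
    linarith
  -- The integrating factor exp(γ e^{-s}) has logarithmic derivative -γ e^{-s}.
  · refine hd.antitoneOn hα (E := fun s => Real.exp ((p + 3) / 2 * Real.exp (-s))) (fun s => ?_)
      fun s => Real.exp_pos _
    have := (((hasDerivAt_neg s).exp).const_mul ((p + 3) / 2)).exp
    refine this.congr_deriv ?_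
    ring

end IsCharacteristicSolution

/-! ### Energy solutions of the radial wave equation in characteristic form -/

/-- The forcing terms of the radial wave equation. -/
def radialForcing (N : ℕ) (p : ℝ) (u ur : ℝ → ℝ → ℝ) (t r : ℝ) : ℝ :=
  ((N : ℝ) - 1) / r * ur t r + |u t r| ^ (p - 1) * u t r

namespace IsEnergySolutionOnRect

variable {N : ℕ} {u ur ut : ℝ → ℝ → ℝ} {a b t₁ t₂ : ℝ}

theorem l2ContOn (h : IsEnergySolutionOnRect N p u ur ut a b t₁ t₂) :
    L2ContOn (volume.restrict (Ioo a b)) (Icc t₁ t₂) u ∧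
    L2ContOn (volume.restrict (Ioo a b)) (Icc t₁ t₂) ur ∧
    L2ContOn (volume.restrict (Ioo a b)) (Icc t₁ t₂) ut := by
  have hint : ∀ t ∈ Icc t₁ t₂, ∀ τ ∈ Icc t₁ t₂, IntegrableOn (fun r => (u τ r - u t r) ^ 2) (Ioo a b) ∧
      IntegrableOn (fun r => (ur τ r - ur t r) ^ 2) (Ioo a b) ∧
      IntegrableOn (fun r => (ut τ r - ut t r) ^ 2) (Ioo a b) := fun t ht τ hτ =>
    ⟨((h.memLp τ hτ).1.sub (h.memLp t ht).1).integrable_sq,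
      ((h.memLp τ hτ).2.1.sub (h.memLp t ht).2.1).integrable_sq,
      ((h.memLp τ hτ).2.2.sub (h.memLp t ht).2.2).integrable_sq⟩
  have hsum : ∀ t ∈ Icc t₁ t₂, ∀ τ ∈ Icc t₁ t₂, ∫ r in Ioo a b,
      ((u τ r - u t r) ^ 2 + (ur τ r - ur t r) ^ 2 + (ut τ r - ut t r) ^ 2)
      = (∫ r in Ioo a b, (u τ r - u t r) ^ 2) + (∫ r in Ioo a b, (ur τ r - ur t r) ^ 2)
        + ∫ r in Ioo a b, (ut τ r - ut t r) ^ 2 := by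
    intro t ht τ hτ
    obtain ⟨i1, i2, i3⟩ := hint t ht τ hτ
    have i12 : IntegrableOn (fun r => (u τ r - u t r) ^ 2 + (ur τ r - ur t r) ^ 2) (Ioo a b) :=
      i1.add i2
    rw [integral_add i12 i3, integral_add i1 i2]
  have h0 : ∀ f : ℝ → ℝ, 0 ≤ ∫ r in Ioo a b, f r ^ 2 := fun f => integral_nonneg fun r => sq_nonneg _
  refine ⟨.of_integral_sq (fun t ht => (h.memLp t ht).1) fun t ht => ?_,
    .of_integral_sq (fun t ht => (h.memLp t ht).2.1) fun t ht => ?_,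
    .of_integral_sq (fun t ht => (h.memLp t ht).2.2) fun t ht => ?_⟩
  all_goals
    refine tendsto_of_tendsto_of_tendsto_of_le_of_le' tendsto_const_nhds (h.continuous t ht)
      (Eventually.of_forall fun τ => h0 _) ?_
    filter_upwards [self_mem_nhdsWithin] with τ hτ
    rw [hsum t ht τ hτ]
    have := h0 fun r => u τ r - u t r
    have := h0 fun r => ur τ r - ur t r
    have := h0 fun r => ut τ r - ut t r
    linarith

/-- On a bounded interval the derivative is integrable, so the primitive that represents `u t` is
bounded. -/
theorem exists_abs_le (h : IsEnergySolutionOnRect N p u ur ut a b t₁ t₂) (hab : a < b) {t : ℝ}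
    (ht : t ∈ Icc t₁ t₂) : ∃ M, 0 ≤ M ∧ ∀ᵐ r ∂volume.restrict (Ioo a b), |u t r| ≤ M := by
  obtain ⟨hu, hur, -⟩ := h.memLp t ht
  have iu : IntegrableOn (u t) (Ioo a b) := hu.integrable (by norm_num)
  have iur : IntegrableOn (ur t) (Ioo a b) := hur.integrable (by norm_num)
  have hmid : (a + b) / 2 ∈ Ioo a b := ⟨by linarith, by linarith⟩
  obtain ⟨C, hC⟩ := (h.weakDeriv_r t ht).exists_primitive hab iu.locallyIntegrableOn
    iur.locallyIntegrableOn hmid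
  have hn : 0 ≤ ∫ r in Ioo a b, ‖ur t r‖ := integral_nonneg fun _ => norm_nonneg _
  refine ⟨|C| + ∫ r in Ioo a b, ‖ur t r‖, by positivity, ?_⟩
  filter_upwards [hC, ae_restrict_mem measurableSet_Ioo] with r hr hrI
  rw [hr]
  refine (abs_add_le _ _).trans (add_le_add le_rfl ?_)
  refine (Real.norm_eq_abs _).symm.le.trans
    (intervalIntegral.norm_integral_le_integral_norm_uIoc.trans ?_)
  exact setIntegral_mono_set iur.norm (ae_of_all _ fun _ => norm_nonneg _)
    (ae_of_all _ (uIoc_subset_uIcc.trans (ordConnected_Ioo.uIcc_subset hmid hrI)))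

theorem integrable_radialForcing (hp : 1 < p)
    (h : IsEnergySolutionOnRect N p u ur ut a b t₁ t₂) (ha : 0 < a) (hab : a < b) {t : ℝ}
    (ht : t ∈ Icc t₁ t₂) : IntegrableOn (radialForcing N p u ur t) (Ioo a b) := by
  obtain ⟨hu, hur, -⟩ := h.memLp t ht
  obtain ⟨M, hM0, hM⟩ := h.exists_abs_le hab ht
  have iur : IntegrableOn (ur t) (Ioo a b) := hur.integrable (by norm_num)
  refine Integrable.add (iur.bdd_mul (c := |(N : ℝ) - 1| / a)
    (by fun_prop : Measurable fun r : ℝ => ((N : ℝ) - 1) / r).aestronglyMeasurable ?_) ?_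
  · filter_upwards [ae_restrict_mem measurableSet_Ioo] with r hr
    rw [norm_div, Real.norm_eq_abs, Real.norm_of_nonneg (ha.trans hr.1).le]
    gcongr
    exact hr.1.le
  · refine Integrable.of_bound ((continuous_abs_rpow_mul hp).comp_aestronglyMeasurable hu.1)
      (M ^ (p - 1) * M) ?_
    filter_upwards [hM] with r hr
    rw [norm_mul, Real.norm_of_nonneg (Real.rpow_nonneg (abs_nonneg _) _), Real.norm_eq_abs]
    exact mul_le_mul (Real.rpow_le_rpow (abs_nonneg _) hr (by linarith)) hr (abs_nonneg _)
      (Real.rpow_nonneg hM0 _)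

/-- The wave operator factors: ∂ₜ + ∂ᵣ applied to ∂ₜu - ∂ᵣu, and ∂ₜ - ∂ᵣ applied to ∂ₜu + ∂ᵣu, both
equal ∂ₜ²u - ∂ᵣ²u. -/
theorem transports (hp : 1 < p) (h : IsEnergySolutionOnRect N p u ur ut a b t₁ t₂) (ha : 0 < a)
    (hab : a < b) {t : ℝ} (ht : t ∈ Icc t₁ t₂) :
    WeakTransport a b (Icc t₁ t₂) t 0 0 u (ut t) ∧
    WeakTransport a b (Icc t₁ t₂) t 1 0 (fun t r => ut t r - ur t r) (radialForcing N p u ur t) ∧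
    WeakTransport a b (Icc t₁ t₂) t (-1) 0 (fun t r => ut t r + ur t r)
      (radialForcing N p u ur t) := by
  have hI : ∀ {φ f : ℝ → ℝ}, IsTest a b φ → IntegrableOn f (Ioo a b) →
      IntegrableOn (fun r => f r * φ r) (Ioo a b) := fun hφ hf =>
    (integrableOn_mul_test hab hφ hf.locallyIntegrableOn).integrableOn
  have i : ∀ t ∈ Icc t₁ t₂, IntegrableOn (ur t) (Ioo a b) ∧ IntegrableOn (ut t) (Ioo a b) :=
    fun t ht => ⟨(h.memLp t ht).2.1.integrable (by norm_num),
      (h.memLp t ht).2.2.integrable (by norm_num)⟩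
  have iF := h.integrable_radialForcing hp ha hab ht
  -- This is the weak form of ∂ₜ ∂ᵣ u = ∂ᵣ ∂ₜ u, obtained by using φ' as a test function for ∂ₜu.
  have hur : ∀ φ, IsTest a b φ → HasDerivWithinAt (fun τ => ∫ r in Ioo a b, ur τ r * φ r)
      (-∫ r in Ioo a b, ut t r * deriv φ r) (Icc t₁ t₂) t := by
    intro φ hφ
    refine ((h.weakDeriv_t _ hφ.deriv t ht).neg).congr_of_mem (fun τ hτ => ?_) ht
    rw [Pi.neg_apply, h.weakDeriv_r τ hτ φ hφ, neg_neg]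
  have hut : ∀ φ, IsTest a b φ → HasDerivWithinAt (fun τ => ∫ r in Ioo a b, ut τ r * φ r)
      (-(∫ r in Ioo a b, ur t r * deriv φ r) + ∫ r in Ioo a b, radialForcing N p u ur t r * φ r)
      (Icc t₁ t₂) t := by
    intro φ hφ
    refine (h.equation φ hφ t ht).congr_deriv ?_
    have i1 : IntegrableOn (fun r => -(ur t r * deriv φ r)) (Ioo a b) :=
      (hI hφ.deriv (i t ht).1).neg
    rw [← integral_neg, ← integral_add i1 (hI hφ iF)]
    refine integral_congr_ae (ae_of_all _ fun r => ?_)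
    simp only [radialForcing]
    ring
  refine ⟨fun φ hφ => by simpa using h.weakDeriv_t φ hφ t ht, fun φ hφ => ?_, fun φ hφ => ?_⟩
  · refine (((hut φ hφ).sub (hur φ hφ)).congr_of_mem (fun τ hτ => ?_) ht).congr_deriv ?_
    · simp only [Pi.sub_apply, sub_mul]
      rw [integral_sub (hI hφ (i τ hτ).2) (hI hφ (i τ hτ).1)]
    · have e : ∀ r, (ut t r - ur t r) * (0 * φ r + (1 + 0 * r) * deriv φ r)
          + radialForcing N p u ur t r * φ r = (ut t r * deriv φ r - ur t r * deriv φ r)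
            + radialForcing N p u ur t r * φ r := fun r => by ring
      simp only [e]
      have i1 : IntegrableOn (fun r => ut t r * deriv φ r - ur t r * deriv φ r) (Ioo a b) :=
        (hI hφ.deriv (i t ht).2).sub (hI hφ.deriv (i t ht).1)
      rw [integral_add i1 (hI hφ iF), integral_sub (hI hφ.deriv (i t ht).2)
        (hI hφ.deriv (i t ht).1)]
      ring
  · refine (((hut φ hφ).add (hur φ hφ)).congr_of_mem (fun τ hτ => ?_) ht).congr_deriv ?_
    · simp only [Pi.add_apply, add_mul]
      rw [integral_add (hI hφ (i τ hτ).2) (hI hφ (i τ hτ).1)]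
    · have e : ∀ r, (ut t r + ur t r) * (0 * φ r + (-1 + 0 * r) * deriv φ r)
          + radialForcing N p u ur t r * φ r = -(ut t r * deriv φ r + ur t r * deriv φ r)
            + radialForcing N p u ur t r * φ r := fun r => by ring
      simp only [e]
      have i1 : IntegrableOn (fun r => ut t r * deriv φ r + ur t r * deriv φ r) (Ioo a b) :=
        (hI hφ.deriv (i t ht).2).add (hI hφ.deriv (i t ht).1)
      have i2 : IntegrableOn (fun r => -(ut t r * deriv φ r + ur t r * deriv φ r)) (Ioo a b) :=
        i1.neg
      rw [integral_add i2 (hI hφ iF), integral_neg, integral_add (hI hφ.deriv (i t ht).2)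
        (hI hφ.deriv (i t ht).1)]
      ring

end IsEnergySolutionOnRect

/-! ### Passage to similarity variables -/

/-- Since T is 1-Lipschitz, the domain contains the backward light cone with vertex (r₀, T(r₀)). The
points with |y| ≤ η < 1 lie strictly inside the cone, so a rectangle around them fits below the
graph; exp(-sm) < r₀ keeps it off the axis. -/
theorem exists_rect {N : ℕ} {r₀ sm : ℝ} {T : ℝ → ℝ} {u ur ut : ℝ → ℝ → ℝ}
    (hr : Real.exp (-sm) < r₀) (hT : LipschitzOnWith 1 T (Ici 0)) (hsm : Real.exp (-sm) ≤ T r₀)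
    (hu : ∀ a b t₁ t₂ : ℝ, a < b → t₁ < t₂ →
      Icc a b ×ˢ Icc t₁ t₂ ⊆ influenceDomain T → IsEnergySolutionOnRect N p u ur ut a b t₁ t₂)
    {s η : ℝ} (hs : s ∈ Ici sm) (hη : 0 ≤ η) (hη1 : η < 1) :
    ∃ a b t₁ t₂, 0 < a ∧ a < r₀ - Real.exp (-s) * η ∧ r₀ + Real.exp (-s) * η < b ∧
      IsEnergySolutionOnRect N p u ur ut a b t₁ t₂ ∧
      ∀ᶠ σ in 𝓝[Ici sm] s, T r₀ - Real.exp (-σ) ∈ Icc t₁ t₂ := by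
  have he := Real.exp_pos (-s)
  have hes : Real.exp (-s) ≤ Real.exp (-sm) := Real.exp_le_exp.2 (by linarith [mem_Ici.1 hs])
  -- The half-width uses a factor θ between η and 1, and the top time a factor between θ and 1. The
  -- first gap leaves room in space, the second places the rectangle under the graph and leaves room
  -- for times slightly later than s.
  set θ := (1 + η) / 2 with hθ
  have hθη : η < θ := by linarith
  have hθ1 : θ < 1 := by linarith
  have hr0 : 0 < r₀ := (Real.exp_pos _).trans hr
  have h1 := mul_lt_mul_of_pos_left hθη he
  have h2 := mul_lt_mul_of_pos_left hθ1 he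
  have h3 : Real.exp (-s) * ((1 + θ) / 2) < Real.exp (-s) * 1 :=
    mul_lt_mul_of_pos_left (by linarith) he
  have h4 : Real.exp (-s) * θ < Real.exp (-s) * ((1 + θ) / 2) :=
    mul_lt_mul_of_pos_left (by linarith) he
  have h5 : 0 ≤ Real.exp (-s) * η := by positivity
  refine ⟨r₀ - Real.exp (-s) * θ, r₀ + Real.exp (-s) * θ, T r₀ - Real.exp (-sm),
    T r₀ - Real.exp (-s) * ((1 + θ) / 2), by linarith, by linarith, by linarith,
    hu _ _ _ _ (by linarith) (by linarith) ?_, ?_⟩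
  · rintro ⟨r, t⟩ ⟨hrI, htI⟩
    simp only [mem_Icc] at hrI htI
    have hr1 : 0 < r := by linarith
    refine ⟨hr1, by simp only; linarith, ?_⟩
    have hL := hT.dist_le_mul r₀ hr0.le r hr1.le
    rw [Real.dist_eq, Real.dist_eq, NNReal.coe_one, one_mul] at hL
    have h6 : |r₀ - r| ≤ Real.exp (-s) * θ := abs_le.2 ⟨by linarith, by linarith⟩
    have h7 := (abs_le.1 (hL.trans h6)).2
    simp only
    linarith
  · have hc : Tendsto (fun σ => Real.exp (-σ)) (𝓝[Ici sm] s) (𝓝 (Real.exp (-s))) :=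
      ((by fun_prop : Continuous fun σ : ℝ => Real.exp (-σ)).tendsto s).mono_left
        nhdsWithin_le_nhds
    filter_upwards [hc.eventually (lt_mem_nhds (by linarith :
      Real.exp (-s) * ((1 + θ) / 2) < Real.exp (-s))), self_mem_nhdsWithin] with σ hσ hσm
    have := Real.exp_le_exp.2 (by linarith [mem_Ici.1 hσm] : -σ ≤ -sm)
    exact ⟨by linarith, by linarith⟩

theorem IsWeakDeriv.integral_comp_affine {a b A B c l : ℝ} {f g φ : ℝ → ℝ}
    (h : IsWeakDeriv a b f g) (hl : 0 < l) (hφ : IsTest A B φ) (ha : a ≤ c + l * A)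
    (hb : c + l * B ≤ b) :
    ∫ y, f (c + l * y) * deriv φ y = -∫ y, l * g (c + l * y) * φ y := by
  have hψ := hφ.comp_affine hl ha hb
  have e : ∀ y : ℝ, -c / l + 1 / l * (c + l * y) = y := fun y => by field_simp; ring
  have hd : ∀ x, deriv (fun x => φ (-c / l + 1 / l * x)) x
      = 1 / l * deriv φ (-c / l + 1 / l * x) := fun x => by
    have h1 : HasDerivAt (fun x : ℝ => -c / l + 1 / l * x) (1 / l) x := by
      simpa using ((hasDerivAt_id x).const_mul (1 / l)).const_add (-c / l)
    have h2 : HasDerivAt (fun x => φ (-c / l + 1 / l * x)) (deriv φ (-c / l + 1 / l * x) * (1 / l))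
        x := (hφ.differentiable _).hasDerivAt.comp x h1
    rw [h2.deriv, mul_comm]
  have hw := h _ hψ
  rw [hψ.deriv.setIntegral_mul f, hψ.setIntegral_mul g,
    RadialWave.integral_comp_affine _ c hl, RadialWave.integral_comp_affine (fun x => g x * _) c hl] at hw
  simp only [hd, e] at hw
  convert! hw using 2
  · ext y
    field_simp
  · refine integral_congr_ae (ae_of_all _ fun y => ?_)
    simp only
    ring

theorem memLp_comp_affine_restrict {a b A B c l : ℝ} {f : ℝ → ℝ}
    (hf : MemLp f 2 (volume.restrict (Ioo a b))) (hl : 0 < l) (ha : a < c + l * A)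
    (hb : c + l * B < b) : MemLp (fun y => f (c + l * y)) 2 (volume.restrict (Icc A B)) := by
  have h1 := memLp_comp_affine ((memLp_indicator_iff_restrict measurableSet_Ioo).2 hf) c hl
  refine (memLp_congr_ae ?_).1 (h1.restrict (Icc A B))
  filter_upwards [ae_restrict_mem measurableSet_Icc] with y hy
  have hm : c + l * y ∈ Ioo a b :=
    ⟨ha.trans_le (by gcongr; exact hy.1), lt_of_le_of_lt (by gcongr; exact hy.2) hb⟩
  exact indicator_of_mem hm f

/-- Around each time the solution is controlled on rectangles that contain the images of the compact
subintervals of `(-1, 1)`. -/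
def HasRects (N : ℕ) (p r₀ T₀ sm : ℝ) (u ur ut : ℝ → ℝ → ℝ) : Prop :=
  ∀ s ∈ Ici sm, ∀ η, 0 ≤ η → η < 1 →
    ∃ a b t₁ t₂, 0 < a ∧ a < r₀ - Real.exp (-s) * η ∧ r₀ + Real.exp (-s) * η < b ∧
      IsEnergySolutionOnRect N p u ur ut a b t₁ t₂ ∧
      ∀ᶠ σ in 𝓝[Ici sm] s, T₀ - Real.exp (-σ) ∈ Icc t₁ t₂

namespace HasRects

variable {N : ℕ} {r₀ T₀ sm : ℝ} {u ur ut : ℝ → ℝ → ℝ}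

theorem exists_rect_Icc (h : HasRects N p r₀ T₀ sm u ur ut) {s A B : ℝ} (hs : s ∈ Ici sm)
    (hA : -1 < A) (hAB : A ≤ B) (hB : B < 1) :
    ∃ a b t₁ t₂, 0 < a ∧ a < b ∧ a < r₀ + Real.exp (-s) * A ∧ r₀ + Real.exp (-s) * B < b ∧
      IsEnergySolutionOnRect N p u ur ut a b t₁ t₂ ∧
      ∀ᶠ σ in 𝓝[Ici sm] s, T₀ - Real.exp (-σ) ∈ Icc t₁ t₂ := by
  obtain ⟨a, b, t₁, t₂, h1, h2, h3, h4, h5⟩ := h s hs (max |A| |B|)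
    ((abs_nonneg _).trans (le_max_left _ _))
    (max_lt (abs_lt.2 ⟨hA, hAB.trans_lt hB⟩) (abs_lt.2 ⟨hA.trans_le hAB, hB⟩))
  have he := (Real.exp_pos (-s)).le
  have hA' : -(max |A| |B|) ≤ A := (neg_le_neg (le_max_left _ _)).trans (neg_abs_le A)
  have hB' : B ≤ max |A| |B| := (le_abs_self B).trans (le_max_right _ _)
  have k1 := mul_le_mul_of_nonneg_left hA' he
  have k2 := mul_le_mul_of_nonneg_left hB' he
  have k3 := mul_le_mul_of_nonneg_left hAB he
  exact ⟨a, b, t₁, t₂, h1, by linarith, by linarith, by linarith, h4, h5⟩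

/-- The change t = T₀ - e^{-σ}, r = r₀ + e^{-σ} y turns the velocity v₀ into v₀ + y, because the
dilation rate e^{-σ} decays at unit rate. -/
theorem weakTransport (h : HasRects N p r₀ T₀ sm u ur ut) {g G : ℝ → ℝ → ℝ} {v₀ : ℝ}
    (hg : ∀ {a b t₁ t₂ : ℝ}, 0 < a → a < b → IsEnergySolutionOnRect N p u ur ut a b t₁ t₂ →
      L2ContOn (volume.restrict (Ioo a b)) (Icc t₁ t₂) g ∧ ∀ t ∈ Icc t₁ t₂,
        WeakTransport a b (Icc t₁ t₂) t v₀ 0 g (G t) ∧ IntegrableOn (G t) (Ioo a b))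
    (k : ℝ) {s : ℝ} (hs : s ∈ Ici sm) :
    WeakTransport (-1) 1 (Ici sm) s v₀ 1
      (fun σ y => Real.exp (-(k * σ)) * g (T₀ - Real.exp (-σ)) (r₀ + Real.exp (-σ) * y))
      (fun y => -k * Real.exp (-(k * s)) * g (T₀ - Real.exp (-s)) (r₀ + Real.exp (-s) * y)
        + Real.exp (-(k * s)) * Real.exp (-s)
          * G (T₀ - Real.exp (-s)) (r₀ + Real.exp (-s) * y)) := by
  intro φ hφ
  obtain ⟨A, B, hA, hAB, hB, hφ'⟩ := hφ.exists_shrink (by norm_num)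
  obtain ⟨a, b, t₁, t₂, ha, hab, h1, h2, h3, h4⟩ := h.exists_rect_Icc hs hA hAB.le hB
  obtain ⟨hL, hT⟩ := hg ha hab h3
  have hts := h4.self_of_nhdsWithin hs
  have hexp : ∀ k : ℝ, HasDerivWithinAt (fun σ => Real.exp (-(k * σ))) (-k * Real.exp (-(k * s)))
      (Ici sm) s := fun k => by
    have := (((hasDerivAt_id s).const_mul k).neg.exp).hasDerivWithinAt (s := Ici sm)
    refine this.congr_deriv ?_
    simp [mul_comm]
  have hexp1 : HasDerivWithinAt (fun σ => Real.exp (-σ)) (-Real.exp (-s)) (Ici sm) s := by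
    simpa using hexp 1
  have he := Real.exp_pos (-s)
  have hCV := (hT _ hts).1.comp_affine hab hL (hT _ hts).2.locallyIntegrableOn
    (τ := fun σ => T₀ - Real.exp (-σ)) (m := fun σ => Real.exp (-(k * σ))) (c := fun _ => r₀)
    (l := fun σ => Real.exp (-σ)) (τ' := Real.exp (-s)) (by simpa using hexp1.const_sub T₀) (hexp k)
    (hasDerivWithinAt_const _ _ _) hexp1 he hs h4 hφ' h1 h2
  refine (hCV.congr_of_mem (fun σ _ => hφ.setIntegral_mul _) hs).congr_deriv ?_
  rw [← setIntegral_eq_integral_of_forall_compl_eq_zero (s := Ioo (-1 : ℝ) 1)]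
  · refine integral_congr_ae (ae_of_all _ fun y => ?_)
    simp only [mul_zero, zero_mul, zero_sub, sub_zero, add_zero, neg_neg]
    field_simp
  · intro y hy
    simp [hφ.zero_of_notMem hy, hφ.deriv_zero_of_notMem hy]

theorem locMemL2 (h : HasRects N p r₀ T₀ sm u ur ut) {g : ℝ → ℝ → ℝ}
    (hg : ∀ {a b t₁ t₂ : ℝ}, IsEnergySolutionOnRect N p u ur ut a b t₁ t₂ →
      ∀ t ∈ Icc t₁ t₂, MemLp (g t) 2 (volume.restrict (Ioo a b)))
    {s : ℝ} (hs : s ∈ Ici sm) :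
    LocMemL2 fun y => g (T₀ - Real.exp (-s)) (r₀ + Real.exp (-s) * y) := by
  intro c d hc hd
  rcases lt_or_ge d c with hcd | hcd
  · simp [Icc_eq_empty_of_lt hcd]
  obtain ⟨a, b, t₁, t₂, ha, hab, h1, h2, h3, h4⟩ := h.exists_rect_Icc hs hc hcd hd
  exact memLp_comp_affine_restrict (hg h3 _ (h4.self_of_nhdsWithin hs)) (Real.exp_pos _) h1 h2

end HasRects

theorem similarity_eq (r₀ T₀ : ℝ) (u : ℝ → ℝ → ℝ) (s y : ℝ) :
    similarity p r₀ T₀ u s y = Real.exp (-(2 / (p - 1) * s))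
      * u (T₀ - Real.exp (-s)) (r₀ + Real.exp (-s) * y) := by
  rw [similarity, ← Real.exp_mul, mul_comm y]
  congr 2
  ring

/-- A solution of the radial wave equation, in similarity variables, is a solution in characteristic
form. -/
theorem HasRects.isCharacteristicSolution (hp : 1 < p) {N : ℕ} {r₀ T₀ sm : ℝ}
    {u ur ut w wy ws : ℝ → ℝ → ℝ} (h : HasRects N p r₀ T₀ sm u ur ut)
    (hw : w = similarity p r₀ T₀ u) (hpath : IsEnergyPath p (Ici sm) w wy ws) :
    IsCharacteristicSolution N p r₀ sm w wy ws := by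
  have hab : (-1 : ℝ) < 1 := by norm_num
  set α := 2 / (p - 1) with hα
  have hp1 : p - 1 ≠ 0 := by linarith
  have hw' : ∀ s y, w s y = Real.exp (-(α * s))
      * u (T₀ - Real.exp (-s)) (r₀ + Real.exp (-s) * y) := fun s y => by
    rw [hw, similarity_eq]
  have hexp : ∀ s, Real.exp (-((α + 1) * s)) = Real.exp (-(α * s)) * Real.exp (-s) := fun s => by
    rw [← Real.exp_add]; ring_nf
  have lr : ∀ s ∈ Ici sm, LocMemL2 fun y => ur (T₀ - Real.exp (-s)) (r₀ + Real.exp (-s) * y) :=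
    fun s hs => h.locMemL2 (fun h t ht => (h.memLp t ht).2.1) hs
  have lt : ∀ s ∈ Ici sm, LocMemL2 fun y => ut (T₀ - Real.exp (-s)) (r₀ + Real.exp (-s) * y) :=
    fun s hs => h.locMemL2 (fun h t ht => (h.memLp t ht).2.2) hs
  -- The given derivatives of w are identified with the rescaled derivatives of u by uniqueness of
  -- weak derivatives.
  have hwy : ∀ s ∈ Ici sm, wy s =ᵐ[volume.restrict (Ioo (-1) 1)] fun y =>
      Real.exp (-((α + 1) * s)) * ur (T₀ - Real.exp (-s)) (r₀ + Real.exp (-s) * y) := by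
    intro s hs
    have l1 : LocMemL2 fun y =>
        Real.exp (-((α + 1) * s)) * ur (T₀ - Real.exp (-s)) (r₀ + Real.exp (-s) * y) :=
      fun c d hc hd => (lr s hs c d hc hd).const_mul _
    refine ae_eq_of_integral_test_eq hab (hpath.mem s hs).locMemL2.2.1.locallyIntegrableOn
      l1.locallyIntegrableOn fun φ hφ => ?_
    obtain ⟨A, B, hA, hAB, hB, hφ'⟩ := hφ.exists_shrink hab
    obtain ⟨a, b, t₁, t₂, -, -, h1, h2, h3, h4⟩ := h.exists_rect_Icc hs hA hAB.le hB
    have k1 := (h3.weakDeriv_r _ (h4.self_of_nhdsWithin hs)).integral_comp_affine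
      (Real.exp_pos (-s)) hφ' h1.le h2.le
    have k2 := (hpath.mem s hs).weakDeriv φ hφ
    rw [hφ.deriv.setIntegral_mul] at k2
    have k3 : ∫ y, w s y * deriv φ y = Real.exp (-(α * s))
        * ∫ y, u (T₀ - Real.exp (-s)) (r₀ + Real.exp (-s) * y) * deriv φ y := by
      rw [← integral_const_mul]
      simp only [hw', mul_assoc]
    rw [k3, k1] at k2
    rw [hφ.setIntegral_mul fun y => _ * _, ← neg_inj, ← k2, mul_neg, ← integral_const_mul]
    simp only [hexp, mul_assoc]
  have lu : ∀ {a b t₁ t₂ : ℝ}, IsEnergySolutionOnRect N p u ur ut a b t₁ t₂ → ∀ t ∈ Icc t₁ t₂,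
      IntegrableOn (ut t) (Ioo a b) := fun h t ht => (h.memLp t ht).2.2.integrable (by norm_num)
  -- The chain rule in weak form. The transport of w has velocity y; integrating by parts moves that
  -- velocity into the term -y ∂_y w. Uniqueness of derivatives within the half-line then identifies
  -- the two time derivatives.
  have hws : ∀ s ∈ Ici sm, ws s =ᵐ[volume.restrict (Ioo (-1) 1)] fun y =>
      -α * w s y + Real.exp (-((α + 1) * s)) * ut (T₀ - Real.exp (-s)) (r₀ + Real.exp (-s) * y)
        - y * wy s y := by
    intro s hs
    obtain ⟨l1, l2, l3⟩ := (hpath.mem s hs).locMemL2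
    have l4 : LocMemL2 fun y => y * wy s y := fun c d hc hd => by
      refine (l2 c d hc hd).of_le_mul (c := 1) ((continuous_id.aestronglyMeasurable).mul
        (l2 c d hc hd).1) ?_
      filter_upwards [ae_restrict_mem measurableSet_Icc] with y hy
      rw [norm_mul]
      gcongr
      exact abs_le.2 ⟨by linarith [hy.1], by linarith [hy.2]⟩
    have l5 : LocMemL2 fun y => -α * w s y
        + Real.exp (-((α + 1) * s)) * ut (T₀ - Real.exp (-s)) (r₀ + Real.exp (-s) * y) :=
      fun c d hc hd => ((l1 c d hc hd).const_mul _).add ((lt s hs c d hc hd).const_mul _)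
    have l6 : LocMemL2 fun y => -α * w s y
        + Real.exp (-((α + 1) * s)) * ut (T₀ - Real.exp (-s)) (r₀ + Real.exp (-s) * y)
        - y * wy s y := fun c d hc hd => (l5 c d hc hd).sub (l4 c d hc hd)
    refine ae_eq_of_integral_test_eq hab l3.locallyIntegrableOn l6.locallyIntegrableOn
      fun φ hφ => ?_
    have hT := h.weakTransport (g := u) (G := ut) (v₀ := 0) (fun ha hab h3 => ⟨h3.l2ContOn.1,
      fun t ht => ⟨(h3.transports hp ha hab ht).1, lu h3 t ht⟩⟩) α hs φ hφ
    simp only [← hw'] at hT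
    have hD := (uniqueDiffOn_Ici sm s hs).eq_deriv _ (hpath.weakDeriv_s φ hφ s hs) hT
    rw [hD]
    have hφy : IsTest (-1) 1 fun y => y * φ y := hφ.mul_left (k := fun y => y) (by fun_prop)
    have hdy : ∀ y, deriv (fun y => y * φ y) y = 1 * φ y + (0 + 1 * y) * deriv φ y := fun y => by
      have h2 : HasDerivAt (fun y => y * φ y) (1 * φ y + y * deriv φ y) y :=
        (hasDerivAt_id y).mul (hφ.differentiable y).hasDerivAt
      rw [h2.deriv]
      ring
    have k2 := (hpath.mem s hs).weakDeriv _ hφy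
    simp only [hdy] at k2
    have ht : IsTest (-1) 1 fun y => 1 * φ y + (0 + 1 * y) * deriv φ y := by
      have := hφy.deriv
      simpa only [funext hdy] using this
    have i1 : IntegrableOn (fun y => w s y * (1 * φ y + (0 + 1 * y) * deriv φ y)) (Ioo (-1) 1) :=
      (integrableOn_mul_test hab ht l1.locallyIntegrableOn).integrableOn
    have i2 : IntegrableOn (fun y => (-α * w s y
        + Real.exp (-((α + 1) * s)) * ut (T₀ - Real.exp (-s)) (r₀ + Real.exp (-s) * y)) * φ y)
        (Ioo (-1) 1) := (integrableOn_mul_test hab hφ l5.locallyIntegrableOn).integrableOn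
    have i3 : IntegrableOn (fun y => wy s y * (y * φ y)) (Ioo (-1) 1) :=
      (integrableOn_mul_test hab hφy l2.locallyIntegrableOn).integrableOn
    have e1 : ∀ y, (-α * Real.exp (-(α * s)) * u (T₀ - Real.exp (-s)) (r₀ + Real.exp (-s) * y)
        + Real.exp (-(α * s)) * Real.exp (-s)
          * ut (T₀ - Real.exp (-s)) (r₀ + Real.exp (-s) * y)) * φ y
        = (-α * w s y + Real.exp (-((α + 1) * s))
          * ut (T₀ - Real.exp (-s)) (r₀ + Real.exp (-s) * y)) * φ y := fun y => by
      rw [hw', hexp]; ring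
    simp only [e1]
    rw [integral_add i1 i2, k2, ← integral_neg]
    have i3' : IntegrableOn (fun y => -(wy s y * (y * φ y))) (Ioo (-1) 1) := i3.neg
    rw [← integral_add i3' i2]
    refine integral_congr_ae (ae_of_all _ fun y => ?_)
    simp only
    ring
  -- The exponents balance because α(p-1) = 2.
  have hF : ∀ s y, Real.exp (-((α + 1) * s)) * Real.exp (-s)
      * (|u (T₀ - Real.exp (-s)) (r₀ + Real.exp (-s) * y)| ^ (p - 1)
        * u (T₀ - Real.exp (-s)) (r₀ + Real.exp (-s) * y)) = |w s y| ^ (p - 1) * w s y := by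
    intro s y
    rw [hw', abs_mul, abs_of_pos (Real.exp_pos _), Real.mul_rpow (Real.exp_pos _).le (abs_nonneg _),
      ← Real.exp_mul, hexp, show -(α * s) * (p - 1) = -s + -s by rw [hα]; field_simp; ring,
      Real.exp_add]
    ring
  refine ⟨hpath, fun s hs => ?_, fun s hs => ?_⟩
  -- By the two identifications, e^{-(α+1)s} (∂ₜu - ∂ᵣu) equals ∂ₛw + (y-1) ∂_y w + α w almost
  -- everywhere.
  · refine (h.weakTransport (g := fun t r => ut t r - ur t r) (G := radialForcing N p u ur)
      (v₀ := 1) (fun ha hab h3 => ⟨?_, fun t ht => ⟨(h3.transports hp ha hab ht).2.1,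
        h3.integrable_radialForcing hp ha hab ht⟩⟩) (α + 1) hs).congr_ae hs (fun σ hσ => ?_) ?_
    · simpa [sub_eq_add_neg] using h3.l2ContOn.2.2.add (h3.l2ContOn.2.1.const_mul (-1))
    · filter_upwards [hwy σ hσ, hws σ hσ] with y h1 h2
      rw [h2, h1]
      ring
    · filter_upwards [hwy s hs, hws s hs] with y h1 h2
      rw [h2, forcing, ← hF, h1, radialForcing, mul_comm y (Real.exp (-s))]
      ring
  · refine (h.weakTransport (g := fun t r => ut t r + ur t r) (G := radialForcing N p u ur)
      (v₀ := -1) (fun ha hab h3 => ⟨?_, fun t ht => ⟨(h3.transports hp ha hab ht).2.2,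
        h3.integrable_radialForcing hp ha hab ht⟩⟩) (α + 1) hs).congr_ae hs (fun σ hσ => ?_) ?_
    · exact h3.l2ContOn.2.2.add h3.l2ContOn.2.1
    · filter_upwards [hwy σ hσ, hws σ hσ] with y h1 h2
      rw [h2, h1]
      ring
    · filter_upwards [hwy s hs, hws s hs] with y h1 h2
      rw [h2, forcing, ← hF, h1, radialForcing, mul_comm y (Real.exp (-s))]
      ring

/-! ### Characteristic form of the equation in similarity variables -/

theorem deriv_affine_mul {φ : ℝ → ℝ} (hφ : Differentiable ℝ φ) (c y : ℝ) :
    deriv (fun y => (y + c) * φ y) y = φ y + (y + c) * deriv φ y := by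
  have h2 : HasDerivAt (fun y => (y + c) * φ y) (1 * φ y + (y + c) * deriv φ y) y :=
    ((hasDerivAt_id y).add_const c).mul (hφ y).hasDerivAt
  rw [h2.deriv, one_mul]

theorem contDiffOn_inv_rho : ContDiffOn ℝ ∞ (fun y => (rho p y)⁻¹) (Ioo (-1) 1) :=
  (contDiffOn_rho (p := p)).inv fun _ hy => (rho_pos hy).ne'

/-- The tested form of the equation, against an unweighted test function. -/
theorem IsSimilaritySolution.hasDerivWithinAt (hp : 1 < p) {N : ℕ} {r₀ s₀ : ℝ}
    {w wy ws : ℝ → ℝ → ℝ} (h : IsSimilaritySolution N p r₀ (Ici s₀) w wy ws) {φ : ℝ → ℝ}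
    (hφ : IsTest (-1) 1 φ) {s : ℝ} (hs : s ∈ Ici s₀) :
    HasDerivWithinAt (fun σ => ∫ y in Ioo (-1) 1, ws σ y * φ y)
      (∫ y in Ioo (-1) 1,
        (-(wy s y * ((1 - y ^ 2) * deriv φ y + 2 * (2 / (p - 1)) * y * φ y))
          - 2 / (p - 1) * (2 / (p - 1) + 1) * (w s y * φ y)
          + forcing N p r₀ w wy s y * φ y
          + ws s y * ((1 - 2 * (2 / (p - 1))) * φ y + 2 * y * deriv φ y))) (Ici s₀) s := by
  have hp1 : p - 1 ≠ 0 := by linarith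
  -- The weight is smooth and positive on the open interval, so dividing by it gives an admissible
  -- test function and removes ρ from the equation.
  have hχ : IsTest (-1) 1 fun y => (rho p y)⁻¹ * φ y := hφ.mul_left_of_contDiffOn contDiffOn_inv_rho
  have hcancel : ∀ y ∈ Ioo (-1 : ℝ) 1, rho p y * ((rho p y)⁻¹ * φ y) = φ y := fun y hy =>
    mul_inv_cancel_left₀ (rho_pos hy).ne' _
  refine ((h.equation _ hχ s hs).congr_of_mem (fun σ _ => ?_) hs).congr_deriv ?_
  · refine setIntegral_congr_fun measurableSet_Ioo fun y hy => ?_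
    simp only [hcancel y hy]
  · refine setIntegral_congr_fun measurableSet_Ioo fun y hy => ?_
    have hq := one_sub_sq_pos hy
    have hρ := rho_pos (p := p) hy
    have d1 : HasDerivAt (fun y => (rho p y)⁻¹ * φ y)
        (-(-(2 * (2 / (p - 1)) * y) * (rho p y / (1 - y ^ 2))) / rho p y ^ 2 * φ y
          + (rho p y)⁻¹ * deriv φ y) y :=
      ((hasDerivAt_rho hy).inv hρ.ne').mul (hφ.differentiable y).hasDerivAt
    have d2 : deriv (fun x => 2 * x * (rho p x * ((rho p x)⁻¹ * φ x))) y
        = 2 * φ y + 2 * y * deriv φ y := by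
      have e : (fun x => 2 * x * (rho p x * ((rho p x)⁻¹ * φ x))) =ᶠ[𝓝 y] fun x => 2 * x * φ x := by
        filter_upwards [isOpen_Ioo.mem_nhds hy] with x hx
        rw [hcancel x hx]
      have d3 : HasDerivAt (fun x => 2 * x * φ x) (2 * 1 * φ y + 2 * y * deriv φ y) y :=
        ((hasDerivAt_id y).const_mul 2).mul (hφ.differentiable y).hasDerivAt
      rw [e.deriv_eq, d3.deriv, mul_one]
    simp only [hcancel y hy, d1.deriv, d2, forcing]
    have e1 : rho p y * (1 - y ^ 2) * wy s y
        * (-(-(2 * (2 / (p - 1)) * y) * (rho p y / (1 - y ^ 2))) / rho p y ^ 2 * φ y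
          + (rho p y)⁻¹ * deriv φ y)
        = wy s y * ((1 - y ^ 2) * deriv φ y + 2 * (2 / (p - 1)) * y * φ y) := by
      field_simp
      ring
    have e2 : 2 * (p + 1) / (p - 1) ^ 2 = 2 / (p - 1) * (2 / (p - 1) + 1) := by
      field_simp; ring
    have e3 : (p + 3) / (p - 1) = 1 + 2 * (2 / (p - 1)) := by
      field_simp; ring
    rw [e1, e2, e3]
    ring

/-- The product (∂ₛ + (y+κ)∂_y)(∂ₛ + (y-κ)∂_y) has ∂_y² coefficient y² - κ², which is the -(1-y²) of
the equation exactly when κ² = 1. The first order terms match thanks to the shift by α w. -/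
theorem IsSimilaritySolution.weakTransport (hp : 1 < p) {N : ℕ} {r₀ s₀ : ℝ}
    {w wy ws : ℝ → ℝ → ℝ} (h : IsSimilaritySolution N p r₀ (Ici s₀) w wy ws)
    (hr : Real.exp (-s₀) < r₀) {κ : ℝ} (hκ : κ ^ 2 = 1) {s : ℝ} (hs : s ∈ Ici s₀) :
    WeakTransport (-1) 1 (Ici s₀) s κ 1
      (fun s y => ws s y + (y + -κ) * wy s y + 2 / (p - 1) * w s y)
      (fun y => forcing N p r₀ w wy s y
        - (2 / (p - 1) + 1) * (ws s y + (y + -κ) * wy s y + 2 / (p - 1) * w s y)) := by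
  intro φ hφ
  have hab : (-1 : ℝ) < 1 := by norm_num
  set α := 2 / (p - 1)
  obtain ⟨c1, c2, c3⟩ := h.path.locL2ContOn
  have hm : ∀ c, IsTest (-1) 1 fun y => (y + c) * φ y := fun c => hφ.mul_left (by fun_prop)
  have hmd : ∀ c, IsTest (-1) 1 fun y => φ y + (y + c) * deriv φ y := fun c => by
    simpa only [funext (deriv_affine_mul hφ.differentiable c)] using (hm c).deriv
  have ii : ∀ {f ψ : ℝ → ℝ}, LocallyIntegrableOn f (Ioo (-1) 1) → IsTest (-1) 1 ψ →
      IntegrableOn (fun y => f y * ψ y) (Ioo (-1) 1) := fun hf hψ =>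
    (integrableOn_mul_test hab hψ hf).integrableOn
  have hwd : ∀ σ ∈ Ici s₀, ∀ c, ∫ y in Ioo (-1) 1, wy σ y * ((y + c) * φ y)
      = -∫ y in Ioo (-1) 1, w σ y * (φ y + (y + c) * deriv φ y) := fun σ hσ c => by
    have := (h.path.mem σ hσ).weakDeriv _ (hm c)
    simp only [deriv_affine_mul hφ.differentiable] at this
    rw [this, neg_neg]
  have hD := ((h.hasDerivWithinAt hp hφ hs).sub (h.path.weakDeriv_s _ (hmd (-κ)) s hs)).add
    ((h.path.weakDeriv_s φ hφ s hs).const_mul α)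
  refine (hD.congr_of_mem (fun σ hσ => ?_) hs).congr_deriv ?_
  · have i1 := ii (c3.locallyIntegrableOn hσ) hφ
    have i2 := ii (c2.locallyIntegrableOn hσ) (hm (-κ))
    have i3 := ii (c1.locallyIntegrableOn hσ) hφ
    have i12 : IntegrableOn (fun y => ws σ y * φ y + wy σ y * ((y + -κ) * φ y)) (Ioo (-1) 1) :=
      i1.add i2
    have i3' : IntegrableOn (fun y => α * (w σ y * φ y)) (Ioo (-1) 1) := i3.const_mul α
    simp only [Pi.add_apply, Pi.sub_apply]
    rw [sub_eq_add_neg, ← hwd σ hσ, ← integral_const_mul, ← integral_add i1 i2,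
      ← integral_add i12 i3']
    refine integral_congr_ae (ae_of_all _ fun y => ?_)
    simp only
    ring
  · have l1 := c1.locallyIntegrableOn hs
    have l2 := c2.locallyIntegrableOn hs
    have l3 := c3.locallyIntegrableOn hs
    have l4 := (h.path.locL2ContOn_forcing hp (N := N) hr).locallyIntegrableOn hs
    have t1 : IsTest (-1) 1 fun y => (1 - y ^ 2) * deriv φ y := hφ.deriv.mul_left (by fun_prop)
    have t2 : IsTest (-1) 1 fun y => 2 * α * y * φ y := hφ.mul_left (by fun_prop)
    have t3 : IsTest (-1) 1 fun y => (1 - 2 * α) * φ y := hφ.mul_left (by fun_prop)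
    have t4 : IsTest (-1) 1 fun y => 2 * y * deriv φ y := hφ.deriv.mul_left (by fun_prop)
    have j0 := hwd s hs κ
    have j1 := ii l2 t1
    have j2 := ii l2 t2
    have j3 : IntegrableOn (fun y => α * (α + 1) * (w s y * φ y)) (Ioo (-1) 1) :=
      (ii l1 hφ).const_mul _
    have j4 := ii l4 hφ
    have j5 := ii l3 t3
    have j6 := ii l3 t4
    have k1 : IntegrableOn (fun y =>
        (-(wy s y * ((1 - y ^ 2) * deriv φ y + 2 * α * y * φ y))
          - α * (α + 1) * (w s y * φ y)
          + forcing N p r₀ w wy s y * φ y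
          + ws s y * ((1 - 2 * α) * φ y + 2 * y * deriv φ y))) (Ioo (-1) 1) := by
      refine (((((j1.add j2).neg).sub j3).add j4).add (j5.add j6)).congr (ae_of_all _ fun y => ?_)
      simp only [Pi.add_apply, Pi.sub_apply, Pi.neg_apply]
      ring
    have k2 := ii l3 (hmd (-κ))
    have k3 : IntegrableOn (fun y => α * (ws s y * φ y)) (Ioo (-1) 1) := (ii l3 hφ).const_mul α
    have k4 := ii l2 (hm κ)
    have k5 := ii l1 (hmd κ)
    have k6 : IntegrableOn (fun y => α * (wy s y * ((y + κ) * φ y)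
      + w s y * (φ y + (y + κ) * deriv φ y))) (Ioo (-1) 1) := (k4.add k5).const_mul α
    have k12 : IntegrableOn (fun y =>
        (-(wy s y * ((1 - y ^ 2) * deriv φ y + 2 * α * y * φ y))
          - α * (α + 1) * (w s y * φ y)
          + forcing N p r₀ w wy s y * φ y
          + ws s y * ((1 - 2 * α) * φ y + 2 * y * deriv φ y))
          - ws s y * (φ y + (y + -κ) * deriv φ y)) (Ioo (-1) 1) := k1.sub k2
    have k123 : IntegrableOn (fun y =>
        (-(wy s y * ((1 - y ^ 2) * deriv φ y + 2 * α * y * φ y))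
          - α * (α + 1) * (w s y * φ y)
          + forcing N p r₀ w wy s y * φ y
          + ws s y * ((1 - 2 * α) * φ y + 2 * y * deriv φ y))
          - ws s y * (φ y + (y + -κ) * deriv φ y) + α * (ws s y * φ y)) (Ioo (-1) 1) := k12.add k3
    -- An integration by parts written as a zero integral; adding it makes both sides agree
    -- pointwise, up to the relation κ² = 1.
    have hz : ∫ y in Ioo (-1) 1, α * (wy s y * ((y + κ) * φ y)
        + w s y * (φ y + (y + κ) * deriv φ y)) = 0 := by
      rw [integral_const_mul, integral_add k4 k5, j0, neg_add_cancel, mul_zero]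
    rw [← integral_const_mul, ← integral_sub k1 k2, ← integral_add k12 k3, ← add_zero (∫ y in _, _),
      ← hz, ← integral_add k123 k6]
    refine integral_congr_ae (ae_of_all _ fun y => ?_)
    simp only
    linear_combination (wy s y * deriv φ y) * hκ

theorem IsSimilaritySolution.isCharacteristicSolution (hp : 1 < p) {N : ℕ} {r₀ s₀ : ℝ}
    {w wy ws : ℝ → ℝ → ℝ} (h : IsSimilaritySolution N p r₀ (Ici s₀) w wy ws)
    (hr : Real.exp (-s₀) < r₀) : IsCharacteristicSolution N p r₀ s₀ w wy ws where
  path := h.path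
  right s hs := by
    simpa only [sub_eq_add_neg] using h.weakTransport hp hr (κ := 1) (by norm_num) hs
  left s hs := by
    simpa only [neg_neg] using h.weakTransport hp hr (κ := -1) (by norm_num) hs

/-! ### Similarity variables with a shifted vertex -/

/-- The time at which a solution is read after the vertex has been moved up by `δ`. -/
def shiftedTime (δ s : ℝ) : ℝ := -Real.log (δ + Real.exp (-s))

/-- The dilation factor after the vertex has been moved up by `δ`. -/
def shiftedFactor (δ s : ℝ) : ℝ := Real.exp (-s) / (δ + Real.exp (-s))

/-- The state `w` after a dilation by `l`. -/
def dilate (p l : ℝ) (f : ℝ → ℝ) (y : ℝ) : ℝ := l ^ (2 / (p - 1)) * f (l * y)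

/-- The space derivative after a dilation by `l`. -/
def dilateSpace (p l : ℝ) (f' : ℝ → ℝ) (y : ℝ) : ℝ := l ^ (2 / (p - 1) + 1) * f' (l * y)

/-- The time derivative after a dilation by `l`. -/
def dilateTime (p l : ℝ) (f f' g : ℝ → ℝ) (y : ℝ) : ℝ :=
  2 / (p - 1) * (l - 1) * (l ^ (2 / (p - 1)) * f (l * y))
    - (1 - l) * (y * (l ^ (2 / (p - 1) + 1) * f' (l * y))) + l ^ (2 / (p - 1) + 1) * g (l * y)

section Shift

variable {δ s₀ s₁ s : ℝ}

theorem shiftedFactor_pos (hδ : 0 < δ) : 0 < shiftedFactor δ s := by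
  have := Real.exp_pos (-s)
  unfold shiftedFactor
  positivity

theorem shiftedFactor_lt_one (hδ : 0 < δ) : shiftedFactor δ s < 1 := by
  have := Real.exp_pos (-s)
  rw [shiftedFactor, div_lt_one (by positivity)]
  linarith

theorem exp_neg_shiftedTime (hδ : 0 < δ) : Real.exp (-shiftedTime δ s) = δ + Real.exp (-s) := by
  have := Real.exp_pos (-s)
  rw [shiftedTime, neg_neg, Real.exp_log (by positivity)]

theorem shiftedFactor_mul_exp (hδ : 0 < δ) :
    shiftedFactor δ s * Real.exp (-shiftedTime δ s) = Real.exp (-s) := by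
  have := Real.exp_pos (-s)
  rw [exp_neg_shiftedTime hδ, shiftedFactor, div_mul_cancel₀ _ (by positivity)]

theorem shiftedFactor_le (hδ : 0 < δ) (hs : s ∈ Ici s₁) : shiftedFactor δ s ≤ shiftedFactor δ s₁ := by
  have h1 := Real.exp_pos (-s)
  have h2 := Real.exp_pos (-s₁)
  have h3 : Real.exp (-s) ≤ Real.exp (-s₁) := Real.exp_le_exp.2 (by linarith [mem_Ici.1 hs])
  rw [shiftedFactor, shiftedFactor, div_le_div_iff₀ (by positivity) (by positivity)]
  nlinarith

theorem shiftedTime_eq (h : δ + Real.exp (-s₁) = Real.exp (-s₀)) : shiftedTime δ s₁ = s₀ := by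
  rw [shiftedTime, h, Real.log_exp, neg_neg]

theorem le_shiftedTime (hδ : 0 < δ) (h : δ + Real.exp (-s₁) = Real.exp (-s₀)) (hs : s ∈ Ici s₁) :
    shiftedTime δ s ∈ Ici s₀ := by
  have h3 : Real.exp (-s) ≤ Real.exp (-s₁) := Real.exp_le_exp.2 (by linarith [mem_Ici.1 hs])
  have h4 : Real.exp (-shiftedTime δ s) ≤ Real.exp (-s₀) := by
    rw [exp_neg_shiftedTime hδ, ← h]
    linarith
  exact neg_le_neg_iff.1 (Real.exp_le_exp.1 h4)

theorem hasDerivAt_exp_neg : HasDerivAt (fun s => Real.exp (-s)) (-Real.exp (-s)) s := by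
  simpa using (hasDerivAt_id s).neg.exp

theorem hasDerivAt_shiftedTime (hδ : 0 < δ) :
    HasDerivAt (shiftedTime δ) (shiftedFactor δ s) s := by
  have := Real.exp_pos (-s)
  have h1 := ((hasDerivAt_exp_neg (s := s)).const_add δ).log (by positivity)
  refine h1.neg.congr_deriv ?_
  rw [shiftedFactor]
  ring

theorem hasDerivAt_shiftedFactor (hδ : 0 < δ) :
    HasDerivAt (shiftedFactor δ) (shiftedFactor δ s * (shiftedFactor δ s - 1)) s := by
  have := Real.exp_pos (-s)
  have h1 := (hasDerivAt_exp_neg (s := s)).div ((hasDerivAt_exp_neg (s := s)).const_add δ)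
    (by positivity)
  refine h1.congr_deriv ?_
  rw [shiftedFactor]
  field_simp
  ring

theorem hasDerivAt_shiftedFactor_rpow (hδ : 0 < δ) (k : ℝ) :
    HasDerivAt (fun s => shiftedFactor δ s ^ k)
      (k * (shiftedFactor δ s - 1) * shiftedFactor δ s ^ k) s := by
  have h0 := shiftedFactor_pos (s := s) hδ
  refine ((hasDerivAt_shiftedFactor (s := s) hδ).rpow_const (Or.inl h0.ne')).congr_deriv ?_
  rw [Real.rpow_sub_one h0.ne']
  field_simp

end Shift

/-! ### Dilated solutions in the energy space -/

theorem L2ContOn.congr_ae {μ : Measure ℝ} {J : Set ℝ} {g h : ℝ → ℝ → ℝ} (hg : L2ContOn μ J g)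
    (hh : ∀ s ∈ J, h s =ᵐ[μ] g s) : L2ContOn μ J h := by
  refine hg.of_le (C := 1) ENNReal.one_ne_top (fun s hs => (memLp_congr_ae (hh s hs)).2 (hg.memLp s hs))
    fun s hs => ?_
  filter_upwards [self_mem_nhdsWithin] with σ hσ
  rw [one_mul, eLpNorm_congr_ae ((hh σ hσ).sub (hh s hs))]

theorem L2ContOn.tendsto_integral_sq {μ : Measure ℝ} {J : Set ℝ} {g : ℝ → ℝ → ℝ}
    (hg : L2ContOn μ J g) {s : ℝ} (hs : s ∈ J) :
    Tendsto (fun σ => ∫ y, (g σ y - g s y) ^ 2 ∂μ) (𝓝[J] s) (𝓝 0) := by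
  have hc : L2ContOn μ J fun _ y => -1 * g s y :=
    ⟨fun _ _ => (hg.memLp s hs).const_mul _, fun _ _ => by
      simpa using tendsto_const_nhds⟩
  have h1 := (hg.add hc).continuousOn_integral_mul (hg.add hc) s hs
  have e : ∀ σ, ∫ y, (g σ y + -1 * g s y) * (g σ y + -1 * g s y) ∂μ
      = ∫ y, (g σ y - g s y) ^ 2 ∂μ := fun σ => by
    refine integral_congr_ae (ae_of_all _ fun y => ?_)
    simp only
    ring
  simp only [ContinuousWithinAt, e] at h1
  simpa using h1

theorem energyDensity_le (hp : 1 < p) (f f' g : ℝ → ℝ) {y : ℝ} (hy : y ∈ Ioo (-1 : ℝ) 1) :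
    0 ≤ energyDensity p f f' g y ∧ energyDensity p f f' g y ≤ f y ^ 2 + f' y ^ 2 + g y ^ 2 := by
  have hq := one_sub_sq_pos hy
  have hρ := rho_pos (p := p) hy
  have hρ1 := rho_le_one hp hy
  refine ⟨by unfold energyDensity; positivity, ?_⟩
  have h1 : f' y ^ 2 * (1 - y ^ 2) ≤ f' y ^ 2 := by nlinarith [sq_nonneg (f' y), sq_nonneg y]
  calc energyDensity p f f' g y ≤ (f y ^ 2 + f' y ^ 2 * (1 - y ^ 2) + g y ^ 2) * 1 := by
        unfold energyDensity; gcongr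
    _ ≤ _ := by linarith

theorem memEnergySpace_of_memLp (hp : 1 < p) {f f' g : ℝ → ℝ}
    (h1 : MemLp f 2 (volume.restrict (Ioo (-1) 1))) (h2 : MemLp f' 2 (volume.restrict (Ioo (-1) 1)))
    (h3 : MemLp g 2 (volume.restrict (Ioo (-1) 1))) (hw : IsWeakDeriv (-1) 1 f f') :
    MemEnergySpace p f f' g := by
  refine ⟨h1.1, h2.1, h3.1, hw, ?_⟩
  refine ((h1.integrable_sq.add h2.integrable_sq).add h3.integrable_sq).mono' ?_ ?_
  · have hρ : AEStronglyMeasurable (rho p) (volume.restrict (Ioo (-1) 1)) :=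
      (continuousOn_rho (p := p)).aestronglyMeasurable measurableSet_Ioo
    have hq : AEStronglyMeasurable (fun y : ℝ => 1 - y ^ 2) (volume.restrict (Ioo (-1) 1)) :=
      (by fun_prop : Continuous fun y : ℝ => 1 - y ^ 2).aestronglyMeasurable
    exact (((h1.1.pow 2).add ((h2.1.pow 2).mul hq)).add (h3.1.pow 2)).mul hρ
  · filter_upwards [ae_restrict_mem measurableSet_Ioo] with y hy
    obtain ⟨k1, k2⟩ := energyDensity_le hp f f' g hy
    rw [Real.norm_of_nonneg k1]
    exact k2

/-- The weights are at most 1, so unweighted L² continuity is stronger than continuity in the energy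
space. Dilated paths satisfy it because they read the original only on compact subintervals. -/
theorem isEnergyPath_of_l2ContOn (hp : 1 < p) {J : Set ℝ} {w wy ws : ℝ → ℝ → ℝ}
    (h1 : L2ContOn (volume.restrict (Ioo (-1) 1)) J w)
    (h2 : L2ContOn (volume.restrict (Ioo (-1) 1)) J wy)
    (h3 : L2ContOn (volume.restrict (Ioo (-1) 1)) J ws)
    (hwy : ∀ s ∈ J, IsWeakDeriv (-1) 1 (w s) (wy s))
    (hws : ∀ φ, IsTest (-1) 1 φ → ∀ s ∈ J, HasDerivWithinAt
      (fun σ => ∫ y in Ioo (-1) 1, w σ y * φ y) (∫ y in Ioo (-1) 1, ws s y * φ y) J s) :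
    IsEnergyPath p J w wy ws := by
  have hm : ∀ s ∈ J, MemEnergySpace p (w s) (wy s) (ws s) := fun s hs =>
    memEnergySpace_of_memLp hp (h1.memLp s hs) (h2.memLp s hs) (h3.memLp s hs) (hwy s hs)
  refine ⟨hm, fun s hs => ?_, hws⟩
  have ht := ((h1.tendsto_integral_sq hs).add (h2.tendsto_integral_sq hs)).add
    (h3.tendsto_integral_sq hs)
  simp only [add_zero] at ht
  refine squeeze_zero' ?_ ?_ ht
  · exact Eventually.of_forall fun σ => setIntegral_nonneg measurableSet_Ioo fun y hy =>
      (energyDensity_le hp _ _ _ hy).1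
  · filter_upwards [self_mem_nhdsWithin] with σ hσ
    have i1 : IntegrableOn (fun y => (w σ y - w s y) ^ 2) (Ioo (-1) 1) :=
      ((h1.memLp σ hσ).sub (h1.memLp s hs)).integrable_sq
    have i2 : IntegrableOn (fun y => (wy σ y - wy s y) ^ 2) (Ioo (-1) 1) :=
      ((h2.memLp σ hσ).sub (h2.memLp s hs)).integrable_sq
    have i3 : IntegrableOn (fun y => (ws σ y - ws s y) ^ 2) (Ioo (-1) 1) :=
      ((h3.memLp σ hσ).sub (h3.memLp s hs)).integrable_sq
    have i12 : IntegrableOn (fun y => (w σ y - w s y) ^ 2 + (wy σ y - wy s y) ^ 2) (Ioo (-1) 1) :=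
      i1.add i2
    rw [← integral_add i1 i2, ← integral_add i12 i3]
    exact setIntegral_mono_on ((hm σ hσ).sub (hm s hs)).integrable (i12.add i3) measurableSet_Ioo
      fun y hy => (energyDensity_le hp _ _ _ hy).2

section Rescale

variable {δ s₀ s₁ : ℝ}

theorem continuousOn_shiftedFactor (hδ : 0 < δ) (J : Set ℝ) : ContinuousOn (shiftedFactor δ) J :=
  fun _ _ => (hasDerivAt_shiftedFactor hδ).continuousAt.continuousWithinAt

theorem continuousOn_shiftedFactor_rpow (hδ : 0 < δ) (k : ℝ) (J : Set ℝ) :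
    ContinuousOn (fun s => shiftedFactor δ s ^ k) J :=
  fun _ _ => (hasDerivAt_shiftedFactor_rpow hδ k).continuousAt.continuousWithinAt

/-- The factor decreases in time from a value below 1, so the dilated points stay in one fixed
compact subinterval and local continuity becomes continuity on the whole interval. -/
theorem LocL2ContOn.rescale (hδ : 0 < δ) (hs : δ + Real.exp (-s₁) = Real.exp (-s₀))
    {g : ℝ → ℝ → ℝ} (hg : LocL2ContOn (-1) 1 (Ici s₀) g) :
    L2ContOn (volume.restrict (Ioo (-1) 1)) (Ici s₁)
      fun s y => g (shiftedTime δ s) (shiftedFactor δ s * y) := by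
  have h1 := shiftedFactor_lt_one (s := s₁) hδ
  obtain ⟨ψ, hψ, hψ1, -⟩ := IsTest.exists_eq_one (a := -1) (b := 1) (neg_lt_neg h1) h1
  have hc := (hg.test_mul (by norm_num) hψ).comp_affine (τ := shiftedTime δ) (c := fun _ => 0)
    (l := shiftedFactor δ) (J := Ici s₁)
    (fun _ _ => (hasDerivAt_shiftedTime hδ).continuousAt.continuousWithinAt)
    (fun s hs' => le_shiftedTime hδ hs hs') continuousOn_const (continuousOn_shiftedFactor hδ _)
    (fun _ _ => shiftedFactor_pos hδ)
  refine (hc.mono_measure Measure.restrict_le_self).congr_ae fun s hs' => ?_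
  filter_upwards [ae_restrict_mem measurableSet_Ioo] with y hy
  have h2 := shiftedFactor_le hδ hs'
  have h3 := shiftedFactor_pos (s := s) hδ
  rw [zero_add, hψ1 _ ⟨by nlinarith [hy.1], by nlinarith [hy.2]⟩, one_mul]

/-- The dilation factor l satisfies l' = l(l-1) and the shifted time has derivative l, so the slope
v₁ becomes v₁ l + 1 - l. The slope 1 of the characteristic fields is therefore preserved. -/
theorem WeakTransport.rescale (hδ : 0 < δ) (hs : δ + Real.exp (-s₁) = Real.exp (-s₀))
    {g : ℝ → ℝ → ℝ} {G : ℝ → ℝ} {s v₀ v₁ : ℝ} (hs' : s ∈ Ici s₁)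
    (hT : WeakTransport (-1) 1 (Ici s₀) (shiftedTime δ s) v₀ v₁ g G)
    (hg : LocL2ContOn (-1) 1 (Ici s₀) g) (hG : LocallyIntegrableOn G (Ioo (-1) 1)) (k : ℝ) :
    WeakTransport (-1) 1 (Ici s₁) s v₀ (v₁ * shiftedFactor δ s + 1 - shiftedFactor δ s)
      (fun s y => shiftedFactor δ s ^ k * g (shiftedTime δ s) (shiftedFactor δ s * y))
      (fun y => k * (shiftedFactor δ s - 1) * shiftedFactor δ s ^ k
          * g (shiftedTime δ s) (shiftedFactor δ s * y)
        + shiftedFactor δ s ^ k * shiftedFactor δ s * G (shiftedFactor δ s * y)) := by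
  intro φ hφ
  have h1 := shiftedFactor_lt_one (s := s) hδ
  have h0 := shiftedFactor_pos (s := s) hδ
  obtain ⟨μ, hμ, hμ1⟩ := exists_between h1
  have hL : L2ContOn (volume.restrict (Ioo (-μ) μ)) (Ici s₀) g :=
    (hg (-μ) μ (by linarith) hμ1).mono_measure (Measure.restrict_mono Ioo_subset_Icc_self le_rfl)
  have hCV := (hT.mono_interval (c := -μ) (d := μ) (by linarith) hμ1.le).comp_affine
    (by linarith) hL (hG.mono_set (Ioo_subset_Ioo (by linarith) hμ1.le))
    (τ := shiftedTime δ) (m := fun s => shiftedFactor δ s ^ k) (c := fun _ => 0)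
    (l := shiftedFactor δ) (J := Ici s₁) (hasDerivAt_shiftedTime hδ).hasDerivWithinAt
    (hasDerivAt_shiftedFactor_rpow hδ k).hasDerivWithinAt (hasDerivWithinAt_const _ _ _)
    (hasDerivAt_shiftedFactor hδ).hasDerivWithinAt h0 hs'
    (by filter_upwards [self_mem_nhdsWithin] with σ hσ using le_shiftedTime hδ hs hσ)
    hφ (by linarith) (by linarith)
  refine (hCV.congr_of_mem (fun σ _ => ?_) hs').congr_deriv ?_
  · simp only [zero_add]
    rw [hφ.setIntegral_mul]
  · rw [← setIntegral_eq_integral_of_forall_compl_eq_zero (s := Ioo (-1 : ℝ) 1)]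
    · refine integral_congr_ae (ae_of_all _ fun y => ?_)
      simp only [zero_add, mul_zero, add_zero, sub_zero]
      field_simp
      ring
    · intro y hy
      simp [hφ.zero_of_notMem hy, hφ.deriv_zero_of_notMem hy]

theorem IsWeakDeriv.dilate {f f' : ℝ → ℝ} {l : ℝ} (hl : 0 < l) (hl1 : l ≤ 1)
    (h : IsWeakDeriv (-1) 1 f f') : IsWeakDeriv (-1) 1 (dilate p l f) (dilateSpace p l f') := by
  intro φ hφ
  have k := h.integral_comp_affine (c := 0) hl hφ (by linarith) (by linarith)
  simp only [zero_add] at k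
  rw [hφ.deriv.setIntegral_mul, hφ.setIntegral_mul]
  simp only [RadialWave.dilate, dilateSpace, mul_assoc]
  rw [integral_const_mul, k, mul_neg, ← integral_const_mul, neg_inj]
  refine integral_congr_ae (ae_of_all _ fun y => ?_)
  simp only
  rw [Real.rpow_add_one hl.ne']
  ring

theorem IsEnergyPath.rescale (hp : 1 < p) (hδ : 0 < δ)
    (hs : δ + Real.exp (-s₁) = Real.exp (-s₀)) {w wy ws : ℝ → ℝ → ℝ}
    (h : IsEnergyPath p (Ici s₀) w wy ws) :
    IsEnergyPath p (Ici s₁) (fun s => dilate p (shiftedFactor δ s) (w (shiftedTime δ s)))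
      (fun s => dilateSpace p (shiftedFactor δ s) (wy (shiftedTime δ s)))
      (fun s => dilateTime p (shiftedFactor δ s) (w (shiftedTime δ s)) (wy (shiftedTime δ s))
        (ws (shiftedTime δ s))) := by
  obtain ⟨c1, c2, c3⟩ := h.locL2ContOn
  have hk := fun k => continuousOn_shiftedFactor_rpow hδ k (Ici s₁)
  have hl := continuousOn_shiftedFactor hδ (Ici s₁)
  have l1 := (c1.rescale hδ hs).mul_time (hk (2 / (p - 1)))
  have l2 := (c2.rescale hδ hs).mul_time (hk (2 / (p - 1) + 1))
  have l3 := (c3.rescale hδ hs).mul_time (hk (2 / (p - 1) + 1))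
  have l2y : L2ContOn (volume.restrict (Ioo (-1) 1)) (Ici s₁) fun s y =>
      y * (shiftedFactor δ s ^ (2 / (p - 1) + 1)
        * wy (shiftedTime δ s) (shiftedFactor δ s * y)) := by
    refine l2.bdd_mul (M := 1) continuous_id.aestronglyMeasurable ?_
    filter_upwards [ae_restrict_mem measurableSet_Ioo] with y hy
    exact abs_le.2 ⟨hy.1.le, hy.2.le⟩
  have l4 : L2ContOn (volume.restrict (Ioo (-1) 1)) (Ici s₁) fun s =>
      dilateTime p (shiftedFactor δ s) (w (shiftedTime δ s)) (wy (shiftedTime δ s))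
        (ws (shiftedTime δ s)) := by
    refine (((l1.mul_time (m := fun s => 2 / (p - 1) * (shiftedFactor δ s - 1)) (by fun_prop)).add
      (l2y.mul_time (m := fun s => -(1 - shiftedFactor δ s)) (by fun_prop))).add l3).congr_ae
      fun s _ => ae_of_all _ fun y => ?_
    simp only [dilateTime]
    ring
  refine isEnergyPath_of_l2ContOn hp l1 l2 l4 (fun s hs' => (h.mem _ (le_shiftedTime hδ hs
    hs')).weakDeriv.dilate (shiftedFactor_pos hδ) (shiftedFactor_lt_one hδ).le) fun φ hφ s hs' => ?_
  have hσ := le_shiftedTime hδ hs hs'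
  have h0 := shiftedFactor_pos (s := s) hδ
  refine ((h.transport hσ).rescale hδ hs hs' c1 (c3.locallyIntegrableOn hσ) (2 / (p - 1)) φ
    hφ).congr_deriv ?_
  set L := shiftedFactor δ s
  set S := shiftedTime δ s
  have hw := (h.mem S hσ).weakDeriv.dilate (p := p) h0 (shiftedFactor_lt_one hδ).le _
    (hφ.mul_left (k := fun y => y + 0) (by fun_prop))
  have hd := deriv_affine_mul hφ.differentiable 0
  simp only [add_zero] at hd
  simp only [add_zero, hd] at hw
  have ii : ∀ {f ψ : ℝ → ℝ}, MemLp f 2 (volume.restrict (Ioo (-1) 1)) → IsTest (-1) 1 ψ →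
      IntegrableOn (fun y => f y * ψ y) (Ioo (-1) 1) := fun hf hψ =>
    hf.integrable_mul (hψ.memLp 2 _)
  have t1 : IsTest (-1) 1 fun y => φ y + y * deriv φ y := by
    have := (hφ.mul_left (k := fun y => y + 0) (by fun_prop)).deriv
    simpa only [add_zero, funext hd] using this
  have t2 : IsTest (-1) 1 fun y => y * φ y := hφ.mul_left (k := fun y => y) (by fun_prop)
  have j1 : IntegrableOn (fun y => dilate p L (w S) y * (φ y + y * deriv φ y)) (Ioo (-1) 1) :=
    ii (l1.memLp s hs') t1
  have j2 : IntegrableOn (fun y => dilateSpace p L (wy S) y * (y * φ y)) (Ioo (-1) 1) :=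
    ii (l2.memLp s hs') t2
  have j3 := ii (l4.memLp s hs') hφ
  -- The field 0 becomes (1-l) y under dilation; this integration by parts puts that transport into
  -- the time derivative of the dilated state.
  have hz : ∫ y in Ioo (-1) 1, (1 - L) * (dilate p L (w S) y * (φ y + y * deriv φ y)
      + dilateSpace p L (wy S) y * (y * φ y)) = 0 := by
    rw [integral_const_mul, integral_add j1 j2, hw, neg_add_cancel, mul_zero]
  have j12 : IntegrableOn (fun y => (1 - L) * (dilate p L (w S) y * (φ y + y * deriv φ y)
      + dilateSpace p L (wy S) y * (y * φ y))) (Ioo (-1) 1) := (j1.add j2).const_mul _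
  have hsum := integral_add j3 j12
  rw [hz, add_zero] at hsum
  rw [← hsum]
  refine integral_congr_ae (ae_of_all _ fun y => ?_)
  simp only [dilateTime, dilate, dilateSpace, L, S] at h0 ⊢
  rw [Real.rpow_add_one h0.ne']
  ring

/-- Both terms scale like l^(α+2): the nonlinearity since α p = α + 2, the first order term since
e^{-s} is l times the exponential at the shifted time. The product y e^{-s} is the same in both sets
of variables, so the radius is unchanged. -/
theorem forcing_rescale (hp : 1 < p) (hδ : 0 < δ) (N : ℕ) (r₀ : ℝ) (w wy : ℝ → ℝ → ℝ) (s y : ℝ) :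
    forcing N p r₀ (fun s => dilate p (shiftedFactor δ s) (w (shiftedTime δ s)))
        (fun s => dilateSpace p (shiftedFactor δ s) (wy (shiftedTime δ s))) s y
      = shiftedFactor δ s ^ (2 / (p - 1) + 1) * shiftedFactor δ s
        * forcing N p r₀ w wy (shiftedTime δ s) (shiftedFactor δ s * y) := by
  have h0 := shiftedFactor_pos (s := s) hδ
  have hp1 : p - 1 ≠ 0 := by linarith
  have e1 := shiftedFactor_mul_exp (s := s) hδ
  simp only [forcing, dilate, dilateSpace]
  have e2 : shiftedFactor δ s * y * Real.exp (-shiftedTime δ s) = y * Real.exp (-s) := by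
    rw [← e1]; ring
  rw [e2, abs_mul, abs_of_pos (Real.rpow_pos_of_pos h0 _),
    Real.mul_rpow (Real.rpow_pos_of_pos h0 _).le (abs_nonneg _), ← Real.rpow_mul h0.le,
    div_mul_cancel₀ _ hp1, Real.rpow_add_one h0.ne', ← e1, Real.rpow_two]
  ring

/-- Moving the vertex up preserves solutions. -/
theorem IsCharacteristicSolution.rescale (hp : 1 < p) {N : ℕ} {r₀ : ℝ} (hδ : 0 < δ)
    (hs : δ + Real.exp (-s₁) = Real.exp (-s₀)) {w wy ws : ℝ → ℝ → ℝ}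
    (hr : Real.exp (-s₀) < r₀) (h : IsCharacteristicSolution N p r₀ s₀ w wy ws) :
    IsCharacteristicSolution N p r₀ s₁
      (fun s => dilate p (shiftedFactor δ s) (w (shiftedTime δ s)))
      (fun s => dilateSpace p (shiftedFactor δ s) (wy (shiftedTime δ s)))
      (fun s => dilateTime p (shiftedFactor δ s) (w (shiftedTime δ s)) (wy (shiftedTime δ s))
        (ws (shiftedTime δ s))) := by
  obtain ⟨c1, c2, c3⟩ := h.path.locL2ContOn
  have c4 := h.path.locL2ContOn_forcing hp (N := N) hr
  have key : ∀ κ : ℝ, (∀ s ∈ Ici s₀, WeakTransport (-1) 1 (Ici s₀) s (-κ) 1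
      (fun s y => ws s y + (y + κ) * wy s y + 2 / (p - 1) * w s y)
      (fun y => forcing N p r₀ w wy s y
        - (2 / (p - 1) + 1) * (ws s y + (y + κ) * wy s y + 2 / (p - 1) * w s y))) →
      ∀ s ∈ Ici s₁, WeakTransport (-1) 1 (Ici s₁) s (-κ) 1
      (fun s y => dilateTime p (shiftedFactor δ s) (w (shiftedTime δ s)) (wy (shiftedTime δ s))
        (ws (shiftedTime δ s)) y
        + (y + κ) * dilateSpace p (shiftedFactor δ s) (wy (shiftedTime δ s)) y
        + 2 / (p - 1) * dilate p (shiftedFactor δ s) (w (shiftedTime δ s)) y)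
      (fun y => forcing N p r₀ (fun s => dilate p (shiftedFactor δ s) (w (shiftedTime δ s)))
          (fun s => dilateSpace p (shiftedFactor δ s) (wy (shiftedTime δ s))) s y
        - (2 / (p - 1) + 1) * (dilateTime p (shiftedFactor δ s) (w (shiftedTime δ s))
            (wy (shiftedTime δ s)) (ws (shiftedTime δ s)) y
          + (y + κ) * dilateSpace p (shiftedFactor δ s) (wy (shiftedTime δ s)) y
          + 2 / (p - 1) * dilate p (shiftedFactor δ s) (w (shiftedTime δ s)) y)) := by
    intro κ hT s hs'
    have hσ := le_shiftedTime hδ hs hs'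
    have c5 : LocL2ContOn (-1) 1 (Ici s₀)
        fun s y => ws s y + (y + κ) * wy s y + 2 / (p - 1) * w s y :=
      (c3.add (c2.mul_continuousOn (k := fun y => y + κ) (by fun_prop))).add (c1.const_mul _)
    have c6 := (c4.locallyIntegrableOn hσ).sub ((c5.const_mul (2 / (p - 1) + 1)).locallyIntegrableOn
      hσ)
    -- The characteristic unknowns, with their term α w, are scaled exactly, by the factor l^(α+1).
    have e : ∀ s y, dilateTime p (shiftedFactor δ s) (w (shiftedTime δ s)) (wy (shiftedTime δ s))
        (ws (shiftedTime δ s)) y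
        + (y + κ) * dilateSpace p (shiftedFactor δ s) (wy (shiftedTime δ s)) y
        + 2 / (p - 1) * dilate p (shiftedFactor δ s) (w (shiftedTime δ s)) y
        = shiftedFactor δ s ^ (2 / (p - 1) + 1)
          * (ws (shiftedTime δ s) (shiftedFactor δ s * y)
            + (shiftedFactor δ s * y + κ) * wy (shiftedTime δ s) (shiftedFactor δ s * y)
            + 2 / (p - 1) * w (shiftedTime δ s) (shiftedFactor δ s * y)) := fun s y => by
      rw [dilateTime, dilate, dilateSpace, Real.rpow_add_one (shiftedFactor_pos hδ).ne']
      ring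
    have hR := (hT _ hσ).rescale hδ hs hs' c5 c6 (2 / (p - 1) + 1)
    rw [one_mul, add_sub_cancel_left] at hR
    refine hR.congr_ae hs' (fun σ _ => ae_of_all _ fun y => e σ y) (ae_of_all _ fun y => ?_)
    simp only [e, forcing_rescale hp hδ]
    ring
  refine ⟨h.path.rescale hp hδ hs, fun s hs' => ?_, fun s hs' => ?_⟩
  · have := key (-1) (fun s hs => by simpa [sub_eq_add_neg] using h.right s hs) s hs'
    simpa [sub_eq_add_neg] using this
  · exact key 1 (fun s hs => h.left s hs) s hs'

end Rescale

/-! ### Lower bound of the functional, continuity under dilation, and the blow-up criterion -/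

@[fun_prop]
theorem measurable_rho : Measurable (rho p) :=
  (by fun_prop : Measurable fun y : ℝ => 1 - y ^ 2).pow_const _

theorem rho_le_rho {x y : ℝ} (hp : 1 < p) (hy : y ∈ Ioo (-1 : ℝ) 1) (h : x ^ 2 ≤ y ^ 2) :
    rho p y ≤ rho p x :=
  Real.rpow_le_rpow (one_sub_sq_pos hy).le (by linarith)
    (div_nonneg (by norm_num) (by linarith))

/-- For late times the cross term is dominated by the quadratic part of E, since g²/2 + c f² - e f g
is nonnegative as soon as e² ≤ 2c; only the potential remains. -/
theorem functionalF_ge (hp : 1 < p) {f f' g : ℝ → ℝ} {s : ℝ} (h : MemEnergySpace p f f' g)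
    (hs : Real.exp (-s) ^ 2 ≤ 2 * ((p + 1) / (p - 1) ^ 2)) :
    -(1 / (p + 1)) * ∫ y in Ioo (-1) 1, |f y| ^ (p + 1) * rho p y ≤ functionalF p f f' g s := by
  obtain ⟨C, -, hC⟩ := MemEnergySpace.potential hp
  obtain ⟨i1, e1⟩ := h.integrable_density hp s
  rw [← e1, ← integral_const_mul]
  refine setIntegral_mono_on ((hC h).1.const_mul _) i1 measurableSet_Ioo fun y hy => ?_
  have hq := one_sub_sq_pos hy
  have hρ := rho_pos (p := p) hy
  have k : 0 ≤ 1 / 2 * g y ^ 2 + 1 / 2 * f' y ^ 2 * (1 - y ^ 2) + (p + 1) / (p - 1) ^ 2 * f y ^ 2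
      - Real.exp (-s) * (f y * g y) := by
    have k1 : 0 ≤ 1 / 2 * f' y ^ 2 * (1 - y ^ 2) := by positivity
    nlinarith [sq_nonneg (g y - Real.exp (-s) * f y), mul_nonneg (sub_nonneg.2 hs) (sq_nonneg (f y))]
  have := mul_nonneg k hρ.le
  rw [densityF]
  linarith

/-- The amplitude contributes l^(α(p+1)) and the Jacobian l^(-1). The weight is at most 1 and is
discarded, so that the unweighted L^(p+1) bound suffices. -/
theorem integral_abs_rpow_dilate_le (hp : 1 < p) {f F F' G : ℝ → ℝ} {l : ℝ} (hl : 0 < l)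
    (hl1 : l ≤ 1) {M : NNReal} (h : MemEnergySpace p F F' G) (hF : F = dilate p l f)
    (hf : AEStronglyMeasurable f (volume.restrict (Ioo (-1) 1)))
    (hM : eLpNorm f (ENNReal.ofReal (p + 1)) (volume.restrict (Ioo (-1) 1)) ≤ M) :
    ∫ y in Ioo (-1) 1, |F y| ^ (p + 1) * rho p y
      ≤ l ^ (2 / (p - 1) * (p + 1) - 1) * (M : ℝ) ^ (p + 1) := by
  obtain ⟨C, -, hC⟩ := MemEnergySpace.potential hp
  have hp1 : 0 < p + 1 := by linarith
  have hmem : MemLp f (ENNReal.ofReal (p + 1)) (volume.restrict (Ioo (-1) 1)) :=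
    ⟨hf, hM.trans_lt ENNReal.coe_lt_top⟩
  have h0 : ENNReal.ofReal (p + 1) ≠ 0 := by simpa using hp1
  have hint : IntegrableOn (fun y => |f y| ^ (p + 1)) (Ioo (-1) 1) := by
    have := hmem.integrable_norm_rpow h0 ENNReal.ofReal_ne_top
    rwa [ENNReal.toReal_ofReal hp1.le] at this
  have hle : ∫ y in Ioo (-1) 1, |f y| ^ (p + 1) ≤ (M : ℝ) ^ (p + 1) := by
    have h1 := hmem.eLpNorm_eq_integral_rpow_norm h0 ENNReal.ofReal_ne_top
    rw [ENNReal.toReal_ofReal hp1.le] at h1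
    rw [h1, ← ENNReal.ofReal_coe_nnreal, ENNReal.ofReal_le_ofReal_iff M.coe_nonneg] at hM
    have hn : 0 ≤ ∫ y in Ioo (-1) 1, ‖f y‖ ^ (p + 1) :=
      integral_nonneg fun y => Real.rpow_nonneg (norm_nonneg _) _
    calc ∫ y in Ioo (-1) 1, |f y| ^ (p + 1)
        = ((∫ y in Ioo (-1) 1, ‖f y‖ ^ (p + 1)) ^ (p + 1)⁻¹) ^ (p + 1) := by
          rw [← Real.rpow_mul hn, inv_mul_cancel₀ hp1.ne', Real.rpow_one]
          rfl
      _ ≤ _ := Real.rpow_le_rpow (Real.rpow_nonneg hn _) hM hp1.le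
  set K : ℝ → ℝ := indicator (Ioo (-1) 1) fun y => |f y| ^ (p + 1) with hK
  have hKi : Integrable K := hint.integrable_indicator measurableSet_Ioo
  have hK0 : ∀ y, 0 ≤ K y := fun y => indicator_nonneg (fun y _ => Real.rpow_nonneg (abs_nonneg _) _) y
  have hKl : Integrable fun y => l ^ (2 / (p - 1) * (p + 1)) * K (l * y) :=
    (hKi.comp_mul_left' hl.ne').const_mul _
  have hKe : ∫ y, l * K (l * y) = ∫ y in Ioo (-1) 1, |f y| ^ (p + 1) := by
    have := RadialWave.integral_comp_affine K 0 hl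
    simp only [zero_add] at this
    rw [← this, hK, integral_indicator measurableSet_Ioo]
  calc ∫ y in Ioo (-1) 1, |F y| ^ (p + 1) * rho p y
      ≤ ∫ y in Ioo (-1) 1, l ^ (2 / (p - 1) * (p + 1)) * K (l * y) := by
        refine setIntegral_mono_on (hC h).1 hKl.integrableOn measurableSet_Ioo fun y hy => ?_
        have hly : l * y ∈ Ioo (-1 : ℝ) 1 := ⟨by nlinarith [hy.1], by nlinarith [hy.2]⟩
        have hlp := Real.rpow_pos_of_pos hl (2 / (p - 1))
        rw [hF, dilate, hK, indicator_of_mem hly, abs_mul, abs_of_pos hlp,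
          Real.mul_rpow hlp.le (abs_nonneg _), ← Real.rpow_mul hl.le]
        exact mul_le_of_le_one_right (by positivity) (rho_le_one hp hy)
    _ ≤ ∫ y, l ^ (2 / (p - 1) * (p + 1)) * K (l * y) :=
        setIntegral_le_integral hKl (ae_of_all _ fun y => mul_nonneg (by positivity) (hK0 _))
    _ = l ^ (2 / (p - 1) * (p + 1) - 1) * ∫ y in Ioo (-1) 1, |f y| ^ (p + 1) := by
        rw [← hKe, ← integral_const_mul, Real.rpow_sub_one hl.ne']
        refine integral_congr_ae (ae_of_all _ fun y => ?_)
        simp only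
        field_simp
    _ ≤ _ := by gcongr

theorem LocMemL2.comp_mul {f : ℝ → ℝ} (h : LocMemL2 f) {l : ℝ} (hl : 0 < l) (hl1 : l < 1) :
    MemLp (fun y => f (l * y)) 2 (volume.restrict (Ioo (-1) 1)) := by
  obtain ⟨μ, hμ, hμ1⟩ := exists_between hl1
  have h1 : MemLp f 2 (volume.restrict (Ioo (-μ) μ)) :=
    (h (-μ) μ (by linarith) hμ1).mono_measure (Measure.restrict_mono Ioo_subset_Icc_self le_rfl)
  have h2 := memLp_comp_affine_restrict (A := -1) (B := 1) (c := 0) h1 hl (by linarith) (by linarith)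
  simp only [zero_add] at h2
  exact h2.mono_measure (Measure.restrict_mono Ioo_subset_Icc_self le_rfl)

theorem MemEnergySpace.dilate (hp : 1 < p) {f f' g : ℝ → ℝ} (h : MemEnergySpace p f f' g) {l : ℝ}
    (hl : 0 < l) (hl1 : l < 1) :
    MemEnergySpace p (dilate p l f) (dilateSpace p l f') (dilateTime p l f f' g) := by
  obtain ⟨l1, l2, l3⟩ := h.locMemL2
  have m1 : MemLp (RadialWave.dilate p l f) 2 (volume.restrict (Ioo (-1) 1)) :=
    (l1.comp_mul hl hl1).const_mul _
  have m2 : MemLp (dilateSpace p l f') 2 (volume.restrict (Ioo (-1) 1)) :=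
    (l2.comp_mul hl hl1).const_mul _
  have m3 := (l3.comp_mul hl hl1).const_mul (l ^ (2 / (p - 1) + 1))
  have m4 : MemLp (fun y => y * dilateSpace p l f' y) 2 (volume.restrict (Ioo (-1) 1)) := by
    refine m2.of_le_mul (c := 1) (continuous_id.aestronglyMeasurable.mul m2.1) ?_
    filter_upwards [ae_restrict_mem measurableSet_Ioo] with y hy
    rw [norm_mul]
    gcongr
    exact abs_le.2 ⟨hy.1.le, hy.2.le⟩
  exact memEnergySpace_of_memLp hp m1 m2
    (((m1.const_mul (2 / (p - 1) * (l - 1))).sub (m4.const_mul (1 - l))).add m3)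
    (h.weakDeriv.dilate hl hl1.le)

/-- The density of the functional of a dilated state, read at the original point `x`. -/
def dilatedDensity (p e l : ℝ) (f f' g : ℝ → ℝ) (x : ℝ) : ℝ :=
  (1 / 2 * (2 / (p - 1) * (l - 1) * (l ^ (2 / (p - 1)) * f x)
      - (1 - l) * (x / l * (l ^ (2 / (p - 1) + 1) * f' x)) + l ^ (2 / (p - 1) + 1) * g x) ^ 2
    + 1 / 2 * (l ^ (2 / (p - 1) + 1) * f' x) ^ 2 * (1 - (x / l) ^ 2)
    + (p + 1) / (p - 1) ^ 2 * (l ^ (2 / (p - 1)) * f x) ^ 2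
    - 1 / (p + 1) * |l ^ (2 / (p - 1)) * f x| ^ (p + 1)
    - l * e * ((l ^ (2 / (p - 1)) * f x) * (2 / (p - 1) * (l - 1) * (l ^ (2 / (p - 1)) * f x)
      - (1 - l) * (x / l * (l ^ (2 / (p - 1) + 1) * f' x)) + l ^ (2 / (p - 1) + 1) * g x)))
  * rho p (x / l)

/-- Written in x = l y, the dependence on l moves from the argument of the merely measurable
functions f, f', g into explicit coefficients, which prepares dominated convergence. The time s₀ -
log l is the one at which the exponential equals l exp(-s₀). -/
theorem functionalF_dilate (hp : 1 < p) {f f' g : ℝ → ℝ} (h : MemEnergySpace p f f' g) {l s₀ : ℝ}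
    (hl : 0 < l) (hl1 : l < 1) :
    functionalF p (dilate p l f) (dilateSpace p l f') (dilateTime p l f f' g) (s₀ - Real.log l)
      = ∫ x in Ioo (-1) 1, indicator (Ioo (-l) l)
        (fun x => l⁻¹ * dilatedDensity p (Real.exp (-s₀)) l f f' g x) x := by
  have he : Real.exp (-(s₀ - Real.log l)) = l * Real.exp (-s₀) := by
    rw [neg_sub, sub_eq_add_neg, Real.exp_add, Real.exp_log hl]
  have hsub : Ioo (-l) l ⊆ Ioo (-1) 1 := Ioo_subset_Ioo (by linarith) hl1.le
  rw [← ((h.dilate hp hl hl1).integrable_density hp _).2, setIntegral_indicator measurableSet_Ioo,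
    inter_eq_self_of_subset_right hsub, ← integral_indicator measurableSet_Ioo,
    ← integral_indicator measurableSet_Ioo,
    RadialWave.integral_comp_affine (indicator (Ioo (-l) l) _) 0 hl]
  congr 1
  ext y
  simp only [zero_add]
  by_cases hy : y ∈ Ioo (-1 : ℝ) 1
  · have hly : l * y ∈ Ioo (-l) l := ⟨by nlinarith [hy.1], by nlinarith [hy.2]⟩
    rw [indicator_of_mem hy, indicator_of_mem hly, mul_inv_cancel_left₀ hl.ne']
    simp only [densityF, dilatedDensity, dilate, dilateSpace, dilateTime, he,
      mul_div_cancel_left₀ y hl.ne']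
  · have hly : l * y ∉ Ioo (-l) l := fun k => hy
      ⟨by nlinarith [k.1], by nlinarith [k.2]⟩
    rw [indicator_of_notMem hy, indicator_of_notMem hly, mul_zero]

/-- Elementary bound for the quadratic part of the dilated density. -/
theorem abs_dilated_quadratic_le {α c₀ k e l a b c z q f2 b2 g2 P P' : ℝ} (hc₀ : 0 ≤ c₀)
    (hk : 0 ≤ k) (hk1 : k ≤ 1) (he : 0 ≤ e) (hl : 0 ≤ l) (hl1 : l ≤ 1) (ha : a ^ 2 ≤ f2)
    (hb : b ^ 2 ≤ b2) (hc : c ^ 2 ≤ g2) (hz : z ^ 2 ≤ 1) (hzq : 1 - z ^ 2 ≤ q)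
    (hlq : (1 - l) ^ 2 ≤ q) (hP : 0 ≤ P) (hPP : P ≤ P') :
    |1 / 2 * (α * (l - 1) * a - (1 - l) * (z * b) + c) ^ 2 + 1 / 2 * b ^ 2 * (1 - z ^ 2) + c₀ * a ^ 2
      - k * P - l * e * (a * (α * (l - 1) * a - (1 - l) * (z * b) + c))|
      ≤ ((1 + e) * (3 * (α ^ 2 + 1)) + 1 + c₀ + e) * (f2 + b2 * q + g2 + P') := by
  set G := α * (l - 1) * a - (1 - l) * (z * b) + c with hG
  have h1 : (1 - l) ^ 2 ≤ 1 := by nlinarith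
  have hq : 0 ≤ q := (sq_nonneg _).trans hlq
  have hb2 : 0 ≤ b2 := (sq_nonneg _).trans hb
  have hf2 : 0 ≤ f2 := (sq_nonneg _).trans ha
  have hg2 : 0 ≤ g2 := (sq_nonneg _).trans hc
  have t1 : (α * (l - 1) * a) ^ 2 ≤ α ^ 2 * f2 := by
    have : (α * (l - 1) * a) ^ 2 = α ^ 2 * ((1 - l) ^ 2 * a ^ 2) := by ring
    rw [this]
    have : (1 - l) ^ 2 * a ^ 2 ≤ 1 * f2 := by gcongr
    gcongr
    linarith
  have t2 : ((1 - l) * (z * b)) ^ 2 ≤ b2 * q := by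
    have : ((1 - l) * (z * b)) ^ 2 = z ^ 2 * (b ^ 2 * (1 - l) ^ 2) := by ring
    rw [this]
    have h2 : b ^ 2 * (1 - l) ^ 2 ≤ b2 * q := by gcongr
    have h3 : z ^ 2 * (b ^ 2 * (1 - l) ^ 2) ≤ 1 * (b ^ 2 * (1 - l) ^ 2) := by gcongr
    linarith
  have t3 : b ^ 2 * (1 - z ^ 2) ≤ b2 * q := by
    have : 0 ≤ 1 - z ^ 2 := by linarith
    gcongr
  have t3' : 0 ≤ b ^ 2 * (1 - z ^ 2) := mul_nonneg (sq_nonneg _) (by linarith)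
  have hGs : G ^ 2 ≤ 3 * (α ^ 2 + 1) * (f2 + b2 * q + g2) := by
    have h4 : ∀ u v c : ℝ, (u - v + c) ^ 2 ≤ 3 * (u ^ 2 + v ^ 2 + c ^ 2) := fun u v c => by
      linarith [sq_nonneg (u + v), sq_nonneg (u - c), sq_nonneg (v + c)]
    have h5 := h4 (α * (l - 1) * a) ((1 - l) * (z * b)) c
    have k1 : 0 ≤ α ^ 2 * (b2 * q + g2) := by positivity
    rw [← hG] at h5
    linarith
  clear_value G
  have t4 : |l * e * (a * G)| ≤ e * (f2 + G ^ 2) := by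
    have hle : 0 ≤ l * e := by positivity
    rw [abs_mul, abs_of_nonneg hle]
    have k2 : |a * G| ≤ f2 + G ^ 2 := by
      rw [abs_le]
      constructor <;> nlinarith [sq_nonneg (a + G), sq_nonneg (a - G)]
    have k3 : l * e ≤ e := mul_le_of_le_one_left he hl1
    gcongr
  have t5 : k * P ≤ P' := (mul_le_of_le_one_left hP hk1).trans hPP
  have t6 : 0 ≤ k * P := by positivity
  have t7 : c₀ * a ^ 2 ≤ c₀ * f2 := by gcongr
  have t7' : 0 ≤ c₀ * a ^ 2 := by positivity
  have hbq : 0 ≤ b2 * q := by positivity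
  have hP' : 0 ≤ P' := hP.trans hPP
  obtain ⟨t8, t9⟩ := abs_le.1 t4
  set Q := f2 + b2 * q + g2 with hQ
  have hQ0 : 0 ≤ Q := by positivity
  have hfQ : f2 ≤ Q := by linarith
  have hbQ : b2 * q ≤ Q := by linarith
  clear_value Q
  have k5 : (1 + e) * G ^ 2 ≤ (1 + e) * (3 * (α ^ 2 + 1) * Q) := by gcongr
  have k6 : 0 ≤ (1 + e) * (3 * (α ^ 2 + 1)) * P' := by positivity
  have k7 : c₀ * f2 ≤ c₀ * Q := by gcongr
  have k8 : e * f2 ≤ e * Q := by gcongr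
  have k9 : 0 ≤ c₀ * P' := by positivity
  have k10 : 0 ≤ e * P' := by positivity
  have k11 := sq_nonneg G
  have tot : G ^ 2 + e * (f2 + G ^ 2) + b2 * q + c₀ * f2 + P'
      ≤ ((1 + e) * (3 * (α ^ 2 + 1)) + 1 + c₀ + e) * (Q + P') := by
    linarith
  rw [abs_le]
  constructor <;> linarith

/-- For |x| < l one has (1-l)² ≤ 1-x², so the term (1-l)(x/l) f' created by the dilation is
controlled by the degenerate weight of f'². Also ρ(x/l) ≤ ρ(x), and l ≥ 1/2 bounds the Jacobian by
2. -/
theorem abs_dilatedDensity_le (hp : 1 < p) {e l : ℝ} (he : 0 ≤ e) (hl : 1 / 2 ≤ l) (hl1 : l < 1)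
    (f f' g : ℝ → ℝ) {x : ℝ} (hx : x ∈ Ioo (-l) l) :
    |l⁻¹ * dilatedDensity p e l f f' g x|
      ≤ 2 * ((1 + e) * (3 * ((2 / (p - 1)) ^ 2 + 1)) + 1 + (p + 1) / (p - 1) ^ 2 + e)
        * (energyDensity p f f' g x + |f x| ^ (p + 1) * rho p x) := by
  have hl0 : 0 < l := by linarith
  have hα : 0 ≤ 2 / (p - 1) := div_nonneg (by norm_num) (by linarith)
  have hc₀ : 0 ≤ (p + 1) / (p - 1) ^ 2 := by positivity
  have hz : x / l ∈ Ioo (-1 : ℝ) 1 := by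
    constructor
    · rw [lt_div_iff₀ hl0]; linarith [hx.1]
    · rw [div_lt_iff₀ hl0]; linarith [hx.2]
  have hx1 : x ∈ Ioo (-1 : ℝ) 1 := ⟨by linarith [hx.1], by linarith [hx.2]⟩
  have hxz : x ^ 2 ≤ (x / l) ^ 2 := by
    rw [div_pow, le_div_iff₀ (by positivity)]
    exact mul_le_of_le_one_right (sq_nonneg x) (by nlinarith)
  have hxl : x ^ 2 < l ^ 2 := by nlinarith [hx.1, hx.2]
  have hla : ∀ k : ℝ, 0 ≤ k → 0 ≤ l ^ k ∧ l ^ k ≤ 1 := fun k hk =>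
    ⟨Real.rpow_nonneg hl0.le _, Real.rpow_le_one hl0.le hl1.le hk⟩
  have hsq : ∀ k : ℝ, 0 ≤ k → ∀ v : ℝ, (l ^ k * v) ^ 2 ≤ v ^ 2 := fun k hk v => by
    obtain ⟨h1, h2⟩ := hla k hk
    rw [mul_pow]
    exact mul_le_of_le_one_left (sq_nonneg _) (pow_le_one₀ h1 h2)
  have hρz := rho_pos (p := p) hz
  have hρ := rho_le_rho hp hz hxz
  have hP : |l ^ (2 / (p - 1)) * f x| ^ (p + 1) ≤ |f x| ^ (p + 1) := by
    obtain ⟨h1, h2⟩ := hla _ hα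
    refine Real.rpow_le_rpow (abs_nonneg _) ?_ (by linarith)
    rw [abs_mul, abs_of_nonneg h1]
    exact mul_le_of_le_one_left (abs_nonneg _) h2
  have key := abs_dilated_quadratic_le (α := 2 / (p - 1)) (c₀ := (p + 1) / (p - 1) ^ 2)
    (k := 1 / (p + 1)) (e := e) (l := l) (a := l ^ (2 / (p - 1)) * f x)
    (b := l ^ (2 / (p - 1) + 1) * f' x) (c := l ^ (2 / (p - 1) + 1) * g x) (z := x / l)
    (q := 1 - x ^ 2) (f2 := f x ^ 2) (b2 := f' x ^ 2) (g2 := g x ^ 2)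
    (P := |l ^ (2 / (p - 1)) * f x| ^ (p + 1)) (P' := |f x| ^ (p + 1)) hc₀
    (by positivity) ((div_le_one (by linarith)).2 (by linarith)) he hl0.le hl1.le (hsq _ hα _)
    (hsq _ (by linarith) _) (hsq _ (by linarith) _) (by linarith [one_sub_sq_pos hz]) (by linarith)
    (by nlinarith) (Real.rpow_nonneg (abs_nonneg _) _) hP
  have hli : l⁻¹ ≤ 2 := by
    rw [inv_le_comm₀ hl0 (by norm_num)]; linarith
  have hq := one_sub_sq_pos hx1
  have hPn : 0 ≤ |f x| ^ (p + 1) := Real.rpow_nonneg (abs_nonneg _) _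
  rw [dilatedDensity, abs_mul, abs_mul, abs_of_pos (inv_pos.2 hl0), abs_of_pos hρz]
  refine (mul_le_mul hli (mul_le_mul key hρ hρz.le ?_) ?_ (by norm_num)).trans_eq ?_
  · positivity
  · positivity
  · rw [energyDensity]
    ring

theorem tendsto_dilatedDensity (hp : 1 < p) (e : ℝ) (f f' g : ℝ → ℝ) {x : ℝ}
    (hx : x ∈ Ioo (-1 : ℝ) 1) :
    Tendsto (fun l => l⁻¹ * dilatedDensity p e l f f' g x) (𝓝 1)
      (𝓝 ((1 / 2 * g x ^ 2 + 1 / 2 * f' x ^ 2 * (1 - x ^ 2) + (p + 1) / (p - 1) ^ 2 * f x ^ 2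
        - 1 / (p + 1) * |f x| ^ (p + 1) - e * (f x * g x)) * rho p x)) := by
  have hl : ContinuousAt (fun l : ℝ => l) 1 := continuousAt_id
  have h1 : ContinuousAt (fun _ : ℝ => (1 : ℝ)) 1 := continuousAt_const
  have hi : ContinuousAt (fun l : ℝ => l⁻¹) 1 := continuousAt_inv₀ one_ne_zero
  have hk : ∀ k : ℝ, ContinuousAt (fun l : ℝ => l ^ k) 1 := fun k =>
    Real.continuousAt_rpow_const _ _ (Or.inl one_ne_zero)
  have hz : ContinuousAt (fun l : ℝ => x / l) 1 := continuousAt_const.div hl one_ne_zero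
  have hρ : ContinuousAt (fun l : ℝ => rho p (x / l)) 1 :=
    ContinuousAt.comp_of_eq ((continuousOn_rho (p := p)).continuousAt (isOpen_Ioo.mem_nhds hx)) hz
      (by simp)
  have ha := (hk (2 / (p - 1))).mul_const (f x)
  have hb := (hk (2 / (p - 1) + 1)).mul_const (f' x)
  have hc := (hk (2 / (p - 1) + 1)).mul_const (g x)
  have hP : ContinuousAt (fun l : ℝ => |l ^ (2 / (p - 1)) * f x| ^ (p + 1)) 1 :=
    (continuous_abs_rpow hp).continuousAt.comp_of_eq ha rfl
  have hG := ((((hl.sub h1).const_mul (2 / (p - 1))).mul ha).sub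
    ((h1.sub hl).mul (hz.mul hb))).add hc
  have hfin := hi.mul ((((((hG.pow 2).const_mul (1 / 2)).add (((hb.pow 2).const_mul (1 / 2)).mul
    (h1.sub (hz.pow 2)))).add ((ha.pow 2).const_mul ((p + 1) / (p - 1) ^ 2))).sub
    (hP.const_mul (1 / (p + 1)))).sub ((hl.mul_const e).mul (ha.mul hG)) |>.mul hρ)
  refine Tendsto.congr (fun l => ?_) (hfin.tendsto.trans_eq ?_)
  · rfl
  · simp

/-- A strict inequality for F at the initial time survives a small upward shift of the vertex. The
limit is one-sided because only l < 1 is meaningful. -/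
theorem tendsto_functionalF_dilate (hp : 1 < p) {f f' g : ℝ → ℝ} (h : MemEnergySpace p f f' g)
    (s₀ : ℝ) : Tendsto (fun l => functionalF p (dilate p l f) (dilateSpace p l f')
      (dilateTime p l f f' g) (s₀ - Real.log l)) (𝓝[<] 1) (𝓝 (functionalF p f f' g s₀)) := by
  obtain ⟨C, -, hC⟩ := MemEnergySpace.potential hp
  have hIoo : ∀ a < 1, ∀ᶠ l in 𝓝[<] (1 : ℝ), a < l ∧ l < 1 := fun a ha => Ioo_mem_nhdsLT ha
  rw [← (h.integrable_density hp s₀).2]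
  have hbi : IntegrableOn (fun x => 2 * ((1 + Real.exp (-s₀)) * (3 * ((2 / (p - 1)) ^ 2 + 1)) + 1
      + (p + 1) / (p - 1) ^ 2 + Real.exp (-s₀))
      * (energyDensity p f f' g x + |f x| ^ (p + 1) * rho p x)) (Ioo (-1) 1) :=
    (h.integrable.add (hC h).1).const_mul _
  refine Tendsto.congr' (f₁ := fun l => ∫ x in Ioo (-1) 1, indicator (Ioo (-l) l)
    (fun x => l⁻¹ * dilatedDensity p (Real.exp (-s₀)) l f f' g x) x) ?_
    (tendsto_integral_filter_of_dominated_convergence _ ?_ ?_ hbi ?_)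
  · filter_upwards [hIoo 0 one_pos] with l hl
    rw [functionalF_dilate hp h hl.1 hl.2]
  · refine Eventually.of_forall fun l => AEStronglyMeasurable.indicator ?_ measurableSet_Ioo
    have m1 := h.meas.aemeasurable
    have m2 := h.meas'.aemeasurable
    have m3 := h.meas_g.aemeasurable
    refine AEMeasurable.aestronglyMeasurable ?_
    unfold dilatedDensity
    fun_prop
  · filter_upwards [hIoo (1 / 2) (by norm_num)] with l hl
    filter_upwards [ae_restrict_mem measurableSet_Ioo] with x hy
    by_cases hx : x ∈ Ioo (-l) l
    · rw [indicator_of_mem hx]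
      exact abs_dilatedDensity_le hp (Real.exp_pos _).le hl.1.le hl.2 f f' g hx
    · rw [indicator_of_notMem hx, norm_zero]
      have h1 := (energyDensity_le hp f f' g hy).1
      have h2 := rho_pos (p := p) hy
      positivity
  · filter_upwards [ae_restrict_mem measurableSet_Ioo] with x hx
    refine ((tendsto_dilatedDensity hp (Real.exp (-s₀)) f f' g hx).mono_left
      nhdsWithin_le_nhds).congr' ?_
    filter_upwards [hIoo |x| (abs_lt.2 hx)] with l hl
    have hxl : x ∈ Ioo (-l) l := abs_lt.1 hl.1
    rw [indicator_of_mem hxl]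

theorem IsSmallPerturbation.mono {N : ℕ} {r₀ s₀ s₁ : ℝ} (h : IsSmallPerturbation N p r₀ s₀)
    (hs : s₀ ≤ s₁) : IsSmallPerturbation N p r₀ s₁ := by
  obtain ⟨h1, h2, δ, h3, h4, h5, h6⟩ := h
  have he : Real.exp (-s₁) ≤ Real.exp (-s₀) := Real.exp_le_exp.2 (by linarith)
  exact ⟨he.trans_lt h1, he.trans h2, δ, h3, h4, he.trans h5, fun s hs' => h6 s (hs.trans hs')⟩

theorem tendsto_exp_neg_atTop : Tendsto (fun s : ℝ => Real.exp (-s)) atTop (𝓝 0) :=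
  Real.tendsto_exp_atBot.comp tendsto_neg_atTop_atBot

theorem tendsto_shiftedFactor {δ : ℝ} (hδ : 0 < δ) :
    Tendsto (shiftedFactor δ) atTop (𝓝 0) := by
  have := tendsto_exp_neg_atTop.div (tendsto_exp_neg_atTop.const_add δ) (by simpa using hδ.ne')
  rw [zero_div] at this
  exact this

/-- The functional is nonnegative along a solution that is global in time and locally bounded in
`L^{p+1}`. -/
theorem IsCharacteristicSolution.functionalF_nonneg (hp : 1 < p) {N : ℕ} {r₀ s₀ : ℝ}
    {w wy ws : ℝ → ℝ → ℝ} (h : IsCharacteristicSolution N p r₀ s₀ w wy ws)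
    (hsm : IsSmallPerturbation N p r₀ s₀)
    (hM : ∀ b : ℝ, ∃ M : NNReal, ∀ s ∈ Icc s₀ b,
      eLpNorm (w s) (ENNReal.ofReal (p + 1)) (volume.restrict (Ioo (-1) 1)) ≤ M) :
    0 ≤ functionalF p (w s₀) (wy s₀) (ws s₀) s₀ := by
  by_contra! hneg
  -- A dilation factor close enough to 1 for the functional of the shifted state to remain negative.
  obtain ⟨l, hl, hl0, hl1⟩ := (((tendsto_functionalF_dilate hp (h.path.mem s₀ self_mem_Ici)
    s₀).eventually_lt_const hneg).and (Ioo_mem_nhdsLT (a := 0) one_pos)).exists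
  set s₁ := s₀ - Real.log l with hs₁
  have he₁ : Real.exp (-s₁) = l * Real.exp (-s₀) := by
    rw [hs₁, neg_sub, sub_eq_add_neg, Real.exp_add, Real.exp_log hl0]
  have hs01 : s₀ ≤ s₁ := by linarith [Real.log_neg hl0 hl1]
  -- This shift makes the factor equal to l at time s₁ and lets time s₁ correspond to the original
  -- time s₀.
  set δ := Real.exp (-s₀) * (1 - l) with hδ'
  have hδ : 0 < δ := mul_pos (Real.exp_pos _) (by linarith)
  have hs : δ + Real.exp (-s₁) = Real.exp (-s₀) := by
    rw [he₁]; ring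
  have hT₁ : shiftedTime δ s₁ = s₀ := shiftedTime_eq hs
  have hF₁ : shiftedFactor δ s₁ = l := by
    rw [shiftedFactor, hs, he₁, mul_div_assoc, div_self (Real.exp_pos _).ne', mul_one]
  have hR := h.rescale hp hδ hs hsm.1
  have hA := (hR.lyapunov hp (hsm.mono hs01)).2.2
  -- The shifted time never exceeds -log δ, so the whole future of the shifted solution only sees a
  -- bounded time interval of the original.
  obtain ⟨M, hM⟩ := hM (-Real.log δ)
  have hc₀ : 0 < 2 * ((p + 1) / (p - 1) ^ 2) := by
    have : 0 < p - 1 := by linarith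
    positivity
  have hβ : 0 < 2 / (p - 1) * (p + 1) - 1 := by
    have : 0 < p - 1 := by linarith
    rw [sub_pos, div_mul_eq_mul_div, lt_div_iff₀ this]
    linarith
  have hneg₁ : functionalH p ((p + 3) / 2) (dilate p (shiftedFactor δ s₁) (w (shiftedTime δ s₁)))
      (dilateSpace p (shiftedFactor δ s₁) (wy (shiftedTime δ s₁)))
      (dilateTime p (shiftedFactor δ s₁) (w (shiftedTime δ s₁)) (wy (shiftedTime δ s₁))
        (ws (shiftedTime δ s₁))) s₁ < 0 := by
    rw [functionalH, hT₁, hF₁]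
    exact mul_neg_of_neg_of_pos hl (Real.exp_pos _)
  -- The exponent α(p+1) - 1 = (p+3)/(p-1) is positive and the factor l tends to 0, so the lower
  -- bound for H tends to 0 and cannot stay below a negative constant.
  have hlim : Tendsto (fun s => -(1 / (p + 1))
      * (shiftedFactor δ s ^ (2 / (p - 1) * (p + 1) - 1) * (M : ℝ) ^ (p + 1))
      * Real.exp ((p + 3) / 2 * Real.exp (-s))) atTop (𝓝 0) := by
    have k1 := ((tendsto_shiftedFactor hδ).rpow_const (p := 2 / (p - 1) * (p + 1) - 1)
      (Or.inr hβ.le)).mul_const ((M : ℝ) ^ (p + 1))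
    have k2 := (Real.continuous_exp.tendsto _).comp (tendsto_exp_neg_atTop.const_mul ((p + 3) / 2))
    have k3 := (k1.const_mul (-(1 / (p + 1)))).mul k2
    rw [Real.zero_rpow hβ.ne'] at k3
    simpa using k3
  refine absurd (le_of_tendsto hlim ?_) hneg₁.not_ge
  have hsq : Tendsto (fun s : ℝ => Real.exp (-s) ^ 2) atTop (𝓝 0) := by
    simpa using tendsto_exp_neg_atTop.pow 2
  filter_upwards [eventually_ge_atTop s₁, hsq.eventually_le_const hc₀] with s hss hes
  refine le_trans ?_ (hA (self_mem_Ici) hss hss)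
  have hσ := le_shiftedTime hδ hs hss
  have hσ' : shiftedTime δ s ≤ -Real.log δ := by
    have := Real.exp_pos (-s)
    exact neg_le_neg (Real.log_le_log hδ (by linarith))
  have hmem := hR.path.mem s hss
  refine mul_le_mul_of_nonneg_right ((mul_le_mul_of_nonpos_left
    (integral_abs_rpow_dilate_le hp (shiftedFactor_pos hδ) (shiftedFactor_lt_one hδ).le hmem rfl
      (h.path.mem _ hσ).meas (hM _ ⟨hσ, hσ'⟩)) ?_).trans (functionalF_ge hp hmem hes))
    (Real.exp_pos _).le
  have : 0 < p + 1 := by linarith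
  exact neg_nonpos.2 (by positivity)

end RadialWave

end

/-! ### The theorem -/

theorem mainTheorem6 (p : ℝ) (hp : 1 < p) :
    ∃ γ : ℝ, 0 < γ ∧ ∃ S₁ : ℝ, ∀ N : ℕ, 1 ≤ N → (2 ≤ N → p ≤ 1 + 4 / ((N : ℝ) - 1)) →
      (∃ S₀ : ℝ, ∀ r₀ : ℝ, 0 < r₀ →
        ∀ T : ℝ → ℝ, (∀ r, 0 ≤ r → 0 < T r) → LipschitzOnWith 1 T (Set.Ici 0) →
        ∀ u : ℝ → ℝ → ℝ, RadialWave.IsRadialSolution N p T u →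
        ∀ sm : ℝ, sm = max (-Real.log (T r₀)) (max S₀ (S₀ - 2 * Real.log r₀)) →
        ∀ w wy ws : ℝ → ℝ → ℝ, w = RadialWave.similarity p r₀ (T r₀) u →
        RadialWave.IsEnergyPath p (Set.Ici sm) w wy ws →
          (∀ b, sm ≤ b → AbsolutelyContinuousOnInterval
            (fun s => RadialWave.functionalF p (w s) (wy s) (ws s) s) sm b) ∧
          (∀ s, sm ≤ s → ∀ F' : ℝ,
            HasDerivWithinAt (fun σ => RadialWave.functionalF p (w σ) (wy σ) (ws σ) σ) F'
              (Set.Ici s) s →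
            MeasureTheory.IntegrableOn (fun y => ws s y ^ 2 * (RadialWave.rho p y / (1 - y ^ 2)))
              (Set.Ioo (-1) 1) ∧
            F' ≤ γ * Real.exp (-s) * RadialWave.functionalF p (w s) (wy s) (ws s) s
              - 2 / (p - 1) *
                ∫ y in Set.Ioo (-1) 1, ws s y ^ 2 * (RadialWave.rho p y / (1 - y ^ 2))) ∧
          AntitoneOn (fun s => RadialWave.functionalH p γ (w s) (wy s) (ws s) s) (Set.Ici sm)) ∧
      (∀ r₀ : ℝ, 0 < r₀ → ∀ s₀ : ℝ, max S₁ (S₁ - 2 * Real.log r₀) ≤ s₀ →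
        ¬ ∃ W Wy Ws : ℝ → ℝ → ℝ,
          RadialWave.IsSimilaritySolution N p r₀ (Set.Ici s₀) W Wy Ws ∧
          (∀ b : ℝ, ∃ M : NNReal, ∀ s ∈ Set.Icc s₀ b,
            MeasureTheory.eLpNorm (W s) (ENNReal.ofReal (p + 1))
              (MeasureTheory.volume.restrict (Set.Ioo (-1) 1)) ≤ M) ∧
          RadialWave.functionalF p (W s₀) (Wy s₀) (Ws s₀) s₀ < 0) := by
  obtain ⟨S, hS⟩ := RadialWave.exists_threshold hp
  -- The value of γ is the midpoint of the admissible range between 2 and p+1. One threshold serves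
  -- as both S₁ and S₀.
  refine ⟨(p + 3) / 2, by linarith, S, fun N hN hpN => ⟨⟨S, ?_⟩, ?_⟩⟩
  · intro r₀ hr₀ T hT hTL u hu sm hsm w wy ws hw hpath
    have h₁ : max S (S - 2 * Real.log r₀) ≤ sm := hsm ▸ le_max_right _ _
    have h₂ : -Real.log (T r₀) ≤ sm := hsm ▸ le_max_left _ _
    have hsmall := hS N hN hpN r₀ hr₀ sm h₁
    have hexp : Real.exp (-sm) ≤ T r₀ := by
      rw [← Real.exp_log (hT r₀ hr₀.le)]
      exact Real.exp_le_exp.2 (by linarith)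
    obtain ⟨ur, ut, hu⟩ := hu
    have hrect : RadialWave.HasRects N p r₀ (T r₀) sm u ur ut := fun s hs η hη hη1 =>
      RadialWave.exists_rect hsmall.1 hTL hexp hu hs hη hη1
    exact (hrect.isCharacteristicSolution hp hw hpath).lyapunov hp hsmall
  · rintro r₀ hr₀ s₀ hs₀ ⟨W, Wy, Ws, hW, hM, hneg⟩
    have hsmall := hS N hN hpN r₀ hr₀ s₀ hs₀
    exact ((hW.isCharacteristicSolution hp hsmall.1).functionalF_nonneg hp hsmall hM).not_gt hneg
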